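/- **Proposition 3.1.** Let $\mathcal B=\mathbb C[[h]]$, $q=e^{h/2}$, $\delta(x)=\sum_{n\in\mathbb Z}x^n$, and, expanded in powers of $x$, $$d(x)=\frac{1-x}{q-q^{-1}x},\quad g(x)=\frac{q^2x-1}{x-q^2},\quad \gamma(x)=(q-q^{-1})d(x),\quad f(x)=q^{1/2}(1-x)\left(\frac{(q^4x;q^4)_\infty}{(q^2x;q^4)_\infty}\right)^2,$$ so that $f(x)f(q^2x)=d(q^2x)^{-1}$. Let $R(x)$ be the $4\times4$ matrix, in the basis $v_1\otimes v_1,v_1\otimes v_2,v_2\otimes v_1,v_2\otimes v_2$, $$R(x)=f(x)\begin{pmatrix}1&&&\\&d(x)&0&\\&\gamma(x)\delta(x)&d(q^2x)&\\&&&1\end{pmatrix}.$$ Here $(1-x)^n\delta(x)$ is a distribution acting on functions with a pole of order at most $n$ at $x=1$: $(v(x)\delta(x))F$ means $\delta(x)(v(x)F)$. *The algebra $\overline U=\overline U_q(\widehat{sl}_2)$* is generated over $\mathcal B$ by central elements $q^{\pm c}$, inverse to each other, and the coefficients of $\xi^\pm(z)=\sum_{n\in\mathbb Z}\xi^\pm_nz^n$,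 $\alpha^\pm(z)=\sum_{n\ge0}\alpha^\pm_{\pm n}z^{\pm n}$ and $\alpha^\pm(z)^{-1}$. With $\phi^\pm(z)=\alpha^\pm(z)^{-1}\alpha^\pm(q^2z)^{-1}$ and $x=z/w$ the relations are $$[\phi^\pm(z),\phi^\pm(w)]=0,\quad \phi^+(z)\phi^-(w)=\tfrac{g(xq^{-c})}{g(xq^{c})}\phi^-(w)\phi^+(z),$$ $$\phi^\pm(z)\xi^\pm(w)=g(x^{\pm1})\xi^\pm(w)\phi^\pm(z),\quad \phi^\pm(z)\xi^\mp(w)=g((xq^c)^{\pm1})^{-1}\xi^\mp(w)\phi^\pm(z),$$ $$(z-q^{\pm2}w)\xi^\pm(z)\xi^\pm(w)=(q^{\pm2}z-w)\xi^\pm(w)\xi^\pm(z),$$ $$[\xi^+(z),\xi^-(w)]=(q-q^{-1})\left(\delta(xq^{-c})\phi^-(w)-\delta(xq^c)\phi^+(z)\right),$$ $$[\alpha^\pm(z),\alpha^\pm(w)]=0,\quad \alpha^+(z)\alpha^-(w)=\tfrac{f(xq^c)}{f(xq^{-c})}\alpha^-(w)\alpha^+(z),$$ $$\alpha^+(z)\xi^+(w)=d(x)^{-1}\xi^+(w)\alpha^+(z),\quad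 \alpha^-(z)\xi^-(w)=d(q^2x^{-1})^{-1}\xi^-(w)\alpha^-(z),$$ $$\alpha^+(z)\xi^-(w)=d(xq^c)\xi^-(w)\alpha^+(z),\quad \alpha^-(z)\xi^+(w)=d(x^{-1}q^{2-c})\xi^+(w)\alpha^-(z).$$ Its Hopf structure is $$\Delta\xi^+(z)=\xi^+(z)\otimes1+\phi^+(z)\otimes\xi^+(zq^{c_1}),\quad \Delta\xi^-(z)=1\otimes\xi^-(z)+\xi^-(zq^{c_2})\otimes\phi^-(z),$$ $$\Delta\alpha^+(z)=\alpha^+(z)\otimes\alpha^+(zq^{c_1}),\quad \Delta\alpha^-(z)=\alpha^-(zq^{c_2})\otimes\alpha^-(z),\quad \Delta q^c=q^c\otimes q^c,$$ $$\varepsilon(\xi^\pm(z))=0,\quad \varepsilon(\alpha^\pm(z))=\varepsilon(q^c)=1,\quad S(q^c)=q^{-c},\quad S(\alpha^\pm(z))=\alpha^\pm(zq^{-c})^{-1},$$ $$S(\xi^+(z))=-\phi^+(zq^{-c})^{-1}\xi^+(zq^{-c}),\quad S(\xi^-(z))=-\xi^-(zq^{-c})\phi^-(zq^{-c})^{-1},$$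 where $c_i$ is $c$ acting on the $i$-th tensor factor. *The algebra $A(R)$* is generated by central elements $q^{\pm c}$, inverse to each other, and the coefficients of the entries of a lower triangular matrix $L^+(z)$ and an upper triangular matrix $L^-(z)$, where $L^\pm_{ii}(z)$ is a series in $z^{\pm1}$ and the off-diagonal entries are series in $z,z^{-1}$. The relations are $$R(x)L_1^\pm(z)L_2^\pm(w)=L_2^\pm(w)L_1^\pm(z)R(x),\quad R(xq^{-c})L_1^+(z)L_2^-(w)=L_2^-(w)L_1^+(z)R(xq^{c}),$$ and $L^\pm_{11}(z)L^\pm_{22}(zq^{-2})=1$. Its Hopf structure is $$\Delta L^+(z)=L^+(z)\mathbin{\dot\otimes}L^+(zq^{c_1}),\quad \Delta L^-(z)=L^-(zq^{c_2})\mathbin{\dot\otimes}L^-(z),\quad \varepsilon(L^\pm(z))=1,\quad S(L^\pm(z))=L^\pm(zq^{-c})^{-1}$$ ($\dot\otimes$: matrix product with entries multiplied by $\otimes$), and $\Delta q^c=q^c\otimes q^c$, $\varepsilon(q^c)=1$, $S(q^c)=q^{-c}$. *Normalization of the zero modes.* Either no further relation is imposed on $\overline U$ and $A(R)$, or the relations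 $\phi^+(0)\phi^-(\infty)=\phi^-(\infty)\phi^+(0)=1$ are imposed on $\overline U$ and, correspondingly, $L^+_{11}(0)^2L^-_{11}(\infty)^2=L^-_{11}(\infty)^2L^+_{11}(0)^2=1$ on $A(R)$. Both algebras are taken in the category of highest weight representations, that is, modules in which every vector is annihilated by all monomials of sufficiently large degree (the coefficient of $z^n$ has degree $n$): elements are finite sums of homogeneous, possibly infinite, sums of monomials which converge on these representations, and two elements are equal if they act equally on all of them. There the coefficients of the defining relations of $A(R)$ are read in normally ordered form, $L_2L_1=R\,L_1L_2\,R^{-1}$. The coproducts take values in the completed tensor squares. The antipodes are anti-homomorphisms to the algebras taken in the category of lowest weight representations, where for $A(R)$ the well-defined currents are the entries of $L^\pm(z)^{-1}$, with the inverted relations. Then, in either normalization, the formulas above define continuous (the antipodes: on each homogeneous part) coassociative coproducts, counits and antipodes on $\overline U$ and on $A(R)$, and $$\mu(L^+(z))=\begin{pmatrix}\alpha^+(z)&0\\ \xi^+(z)\alpha^+(z)&\alpha^+(q^2z)^{-1}\end{pmatrix},\qquad \mu(L^-(z))=\begin{pmatrix}\alpha^-(z)&-\alpha^-(z)\xi^-(z)\\0&\alpha^-(q^2z)^{-1}\end{pmatrix},\qquad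 \mu(q^c)=q^c,$$ defines an isomorphism $\mu:A(R)\to\overline U$ of topological algebras which is compatible with the coproducts, the counits and the antipodes. (For the antipodes, the isomorphism of the algebras on lowest weight representations sends $L^\pm(z)^{-1}$ to the inverses of these matrices.) -/

import Mathlib

namespace QCurrent

noncomputable section

open PowerSeries

/-! ### Scalars and scalar functions -/

/-- The ground ring of formal power series in `h` over the complex numbers. -/
abbrev B : Type := PowerSeries ℂ

/-- The element `q ^ t = exp (t h / 2)` of the ground ring, where `q = exp (h / 2)`. -/
def qp (t : ℂ) : B := PowerSeries.rescale (t / 2) (PowerSeries.exp ℂ)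

theorem qp_add (s t : ℂ) : qp (s + t) = qp s * qp t := by
  unfold qp
  rw [PowerSeries.exp_mul_exp_eq_exp_add, add_div]

theorem qp_zero : qp 0 = 1 := by
  simp [qp]

theorem constantCoeff_qp (t : ℂ) : PowerSeries.constantCoeff (qp t) = 1 := by
  rw [← PowerSeries.coeff_zero_eq_constantCoeff_apply]
  simp [qp, PowerSeries.coeff_rescale, PowerSeries.coeff_exp]

/-- `d(x) = (1 - x) / (q - q⁻¹ x)`, expanded in powers of `x`. -/
def d : PowerSeries B := (1 - X) * PowerSeries.mk (fun n : ℕ => qp (-(2 * n + 1)))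

/-- `d(q² x)`. -/
def dq : PowerSeries B := PowerSeries.rescale (qp 2) d

/-- `g(x) = (q² x - 1) / (x - q²)`, expanded in powers of `x`. -/
def g : PowerSeries B :=
  (1 - PowerSeries.C (qp 2) * X) * PowerSeries.mk (fun n : ℕ => qp (-(2 * n + 2)))

/-- The `q²`-integer `1 + q² + ⋯ + q^(2(m-1)) = (1 - q^(2m)) / (1 - q²)`. -/
def qint (m : ℕ) : B := ∑ i ∈ Finset.range m, qp (2 * i)

/-- `(q⁴ x; q⁴)_∞ / (q² x; q⁴)_∞`, written as a power series in `x` by the `q`-binomial theorem: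
the coefficient of `x ^ n` is `q^(2n) (q²; q⁴)_n / (q⁴; q⁴)_n`. The factor
`(1 - q^(4j+2)) / (1 - q^(4j+4))` is a quotient of two `q²`-integers. -/
def gt : PowerSeries B :=
  PowerSeries.mk (fun n : ℕ =>
    qp (2 * n) * ∏ j ∈ Finset.range n, (qint (2 * j + 1) * (qint (2 * j + 2))⁻¹))

/-- The scalar factor `f(x) = q^(1/2) (1 - x) ((q⁴ x; q⁴)_∞ / (q² x; q⁴)_∞)²`. -/
def f : PowerSeries B := PowerSeries.C (qp (1 / 2)) * (1 - X) * gt ^ 2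

/-- `γ(x) = (q - q⁻¹) d(x)`. -/
def gam : PowerSeries B := PowerSeries.C (qp 1 - qp (-1)) * d

theorem d_eq : d * (PowerSeries.C (qp 1) - PowerSeries.C (qp (-1)) * X) = 1 - X := by
  have key : PowerSeries.mk (fun n : ℕ => qp (-(2 * n + 1))) *
      (PowerSeries.C (qp 1) - PowerSeries.C (qp (-1)) * X) = 1 := by
    ext1 n
    rw [mul_sub, map_sub, PowerSeries.coeff_mul_C, ← mul_assoc]
    cases n with
    | zero => simp [← qp_add, qp_zero]
    | succ n =>
      rw [PowerSeries.coeff_succ_mul_X, PowerSeries.coeff_mul_C]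
      simp only [PowerSeries.coeff_mk, ← qp_add, PowerSeries.coeff_one]
      push_cast
      rw [sub_eq_zero]
      congr 1
      ring
  rw [d, mul_assoc, key, mul_one]

theorem g_eq : g * (PowerSeries.C (qp 2) - X) = 1 - PowerSeries.C (qp 2) * X := by
  have key : PowerSeries.mk (fun n : ℕ => qp (-(2 * n + 2))) *
      (PowerSeries.C (qp 2) - X) = 1 := by
    ext1 n
    rw [mul_sub, map_sub, PowerSeries.coeff_mul_C]
    cases n with
    | zero => simp [← qp_add, qp_zero]
    | succ n =>
      rw [PowerSeries.coeff_succ_mul_X]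
      simp only [PowerSeries.coeff_mk, ← qp_add, PowerSeries.coeff_one]
      push_cast
      rw [sub_eq_zero]
      congr 1
      ring
  rw [g, mul_assoc, key, mul_one]

theorem isUnit_qp (t : ℂ) : IsUnit (qp t) :=
  IsUnit.of_mul_eq_one (qp (-t)) (by rw [← qp_add, add_neg_cancel, qp_zero])

theorem isUnit_d : IsUnit d := by
  rw [PowerSeries.isUnit_iff_constantCoeff]
  have : PowerSeries.constantCoeff d = qp (-1) := by simp [d]
  exact this ▸ isUnit_qp (-1)

theorem isUnit_dq : IsUnit dq := isUnit_d.map _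

theorem isUnit_g : IsUnit g := by
  rw [PowerSeries.isUnit_iff_constantCoeff]
  have : PowerSeries.constantCoeff g = qp (-2) := by simp [g]
  exact this ▸ isUnit_qp (-2)

theorem isUnit_f : IsUnit f := by
  rw [PowerSeries.isUnit_iff_constantCoeff]
  have : PowerSeries.constantCoeff f = qp (1 / 2) := by simp [f, gt, qp_zero]
  exact this ▸ isUnit_qp (1 / 2)

theorem qint_mul (m : ℕ) : qint m * (1 - qp 2) = 1 - qp (2 * m) := by
  induction m with
  | zero => simp [qint, qp_zero]
  | succ m ih =>
    rw [qint, Finset.sum_range_succ, ← qint, add_mul, ih, mul_sub, ← qp_add]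
    push_cast
    rw [mul_add, mul_one, mul_one]
    ring

theorem qint_succ_mul_inv (m : ℕ) : qint (m + 1) * (qint (m + 1))⁻¹ = 1 := by
  apply PowerSeries.mul_inv_cancel
  rw [qint, map_sum]
  simp only [constantCoeff_qp]
  simp only [Finset.sum_const, Finset.card_range, nsmul_eq_mul, mul_one]
  exact_mod_cast Nat.succ_ne_zero m

theorem gt_eq : (1 - PowerSeries.C (qp 2) * X) * gt =
    (1 - PowerSeries.C (qp 4) * X) * PowerSeries.rescale (qp 4) gt := by
  ext1 n
  rw [sub_mul, sub_mul, one_mul, one_mul, map_sub, map_sub, mul_assoc, mul_assoc,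
    PowerSeries.coeff_C_mul, PowerSeries.coeff_C_mul, PowerSeries.coeff_rescale]
  cases n with
  | zero => simp
  | succ n =>
    rw [PowerSeries.coeff_succ_X_mul, PowerSeries.coeff_succ_X_mul, PowerSeries.coeff_rescale]
    simp only [gt, PowerSeries.coeff_mk, Finset.prod_range_succ]
    have hp : ∀ m : ℕ, qp 4 ^ m = qp (4 * m) := by
      intro m
      induction m with
      | zero => simp [qp_zero]
      | succ m ih => rw [pow_succ, ih, ← qp_add]; congr 1; push_cast; ring
    rw [hp, hp]
    generalize (∏ j ∈ Finset.range n, (qint (2 * j + 1) * (qint (2 * j + 2))⁻¹)) = P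
    have h1 := qint_mul (2 * n + 1)
    have h2 := qint_mul (2 * n + 2)
    have h3 := qint_succ_mul_inv (2 * n + 1)
    have e1 : qp (2 * ((n + 1 : ℕ) : ℂ)) = qp 2 * qp (2 * n) := by
      rw [← qp_add]; congr 1; push_cast; ring
    have e2 : qp (4 * ((n + 1 : ℕ) : ℂ)) = qp (2 * ((2 * n + 2 : ℕ) : ℂ)) := by
      congr 1; push_cast; ring
    have e3 : qp 4 * qp (4 * (n : ℂ)) = qp 2 * qp (2 * ((2 * n + 1 : ℕ) : ℂ)) := by
      rw [← qp_add, ← qp_add]; congr 1; push_cast; ring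
    rw [e1, e2]
    have h4 : qp (2 * ((2 * n + 2 : ℕ) : ℂ)) = 1 - qint (2 * n + 2) * (1 - qp 2) := by
      rw [h2]; ring
    have h5 : qp 4 * qp (4 * (n : ℂ)) = qp 2 * (1 - qint (2 * n + 1) * (1 - qp 2)) := by
      rw [e3, h1]; ring
    rw [h4]
    change qint (2 * n + 2) * (qint (2 * n + 2))⁻¹ = 1 at h3
    linear_combination (P * qp (2 * (n : ℂ))) * h5 +
      (qp 2 * qp (2 * (n : ℂ)) * P * qint (2 * n + 1) * (1 - qp 2)) * h3

theorem qp_pow (t : ℂ) (m : ℕ) : qp t ^ m = qp (t * m) := by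
  induction m with
  | zero => simp [qp_zero]
  | succ m ih => rw [pow_succ, ih, ← qp_add]; congr 1; push_cast; ring

theorem rescale_const (a b : B) :
    PowerSeries.rescale a (PowerSeries.C b) = PowerSeries.C b := by
  ext1 n
  rw [PowerSeries.coeff_rescale, PowerSeries.coeff_C]
  split_ifs with h <;> simp [h]

theorem constantCoeff_rescale_eq (a : B) (p : PowerSeries B) :
    PowerSeries.constantCoeff (PowerSeries.rescale a p) = PowerSeries.constantCoeff p := by
  rw [← PowerSeries.coeff_zero_eq_constantCoeff_apply, PowerSeries.coeff_rescale]
  simp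

theorem rescale_rescale_gt :
    PowerSeries.rescale (qp 2) (PowerSeries.rescale (qp 2) gt) = PowerSeries.rescale (qp 4) gt := by
  rw [PowerSeries.rescale_rescale, ← qp_add]
  norm_num

theorem gt_mul_gt :
    (1 - PowerSeries.C (qp 2) * X) * (gt * PowerSeries.rescale (qp 2) gt) = 1 := by
  set H := (1 - PowerSeries.C (qp 2) * X) * (gt * PowerSeries.rescale (qp 2) gt) with hH
  have h22 : PowerSeries.C (qp 2) * PowerSeries.C (qp 2) = PowerSeries.C (qp 4) := by
    rw [← map_mul, ← qp_add]; norm_num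
  have hr : PowerSeries.rescale (qp 2) H = H := by
    have : PowerSeries.rescale (qp 2) H = (1 - PowerSeries.C (qp 4) * X) *
        (PowerSeries.rescale (qp 2) gt * PowerSeries.rescale (qp 4) gt) := by
      rw [hH, map_mul, map_mul, rescale_rescale_gt, map_sub, map_mul, map_one,
        PowerSeries.rescale_X, rescale_const, ← mul_assoc (PowerSeries.C (qp 2)), h22]
    rw [this, mul_left_comm, ← gt_eq, hH]
    ring
  ext1 n
  cases n with
  | zero => simp [hH, constantCoeff_rescale_eq, gt, qp_zero]
  | succ n =>
    have h1 := congrArg (PowerSeries.coeff (n + 1)) hr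
    rw [PowerSeries.coeff_rescale, qp_pow] at h1
    have h2 : (qp (2 * ((n + 1 : ℕ) : ℂ)) - 1) * PowerSeries.coeff (n + 1) H = 0 := by
      rw [sub_mul, h1, one_mul, sub_self]
    rcases mul_eq_zero.1 h2 with h3 | h3
    · exfalso
      have h4 := congrArg (PowerSeries.coeff 1) h3
      simp [qp, PowerSeries.coeff_rescale, PowerSeries.coeff_exp, PowerSeries.coeff_one] at h4
      exact Nat.cast_add_one_ne_zero n h4
    · rw [h3, PowerSeries.coeff_one, if_neg (Nat.succ_ne_zero n)]

/-- The difference equation `f(x) f(q² x) = d(q² x)⁻¹` that characterizes `f`. -/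
theorem f_difference : f * PowerSeries.rescale (qp 2) f * dq = 1 := by
  have hd : dq * (PowerSeries.C (qp 1) * (1 - X)) = 1 - PowerSeries.C (qp 2) * X := by
    have h := congrArg (PowerSeries.rescale (qp 2)) d_eq
    rw [map_mul, map_sub, map_sub, map_mul, map_one, PowerSeries.rescale_X, rescale_const,
      rescale_const, ← mul_assoc, ← map_mul, ← qp_add] at h
    rw [← h, dq, mul_sub, mul_one]
    norm_num
  have hc : PowerSeries.C (qp (1 / 2)) * PowerSeries.C (qp (1 / 2)) = PowerSeries.C (qp 1) := by
    rw [← map_mul, ← qp_add]; norm_num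
  have hf : PowerSeries.rescale (qp 2) f = PowerSeries.C (qp (1 / 2)) *
      (1 - PowerSeries.C (qp 2) * X) * PowerSeries.rescale (qp 2) gt ^ 2 := by
    rw [f, map_mul, map_mul, map_pow, map_sub, map_one, PowerSeries.rescale_X,
      rescale_const]
  have hg := gt_mul_gt
  rw [hf, f]
  calc _ = (PowerSeries.C (qp (1 / 2)) * PowerSeries.C (qp (1 / 2))) * (1 - X) * dq *
        (1 - PowerSeries.C (qp 2) * X) * (gt * PowerSeries.rescale (qp 2) gt) ^ 2 := by ring
    _ = (dq * (PowerSeries.C (qp 1) * (1 - X))) *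
        (1 - PowerSeries.C (qp 2) * X) * (gt * PowerSeries.rescale (qp 2) gt) ^ 2 := by
          rw [hc]; ring
    _ = ((1 - PowerSeries.C (qp 2) * X) * (gt * PowerSeries.rescale (qp 2) gt)) ^ 2 := by
          rw [hd]; ring
    _ = 1 := by rw [hg, one_pow]

/-! ### The singular R-matrix

Rows and columns are indexed by pairs `(i, j)`, standing for the basis vector `v_i ⊗ v_j`, with
`0, 1` for the indices `1, 2`. The matrix is `R(x) = R0(x) + R1(x) δ(x)` with
`δ(x) = ∑ x ^ n` over all integers `n`. The coefficient `R1(x)` is kept apart from `δ(x)`: it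
vanishes at `x = 1`, and `R1(x) δ(x)` is a distribution that acts on functions which may have
poles at `x = 1`, so the two must not be multiplied as formal series. -/

abbrev Ix : Type := Fin 2 × Fin 2

/-- The part of `R(x)` without `δ(x)`, the diagonal matrix with entries
`f(x), f(x) d(x), f(x) d(q² x), f(x)`. -/
def R0 : Matrix Ix Ix (PowerSeries B) :=
  Matrix.diagonal fun p =>
    if p = (0, 1) then f * d else if p = (1, 0) then f * dq else f

/-- The coefficient of `δ(x)` in `R(x)`; its only entry is `f(x) γ(x)`, in row `v₂ ⊗ v₁` and
column `v₁ ⊗ v₂`. -/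
def R1 : Matrix Ix Ix (PowerSeries B) := Matrix.single (1, 0) (0, 1) (f * gam)

/-- The part of `R(x)⁻¹` without `δ(x)`. -/
def Q0 : Matrix Ix Ix (PowerSeries B) :=
  Matrix.diagonal fun p =>
    if p = (0, 1) then Ring.inverse (f * d) else if p = (1, 0) then Ring.inverse (f * dq)
    else Ring.inverse f

/-- The coefficient of `δ(x)` in `R(x)⁻¹`. -/
def Q1 : Matrix Ix Ix (PowerSeries B) :=
  Matrix.single (1, 0) (0, 1) (-(Ring.inverse (f * dq) * (f * gam) * Ring.inverse (f * d)))

/-- `Q0 + Q1 δ` is the inverse of `R0 + R1 δ`; no term in `δ²` occurs since `R1 Q1 = 0`. -/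
theorem R_mul_Q : R0 * Q0 = 1 ∧ R0 * Q1 + R1 * Q0 = 0 ∧ R1 * Q1 = 0 := by
  have h1 := Ring.mul_inverse_cancel f isUnit_f
  have h2 := Ring.mul_inverse_cancel (f * d) (isUnit_f.mul isUnit_d)
  have h3 := Ring.mul_inverse_cancel (f * dq) (isUnit_f.mul isUnit_dq)
  unfold R0 Q0 R1 Q1
  generalize f * gam = v
  generalize Ring.inverse (f * d) = u' at *
  generalize f * d = u at *
  generalize Ring.inverse (f * dq) = w' at *
  generalize f * dq = w at *
  generalize Ring.inverse f = f' at *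
  generalize f = f0 at *
  refine ⟨?_, ?_, ?_⟩
  · rw [Matrix.diagonal_mul_diagonal, ← Matrix.diagonal_one]
    congr 1
    funext p
    split_ifs
    · exact h2
    · exact h3
    · exact h1
  · ext1 a b
    rw [Matrix.add_apply, Matrix.diagonal_mul, Matrix.mul_diagonal, Matrix.single_apply,
      Matrix.single_apply]
    by_cases h : (1, 0) = a ∧ (0, 1) = b
    · obtain ⟨rfl, rfl⟩ := h
      have h0 : ¬ ((1, 0) : Ix) = (0, 1) := by decide
      rw [if_neg h0, if_pos rfl, if_pos rfl, if_pos ⟨rfl, rfl⟩, if_pos ⟨rfl, rfl⟩,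
        Matrix.zero_apply]
      linear_combination (-(v * u')) * h3
    · rw [if_neg h, if_neg h, mul_zero, zero_mul, add_zero, Matrix.zero_apply]
  · rw [Matrix.single_mul_single_of_ne]
    decide

/-! ### Generators and relations

All current relations are written out in modes: `X(z) = ∑ X k z ^ k` over the integers `k`. -/

inductive Sgn
  | pos
  | neg

/-- The two categories in use: highest weight and lowest weight representations. -/
inductive Dir
  | high
  | low

section Currents

variable {E : Type*} [Ring E] [Algebra B E]

/-- The integer power `κ ^ n` of a unit `κ` with inverse `κ'`. -/
def kpow (κ κ' : E) (n : ℤ) : E := κ ^ n.toNat * κ' ^ (-n).toNat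

/-- The coefficient of `x ^ n` in `u(x)`. -/
def sc (u : PowerSeries B) (n : ℕ) : E := algebraMap B E (PowerSeries.coeff n u)

/-- The coefficient of `x ^ n` in `u(x κ⁻¹) v(x κ)`. -/
def twist (κ κ' : E) (u v : PowerSeries B) (n : ℕ) : E :=
  ∑ p ∈ Finset.HasAntidiagonal.antidiagonal n,
    (PowerSeries.coeff p.1 u * PowerSeries.coeff p.2 v) • kpow κ κ' ((p.2 : ℤ) - (p.1 : ℤ))

/-- The modes of the product `X(z) X(q² z)`. -/
def dbl (X : ℤ → E) (k : ℤ) : E := ∑ᶠ i : ℤ, qp (2 * ((k - i : ℤ) : ℂ)) • (X i * X (k - i))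

/-- `X(z) Y(w) = ρ(z/w) Y(w) X(z)` with `ρ` a power series. -/
def ExchFwd (ρ : ℕ → E) (X Y : ℤ → E) : Prop :=
  ∀ k l, X k * Y l = ∑ᶠ n : ℕ, ρ n * Y (l + n) * X (k - n)

/-- `X(z) Y(w) = ρ(w/z) Y(w) X(z)` with `ρ` a power series. -/
def ExchBwd (ρ : ℕ → E) (X Y : ℤ → E) : Prop :=
  ∀ k l, X k * Y l = ∑ᶠ n : ℕ, ρ n * Y (l - n) * X (k + n)

end Currents

/-- The exponent `±1`. -/
def Sgn.int : Sgn → ℤ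
  | .pos => 1
  | .neg => -1

/-- Generators of the extended Drinfeld algebra: the modes of `ξ^±(z)`, of `α^±(z)`, of the inverse
series `α^±(z)⁻¹`, and `q^c`, `q^(-c)`. -/
inductive UGen
  | xi (s : Sgn) (k : ℤ)
  | al (s : Sgn) (k : ℤ)
  | be (s : Sgn) (k : ℤ)
  | qc
  | qc'

/-- The degree of a generator: the mode of `z ^ k` has degree `k`. -/
def UGen.deg : UGen → ℤ
  | .xi _ k => k
  | .al _ k => k
  | .be _ k => k
  | .qc => 0
  | .qc' => 0

/-- The modes of `φ^±(z) = α^±(z)⁻¹ α^±(q² z)⁻¹`. -/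
def phi {E : Type*} [Ring E] [Algebra B E] (a : UGen → E) (s : Sgn) : ℤ → E :=
  dbl fun k => a (.be s k)

/-- The modes of `φ^±(z)⁻¹ = α^±(z) α^±(q² z)`. -/
def phiInv {E : Type*} [Ring E] [Algebra B E] (a : UGen → E) (s : Sgn) : ℤ → E :=
  dbl fun k => a (.al s k)

/-- The defining relations of the extended Drinfeld algebra. The normalization
`φ^+(0) φ^-(∞) = φ^-(∞) φ^+(0) = 1` of the zero modes is imposed if `ζ` is `true`. -/
structure URel (ζ : Bool) {E : Type*} [Ring E] [Algebra B E] (a : UGen → E) : Prop where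
  qc_mul : a .qc * a .qc' = 1
  qc_central : ∀ x, Commute (a .qc) (a x)
  qc'_central : ∀ x, Commute (a .qc') (a x)
  al_pos : ∀ k < 0, a (.al .pos k) = 0
  al_neg : ∀ k > 0, a (.al .neg k) = 0
  be_pos : ∀ k < 0, a (.be .pos k) = 0
  be_neg : ∀ k > 0, a (.be .neg k) = 0
  al_be : ∀ s (k : ℤ), ∑ᶠ i : ℤ, a (.al s i) * a (.be s (k - i)) = if k = 0 then 1 else 0
  be_al : ∀ s (k : ℤ), ∑ᶠ i : ℤ, a (.be s i) * a (.al s (k - i)) = if k = 0 then 1 else 0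
  -- relations between `φ^±` and `ξ^±`
  phi_zero : ζ = true → phi a .pos 0 * phi a .neg 0 = 1 ∧ phi a .neg 0 * phi a .pos 0 = 1
  phi_comm : ∀ s k l, Commute (phi a s k) (phi a s l)
  phi_phi : ExchFwd (twist (a .qc) (a .qc') g (Ring.inverse g)) (phi a .pos) (phi a .neg)
  phi_xi_pos_pos : ExchFwd (sc g) (phi a .pos) (fun l => a (.xi .pos l))
  phi_xi_neg_neg : ExchBwd (sc g) (phi a .neg) (fun l => a (.xi .neg l))
  phi_xi_pos_neg : ExchFwd (twist (a .qc) (a .qc') 1 (Ring.inverse g))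
    (phi a .pos) (fun l => a (.xi .neg l))
  phi_xi_neg_pos : ExchBwd (twist (a .qc) (a .qc') (Ring.inverse g) 1)
    (phi a .neg) (fun l => a (.xi .pos l))
  /-- `(z - q^(±2) w) ξ^±(z) ξ^±(w) = (q^(±2) z - w) ξ^±(w) ξ^±(z)`. -/
  xi_xi : ∀ (s : Sgn) k l,
    a (.xi s (k - 1)) * a (.xi s l) - qp (2 * s.int) • (a (.xi s k) * a (.xi s (l - 1))) =
      qp (2 * s.int) • (a (.xi s l) * a (.xi s (k - 1))) - a (.xi s (l - 1)) * a (.xi s k)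
  /-- `[ξ^+(z), ξ^-(w)] = (q - q⁻¹) (δ(q^(-c) z/w) φ^-(w) - δ(q^c z/w) φ^+(z))`. -/
  xi_pos_xi_neg : ∀ k l,
    a (.xi .pos k) * a (.xi .neg l) - a (.xi .neg l) * a (.xi .pos k) =
      (qp 1 - qp (-1)) • (kpow (a .qc) (a .qc') (-k) * phi a .neg (k + l)
        - kpow (a .qc) (a .qc') (-l) * phi a .pos (k + l))
  -- relations with `α^±`
  al_comm : ∀ s k l, Commute (a (.al s k)) (a (.al s l))
  al_xi_pos_pos : ExchFwd (sc (Ring.inverse d)) (fun k => a (.al .pos k)) (fun l => a (.xi .pos l))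
  al_xi_neg_neg : ExchBwd (sc (Ring.inverse dq)) (fun k => a (.al .neg k)) (fun l => a (.xi .neg l))
  al_xi_pos_neg : ExchFwd (twist (a .qc) (a .qc') 1 d)
    (fun k => a (.al .pos k)) (fun l => a (.xi .neg l))
  al_xi_neg_pos : ExchBwd (twist (a .qc) (a .qc') dq 1)
    (fun k => a (.al .neg k)) (fun l => a (.xi .pos l))
  al_al : ExchFwd (twist (a .qc) (a .qc') (Ring.inverse f) f)
    (fun k => a (.al .pos k)) (fun l => a (.al .neg l))

/-- Generators of the `L`-matrix algebra: the modes of the entries of `L^±(z)`, and `q^c`,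
`q^(-c)`. -/
inductive AGen
  | L (s : Sgn) (i j : Fin 2) (k : ℤ)
  | qc
  | qc'

def AGen.deg : AGen → ℤ
  | .L _ _ _ k => k
  | .qc => 0
  | .qc' => 0

section RLL

variable {M : Type} [AddCommGroup M] [Module B M]

/-- The coefficient of `z ^ k w ^ l` in `u(κ⁻¹ z/w) v(κ z/w) X(z) Y(w) m`, where `XY i j` is the
operator `X i * Y j`. -/
def nprod (κ κ' : Module.End B M) (u v : PowerSeries B) (XY : ℤ → ℤ → Module.End B M)
    (m : M) (k l : ℤ) : M :=
  ∑ᶠ n : ℕ, twist κ κ' u v n (XY (k - n) (l + n) m)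

/-- The coefficients of `z ^ k w ^ l` in the summands of `δ(κ z/w) G(z, w)`. -/
def dterm (κ κ' : Module.End B M) (G : ℤ → ℤ → M) (k l : ℤ) (n : ℤ) : M :=
  kpow κ κ' n (G (k - n) (l + n))

/-- The relation `R(κ⁻¹ z/w) X₁(z) Y₂(w) = Y₂(w) X₁(z) R(κ z/w)` for two matrices `X`, `Y` of
currents, in the form
`Y₂(w) X₁(z) = R(κ⁻¹ z/w) X₁(z) Y₂(w) R(κ z/w)⁻¹`,
in which every infinite sum of modes that occurs is a normally ordered one.
The product of the operators `a` and `b` is `comp a b`.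

The right hand side is expanded by `R = R0 + R1 δ` and `R⁻¹ = Q0 + Q1 δ`. A product
`(v(x) δ(x)) X(z) Y(w)`, `x = z/w`, is `δ(x) (v(x) X(z) Y(w))`: a zero of `v` at `x = 1` cancels a
pole of `X(z) Y(w)` before `δ(x)` is applied, and it is part of the relation that
`v(x) X(z) Y(w)` then has a product with `δ(x)`, each coefficient being a finite sum on each vector.
The product of the two terms in `δ` is absent: it is a multiple of the current `X₁₂(z) Y₂₁(w)`, and
`X₁₂ = 0` or `Y₂₁ = 0` by triangularity in all cases. -/
structure RLL (comp : Module.End B M → Module.End B M → Module.End B M)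
    (κ κ' : Module.End B M) (X Y : Fin 2 → Fin 2 → ℤ → Module.End B M) : Prop where
  finite_left : ∀ (a b s t : Ix) (m : M) (k l : ℤ),
    (Function.support (dterm κ' κ (nprod κ κ' (R1 a s) (Q0 t b)
      (fun i j => comp (X s.1 t.1 i) (Y s.2 t.2 j)) m) k l)).Finite
  finite_right : ∀ (a b s t : Ix) (m : M) (k l : ℤ),
    (Function.support (dterm κ κ' (nprod κ κ' (R0 a s) (Q1 t b)
      (fun i j => comp (X s.1 t.1 i) (Y s.2 t.2 j)) m) k l)).Finite
  eq : ∀ (a b : Ix) (m : M) (k l : ℤ),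
    comp (Y a.2 b.2 l) (X a.1 b.1 k) m =
      ∑ s : Ix, ∑ t : Ix,
        (nprod κ κ' (R0 a s) (Q0 t b) (fun i j => comp (X s.1 t.1 i) (Y s.2 t.2 j)) m k l
        + ∑ᶠ n : ℤ, dterm κ' κ (nprod κ κ' (R1 a s) (Q0 t b)
            (fun i j => comp (X s.1 t.1 i) (Y s.2 t.2 j)) m) k l n
        + ∑ᶠ n : ℤ, dterm κ κ' (nprod κ κ' (R0 a s) (Q1 t b)
            (fun i j => comp (X s.1 t.1 i) (Y s.2 t.2 j)) m) k l n)

end RLL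

/-- The product in the algebra, or the opposite product. -/
def Dir.comp {E : Type*} [Ring E] : Dir → E → E → E
  | .high, x, y => x * y
  | .low, x, y => y * x

/-- The first of two elements for highest weight, the second for lowest weight representations. -/
def Dir.pick {E : Type*} : Dir → E → E → E
  | .high, x, _ => x
  | .low, _, y => y

/-- The defining relations of the `L`-matrix algebra `A(R)` on a module.

On highest weight representations (`.high`) the generators are the modes of `L^±(z)`. On lowest
weight representations (`.low`) the well defined objects are the inverse matrices
`K^±(z) = L^±(z)⁻¹`, and the generators stand for the modes of `K^±(z)`; their relations, obtained
by inverting those of `L^±(z)`, are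
`R(z/w) K₂^±(w) K₁^±(z) = K₁^±(z) K₂^±(w) R(z/w)`,
`R(q^c z/w) K₂^-(w) K₁^+(z) = K₁^+(z) K₂^-(w) R(q^(-c) z/w)` and
`K^±₂₂(q⁻² z) K^±₁₁(z) = 1`, that is, the relations of `L^±(z)` with the opposite product and with
`q^c` replaced by its inverse.

The normalization `L^+₁₁(0)² L^-₁₁(∞)² = 1` of the zero modes is imposed if `ζ` is `true`. -/
structure ARel (ζ : Bool) (D : Dir) {M : Type} [AddCommGroup M] [Module B M]
    (a : AGen → Module.End B M) : Prop where
  qc_mul : a .qc * a .qc' = 1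
  qc_central : ∀ x, Commute (a .qc) (a x)
  qc'_central : ∀ x, Commute (a .qc') (a x)
  lower : ∀ k, a (.L .pos 0 1 k) = 0
  upper : ∀ k, a (.L .neg 1 0 k) = 0
  diag_pos : ∀ i, ∀ k < 0, a (.L .pos i i k) = 0
  diag_neg : ∀ i, ∀ k > 0, a (.L .neg i i k) = 0
  rll_same : ∀ s, RLL D.comp 1 1 (fun i j k => a (.L s i j k)) (fun i j k => a (.L s i j k))
  rll_mixed : RLL D.comp
    (D.pick (a .qc) (a .qc')) (D.pick (a .qc') (a .qc))
    (fun i j k => a (.L .pos i j k)) (fun i j k => a (.L .neg i j k))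
  /-- The quantum determinant `L₁₁(z) L₂₂(q⁻² z)` equals `1`. -/
  qdet : ∀ s (k : ℤ), ∑ᶠ i : ℤ, qp (-(2 * ((k - i : ℤ) : ℂ))) •
    D.comp (a (.L s 0 0 i)) (a (.L s 1 1 (k - i))) = if k = 0 then 1 else 0
  zero_modes : ζ = true → a (.L .pos 0 0 0) ^ 2 * a (.L .neg 0 0 0) ^ 2 = 1 ∧
    a (.L .neg 0 0 0) ^ 2 * a (.L .pos 0 0 0) ^ 2 = 1

/-! ### Algebras in the category of highest (lowest) weight representations -/

/-- A presentation of a graded algebra: generators with degrees, relations between operators, and a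
sign, `1` for highest weight and `-1` for lowest weight representations. -/
structure Theory where
  Gen : Type
  deg : Gen → ℤ
  Rel : ∀ (M : Type) [AddCommGroup M] [Module B M], (Gen → Module.End B M) → Prop
  sgn : ℤ

/-- A space with `n` commuting actions of the algebra. In each of them every vector is annihilated
by all monomials in the generators of sufficiently large degree (sufficiently negative degree, in
the lowest weight case). For `n = 1` these are the highest (lowest) weight representations; for
`n = 2` they include the tensor products of two such representations. -/
structure Rep (T : Theory) (n : ℕ) where
  carrier : Type
  [grp : AddCommGroup carrier]
  [mod : Module B carrier]
  act : Fin n → T.Gen → Module.End B carrier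
  rel : ∀ i, T.Rel carrier (act i)
  bounded : ∀ i (v : carrier), ∃ N : ℤ, ∀ w : List T.Gen,
    N ≤ T.sgn * (w.map T.deg).sum → (w.map (act i)).prod v = 0
  comm : ∀ i j, i ≠ j → ∀ x y, Commute (act i x) (act j y)

attribute [instance] Rep.grp Rep.mod

/-- The linear combinations of monomials of degree `k`. -/
def homog (T : Theory) (n : ℕ) (k : ℤ) : Submodule B (FreeAlgebra B (Fin n × T.Gen)) :=
  Submodule.span B {x | ∃ w : List (Fin n × T.Gen),
    (w.map fun p => T.deg p.2).sum = k ∧ x = (w.map (FreeAlgebra.ι B)).prod}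

/-- The action of noncommutative polynomials in the generators. -/
def Rep.eval {T : Theory} {n : ℕ} (V : Rep T n) :
    FreeAlgebra B (Fin n × T.Gen) →ₐ[B] Module.End B V.carrier :=
  FreeAlgebra.lift B fun p => V.act p.1 p.2

/-- The families of operators on all representations that are limits of polynomials of degree `k` in
the generators: on any finitely many vectors of representations they agree with such a polynomial.
Infinite normally ordered sums of monomials of degree `k` are of this kind. -/
def piece (T : Theory) (n : ℕ) (k : ℤ) : Set ((V : Rep T n) → Module.End B V.carrier) :=
  {η | ∀ S : Finset (Σ V : Rep T n, V.carrier), ∃ x ∈ homog T n k,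
    ∀ p ∈ S, η p.1 p.2 = p.1.eval x p.2}

/-- The algebra with the given generators and relations in the category of highest (lowest) weight
representations (`n = 1`), completed degree by degree so that normally ordered infinite sums make
sense; two elements are equal if they act equally on all representations. For general `n` this is
the completed `n`-th tensor power. -/
def completed (T : Theory) (n : ℕ) :
    Subalgebra B ((V : Rep T n) → Module.End B V.carrier) :=
  Algebra.adjoin B (⋃ k, piece T n k)

abbrev Completed (T : Theory) (n : ℕ) : Type 1 := completed T n

/-- The topology of pointwise convergence on the vectors of all representations, each
representation being discrete. -/
instance (T : Theory) (n : ℕ) : TopologicalSpace (Completed T n) :=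
  ⨅ p : (Σ V : Rep T n, V.carrier), TopologicalSpace.induced (fun η => η.1 p.1 p.2) ⊥

theorem act_mem (T : Theory) (n : ℕ) (i : Fin n) (x : T.Gen) :
    (fun V : Rep T n => V.act i x) ∈ completed T n := by
  refine Algebra.subset_adjoin (Set.mem_iUnion.2 ⟨T.deg x, fun S => ?_⟩)
  refine ⟨FreeAlgebra.ι B (i, x), Submodule.subset_span ⟨[(i, x)], by simp, by simp⟩, ?_⟩
  intro p _
  simp [Rep.eval]

/-- The generator `x` in the `i`-th tensor factor. -/
def gen (T : Theory) {n : ℕ} (i : Fin n) (x : T.Gen) : Completed T n :=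
  ⟨fun V => V.act i x, act_mem T n i x⟩

/-- Restriction of a space with `n` commuting actions to some of the actions. -/
def Rep.restrict {T : Theory} {m n : ℕ} (e : Fin m ↪ Fin n) (V : Rep T n) : Rep T m where
  carrier := V.carrier
  act i := V.act (e i)
  rel i := V.rel (e i)
  bounded i := V.bounded (e i)
  comm i j h := V.comm (e i) (e j) (fun h' => h (e.injective h'))

def embAux (T : Theory) {m n : ℕ} (e : Fin m ↪ Fin n) :
    ((V : Rep T m) → Module.End B V.carrier) →ₐ[B] ((V : Rep T n) → Module.End B V.carrier) where
  toFun η V := η (V.restrict e)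
  map_one' := rfl
  map_mul' _ _ := rfl
  map_zero' := rfl
  map_add' _ _ := rfl
  commutes' _ := rfl

theorem embAux_piece (T : Theory) {m n : ℕ} (e : Fin m ↪ Fin n) (k : ℤ)
    (η : (V : Rep T m) → Module.End B V.carrier) (h : η ∈ piece T m k) :
    embAux T e η ∈ piece T n k := by
  classical
  intro S
  let r : (Σ V : Rep T n, V.carrier) → (Σ V : Rep T m, V.carrier) :=
    fun p => ⟨p.1.restrict e, p.2⟩
  obtain ⟨x, hx, hS⟩ := h (S.image r)
  have hmap : ∀ V : Rep T n, ∀ y : FreeAlgebra B (Fin m × T.Gen),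
      V.eval (FreeAlgebra.lift B (fun p => FreeAlgebra.ι B (e p.1, p.2)) y) =
        (V.restrict e).eval y := by
    intro V y
    have : V.eval.comp (FreeAlgebra.lift B (fun p : Fin m × T.Gen =>
        FreeAlgebra.ι B (e p.1, p.2))) = (V.restrict e).eval := by
      apply FreeAlgebra.hom_ext
      funext p
      simp only [Function.comp_apply, AlgHom.coe_comp, FreeAlgebra.lift_ι_apply, Rep.eval]
      exact (FreeAlgebra.lift_ι_apply (R := B) (fun p => (V.restrict e).act p.1 p.2) p).symm
    exact DFunLike.congr_fun this y
  refine ⟨FreeAlgebra.lift B (fun p => FreeAlgebra.ι B (e p.1, p.2)) x, ?_, ?_⟩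
  · have hle : homog T m k ≤ (homog T n k).comap
        (FreeAlgebra.lift B (fun p : Fin m × T.Gen =>
          FreeAlgebra.ι B (e p.1, p.2))).toLinearMap := by
      refine Submodule.span_le.2 ?_
      rintro _ ⟨w, hw, rfl⟩
      refine Submodule.subset_span ⟨w.map fun p => (e p.1, p.2), ?_, ?_⟩
      · rw [← hw, List.map_map]
        rfl
      · rw [AlgHom.toLinearMap_apply, map_list_prod, List.map_map, List.map_map]
        congr 1
        apply List.map_congr_left
        intro p _
        simp
    exact hle hx
  · intro p hp
    rw [hmap]
    exact hS (r p) (Finset.mem_image_of_mem r hp)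

/-- The inclusion of a tensor power into a higher one, given by the choice of the tensor factors. -/
def emb (T : Theory) {m n : ℕ} (e : Fin m ↪ Fin n) : Completed T m →ₐ[B] Completed T n :=
  ((embAux T e).comp (completed T m).val).codRestrict (completed T n) (by
    rintro ⟨η, hη⟩
    have hle : (completed T m).map (embAux T e) ≤ completed T n := by
      rw [completed, AlgHom.map_adjoin]
      refine Algebra.adjoin_mono ?_
      rintro _ ⟨η, h, rfl⟩
      obtain ⟨k, hk⟩ := Set.mem_iUnion.1 h
      exact Set.mem_iUnion.2 ⟨k, embAux_piece T e k η hk⟩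
    exact hle ⟨η, hη, rfl⟩)

/-- The inclusion of the algebra as the `i`-th tensor factor. -/
def leg (T : Theory) {n : ℕ} (i : Fin n) : Completed T 1 →ₐ[B] Completed T n :=
  emb T ⟨fun _ => i, fun _ _ _ => Subsingleton.elim _ _⟩

/-- Hopf algebra structure maps in the category of highest weight representations. The algebra is
given by the theory `T` of its highest weight representations and the theory `T'` of its lowest
weight representations. The antipode exchanges the two categories: it turns normally ordered sums
into anti-normally ordered ones, which act on lowest weight representations. All maps are continuous
(the antipode, on each homogeneous part), so they are determined by their values on the
generators. -/
structure HopfData (T T' : Theory) where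
  Δ : Completed T 1 →ₐ[B] Completed T 2
  ε : Completed T 1 →ₐ[B] B
  S : Completed T 1 →ₐ[B] (Completed T' 1)ᵐᵒᵖ
  continuous_Δ : Continuous Δ
  continuous_ε : IsLocallyConstant ε
  continuous_S : ∀ k, ContinuousOn S {x | x.1 ∈ piece T 1 k}
  /-- `(Δ ⊗ id) Δ = (id ⊗ Δ) Δ`; the maps `D₁` and `D₂` are `Δ ⊗ id` and `id ⊗ Δ`. -/
  coassoc : ∃ D₁ D₂ : Completed T 2 →ₐ[B] Completed T 3, Continuous D₁ ∧ Continuous D₂ ∧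
    (∀ x, D₁ (leg T 0 x) = emb T Fin.castSuccEmb (Δ x)) ∧ (∀ x, D₁ (leg T 1 x) = leg T 2 x) ∧
    (∀ x, D₂ (leg T 0 x) = leg T 0 x) ∧ (∀ x, D₂ (leg T 1 x) = emb T (Fin.succEmb 2) (Δ x)) ∧
    ∀ x, D₁ (Δ x) = D₂ (Δ x)
  /-- `(ε ⊗ id) Δ = id = (id ⊗ ε) Δ`; the maps `E₁` and `E₂` are `ε ⊗ id` and `id ⊗ ε`. -/
  counit : ∃ E₁ E₂ : Completed T 2 →ₐ[B] Completed T 1, Continuous E₁ ∧ Continuous E₂ ∧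
    (∀ x, E₁ (leg T 0 x) = algebraMap B _ (ε x)) ∧ (∀ x, E₁ (leg T 1 x) = x) ∧
    (∀ x, E₂ (leg T 0 x) = x) ∧ (∀ x, E₂ (leg T 1 x) = algebraMap B _ (ε x)) ∧
    ∀ x, E₁ (Δ x) = x ∧ E₂ (Δ x) = x

/-! ### The two algebras and their structure maps -/

def Dir.int : Dir → ℤ
  | .high => 1
  | .low => -1

/-- The extended Drinfeld algebra on highest (lowest) weight representations. -/
def UTh (ζ : Bool) (D : Dir) : Theory where
  Gen := UGen
  deg := UGen.deg
  Rel _ _ _ a := URel ζ a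
  sgn := D.int

/-- The `L`-matrix algebra `A(R)` on highest (lowest) weight representations. -/
def ATh (ζ : Bool) (D : Dir) : Theory where
  Gen := AGen
  deg := AGen.deg
  Rel _ _ _ a := ARel ζ D a
  sgn := D.int

/-- The generators of the extended Drinfeld algebra in the `i`-th tensor factor. -/
def ug (ζ : Bool) (D : Dir) {n : ℕ} (i : Fin n) (x : UGen) : Completed (UTh ζ D) n :=
  gen (UTh ζ D) i x

/-- The generators of `A(R)` in the `i`-th tensor factor. -/
def ag (ζ : Bool) (D : Dir) {n : ℕ} (i : Fin n) (x : AGen) : Completed (ATh ζ D) n :=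
  gen (ATh ζ D) i x

open MulOpposite in
/-- The Hopf structure of the extended Drinfeld algebra:
`Δ(q^c) = q^c ⊗ q^c`,
`Δ(ξ^+(z)) = ξ^+(z) ⊗ 1 + φ^+(z) ⊗ ξ^+(z q^(c₁))`,
`Δ(ξ^-(z)) = 1 ⊗ ξ^-(z) + ξ^-(z q^(c₂)) ⊗ φ^-(z)`,
`Δ(α^+(z)) = α^+(z) ⊗ α^+(z q^(c₁))`, `Δ(α^-(z)) = α^-(z q^(c₂)) ⊗ α^-(z)`,
`ε(q^c) = 1`, `ε(α^±(z)) = 1`, `ε(ξ^±(z)) = 0`,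
`S(q^c) = q^(-c)`, `S(α^±(z)) = α^±(z q^(-c))⁻¹`,
`S(ξ^+(z)) = -φ^+(z q^(-c))⁻¹ ξ^+(z q^(-c))`, `S(ξ^-(z)) = -ξ^-(z q^(-c)) φ^-(z q^(-c))⁻¹`. -/
structure IsDrinfeldHopf (ζ : Bool) (H : HopfData (UTh ζ .high) (UTh ζ .low)) : Prop where
  Δ_qc : H.Δ (ug ζ .high 0 .qc) = ug ζ .high 0 .qc * ug ζ .high 1 .qc
  Δ_xi_pos : ∀ k, HasSum (fun n : ℤ => phi (ug ζ .high (n := 2) 0) .pos n *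
      kpow (ug ζ .high 0 .qc) (ug ζ .high 0 .qc') (k - n) * ug ζ .high 1 (.xi .pos (k - n)))
    (H.Δ (ug ζ .high 0 (.xi .pos k)) - ug ζ .high 0 (.xi .pos k))
  Δ_xi_neg : ∀ k, HasSum (fun n : ℤ => ug ζ .high (n := 2) 0 (.xi .neg n) *
      kpow (ug ζ .high 1 .qc) (ug ζ .high 1 .qc') n * phi (ug ζ .high 1) .neg (k - n))
    (H.Δ (ug ζ .high 0 (.xi .neg k)) - ug ζ .high 1 (.xi .neg k))
  Δ_al_pos : ∀ k, HasSum (fun n : ℤ => ug ζ .high (n := 2) 0 (.al .pos n) *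
      kpow (ug ζ .high 0 .qc) (ug ζ .high 0 .qc') (k - n) * ug ζ .high 1 (.al .pos (k - n)))
    (H.Δ (ug ζ .high 0 (.al .pos k)))
  Δ_al_neg : ∀ k, HasSum (fun n : ℤ => ug ζ .high (n := 2) 0 (.al .neg n) *
      kpow (ug ζ .high 1 .qc) (ug ζ .high 1 .qc') n * ug ζ .high 1 (.al .neg (k - n)))
    (H.Δ (ug ζ .high 0 (.al .neg k)))
  ε_qc : H.ε (ug ζ .high 0 .qc) = 1
  ε_xi : ∀ s k, H.ε (ug ζ .high 0 (.xi s k)) = 0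
  ε_al : ∀ s k, H.ε (ug ζ .high 0 (.al s k)) = if k = 0 then 1 else 0
  S_qc : H.S (ug ζ .high 0 .qc) = op (ug ζ .low 0 .qc')
  S_al : ∀ s k, H.S (ug ζ .high 0 (.al s k)) =
    op (kpow (ug ζ .low 0 .qc) (ug ζ .low 0 .qc') (-k) * ug ζ .low 0 (.be s k))
  S_xi_pos : ∀ k, HasSum (fun n : ℤ => -(kpow (ug ζ .low 0 .qc) (ug ζ .low 0 .qc') (-k) *
      phiInv (ug ζ .low (n := 1) 0) .pos n * ug ζ .low 0 (.xi .pos (k - n))))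
    (unop (H.S (ug ζ .high 0 (.xi .pos k))))
  S_xi_neg : ∀ k, HasSum (fun n : ℤ => -(kpow (ug ζ .low 0 .qc) (ug ζ .low 0 .qc') (-k) *
      ug ζ .low (n := 1) 0 (.xi .neg n) * phiInv (ug ζ .low 0) .neg (k - n)))
    (unop (H.S (ug ζ .high 0 (.xi .neg k))))

open MulOpposite in
/-- The Hopf structure of `A(R)`: `Δ(q^c) = q^c ⊗ q^c`,
`Δ(L^+_{ij}(z)) = ∑_p L^+_{ip}(z) ⊗ L^+_{pj}(z q^(c₁))`,
`Δ(L^-_{ij}(z)) = ∑_p L^-_{ip}(z q^(c₂)) ⊗ L^-_{pj}(z)`,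
`ε(q^c) = 1`, `ε(L^±(z)) = 1`, `S(q^c) = q^(-c)`, `S(L^±(z)) = L^±(z q^(-c))⁻¹`. The entries of
`L^±(z)⁻¹` are the generators on lowest weight representations. -/
structure IsLHopf (ζ : Bool) (H : HopfData (ATh ζ .high) (ATh ζ .low)) : Prop where
  Δ_qc : H.Δ (ag ζ .high 0 .qc) = ag ζ .high 0 .qc * ag ζ .high 1 .qc
  Δ_L_pos : ∀ i j k, HasSum (fun n : ℤ => ∑ p : Fin 2, ag ζ .high (n := 2) 0 (.L .pos i p n) *
      kpow (ag ζ .high 0 .qc) (ag ζ .high 0 .qc') (k - n) * ag ζ .high 1 (.L .pos p j (k - n)))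
    (H.Δ (ag ζ .high 0 (.L .pos i j k)))
  Δ_L_neg : ∀ i j k, HasSum (fun n : ℤ => ∑ p : Fin 2, ag ζ .high (n := 2) 0 (.L .neg i p n) *
      kpow (ag ζ .high 1 .qc) (ag ζ .high 1 .qc') n * ag ζ .high 1 (.L .neg p j (k - n)))
    (H.Δ (ag ζ .high 0 (.L .neg i j k)))
  ε_qc : H.ε (ag ζ .high 0 .qc) = 1
  ε_L : ∀ s i j k, H.ε (ag ζ .high 0 (.L s i j k)) = if i = j ∧ k = 0 then 1 else 0
  S_qc : H.S (ag ζ .high 0 .qc) = op (ag ζ .low 0 .qc')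
  S_L : ∀ s i j k, H.S (ag ζ .high 0 (.L s i j k)) =
    op (kpow (ag ζ .low 0 .qc) (ag ζ .low 0 .qc') (-k) * ag ζ .low 0 (.L s i j k))

/-- The values of `μ` on the generators:
`L^+(z) ↦ [[α^+(z), 0], [ξ^+(z) α^+(z), α^+(q² z)⁻¹]]`,
`L^-(z) ↦ [[α^-(z), -α^-(z) ξ^-(z)], [0, α^-(q² z)⁻¹]]`, `q^c ↦ q^c`. -/
structure IsMu (ζ : Bool)
    (μ : Completed (ATh ζ .high) 1 ≃ₐ[B] Completed (UTh ζ .high) 1) : Prop where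
  qc : μ (ag ζ .high 0 .qc) = ug ζ .high 0 .qc
  pos_11 : ∀ k, μ (ag ζ .high 0 (.L .pos 0 0 k)) = ug ζ .high 0 (.al .pos k)
  pos_12 : ∀ k, μ (ag ζ .high 0 (.L .pos 0 1 k)) = 0
  pos_21 : ∀ k, HasSum
    (fun n : ℤ => ug ζ .high 0 (.xi .pos n) * ug ζ .high 0 (.al .pos (k - n)))
    (μ (ag ζ .high 0 (.L .pos 1 0 k)))
  pos_22 : ∀ k, μ (ag ζ .high 0 (.L .pos 1 1 k)) = qp (2 * (k : ℂ)) • ug ζ .high 0 (.be .pos k)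
  neg_11 : ∀ k, μ (ag ζ .high 0 (.L .neg 0 0 k)) = ug ζ .high 0 (.al .neg k)
  neg_12 : ∀ k, HasSum
    (fun n : ℤ => -(ug ζ .high 0 (.al .neg n) * ug ζ .high 0 (.xi .neg (k - n))))
    (μ (ag ζ .high 0 (.L .neg 0 1 k)))
  neg_21 : ∀ k, μ (ag ζ .high 0 (.L .neg 1 0 k)) = 0
  neg_22 : ∀ k, μ (ag ζ .high 0 (.L .neg 1 1 k)) = qp (2 * (k : ℂ)) • ug ζ .high 0 (.be .neg k)

/-- The same isomorphism on lowest weight representations. The generators of `A(R)` there are the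
entries of `L^±(z)⁻¹`, so the images are the inverses of the matrices above:
`L^+(z)⁻¹ ↦ [[α^+(z)⁻¹, 0], [-α^+(q² z) ξ^+(z), α^+(q² z)]]`,
`L^-(z)⁻¹ ↦ [[α^-(z)⁻¹, ξ^-(z) α^-(q² z)], [0, α^-(q² z)]]`. -/
structure IsMuLow (ζ : Bool)
    (μ : Completed (ATh ζ .low) 1 ≃ₐ[B] Completed (UTh ζ .low) 1) : Prop where
  qc : μ (ag ζ .low 0 .qc) = ug ζ .low 0 .qc
  pos_11 : ∀ k, μ (ag ζ .low 0 (.L .pos 0 0 k)) = ug ζ .low 0 (.be .pos k)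
  pos_12 : ∀ k, μ (ag ζ .low 0 (.L .pos 0 1 k)) = 0
  pos_21 : ∀ k, HasSum (fun n : ℤ => -(qp (2 * (n : ℂ)) •
      (ug ζ .low 0 (.al .pos n) * ug ζ .low 0 (.xi .pos (k - n)))))
    (μ (ag ζ .low 0 (.L .pos 1 0 k)))
  pos_22 : ∀ k, μ (ag ζ .low 0 (.L .pos 1 1 k)) = qp (2 * (k : ℂ)) • ug ζ .low 0 (.al .pos k)
  neg_11 : ∀ k, μ (ag ζ .low 0 (.L .neg 0 0 k)) = ug ζ .low 0 (.be .neg k)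
  neg_12 : ∀ k, HasSum (fun n : ℤ => qp (2 * ((k - n : ℤ) : ℂ)) •
      (ug ζ .low 0 (.xi .neg n) * ug ζ .low 0 (.al .neg (k - n))))
    (μ (ag ζ .low 0 (.L .neg 0 1 k)))
  neg_21 : ∀ k, μ (ag ζ .low 0 (.L .neg 1 0 k)) = 0
  neg_22 : ∀ k, μ (ag ζ .low 0 (.L .neg 1 1 k)) = qp (2 * (k : ℂ)) • ug ζ .low 0 (.al .neg k)

end

end QCurrent

open QCurrent

set_option linter.unusedSectionVars false
set_option autoImplicit false

namespace QCurrent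

noncomputable section

open PowerSeries Filter Topology MulOpposite Finset.HasAntidiagonal

/-- A graded topological ring in which products `x * y` of fixed total degree become small when the
degree of `y` is large, so that normally ordered sums converge. -/
class CurrentRing (R E : Type*) [CommRing R] [Ring E] [Algebra R E] [TopologicalSpace E] where
  grading : ℤ → Submodule R E
  one_mem_grading : (1 : E) ∈ grading 0
  mul_mem_grading : ∀ {i j x y}, x ∈ grading i → y ∈ grading j → x * y ∈ grading (i + j)
  isClosed_grading : ∀ k, IsClosed (grading k : Set E)
  exists_small : ∀ (s : ℤ), ∀ U ∈ 𝓝 (0 : E), ∃ V : Submodule R E, (V : Set E) ⊆ U ∧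
    ∃ N : ℤ, ∀ i j, i + j = s → N ≤ j → ∀ x ∈ grading i, ∀ y ∈ grading j, x * y ∈ V
  summable_of_tendsto : ∀ (s : ℤ) (ι : Type) (f : ι → E), (∀ i, f i ∈ grading s) →
    Tendsto f cofinite (𝓝 0) → Summable f

variable (R : Type*) {E : Type*} [CommRing R] [Ring E] [Algebra R E] [TopologicalSpace E]
  [T2Space E] [IsTopologicalAddGroup E] [SeparatelyContinuousMul E] [CurrentRing R E]

open CurrentRing

/-- The elements of degree `k`. -/
abbrev pc (k : ℤ) : Submodule R E := grading k

/-- The span of the products of total degree `s` whose right factor has degree at least `N`. -/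
def deepPart (s N : ℤ) : Submodule R E :=
  Submodule.span R {z | ∃ i j, i + j = s ∧ N ≤ j ∧ ∃ x ∈ pc R i, ∃ y ∈ pc R j, z = x * y}

variable {R}

lemma mul_mem_pc {i j : ℤ} {x y : E} (hx : x ∈ pc R i) (hy : y ∈ pc R j) :
    x * y ∈ pc R (i + j) := mul_mem_grading hx hy

lemma mul_mem_pc' {i j k : ℤ} {x y : E} (hx : x ∈ pc R i) (hy : y ∈ pc R j) (h : i + j = k) :
    x * y ∈ pc R k := h ▸ mul_mem_pc hx hy

lemma mul_mem_deepPart {i j s N : ℤ} {x y : E} (hx : x ∈ pc R i) (hy : y ∈ pc R j)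
    (h : i + j = s) (hN : N ≤ j) : x * y ∈ deepPart R (E := E) s N :=
  Submodule.subset_span ⟨i, j, h, hN, x, hx, y, hy, rfl⟩

variable (R) in
/-- A family of elements of degree `s` all but finitely many of which are arbitrarily deep. -/
structure Deep {ι : Type} (s : ℤ) (f : ι → E) : Prop where
  mem : ∀ i, f i ∈ pc R s
  fin : ∀ N, {i | f i ∉ deepPart R s N}.Finite

section Deep

variable {ι κ : Type} {s : ℤ}

lemma hasSum_mul_left (a : E) {f : ι → E} {x : E} (h : HasSum f x) :
    HasSum (fun i => a * f i) (a * x) :=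
  h.map (AddMonoidHom.mulLeft a) (continuous_const_mul a)

lemma hasSum_mul_right (a : E) {f : ι → E} {x : E} (h : HasSum f x) :
    HasSum (fun i => f i * a) (x * a) :=
  h.map (AddMonoidHom.mulRight a) (continuous_mul_const a)

lemma hasSum_smul (c : R) {f : ι → E} {x : E} (h : HasSum f x) :
    HasSum (fun i => c • f i) (c • x) := by
  simp only [Algebra.smul_def]
  exact hasSum_mul_left _ h

lemma tsum_mulLeft (a : E) {f : ι → E} (h : Summable f) : ∑' i, a * f i = a * ∑' i, f i :=
  (hasSum_mul_left a h.hasSum).tsum_eq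

lemma tsum_mulRight (a : E) {f : ι → E} (h : Summable f) : ∑' i, f i * a = (∑' i, f i) * a :=
  (hasSum_mul_right a h.hasSum).tsum_eq

lemma tsum_smulLeft (c : R) {f : ι → E} (h : Summable f) : ∑' i, c • f i = c • ∑' i, f i :=
  (hasSum_smul c h.hasSum).tsum_eq

variable {f : ι → E}

lemma Deep.summable (h : Deep R s f) : Summable f := by
  refine summable_of_tendsto (R := R) s ι f h.mem ?_
  intro U hU
  obtain ⟨V, hVU, N, hN⟩ := exists_small (R := R) s U hU
  rw [mem_map, mem_cofinite]
  refine (h.fin N).subset fun i hi hd => hi (hVU ?_)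
  have hle : deepPart R s N ≤ V := by
    refine Submodule.span_le.2 ?_
    rintro _ ⟨i, j, hij, hj, x, hx, y, hy, rfl⟩
    exact hN i j hij hj x hx y hy
  exact hle hd

lemma tsum_mem_pc (h : ∀ i, f i ∈ pc R s) : ∑' i, f i ∈ pc R s := by
  by_cases hf : Summable f
  · refine (isClosed_grading (R := R) s).mem_of_tendsto hf.hasSum (Eventually.of_forall fun t => ?_)
    exact Submodule.sum_mem _ fun i _ => h i
  · rw [tsum_eq_zero_of_not_summable hf]
    exact zero_mem _

lemma Deep.comp_injective {g : κ → ι} (h : Deep R s f) (hg : Function.Injective g) :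
    Deep R s (fun j => f (g j)) :=
  ⟨fun j => h.mem _, fun N => (h.fin N).preimage hg.injOn⟩

lemma Deep.congr {g : ι → E} (h : Deep R s f) (hg : ∀ i, g i = f i) : Deep R s g := by
  rwa [funext hg]

lemma Deep.smul (h : Deep R s f) (c : ι → R) : Deep R s (fun i => c i • f i) :=
  ⟨fun i => Submodule.smul_mem _ _ (h.mem i), fun N => (h.fin N).subset fun i hi hd =>
    hi (Submodule.smul_mem _ _ hd)⟩

variable (R) in
lemma tsum_prod_of_deep {f : ι × κ → E} (h : Deep R s f) :
    ∑' p, f p = ∑' i, ∑' j, f (i, j) := by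
  exact h.summable.tsum_prod' fun i =>
    (h.comp_injective (g := fun j => (i, j)) (Prod.mk_right_injective i)).summable

variable (R) in
lemma tsum_prod_of_deep' {f : ι × κ → E} (h : Deep R s f) :
    ∑' p, f p = ∑' j, ∑' i, f (i, j) := by
  rw [← (Equiv.prodComm κ ι).tsum_eq]
  exact tsum_prod_of_deep R (h.comp_injective (Equiv.prodComm κ ι).injective)

variable (R) in
lemma tsum_antidiagonal_of_deep {f : ℕ × ℕ → E} (h : Deep R s f) :
    ∑' p, f p = ∑' n : ℕ, ∑ p ∈ antidiagonal n, f p := by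
  rw [← sigmaAntidiagonalEquivProd.tsum_eq f]
  have h2 : Deep R s (fun c => f (sigmaAntidiagonalEquivProd c)) :=
    h.comp_injective (Equiv.injective _)
  rw [h2.summable.tsum_sigma' fun n => (h2.comp_injective (g := fun c => ⟨n, c⟩)
    (sigma_mk_injective (β := fun n : ℕ => antidiagonal n))).summable]
  refine tsum_congr fun n => ?_
  rw [tsum_fintype]
  exact Finset.sum_coe_sort (antidiagonal n) f

lemma deep_mul {x y : ι → E} {a b : ι → ℤ} (c : ι → R) (hx : ∀ i, x i ∈ pc R (a i))
    (hy : ∀ i, y i ∈ pc R (b i)) (hab : ∀ i, a i + b i = s) (p : ι → Prop)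
    (h0 : ∀ i, ¬ p i → x i * y i = 0) (hfin : ∀ N : ℤ, {i | b i < N ∧ p i}.Finite) :
    Deep R s (fun i => c i • (x i * y i)) := by
  refine ⟨fun i => Submodule.smul_mem _ _ (mul_mem_pc' (hx i) (hy i) (hab i)), fun N => ?_⟩
  refine (hfin N).subset fun i hi => ?_
  by_contra h
  rw [Set.mem_ofPred_eq, not_and_or, not_lt] at h
  refine hi (Submodule.smul_mem _ _ ?_)
  rcases h with h | h
  · exact mul_mem_deepPart (hx i) (hy i) (hab i) h
  · rw [h0 i h]; exact zero_mem _

lemma deep_mul₃ {x y z : ι → E} {a b e : ι → ℤ} (c : ι → R) (hx : ∀ i, x i ∈ pc R (a i))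
    (hy : ∀ i, y i ∈ pc R (b i)) (hz : ∀ i, z i ∈ pc R (e i)) (hab : ∀ i, a i + b i + e i = s)
    (p : ι → Prop) (h0 : ∀ i, ¬ p i → x i * (y i * z i) = 0)
    (hfin : ∀ N : ℤ, {i | e i < N ∧ b i + e i < N ∧ p i}.Finite) :
    Deep R s (fun i => c i • (x i * (y i * z i))) := by
  refine ⟨fun i => Submodule.smul_mem _ _ (mul_mem_pc' (hx i) (mul_mem_pc (hy i) (hz i))
    (by rw [← hab i]; ring)), fun N => ?_⟩
  refine (hfin N).subset fun i hi => ?_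
  by_contra h
  rw [Set.mem_ofPred_eq, not_and_or, not_and_or, not_lt, not_lt] at h
  refine hi (Submodule.smul_mem _ _ ?_)
  rcases h with h | h | h
  · rw [← mul_assoc]
    exact mul_mem_deepPart (mul_mem_pc (hx i) (hy i)) (hz i) (hab i) h
  · exact mul_mem_deepPart (hx i) (mul_mem_pc (hy i) (hz i)) (by rw [← hab i]; ring) h
  · rw [h0 i h]; exact zero_mem _

end Deep

/-! ### Currents -/

variable (R) in
/-- The mode of `z ^ k` has degree `k`. -/
def IsCurrent (X : ℤ → E) : Prop := ∀ k, X k ∈ pc R k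

/-- A series in nonnegative powers of `z`. -/
def Plus {E : Type*} [Zero E] (X : ℤ → E) : Prop := ∀ k < 0, X k = 0

/-- A series in nonpositive powers of `z`. -/
def Minus {E : Type*} [Zero E] (X : ℤ → E) : Prop := ∀ k > 0, X k = 0

/-- The modes of `X(z) Y(z)`. -/
def conv (X Y : ℤ → E) (k : ℤ) : E := ∑' n : ℤ, X (k - n) * Y n

/-- The coefficients of `ρ(z/w) X(z) Y(w)`. -/
def nop (ρ : R⟦X⟧) (X Y : ℤ → E) (k l : ℤ) : E :=
  ∑' n : ℕ, coeff n ρ • (X (k - n) * Y (l + n))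

/-- `Y(w) X(z) = ρ(z/w) X(z) Y(w) + H(z, w)`. -/
def NRel (ρ : R⟦X⟧) (X Y : ℤ → E) (H : ℤ → ℤ → E) : Prop :=
  ∀ k l, Y l * X k = nop ρ X Y k l + H k l

/-- `Y(w) X(z) = ρ(z/w) X(z) Y(w)`. -/
def NExch (ρ : R⟦X⟧) (X Y : ℤ → E) : Prop := ∀ k l, Y l * X k = nop ρ X Y k l

lemma NExch.nrel {ρ : R⟦X⟧} {X Y : ℤ → E} (h : NExch ρ X Y) :
    NRel ρ X Y fun _ _ => 0 := fun k l => by rw [h k l, add_zero]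

lemma NRel.nexch {ρ : R⟦X⟧} {X Y : ℤ → E} (h : NRel ρ X Y fun _ _ => 0) :
    NExch ρ X Y := fun k l => by rw [h k l, add_zero]

section Currents

variable {X Y Z P : ℤ → E} {ρ σ : R⟦X⟧}

lemma deep_conv (hX : IsCurrent R X) (hY : IsCurrent R Y) (h : Plus Y ∨ Minus X) (k : ℤ) :
    Deep R k (fun n : ℤ => X (k - n) * Y n) := by
  refine (deep_mul (R := R) (s := k) (fun _ : ℤ => 1) (fun n => hX (k - n)) (fun n => hY n)
    (fun n => by ring) (fun n => 0 ≤ n ∨ k ≤ n ∧ Minus X) ?_ ?_).congr fun i => (one_smul _ _).symm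
  · intro n hn
    rcases h with h | h
    · rw [h n (by omega), mul_zero]
    · rw [h (k - n) (by_contra fun h' => hn (Or.inr ⟨by omega, h⟩)), zero_mul]
  · intro N
    refine (Set.finite_Icc (min 0 k) N).subset ?_
    rintro n ⟨h1, h2 | h2⟩ <;> simp only [Set.mem_Icc] <;> omega

lemma isCurrent_conv (hX : IsCurrent R X) (hY : IsCurrent R Y) : IsCurrent R (conv X Y) :=
  fun k => tsum_mem_pc fun n => mul_mem_pc' (hX _) (hY _) (by ring)

lemma deep_nop (ρ : R⟦X⟧) (hX : IsCurrent R X) (hY : IsCurrent R Y) (k l : ℤ) :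
    Deep R (k + l) (fun n : ℕ => coeff n ρ • (X (k - n) * Y (l + n))) := by
  refine deep_mul (R := R) (fun n : ℕ => coeff n ρ) (fun n : ℕ => hX (k - n))
    (fun n : ℕ => hY (l + n)) (fun n => by ring) (fun _ => True) (fun _ h => (h trivial).elim) ?_
  intro N
  refine (Set.finite_Iic (N - l).toNat).subset ?_
  rintro n ⟨h1, -⟩
  simp only [Set.mem_Iic]
  omega

lemma deep_nop₂ (ρ σ : R⟦X⟧) (hX : IsCurrent R X) (hY : IsCurrent R Y) (k l : ℤ) :
    Deep R (k + l) (fun p : ℕ × ℕ => (coeff p.1 ρ * coeff p.2 σ) •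
      (X (k - (p.1 + p.2)) * Y (l + (p.1 + p.2)))) := by
  refine deep_mul (R := R) (fun p : ℕ × ℕ => coeff p.1 ρ * coeff p.2 σ)
    (fun p : ℕ × ℕ => hX (k - (p.1 + p.2)))
    (fun p : ℕ × ℕ => hY (l + (p.1 + p.2))) (fun n => by ring) (fun _ => True)
    (fun _ h => (h trivial).elim) ?_
  intro N
  refine ((Set.finite_Iic (N - l).toNat).prod (Set.finite_Iic (N - l).toNat)).subset ?_
  rintro ⟨n, m⟩ ⟨h1, -⟩
  simp only [Set.mem_prod, Set.mem_Iic] at *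
  omega

lemma nop_mul (hX : IsCurrent R X) (hY : IsCurrent R Y) (k l : ℤ) :
    nop (ρ * σ) X Y k l = ∑' p : ℕ × ℕ, (coeff p.1 ρ * coeff p.2 σ) •
      (X (k - (p.1 + p.2)) * Y (l + (p.1 + p.2))) := by
  rw [tsum_antidiagonal_of_deep R (deep_nop₂ ρ σ hX hY k l), nop]
  refine tsum_congr fun n => ?_
  rw [coeff_mul, Finset.sum_smul]
  refine Finset.sum_congr rfl fun p hp => ?_
  rw [← mem_antidiagonal.1 hp]
  push_cast
  rfl

lemma nop_one (k l : ℤ) :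
    nop (1 : R⟦X⟧) X Y k l = X k * Y l := by
  rw [nop, tsum_eq_single 0 fun n hn => by rw [coeff_one, if_neg hn, zero_smul]]
  simp

lemma nop_mul_aux {c : R⟦X⟧} (hX : IsCurrent R X) (hY : IsCurrent R Y)
    (hP : IsCurrent R P) (hc : Plus P ∨ Minus X) (hPY : NExch ρ P Y) (k l : ℤ) :
    (Summable fun i => nop c X Y (k - i) l * P i) ∧
      ∑' i, nop c X Y (k - i) l * P i = nop (c * ρ) (conv X P) Y k l := by
  let F : ℤ × (ℕ × ℕ) → E := fun p => (coeff p.2.1 c * coeff p.2.2 ρ) •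
    (X (k - p.1 - p.2.1) * (P (p.1 - p.2.2) * Y (l + p.2.1 + p.2.2)))
  have hF : Deep R (k + l) F := by
    refine deep_mul₃ (R := R) (fun p : ℤ × (ℕ × ℕ) => coeff p.2.1 c * coeff p.2.2 ρ)
      (fun p : ℤ × (ℕ × ℕ) => hX (k - p.1 - p.2.1)) (fun p => hP (p.1 - p.2.2))
      (fun p => hY (l + p.2.1 + p.2.2)) (fun p => by ring)
      (fun p => p.2.2 ≤ p.1 ∨ k - p.1 - p.2.1 ≤ 0) ?_ ?_
    · intro p hp
      rcases hc with hc | hc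
      · rw [hc _ (by omega), zero_mul, mul_zero]
      · rw [hc _ (by omega), zero_mul]
    · intro N
      refine ((Set.finite_Icc (-(max N 0 + |k| + |l|)) (max N 0 + |k| + |l|)).prod
        ((Set.finite_Iic (N - l).toNat).prod (Set.finite_Iic (N - l).toNat))).subset ?_
      rintro ⟨i, n, m⟩ ⟨h1, h2, h3⟩
      simp only [Set.mem_prod, Set.mem_Iic, Set.mem_Icc] at *
      refine ⟨⟨?_, ?_⟩, ?_, ?_⟩ <;>
      · rcases abs_cases k with ⟨h, _⟩ | ⟨h, _⟩ <;> rcases abs_cases l with ⟨h', _⟩ | ⟨h', _⟩ <;>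
        rw [h, h'] at * <;> omega
  have e1 : ∀ i, nop c X Y (k - i) l * P i = ∑' p : ℕ × ℕ, F (i, p) := by
    intro i
    rw [tsum_prod_of_deep R (hF.comp_injective (Prod.mk_right_injective i)), nop,
      ← tsum_mulRight _ (deep_nop c hX hY (k - i) l).summable]
    refine tsum_congr fun n => ?_
    rw [smul_mul_assoc, mul_assoc, hPY i (l + n), nop,
      ← tsum_mulLeft _ (deep_nop ρ hP hY i (l + n)).summable,
      ← tsum_smulLeft _ ]
    · refine tsum_congr fun m => ?_
      rw [mul_smul_comm, smul_smul]
    · exact (hasSum_mul_left _ (deep_nop ρ hP hY i (l + n)).summable.hasSum).summable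
  let e : ℤ × (ℕ × ℕ) ≃ ℤ × (ℕ × ℕ) :=
    { toFun := fun p => (p.1 + p.2.2, p.2)
      invFun := fun p => (p.1 - p.2.2, p.2)
      left_inv := fun p => by simp
      right_inv := fun p => by simp }
  have e2 : ∑' i, nop c X Y (k - i) l * P i = nop (c * ρ) (conv X P) Y k l := by
    rw [nop_mul (isCurrent_conv hX hP) hY, tsum_congr e1, ← tsum_prod_of_deep R hF, ← e.tsum_eq,
      tsum_prod_of_deep' R (hF.comp_injective e.injective)]
    refine tsum_congr fun p => ?_
    rw [conv, ← tsum_mulRight _ (deep_conv hX hP hc _).summable, ← tsum_smulLeft _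
      (hasSum_mul_right _ (deep_conv hX hP hc _).summable.hasSum).summable]
    refine tsum_congr fun i => ?_
    simp only [F, e, Equiv.coe_fn_mk]
    rw [mul_assoc, show k - (i + (p.2 : ℤ)) - p.1 = k - (p.1 + p.2) - i by ring,
      add_sub_cancel_right, ← add_assoc l]
  have s1 : Summable fun i => nop c X Y (k - i) l * P i := by
    simp only [e1]
    exact (hF.summable.hasSum.prod_fiberwise fun i =>
      (hF.comp_injective (Prod.mk_right_injective i)).summable.hasSum).summable
  exact ⟨s1, e2⟩

lemma summable_nop_mul {c : R⟦X⟧} (hX : IsCurrent R X) (hY : IsCurrent R Y)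
    (hP : IsCurrent R P) (hc : Plus P ∨ Minus X) (hPY : NExch ρ P Y) (k l : ℤ) :
    Summable fun i => nop c X Y (k - i) l * P i := (nop_mul_aux hX hY hP hc hPY k l).1

lemma tsum_nop_mul {c : R⟦X⟧} (hX : IsCurrent R X) (hY : IsCurrent R Y)
    (hP : IsCurrent R P) (hc : Plus P ∨ Minus X) (hPY : NExch ρ P Y) (k l : ℤ) :
    ∑' i, nop c X Y (k - i) l * P i = nop (c * ρ) (conv X P) Y k l := (nop_mul_aux hX hY hP hc hPY k l).2

lemma NRel.conv_first {c : R⟦X⟧} {H : ℤ → ℤ → E} (hX : IsCurrent R X)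
    (hY : IsCurrent R Y) (hP : IsCurrent R P) (hc : Plus P ∨ Minus X)
    (h : NRel c X Y H) (hPY : NExch ρ P Y)
    (hH : ∀ k l, Summable fun i : ℤ => H (k - i) l * P i) :
    NRel (c * ρ) (conv X P) Y fun k l => ∑' i : ℤ, H (k - i) l * P i := by
  intro k l
  rw [conv, ← tsum_mulLeft _ (deep_conv hX hP hc _).summable, ← tsum_nop_mul hX hY hP hc hPY,
    ← (summable_nop_mul hX hY hP hc hPY k l).tsum_add (hH k l)]
  refine tsum_congr fun i => ?_
  rw [← mul_assoc, h, add_mul]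

lemma mul_nop_aux {c : R⟦X⟧} (hX : IsCurrent R X) (hY : IsCurrent R Y)
    (hP : IsCurrent R P) (hc : Plus Y ∨ Minus P) (hPX : NExch ρ X P) (k l : ℤ) :
    (Summable fun i => P (l - i) * nop c X Y k i) ∧
      ∑' i, P (l - i) * nop c X Y k i = nop (c * ρ) X (conv P Y) k l := by
  let F : ℤ × (ℕ × ℕ) → E := fun p => (coeff p.2.1 c * coeff p.2.2 ρ) •
    (X (k - p.2.1 - p.2.2) * (P (l - p.1 + p.2.2) * Y (p.1 + p.2.1)))
  have hF : Deep R (k + l) F := by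
    refine deep_mul₃ (R := R) (fun p : ℤ × (ℕ × ℕ) => coeff p.2.1 c * coeff p.2.2 ρ)
      (fun p : ℤ × (ℕ × ℕ) => hX (k - p.2.1 - p.2.2)) (fun p => hP (l - p.1 + p.2.2))
      (fun p => hY (p.1 + p.2.1)) (fun p => by ring)
      (fun p => 0 ≤ p.1 + p.2.1 ∨ l - p.1 + p.2.2 ≤ 0) ?_ ?_
    · intro p hp
      rcases hc with hc | hc
      · rw [hc _ (by omega), mul_zero, mul_zero]
      · rw [hc _ (by omega), zero_mul, mul_zero]
    · intro N
      refine ((Set.finite_Icc (-(|N| + |k| + |l|)) (|N| + |k| + |l|)).prod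
        ((Set.finite_Iic (|N| + |l|).toNat).prod (Set.finite_Iic (|N| + |l|).toNat))).subset ?_
      rintro ⟨i, n, m⟩ ⟨h1, h2, h3⟩
      simp only [Set.mem_prod, Set.mem_Iic, Set.mem_Icc] at *
      have := le_abs_self N
      have := neg_abs_le N
      have := le_abs_self l
      have := neg_abs_le l
      have := abs_nonneg k
      refine ⟨⟨?_, ?_⟩, ?_, ?_⟩ <;> omega
  have e1 : ∀ i, P (l - i) * nop c X Y k i = ∑' p : ℕ × ℕ, F (i, p) := by
    intro i
    rw [tsum_prod_of_deep R (hF.comp_injective (Prod.mk_right_injective i)), nop,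
      ← tsum_mulLeft _ (deep_nop c hX hY k i).summable]
    refine tsum_congr fun n => ?_
    rw [mul_smul_comm, ← mul_assoc, hPX (k - n) (l - i), nop,
      ← tsum_mulRight _ (deep_nop ρ hX hP (k - n) (l - i)).summable,
      ← tsum_smulLeft _ ]
    · refine tsum_congr fun m => ?_
      rw [smul_mul_assoc, smul_smul, mul_assoc]
    · exact (hasSum_mul_right _ (deep_nop ρ hX hP (k - n) (l - i)).summable.hasSum).summable
  let e : ℤ × (ℕ × ℕ) ≃ ℤ × (ℕ × ℕ) :=
    { toFun := fun p => (p.1 - p.2.1, p.2)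
      invFun := fun p => (p.1 + p.2.1, p.2)
      left_inv := fun p => by simp
      right_inv := fun p => by simp }
  have e2 : ∑' i, P (l - i) * nop c X Y k i = nop (c * ρ) X (conv P Y) k l := by
    rw [nop_mul hX (isCurrent_conv hP hY), tsum_congr e1, ← tsum_prod_of_deep R hF, ← e.tsum_eq,
      tsum_prod_of_deep' R (hF.comp_injective e.injective)]
    refine tsum_congr fun p => ?_
    rw [conv, ← tsum_mulLeft _ (deep_conv hP hY hc _).summable, ← tsum_smulLeft _
      (hasSum_mul_left _ (deep_conv hP hY hc _).summable.hasSum).summable]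
    refine tsum_congr fun i => ?_
    simp only [F, e, Equiv.coe_fn_mk]
    rw [show l - (i - (p.1 : ℤ)) + p.2 = l + (p.1 + p.2) - i by ring,
      sub_add_cancel, ← sub_sub k]
  have s1 : Summable fun i => P (l - i) * nop c X Y k i := by
    simp only [e1]
    exact (hF.summable.hasSum.prod_fiberwise fun i =>
      (hF.comp_injective (Prod.mk_right_injective i)).summable.hasSum).summable
  exact ⟨s1, e2⟩

lemma summable_mul_nop {c : R⟦X⟧} (hX : IsCurrent R X) (hY : IsCurrent R Y)
    (hP : IsCurrent R P) (hc : Plus Y ∨ Minus P) (hPX : NExch ρ X P) (k l : ℤ) :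
    Summable fun i => P (l - i) * nop c X Y k i := (mul_nop_aux hX hY hP hc hPX k l).1

lemma tsum_mul_nop {c : R⟦X⟧} (hX : IsCurrent R X) (hY : IsCurrent R Y)
    (hP : IsCurrent R P) (hc : Plus Y ∨ Minus P) (hPX : NExch ρ X P) (k l : ℤ) :
    ∑' i, P (l - i) * nop c X Y k i = nop (c * ρ) X (conv P Y) k l := (mul_nop_aux hX hY hP hc hPX k l).2

lemma NRel.conv_second {c : R⟦X⟧} {H : ℤ → ℤ → E} (hX : IsCurrent R X)
    (hY : IsCurrent R Y) (hP : IsCurrent R P) (hc : Plus Y ∨ Minus P)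
    (h : NRel c X Y H) (hPX : NExch ρ X P)
    (hH : ∀ k l, Summable fun j : ℤ => P (l - j) * H k j) :
    NRel (c * ρ) X (conv P Y) fun k l => ∑' j : ℤ, P (l - j) * H k j := by
  intro k l
  rw [conv, ← tsum_mulRight _ (deep_conv hP hY hc _).summable, ← tsum_mul_nop hX hY hP hc hPX,
    ← (summable_mul_nop hX hY hP hc hPX k l).tsum_add (hH k l)]
  refine tsum_congr fun i => ?_
  rw [mul_assoc, h, mul_add]

end Currents

section Calculus

variable {X Y Z P N X' Y' : ℤ → E} {ρ σ : R⟦X⟧}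

lemma NExch.conv_first {c : R⟦X⟧} (hX : IsCurrent R X)
    (hY : IsCurrent R Y) (hP : IsCurrent R P) (hc : Plus P ∨ Minus X)
    (h : NExch c X Y) (hPY : NExch ρ P Y) : NExch (c * ρ) (conv X P) Y := by
  have := h.nrel.conv_first hX hY hP hc hPY (fun k l => by simpa using summable_zero)
  simp only [zero_mul, tsum_zero] at this
  exact this.nexch

lemma NExch.conv_second {c : R⟦X⟧} (hX : IsCurrent R X)
    (hY : IsCurrent R Y) (hP : IsCurrent R P) (hc : Plus Y ∨ Minus P)
    (h : NExch c X Y) (hPX : NExch ρ X P) : NExch (c * ρ) X (conv P Y) := by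
  have := h.nrel.conv_second hX hY hP hc hPX (fun k l => by simpa using summable_zero)
  simp only [mul_zero, tsum_zero] at this
  exact this.nexch

/-! #### Multiplication of two-variable distributions by series in `z/w` -/

/-- The coefficients of `ρ(z/w) T(z, w)`. -/
def act (ρ : R⟦X⟧) (T : ℤ → ℤ → E) (k l : ℤ) : E :=
  ∑' n : ℕ, coeff n ρ • T (k - n) (l + n)

variable (R) in
def Reg (T : ℤ → ℤ → E) : Prop := ∀ k l, Deep R (k + l) fun n : ℕ => T (k - n) (l + n)

lemma nop_eq_act (ρ : R⟦X⟧) (X Y : ℤ → E) :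
    nop ρ X Y = act ρ fun k l => X k * Y l := rfl

lemma reg_mul (hX : IsCurrent R X) (hY : IsCurrent R Y) : Reg R fun k l => X k * Y l := by
  intro k l
  refine (deep_mul (R := R) (fun _ : ℕ => 1) (fun n : ℕ => hX (k - n)) (fun n : ℕ => hY (l + n))
    (fun n => by ring) (fun _ => True) (fun _ h => (h trivial).elim) ?_).congr
      fun i => (one_smul _ _).symm
  intro N
  refine (Set.finite_Iic (N - l).toNat).subset ?_
  rintro n ⟨h1, -⟩
  simp only [Set.mem_Iic]
  omega

lemma reg_mul_swap (hX : IsCurrent R X) (hY : IsCurrent R Y) (h : Plus X ∨ Minus Y) :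
    Reg R fun k l => Y l * X k := by
  intro k l
  refine ⟨fun n => mul_mem_pc' (hY _) (hX _) (by ring), fun N => ?_⟩
  refine (Set.finite_Iic (|k| + |l|).toNat).subset ?_
  intro n hn
  by_contra h'
  have h1 := le_abs_self k
  have h2 := neg_abs_le l
  have h3 := abs_nonneg k
  have h4 := abs_nonneg l
  simp only [Set.mem_Iic, not_le] at h'
  refine hn ?_
  dsimp only
  rcases h with h | h
  · rw [h _ (by omega), mul_zero]; exact zero_mem _
  · rw [h _ (by omega), zero_mul]; exact zero_mem _

lemma Reg.deep₂ {T : ℤ → ℤ → E} (h : Reg R T) (k l : ℤ) :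
    Deep R (k + l) fun p : ℕ × ℕ => (coeff p.1 ρ * coeff p.2 σ) •
      T (k - (p.1 + p.2 : ℕ)) (l + (p.1 + p.2 : ℕ)) := by
  refine Deep.smul ⟨fun p : ℕ × ℕ => (h k l).mem (p.1 + p.2), fun N => ?_⟩ _
  obtain ⟨M, hM⟩ := ((h k l).fin N).bddAbove
  refine ((Set.finite_Iic M).prod (Set.finite_Iic M)).subset ?_
  rintro ⟨n, m⟩ hp
  have : n + m ≤ M := hM hp
  exact ⟨by simp only [Set.mem_Iic]; omega, by simp only [Set.mem_Iic]; omega⟩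

lemma act_act {T : ℤ → ℤ → E} (h : Reg R T) : act ρ (act σ T) = act (ρ * σ) T := by
  funext k l
  have e1 : ∀ n : ℕ, coeff n ρ • act σ T (k - n) (l + n) =
      ∑' m : ℕ, (coeff n ρ * coeff m σ) • T (k - (n + m : ℕ)) (l + (n + m : ℕ)) := by
    intro n
    rw [act, ← tsum_smulLeft]
    · refine tsum_congr fun m => ?_
      rw [smul_smul]
      push_cast
      rw [sub_sub, add_assoc]
    · exact ((h (k - n) (l + n)).smul fun m => coeff m σ).summable
  rw [act, tsum_congr e1, ← tsum_prod_of_deep R (h.deep₂ k l),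
    tsum_antidiagonal_of_deep R (h.deep₂ k l), act]
  refine tsum_congr fun n => ?_
  rw [coeff_mul, Finset.sum_smul]
  refine Finset.sum_congr rfl fun p hp => ?_
  rw [← mem_antidiagonal.1 hp]

lemma act_one (T : ℤ → ℤ → E) : act (1 : R⟦X⟧) T = T := by
  funext k l
  rw [act, tsum_eq_single 0 fun n hn => by rw [coeff_one, if_neg hn, zero_smul]]
  simp

lemma act_C_mul {T : ℤ → ℤ → E} (h : Reg R T) (c : R) (k l : ℤ) :
    act (C c * ρ) T k l = c • act ρ T k l := by
  rw [act, act, ← tsum_smulLeft]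
  · refine tsum_congr fun n => ?_
    rw [coeff_C_mul, smul_smul]
  · exact ((h k l).smul _).summable

lemma act_X_sub_C (p : R) (T : ℤ → ℤ → E) (k l : ℤ) :
    act (PowerSeries.X - C p) T k l = T (k - 1) (l + 1) - p • T k l := by
  rw [act, tsum_eq_sum (s := {0, 1}) ?_]
  · rw [Finset.sum_pair (by decide)]
    simp [coeff_X, sub_eq_neg_add]
  · intro n hn
    simp only [Finset.mem_insert, Finset.mem_singleton, not_or] at hn
    rw [map_sub, coeff_X, coeff_C, if_neg hn.1, if_neg hn.2, sub_zero, zero_smul]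

lemma nexch_iff (hX : IsCurrent R X) (hY : IsCurrent R Y) (h : Plus X ∨ Minus Y)
    (u : R⟦X⟧ˣ) :
    NExch (u : R⟦X⟧) X Y ↔
      ∀ k l, X k * Y l = act (↑u⁻¹ : R⟦X⟧) (fun k l => Y l * X k) k l := by
  constructor
  · intro H k l
    have : (fun k l => Y l * X k) = act (u : R⟦X⟧) fun k l => X k * Y l :=
      funext₂ H
    rw [this, act_act (reg_mul hX hY), Units.inv_mul, act_one]
  · intro H k l
    have : (fun k l => X k * Y l) = act (↑u⁻¹ : R⟦X⟧) fun k l => Y l * X k :=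
      funext₂ H
    rw [nop_eq_act, this, act_act (reg_mul_swap hX hY h), Units.mul_inv, act_one]

lemma nexch_one_iff : NExch (1 : R⟦X⟧) X Y ↔ ∀ k l, Y l * X k = X k * Y l := by
  simp only [NExch, nop_eq_act, act_one]

/-! #### Rescaled currents -/

/-- The modes of `X(c z)`. -/
def shift (c : Rˣ) (X : ℤ → E) (k : ℤ) : E := (↑(c ^ k) : R) • X k

lemma isCurrent_shift (c : Rˣ) (hX : IsCurrent R X) : IsCurrent R (shift c X) :=
  fun k => Submodule.smul_mem _ _ (hX k)

lemma Plus.shift (c : Rˣ) (hX : Plus X) : Plus (shift c X) :=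
  fun k hk => by rw [QCurrent.shift, hX k hk, smul_zero]

lemma Minus.shift (c : Rˣ) (hX : Minus X) : Minus (shift c X) :=
  fun k hk => by rw [QCurrent.shift, hX k hk, smul_zero]

lemma shift_shift (c c' : Rˣ) (X : ℤ → E) : shift c (shift c' X) = shift (c * c') X := by
  funext k
  simp [shift, smul_smul, mul_zpow]

lemma shift_one (X : ℤ → E) : shift (1 : Rˣ) X = X := by
  funext k
  simp [shift]

lemma zpow_mul_zpow_of_add (c : Rˣ) {a b e : ℤ} (h : a + b = e) :
    (↑(c ^ a) : R) * (↑(c ^ b) : R) = (↑(c ^ e) : R) := by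
  rw [← Units.val_mul, ← zpow_add, h]

lemma shift_conv (c : Rˣ) (hX : IsCurrent R X) (hY : IsCurrent R Y) (h : Plus Y ∨ Minus X) :
    shift c (conv X Y) = conv (shift c X) (shift c Y) := by
  funext k
  rw [shift, conv, conv, ← tsum_smulLeft _ (deep_conv hX hY h k).summable]
  refine tsum_congr fun n => ?_
  rw [shift, shift, smul_mul_smul_comm, zpow_mul_zpow_of_add c (sub_add_cancel k n)]

lemma coeff_rescale_units (c : Rˣ) (n : ℕ) :
    coeff n (rescale (c : R) ρ) = (↑(c ^ (n : ℤ)) : R) * coeff n ρ := by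
  rw [coeff_rescale, zpow_natCast, Units.val_pow_eq_pow_val]

lemma NExch.shift_first (c : Rˣ) (hX : IsCurrent R X) (hY : IsCurrent R Y)
    (h : NExch ρ X Y) : NExch (rescale (c : R) ρ) (shift c X) Y := by
  intro k l
  rw [shift, mul_smul_comm, h k l, nop, nop, ← tsum_smulLeft _ (deep_nop ρ hX hY k l).summable]
  refine tsum_congr fun n => ?_
  rw [shift, smul_mul_assoc, smul_smul, smul_smul, coeff_rescale_units, mul_right_comm,
    zpow_mul_zpow_of_add c (add_sub_cancel (n : ℤ) k)]

lemma NExch.shift_second (c : Rˣ) (hX : IsCurrent R X) (hY : IsCurrent R Y)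
    (h : NExch ρ X Y) : NExch (rescale (↑c⁻¹ : R) ρ) X (shift c Y) := by
  intro k l
  rw [shift, smul_mul_assoc, h k l, nop, nop, ← tsum_smulLeft _ (deep_nop ρ hX hY k l).summable]
  refine tsum_congr fun n => ?_
  rw [shift, mul_smul_comm, smul_smul, smul_smul, coeff_rescale_units, mul_right_comm, inv_zpow',
    zpow_mul_zpow_of_add c (show -(n : ℤ) + (l + n) = l by ring)]

lemma nop_add_second (hX : IsCurrent R X) (hY : IsCurrent R Y) (hZ : IsCurrent R Z) (k l : ℤ) :
    nop ρ X (fun k => Y k + Z k) k l = nop ρ X Y k l + nop ρ X Z k l := by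
  rw [nop, nop, nop, ← (deep_nop ρ hX hY k l).summable.tsum_add (deep_nop ρ hX hZ k l).summable]
  simp only [mul_add, smul_add]

lemma nop_add_first (hX : IsCurrent R X) (hY : IsCurrent R Y) (hZ : IsCurrent R Z) (k l : ℤ) :
    nop ρ (fun k => X k + Z k) Y k l = nop ρ X Y k l + nop ρ Z Y k l := by
  rw [nop, nop, nop, ← (deep_nop ρ hX hY k l).summable.tsum_add (deep_nop ρ hZ hY k l).summable]
  simp only [add_mul, smul_add]

lemma NExch.add_second (hX : IsCurrent R X) (hY : IsCurrent R Y) (hZ : IsCurrent R Z)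
    (h : NExch ρ X Y) (h' : NExch ρ X Z) : NExch ρ X fun k => Y k + Z k := fun k l => by
  rw [nop_add_second hX hY hZ, ← h, ← h', add_mul]

lemma NExch.add_first (hX : IsCurrent R X) (hY : IsCurrent R Y) (hZ : IsCurrent R Z)
    (h : NExch ρ X Y) (h' : NExch ρ Z Y) : NExch ρ (fun k => X k + Z k) Y := fun k l => by
  rw [nop_add_first hX hY hZ, ← h, ← h', mul_add]

lemma nop_neg_second (k l : ℤ) : nop ρ X (fun k => -Y k) k l = -nop ρ X Y k l := by
  simp only [nop, mul_neg, smul_neg, tsum_neg]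

lemma nop_neg_first (k l : ℤ) : nop ρ (fun k => -X k) Y k l = -nop ρ X Y k l := by
  simp only [nop, neg_mul, smul_neg, tsum_neg]

lemma NExch.neg_second (h : NExch ρ X Y) : NExch ρ X fun k => -Y k := fun k l => by
  rw [nop_neg_second, ← h, neg_mul]

lemma NExch.neg_first (h : NExch ρ X Y) : NExch ρ (fun k => -X k) Y := fun k l => by
  rw [nop_neg_first, ← h, mul_neg]

lemma IsCurrent.neg (hX : IsCurrent R X) : IsCurrent R fun k => -X k :=
  fun k => neg_mem (hX k)

lemma IsCurrent.add (hX : IsCurrent R X) (hY : IsCurrent R Y) : IsCurrent R fun k => X k + Y k :=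
  fun k => add_mem (hX k) (hY k)

/-! #### Products of currents -/

lemma conv_neg_left : conv (fun k => -X k) Y = fun k => -conv X Y k := by
  funext k; simp only [conv, neg_mul, tsum_neg]

lemma conv_neg_right : conv X (fun k => -Y k) = fun k => -conv X Y k := by
  funext k; simp only [conv, mul_neg, tsum_neg]

lemma conv_add_left (hX : IsCurrent R X) (hZ : IsCurrent R Z) (hY : IsCurrent R Y)
    (h : Plus Y ∨ (Minus X ∧ Minus Z)) :
    conv (fun k => X k + Z k) Y = fun k => conv X Y k + conv Z Y k := by
  funext k
  rw [conv, conv, conv, ← (deep_conv hX hY (h.imp_right And.left) k).summable.tsum_add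
    (deep_conv hZ hY (h.imp_right And.right) k).summable]
  simp only [add_mul]

lemma conv_add_right (hX : IsCurrent R X) (hZ : IsCurrent R Z) (hY : IsCurrent R Y)
    (h : (Plus Y ∧ Plus Z) ∨ Minus X) :
    conv X (fun k => Y k + Z k) = fun k => conv X Y k + conv X Z k := by
  funext k
  rw [conv, conv, conv, ← (deep_conv hX hY (h.imp_left And.left) k).summable.tsum_add
    (deep_conv hX hZ (h.imp_left And.right) k).summable]
  simp only [mul_add]

lemma Plus.conv (hX : Plus X) (hY : Plus Y) : Plus (conv X Y) := fun k hk => by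
  rw [QCurrent.conv, ← tsum_zero (α := E) (β := ℤ)]
  refine tsum_congr fun n => ?_
  rcases lt_or_ge n 0 with h | h
  · rw [hY n h, mul_zero]
  · rw [hX _ (by omega), zero_mul]

lemma Minus.conv (hX : Minus X) (hY : Minus Y) : Minus (conv X Y) := fun k hk => by
  rw [QCurrent.conv, ← tsum_zero (α := E) (β := ℤ)]
  refine tsum_congr fun n => ?_
  rcases lt_or_ge 0 n with h | h
  · rw [hY n h, mul_zero]
  · rw [hX _ (by omega), zero_mul]

lemma conv_comm (h : ∀ k l, X k * Y l = Y l * X k) : conv X Y = conv Y X := by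
  funext k
  rw [conv, conv, ← (Equiv.subLeft k).tsum_eq]
  refine tsum_congr fun n => ?_
  rw [Equiv.subLeft_apply, sub_sub_cancel, h]

/-- The constant current `1`. -/
def oneCurrent (E : Type*) [Ring E] (k : ℤ) : E := if k = 0 then 1 else 0

lemma conv_one (X : ℤ → E) : conv X (oneCurrent E) = X := by
  funext k
  rw [conv, tsum_eq_single 0 fun n hn => by rw [oneCurrent, if_neg hn, mul_zero]]
  simp [oneCurrent]

lemma one_conv (X : ℤ → E) : conv (oneCurrent E) X = X := by
  funext k
  rw [conv, tsum_eq_single k fun n hn => by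
    rw [oneCurrent, if_neg (by omega), zero_mul]]
  simp [oneCurrent]

lemma isCurrent_one : IsCurrent R (oneCurrent E) := fun k => by
  unfold oneCurrent
  split_ifs with h
  · rw [h]; exact one_mem_grading
  · exact zero_mem _

lemma shift_oneCurrent (c : Rˣ) : shift c (oneCurrent E) = oneCurrent E := by
  funext k
  unfold shift oneCurrent
  split_ifs with h
  · simp [h]
  · simp

/-- Associativity of products of currents; the outer factors may have their degrees displaced. -/
lemma conv_assoc' {a c : ℤ} (hX : ∀ k, X k ∈ pc R (k + a)) (hY : IsCurrent R Y)
    (hZ : ∀ k, Z k ∈ pc R (k + c))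
    (h : (Plus Y ∧ Plus Z) ∨ (Minus X ∧ Minus Y) ∨ (Minus X ∧ Plus Z)) :
    conv (conv X Y) Z = conv X (conv Y Z) := by
  funext k
  let F : ℤ × ℤ → E := fun p => X (k - p.1 - p.2) * (Y p.1 * Z p.2)
  have hF : Deep R (k + a + c) F := by
    refine (deep_mul₃ (R := R) (fun p : ℤ × ℤ => 1) (fun p : ℤ × ℤ => hX (k - p.1 - p.2))
      (fun p => hY p.1) (fun p => hZ p.2) (fun p => by ring)
      (fun p => (0 ≤ p.1 ∧ 0 ≤ p.2) ∨ (k - p.1 - p.2 ≤ 0 ∧ p.1 ≤ 0) ∨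
        (k - p.1 - p.2 ≤ 0 ∧ 0 ≤ p.2)) ?_ ?_).congr fun p => (one_smul _ _).symm
    · intro p hp
      by_contra h0
      refine hp ?_
      have hx : X (k - p.1 - p.2) ≠ 0 := fun h' => h0 (by rw [h', zero_mul])
      have hy : Y p.1 ≠ 0 := fun h' => h0 (by rw [h', zero_mul, mul_zero])
      have hz : Z p.2 ≠ 0 := fun h' => h0 (by rw [h', mul_zero, mul_zero])
      have mx : Minus X → k - p.1 - p.2 ≤ 0 := fun h' => not_lt.1 fun h'' => hx (h' _ h'')
      have my : Minus Y → p.1 ≤ 0 := fun h' => not_lt.1 fun h'' => hy (h' _ h'')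
      have py : Plus Y → 0 ≤ p.1 := fun h' => not_lt.1 fun h'' => hy (h' _ h'')
      have pz : Plus Z → 0 ≤ p.2 := fun h' => not_lt.1 fun h'' => hz (h' _ h'')
      tauto
    · intro N
      refine ((Set.finite_Icc (-(|N| + |k| + |c|)) (|N| + |k| + |c|)).prod
        (Set.finite_Icc (-(|N| + |k| + |c|)) (|N| + |k| + |c|))).subset ?_
      rintro ⟨i, j⟩ ⟨h1, h2, h3⟩
      simp only [Set.mem_prod, Set.mem_Icc] at *
      have := le_abs_self N
      have := neg_abs_le N
      have := le_abs_self c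
      have := neg_abs_le c
      have := le_abs_self k
      have := neg_abs_le k
      refine ⟨⟨?_, ?_⟩, ?_, ?_⟩ <;> omega
  let e : ℤ × ℤ ≃ ℤ × ℤ :=
    { toFun := fun p => (p.1 - p.2, p.2)
      invFun := fun p => (p.1 + p.2, p.2)
      left_inv := fun p => by simp
      right_inv := fun p => by simp }
  have hs1 : ∀ j, Summable fun i : ℤ => X (k - j - i) * Y i * Z j := fun j =>
    ((hF.comp_injective (Prod.mk_left_injective j)).congr fun i => by
      simp only [F]; rw [mul_assoc, sub_right_comm]).summable
  have hF' := hF.comp_injective e.injective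
  calc conv (conv X Y) Z k = ∑' j, ∑' i, F (i, j) := by
        rw [conv]
        refine tsum_congr fun j => ?_
        by_cases hZ0 : Z j = 0
        · rw [hZ0, mul_zero, ← tsum_zero (α := E) (β := ℤ)]
          refine tsum_congr fun i => ?_
          simp only [F]; rw [hZ0, mul_zero, mul_zero]
        · have hxy : Plus Y ∨ Minus X := by tauto
          have hd : Deep R (k - j + a) fun i : ℤ => X (k - j - i) * Y i := by
            refine (deep_mul (R := R) (fun _ : ℤ => 1) (fun n => hX (k - j - n)) (fun n => hY n)
              (fun n => by ring) (fun n => 0 ≤ n ∨ k - j - n ≤ 0) ?_ ?_).congr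
                fun i => (one_smul _ _).symm
            · intro n hn
              rcases hxy with h | h
              · rw [h n (by omega), mul_zero]
              · rw [h _ (by omega), zero_mul]
            · intro N
              refine (Set.finite_Icc (min 0 (k - j)) N).subset ?_
              rintro n ⟨h1, h2⟩
              simp only [Set.mem_Icc]
              omega
          rw [conv, ← tsum_mulRight _ hd.summable]
          refine tsum_congr fun i => ?_
          simp only [F]; rw [mul_assoc, sub_right_comm]
    _ = ∑' p, F p := (tsum_prod_of_deep' R hF).symm
    _ = ∑' p, F (e p) := (e.tsum_eq F).symm
    _ = ∑' i, ∑' j, F (e (i, j)) := tsum_prod_of_deep R hF'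
    _ = conv X (conv Y Z) k := by
        rw [conv]
        refine tsum_congr fun i => ?_
        by_cases hX0 : X (k - i) = 0
        · rw [hX0, zero_mul, ← tsum_zero (α := E) (β := ℤ)]
          refine tsum_congr fun j => ?_
          simp only [F, e, Equiv.coe_fn_mk]
          rw [show k - (i - j) - j = k - i by ring, hX0, zero_mul]
        · have hxy : Plus Z ∨ Minus Y := by tauto
          have hd : Deep R (i + c) fun j : ℤ => Y (i - j) * Z j := by
            refine (deep_mul (R := R) (fun _ : ℤ => 1) (fun n => hY (i - n)) (fun n => hZ n)
              (fun n => by ring) (fun n => 0 ≤ n ∨ i - n ≤ 0) ?_ ?_).congr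
                fun i => (one_smul _ _).symm
            · intro n hn
              rcases hxy with h | h
              · rw [h n (by omega), mul_zero]
              · rw [h _ (by omega), zero_mul]
            · intro N
              refine (Set.finite_Icc (min 0 i) (N - c)).subset ?_
              rintro n ⟨h1, h2⟩
              simp only [Set.mem_Icc]
              omega
          rw [conv, ← tsum_mulLeft _ hd.summable]
          refine tsum_congr fun j => ?_
          simp only [F, e, Equiv.coe_fn_mk]
          rw [show k - (i - j) - j = k - i by ring]

lemma conv_assoc (hX : IsCurrent R X) (hY : IsCurrent R Y) (hZ : IsCurrent R Z)
    (h : (Plus Y ∧ Plus Z) ∨ (Minus X ∧ Minus Y) ∨ (Minus X ∧ Plus Z)) :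
    conv (conv X Y) Z = conv X (conv Y Z) :=
  conv_assoc' (R := R) (a := 0) (c := 0) (fun k => by simpa using hX k) hY
    (fun k => by simpa using hZ k) h

end Calculus

section Calculus

variable {X Y Z P N X' Y' : ℤ → E} {ρ σ : R⟦X⟧}

lemma summable_conv (hX : IsCurrent R X) (hY : IsCurrent R Y) (h : Plus Y ∨ Minus X) (k : ℤ) :
    Summable fun n : ℤ => X (k - n) * Y n := (deep_conv hX hY h k).summable

lemma NExch.inv_first {u : R⟦X⟧ˣ} (hX : IsCurrent R X) (hY : IsCurrent R Y)
    (hX' : IsCurrent R X') (hp : Plus X) (hp' : Plus X') (h1 : conv X X' = oneCurrent E)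
    (h2 : conv X' X = oneCurrent E) (h : NExch (u : R⟦X⟧) X Y) :
    NExch (↑u⁻¹ : R⟦X⟧) X' Y := by
  intro k l
  let t : ℤ → E := fun k => Y l * X' k - nop (↑u⁻¹ : R⟦X⟧) X' Y k l
  have ht : ∀ k, t k ∈ pc R (k + l) := fun k => Submodule.sub_mem _
    (mul_mem_pc' (hY _) (hX' _) (by ring)) (tsum_mem_pc (deep_nop _ hX' hY k l).mem)
  have e0 : conv t X = fun _ => 0 := by
    funext k
    have s1 : Summable fun i => Y l * X' (k - i) * X i := by
      simp only [mul_assoc]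
      exact (hasSum_mul_left _ (summable_conv hX' hX (Or.inl hp) k).hasSum).summable
    have s2 : Summable fun i => nop (↑u⁻¹ : R⟦X⟧) X' Y (k - i) l * X i :=
      (summable_nop_mul hX' hY hX (Or.inl hp) h k l)
    simp only [conv, t, sub_mul]
    rw [s1.tsum_sub s2, tsum_nop_mul hX' hY hX (Or.inl hp) h, h2, Units.inv_mul,
      nop_one]
    simp only [mul_assoc]
    rw [tsum_mulLeft _ (summable_conv hX' hX (Or.inl hp) k)]
    change Y l * conv X' X k - _ = 0
    rw [h2]
    unfold oneCurrent
    split_ifs <;> simp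
  have e1 : conv (conv t X) X' = t := by
    rw [conv_assoc' (R := R) (c := 0) ht hX (fun k => by simpa using hX' k) (Or.inl ⟨hp, hp'⟩), h1,
      conv_one]
  have e2 : t k = 0 := by
    rw [← e1, e0]
    simp [conv]
  exact sub_eq_zero.1 e2

lemma NExch.inv_second {u : R⟦X⟧ˣ} (hX : IsCurrent R X) (hY : IsCurrent R Y)
    (hY' : IsCurrent R Y') (hp : Minus Y) (hp' : Minus Y') (h1 : conv Y Y' = oneCurrent E)
    (h2 : conv Y' Y = oneCurrent E) (h : NExch (u : R⟦X⟧) X Y) :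
    NExch (↑u⁻¹ : R⟦X⟧) X Y' := by
  intro k l
  let t : ℤ → E := fun l => Y' l * X k - nop (↑u⁻¹ : R⟦X⟧) X Y' k l
  have ht : ∀ l, t l ∈ pc R (l + k) := fun l => Submodule.sub_mem _
    (mul_mem_pc' (hY' _) (hX _) (by ring))
    (add_comm k l ▸ tsum_mem_pc (deep_nop _ hX hY' k l).mem)
  have e0 : conv Y t = fun _ => 0 := by
    funext l
    have s1 : Summable fun i => Y (l - i) * (Y' i * X k) := by
      simp only [← mul_assoc]
      exact (hasSum_mul_right _ (summable_conv hY hY' (Or.inr hp) l).hasSum).summable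
    have s2 : Summable fun i => Y (l - i) * nop (↑u⁻¹ : R⟦X⟧) X Y' k i :=
      (summable_mul_nop hX hY' hY (Or.inr hp) h k l)
    simp only [conv, t, mul_sub]
    rw [s1.tsum_sub s2, tsum_mul_nop hX hY' hY (Or.inr hp) h, h1, Units.inv_mul,
      nop_one]
    simp only [← mul_assoc]
    rw [tsum_mulRight _ (summable_conv hY hY' (Or.inr hp) l)]
    change conv Y Y' l * X k - _ = 0
    rw [h1]
    unfold oneCurrent
    split_ifs <;> simp
  have e1 : conv Y' (conv Y t) = t := by
    rw [← conv_assoc' (R := R) (a := 0) (fun k => by simpa using hY' k) hY ht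
      (Or.inr (Or.inl ⟨hp', hp⟩)), h2, one_conv]
  have e2 : t l = 0 := by
    rw [← e1, e0]
    simp [conv]
  exact sub_eq_zero.1 e2

/-! #### The difference of two expansions -/

lemma tsum_expansion_sub (c : R) {h : ℤ → E} {s : ℤ} (hd : Deep R s h)
    (hσ : ∀ n : ℕ, coeff (n + 1) σ = -c) (hρ : ∀ n : ℕ, coeff (n + 1) ρ = c)
    (h0 : coeff 0 ρ - coeff 0 σ = c) (l : ℤ) :
    ∑' n : ℕ, coeff n ρ • h (l - n) = (∑' n : ℕ, coeff n σ • h (l + n)) + c • ∑' m, h m := by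
  have i1 : Function.Injective fun n : ℕ => l - (n : ℤ) := fun a b h => by
    simp only at h; omega
  have i2 : Function.Injective fun n : ℕ => l + (n : ℤ) := fun a b h => by
    simp only at h; omega
  have i3 : Function.Injective fun n : ℕ => l + ((n + 1 : ℕ) : ℤ) := fun a b h => by
    simp only at h; omega
  have i4 : Function.Injective fun n : ℕ => l - ((n + 1 : ℕ) : ℤ) := fun a b h => by
    simp only at h; omega
  have d1 := (hd.comp_injective i1).smul fun n => coeff n ρ
  have d2 := (hd.comp_injective i2).smul fun n => coeff n σ
  have d3 := (hd.comp_injective i3).summable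
  have d4 := (hd.comp_injective i4).summable
  have d5 := (hd.comp_injective i2).summable
  have key : ∑' m, h m = h l + ∑' n : ℕ, h (l + ((n + 1 : ℕ) : ℤ)) +
      ∑' n : ℕ, h (l - ((n + 1 : ℕ) : ℤ)) := by
    rw [← (Equiv.addLeft l).tsum_eq h]
    have := HasSum.of_nat_of_neg_add_one (f := fun m : ℤ => h (l + m)) d5.hasSum
      (m' := ∑' n : ℕ, h (l - ((n + 1 : ℕ) : ℤ))) (by
        refine d4.hasSum.congr_fun ?_
        intro n; congr 1)
    have h3 := this.tsum_eq
    simp only [Equiv.coe_addLeft]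
    rw [h3, d5.tsum_eq_zero_add]
    simp
  rw [d1.summable.tsum_eq_zero_add, d2.summable.tsum_eq_zero_add, key]
  simp only [hσ, hρ, neg_smul, tsum_neg]
  rw [tsum_smulLeft _ d3, tsum_smulLeft _ d4, ← h0]
  simp only [Nat.cast_zero, add_zero, sub_zero, smul_add, sub_smul]
  abel

/-- If `Y(w) X(z) = u(z/w) X(z) Y(w)` with `X` plus, and `u(w/z)⁻¹ - σ(z/w) = c δ(z/w)`. -/
lemma NExch.delta_plus {u : R⟦X⟧ˣ} (c : R) (hX : IsCurrent R X) (hY : IsCurrent R Y)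
    (hp : Plus X) (h : NExch (u : R⟦X⟧) X Y)
    (hσ : ∀ n : ℕ, coeff (n + 1) σ = -c)
    (hρ : ∀ n : ℕ, coeff (n + 1) (↑u⁻¹ : R⟦X⟧) = c)
    (h0 : coeff 0 (↑u⁻¹ : R⟦X⟧) - coeff 0 σ = c) (k l : ℤ) :
    X l * Y k = nop σ Y X k l + c • conv Y X (k + l) := by
  rw [(nexch_iff hX hY (Or.inl hp) u).1 h l k, conv, nop, act]
  have := tsum_expansion_sub c (deep_conv hY hX (Or.inl hp) (k + l)) hσ hρ h0 l
  convert this using 1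
  · refine tsum_congr fun n => ?_
    congr 3; ring
  · congr 1
    refine tsum_congr fun n => ?_
    congr 3; ring

lemma NExch.delta_minus {u : R⟦X⟧ˣ} (c : R) (hN : IsCurrent R N) (hY : IsCurrent R Y)
    (hp : Minus N) (h : NExch (u : R⟦X⟧) Y N)
    (hσ : ∀ n : ℕ, coeff (n + 1) σ = -c)
    (hρ : ∀ n : ℕ, coeff (n + 1) (↑u⁻¹ : R⟦X⟧) = c)
    (h0 : coeff 0 (↑u⁻¹ : R⟦X⟧) - coeff 0 σ = c) (k l : ℤ) :
    Y l * N k = nop σ N Y k l + c • conv N Y (k + l) := by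
  rw [(nexch_iff hY hN (Or.inr hp) u).1 h l k, conv, nop, act]
  have := tsum_expansion_sub c (deep_conv hN hY (Or.inr hp) (k + l)) hσ hρ h0 l
  convert this using 1
  · refine tsum_congr fun n => ?_
    congr 3; ring
  · congr 1
    refine tsum_congr fun n => ?_
    congr 3; ring

end Calculus

/-! #### Quadratic relations -/

section Quadratic

variable {e Y N : ℤ → E}

/-- `(z - p w) e(z) e(w) = (p z - w) e(w) e(z)`. -/
def Quad (p : R) (e : ℤ → E) : Prop := ∀ k l,
  e (k - 1) * e l - p • (e k * e (l - 1)) = p • (e l * e (k - 1)) - e (l - 1) * e k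

/-- The coefficients of `T(z, w) Y(z) Y(w)`. -/
def dressRight (Y : ℤ → E) (T : ℤ → ℤ → E) (k l : ℤ) : E :=
  ∑' p : ℤ × ℤ, T (k - p.1) (l - p.2) * (Y p.1 * Y p.2)

/-- The coefficients of `N(z) N(w) T(z, w)`. -/
def dressLeft (N : ℤ → E) (T : ℤ → ℤ → E) (k l : ℤ) : E :=
  ∑' p : ℤ × ℤ, (N p.1 * N p.2) * T (k - p.1) (l - p.2)

lemma deep_dressRight (hY : IsCurrent R Y) (hp : Plus Y) {T : ℤ → ℤ → E}
    (hT : ∀ k l, T k l ∈ pc R (k + l)) (k l : ℤ) :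
    Deep R (k + l) fun p : ℤ × ℤ => T (k - p.1) (l - p.2) * (Y p.1 * Y p.2) := by
  refine (deep_mul (R := R) (fun p : ℤ × ℤ => 1) (fun p => hT (k - p.1) (l - p.2))
    (fun p => mul_mem_pc (hY p.1) (hY p.2)) (fun p => by ring) (fun p => 0 ≤ p.1 ∧ 0 ≤ p.2) ?_
    ?_).congr fun p => (one_smul _ _).symm
  · intro p h
    rw [not_and_or, not_le, not_le] at h
    rcases h with h | h
    · rw [hp _ h, zero_mul, mul_zero]
    · rw [hp _ h, mul_zero, mul_zero]
  · intro N
    refine ((Set.finite_Icc 0 N).prod (Set.finite_Icc 0 N)).subset ?_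
    rintro ⟨i, j⟩ ⟨h1, h2, h3⟩
    simp only [Set.mem_prod, Set.mem_Icc] at *
    omega

lemma deep_dressLeft (hN : IsCurrent R N) (hp : Minus N) {T : ℤ → ℤ → E}
    (hT : ∀ k l, T k l ∈ pc R (k + l)) (k l : ℤ) :
    Deep R (k + l) fun p : ℤ × ℤ => (N p.1 * N p.2) * T (k - p.1) (l - p.2) := by
  refine (deep_mul (R := R) (fun p : ℤ × ℤ => 1) (fun p => mul_mem_pc (hN p.1) (hN p.2))
    (fun p => hT (k - p.1) (l - p.2)) (fun p => by ring) (fun p => p.1 ≤ 0 ∧ p.2 ≤ 0) ?_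
    ?_).congr fun p => (one_smul _ _).symm
  · intro p h
    rw [not_and_or, not_le, not_le] at h
    rcases h with h | h
    · rw [hp _ h, zero_mul, zero_mul]
    · rw [hp _ h, mul_zero, zero_mul]
  · intro N
    refine ((Set.finite_Icc (k + l - N) 0).prod (Set.finite_Icc (k + l - N) 0)).subset ?_
    rintro ⟨i, j⟩ ⟨h1, h2, h3⟩
    simp only [Set.mem_prod, Set.mem_Icc] at *
    omega

lemma dressRight_swap (hc : ∀ k l, Y k * Y l = Y l * Y k) (T : ℤ → ℤ → E) (k l : ℤ) :
    dressRight Y (fun k l => T l k) k l = dressRight Y T l k := by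
  rw [dressRight, dressRight, ← (Equiv.prodComm ℤ ℤ).tsum_eq]
  refine tsum_congr fun p => ?_
  rw [Equiv.prodComm_apply, Prod.fst_swap, Prod.snd_swap, hc]

lemma dressLeft_swap (hc : ∀ k l, N k * N l = N l * N k) (T : ℤ → ℤ → E) (k l : ℤ) :
    dressLeft N (fun k l => T l k) k l = dressLeft N T l k := by
  rw [dressLeft, dressLeft, ← (Equiv.prodComm ℤ ℤ).tsum_eq]
  refine tsum_congr fun p => ?_
  rw [Equiv.prodComm_apply, Prod.fst_swap, Prod.snd_swap, hc]

lemma conv_mul_conv_right {u : R⟦X⟧ˣ} (he : IsCurrent R e) (hY : IsCurrent R Y)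
    (hp : Plus Y) (h : NExch (u : R⟦X⟧) Y e) (k l : ℤ) :
    conv e Y k * conv e Y l = dressRight Y (nop (↑u⁻¹ : R⟦X⟧) e e) k l := by
  let ρ : R⟦X⟧ := ↑u⁻¹
  let F : (ℤ × ℤ) × ℕ → E := fun p => coeff p.2 ρ •
    (e (k - p.1.1) * (e (l - p.1.2 + p.2) * (Y (p.1.1 - p.2) * Y p.1.2)))
  have hF : Deep R (k + l) F := by
    refine deep_mul₃ (R := R) (fun p : (ℤ × ℤ) × ℕ => coeff p.2 ρ)
      (fun p : (ℤ × ℤ) × ℕ => he (k - p.1.1)) (fun p => he (l - p.1.2 + p.2))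
      (fun p => mul_mem_pc (hY (p.1.1 - p.2)) (hY p.1.2)) (fun p => by ring)
      (fun p => 0 ≤ p.1.1 - p.2 ∧ 0 ≤ p.1.2) ?_ ?_
    · intro p h
      rw [not_and_or, not_le, not_le] at h
      rcases h with h | h
      · rw [hp _ h, zero_mul, mul_zero, mul_zero]
      · rw [hp _ h, mul_zero, mul_zero, mul_zero]
    · intro N
      refine (((Set.finite_Icc (-(|N| + |k| + |l|)) (|N| + |k| + |l|)).prod
        (Set.finite_Icc (-(|N| + |k| + |l|)) (|N| + |k| + |l|))).prod
        (Set.finite_Iic (|N| + |k| + |l|).toNat)).subset ?_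
      rintro ⟨⟨i, j⟩, n⟩ ⟨h1, h2, h3, h4⟩
      simp only [Set.mem_prod, Set.mem_Icc, Set.mem_Iic] at *
      have := le_abs_self N
      have := neg_abs_le l
      have := abs_nonneg k
      have := abs_nonneg l
      refine ⟨⟨⟨?_, ?_⟩, ?_, ?_⟩, ?_⟩ <;> omega
  let ε : (ℤ × ℤ) × ℕ ≃ (ℤ × ℤ) × ℕ :=
    { toFun := fun p => ((p.1.1 + p.2, p.1.2), p.2)
      invFun := fun p => ((p.1.1 - p.2, p.1.2), p.2)
      left_inv := fun p => by simp
      right_inv := fun p => by simp }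
  have hF' := hF.comp_injective ε.injective
  have hG : Deep R (k + l) fun p : ℤ × ℤ => e (k - p.1) * Y p.1 * (e (l - p.2) * Y p.2) := by
    refine ⟨fun p => mul_mem_pc' (mul_mem_pc (he _) (hY _)) (mul_mem_pc (he _) (hY _)) (by ring),
      fun N => ?_⟩
    refine ((Set.finite_Icc 0 (N - l)).prod (Set.finite_Icc 0 N)).subset ?_
    rintro ⟨i, j⟩ hij
    by_contra hc
    refine hij ?_
    dsimp only
    by_cases hi : i < 0
    · rw [hp i hi, mul_zero, zero_mul]; exact zero_mem _
    by_cases hj : j < 0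
    · rw [hp j hj, mul_zero, mul_zero]; exact zero_mem _
    simp only [Set.mem_prod, Set.mem_Icc] at hc
    by_cases hj2 : N ≤ j
    · rw [← mul_assoc]
      exact mul_mem_deepPart (mul_mem_pc (mul_mem_pc (he _) (hY _)) (he _)) (hY _) (by ring) hj2
    · rw [mul_assoc]
      exact mul_mem_deepPart (he _) (mul_mem_pc (hY i) (mul_mem_pc (he (l - j)) (hY j)))
        (by ring) (by omega)
  have e1 : ∀ p : ℤ × ℤ, e (k - p.1) * Y p.1 * (e (l - p.2) * Y p.2) = ∑' n, F (p, n) := by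
    intro p
    have hd := (reg_mul_swap hY he (Or.inl hp) p.1 (l - p.2)).smul fun n => coeff n ρ
    rw [mul_assoc, ← mul_assoc (Y p.1), (nexch_iff hY he (Or.inl hp) u).1 h, act,
      ← tsum_mulRight _ hd.summable,
      ← tsum_mulLeft _ (hasSum_mul_right _ hd.summable.hasSum).summable]
    refine tsum_congr fun n => ?_
    simp only [F]
    rw [smul_mul_assoc, mul_smul_comm, mul_assoc (e (l - p.2 + n))]
  calc conv e Y k * conv e Y l = ∑' i, ∑' j, e (k - i) * Y i * (e (l - j) * Y j) := by
        rw [conv, conv, ← tsum_mulRight _ (summable_conv he hY (Or.inl hp) k)]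
        exact tsum_congr fun i => (tsum_mulLeft _ (summable_conv he hY (Or.inl hp) l)).symm
    _ = ∑' p : ℤ × ℤ, e (k - p.1) * Y p.1 * (e (l - p.2) * Y p.2) := (tsum_prod_of_deep R hG).symm
    _ = ∑' p, ∑' n, F (p, n) := tsum_congr e1
    _ = ∑' q, F q := (tsum_prod_of_deep R hF).symm
    _ = ∑' q, F (ε q) := (ε.tsum_eq F).symm
    _ = ∑' p, ∑' n, F (ε (p, n)) := tsum_prod_of_deep R hF'
    _ = _ := by
      rw [dressRight]
      refine tsum_congr fun p => ?_
      rw [nop, ← tsum_mulRight _ (deep_nop _ he he _ _).summable]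
      refine tsum_congr fun n => ?_
      simp only [F, ε, Equiv.coe_fn_mk]
      rw [add_sub_cancel_right, smul_mul_assoc, mul_assoc, sub_sub]

lemma conv_mul_conv_left {u : R⟦X⟧ˣ} (he : IsCurrent R e) (hN : IsCurrent R N)
    (hp : Minus N) (h : NExch (u : R⟦X⟧) e N) (k l : ℤ) :
    conv N e k * conv N e l = dressLeft N (nop (↑u⁻¹ : R⟦X⟧) e e) k l := by
  let ρ : R⟦X⟧ := ↑u⁻¹
  let F : (ℤ × ℤ) × ℕ → E := fun p => coeff p.2 ρ •
    ((N p.1.1 * N (p.1.2 + p.2)) * (e (k - p.1.1 - p.2) * e (l - p.1.2)))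
  have hF : Deep R (k + l) F := by
    refine deep_mul₃ (R := R) (fun p : (ℤ × ℤ) × ℕ => coeff p.2 ρ)
      (fun p : (ℤ × ℤ) × ℕ => mul_mem_pc (hN p.1.1) (hN (p.1.2 + p.2)))
      (fun p => he (k - p.1.1 - p.2)) (fun p => he (l - p.1.2)) (fun p => by ring)
      (fun p => p.1.1 ≤ 0 ∧ p.1.2 + p.2 ≤ 0) ?_ ?_
    · intro p h
      rw [not_and_or, not_le, not_le] at h
      rcases h with h | h
      · rw [hp _ h, zero_mul, zero_mul]
      · rw [hp _ h, mul_zero, zero_mul]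
    · intro N
      refine (((Set.finite_Icc (-(2 * |N| + 2 * |k| + 2 * |l|)) (2 * |N| + 2 * |k| + 2 * |l|)).prod
        (Set.finite_Icc (-(2 * |N| + 2 * |k| + 2 * |l|)) (2 * |N| + 2 * |k| + 2 * |l|))).prod
        (Set.finite_Iic (2 * |N| + 2 * |k| + 2 * |l|).toNat)).subset ?_
      rintro ⟨⟨i, j⟩, n⟩ ⟨h1, h2, h3, h4⟩
      simp only [Set.mem_prod, Set.mem_Icc, Set.mem_Iic] at *
      have := le_abs_self N
      have := neg_abs_le N
      have := neg_abs_le l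
      have := le_abs_self l
      have := neg_abs_le k
      have := le_abs_self k
      refine ⟨⟨⟨?_, ?_⟩, ?_, ?_⟩, ?_⟩ <;> omega
  let ε : (ℤ × ℤ) × ℕ ≃ (ℤ × ℤ) × ℕ :=
    { toFun := fun p => ((p.1.1, p.1.2 - p.2), p.2)
      invFun := fun p => ((p.1.1, p.1.2 + p.2), p.2)
      left_inv := fun p => by simp
      right_inv := fun p => by simp }
  have hF' := hF.comp_injective ε.injective
  have hG : Deep R (k + l) fun p : ℤ × ℤ => N p.1 * e (k - p.1) * (N p.2 * e (l - p.2)) := by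
    refine ⟨fun p => mul_mem_pc' (mul_mem_pc (hN _) (he _)) (mul_mem_pc (hN _) (he _)) (by ring),
      fun M => ?_⟩
    refine ((Set.finite_Icc (k + l - M) 0).prod (Set.finite_Icc (l - M) 0)).subset ?_
    rintro ⟨i, j⟩ hij
    by_contra hc
    refine hij ?_
    dsimp only
    by_cases hi : 0 < i
    · rw [hp i hi, zero_mul, zero_mul]; exact zero_mem _
    by_cases hj : 0 < j
    · rw [hp j hj, zero_mul, mul_zero]; exact zero_mem _
    simp only [Set.mem_prod, Set.mem_Icc] at hc
    by_cases hj2 : M ≤ l - j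
    · rw [← mul_assoc]
      exact mul_mem_deepPart (mul_mem_pc (mul_mem_pc (hN i) (he (k - i))) (hN j)) (he _) (by ring)
        hj2
    · rw [mul_assoc]
      exact mul_mem_deepPart (hN _) (mul_mem_pc (he (k - i)) (mul_mem_pc (hN j) (he (l - j))))
        (by ring) (by omega)
  have e1 : ∀ p : ℤ × ℤ, N p.1 * e (k - p.1) * (N p.2 * e (l - p.2)) = ∑' n, F (p, n) := by
    intro p
    have hd := (reg_mul_swap he hN (Or.inr hp) (k - p.1) p.2).smul fun n => coeff n ρ
    rw [mul_assoc, ← mul_assoc (e (k - p.1)), (nexch_iff he hN (Or.inr hp) u).1 h, act,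
      ← tsum_mulRight _ hd.summable,
      ← tsum_mulLeft _ (hasSum_mul_right _ hd.summable.hasSum).summable]
    refine tsum_congr fun n => ?_
    simp only [F]
    rw [smul_mul_assoc, mul_smul_comm]
    simp only [mul_assoc]
  calc conv N e k * conv N e l = ∑' i, ∑' j, N i * e (k - i) * (N j * e (l - j)) := by
        have hk := summable_conv hN he (Or.inr hp) k
        have hl := summable_conv hN he (Or.inr hp) l
        have flip : ∀ k, conv N e k = ∑' i, N i * e (k - i) := fun k => by
          rw [conv, ← (Equiv.subLeft k).tsum_eq]
          simp only [Equiv.subLeft_apply, sub_sub_cancel]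
        have flips : ∀ k, Summable fun i => N i * e (k - i) := fun k => by
          have := (Equiv.subLeft k).summable_iff.2 (summable_conv hN he (Or.inr hp) k)
          simpa only [Function.comp_def, Equiv.subLeft_apply, sub_sub_cancel] using this
        rw [flip, flip, ← tsum_mulRight _ (flips k)]
        exact tsum_congr fun i => (tsum_mulLeft _ (flips l)).symm
    _ = ∑' p : ℤ × ℤ, N p.1 * e (k - p.1) * (N p.2 * e (l - p.2)) := (tsum_prod_of_deep R hG).symm
    _ = ∑' p, ∑' n, F (p, n) := tsum_congr e1
    _ = ∑' q, F q := (tsum_prod_of_deep R hF).symm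
    _ = ∑' q, F (ε q) := (ε.tsum_eq F).symm
    _ = ∑' p, ∑' n, F (ε (p, n)) := tsum_prod_of_deep R hF'
    _ = _ := by
      rw [dressLeft]
      refine tsum_congr fun p => ?_
      rw [nop, ← tsum_mulLeft _ (deep_nop _ he he _ _).summable]
      refine tsum_congr fun n => ?_
      simp only [F, ε, Equiv.coe_fn_mk]
      rw [sub_add_cancel, mul_smul_comm, show l - (p.2 - (n : ℤ)) = l - p.2 + n by ring]

lemma quad_iff {p : R} : Quad p e ↔ ∀ k l, e (k - 1) * e l - p • (e k * e (l - 1)) =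
    -(e (l - 1) * e k - p • (e l * e (k - 1))) := by
  simp only [Quad, neg_sub]

lemma nop_sub_smul (he : IsCurrent R e) {μ : R⟦X⟧} {p p' a : R}
    (hμ : (PowerSeries.X - C p') * μ =
      C a * (PowerSeries.X - C p)) (k l : ℤ) :
    nop μ e e (k - 1) l - p' • nop μ e e k (l - 1) =
      a • (e (k - 1) * e l - p • (e k * e (l - 1))) := by
  have h2 : act (PowerSeries.X - C p') (nop μ e e) k (l - 1) =
      act (C a * (PowerSeries.X - C p)) (fun k l => e k * e l) k (l - 1) := by
    rw [nop_eq_act, act_act (reg_mul he he), hμ]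
  rw [act_C_mul (reg_mul he he)] at h2
  simpa only [act_X_sub_C, sub_add_cancel] using h2

lemma Quad.conv_right {u : R⟦X⟧ˣ} {p p' a : R} (h : Quad p e) (he : IsCurrent R e)
    (hY : IsCurrent R Y) (hp : Plus Y) (hc : ∀ k l, Y k * Y l = Y l * Y k)
    (hu : NExch (u : R⟦X⟧) Y e)
    (ha : (PowerSeries.X - C p') * (↑u⁻¹ : R⟦X⟧) =
      C a * (PowerSeries.X - C p)) : Quad p' (conv e Y) := by
  have key : ∀ k l, conv e Y (k - 1) * conv e Y l - p' • (conv e Y k * conv e Y (l - 1)) =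
      dressRight Y (fun k l => a • (e (k - 1) * e l - p • (e k * e (l - 1)))) k l := by
    intro k l
    have hK : ∀ k l, nop (↑u⁻¹ : R⟦X⟧) e e k l ∈ pc R (k + l) := fun k l =>
      tsum_mem_pc (deep_nop _ he he k l).mem
    have d1 := (deep_dressRight hY hp hK (k - 1) l).summable
    have d2 := (deep_dressRight hY hp hK k (l - 1)).summable
    rw [conv_mul_conv_right he hY hp hu, conv_mul_conv_right he hY hp hu, dressRight, dressRight,
      ← tsum_smulLeft _ d2, ← d1.tsum_sub (hasSum_smul p' d2.hasSum).summable, dressRight]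
    refine tsum_congr fun i => ?_
    rw [← nop_sub_smul he ha, sub_mul, smul_mul_assoc, sub_right_comm k, sub_right_comm l]
  rw [quad_iff] at h ⊢
  intro k l
  rw [key, key, ← dressRight_swap hc, dressRight, dressRight, ← tsum_neg]
  refine tsum_congr fun i => ?_
  rw [h, smul_neg, neg_mul]

lemma Quad.conv_left {u : R⟦X⟧ˣ} {p p' a : R} (h : Quad p e) (he : IsCurrent R e)
    (hN : IsCurrent R N) (hp : Minus N) (hc : ∀ k l, N k * N l = N l * N k)
    (hu : NExch (u : R⟦X⟧) e N)
    (ha : (PowerSeries.X - C p') * (↑u⁻¹ : R⟦X⟧) =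
      C a * (PowerSeries.X - C p)) : Quad p' (conv N e) := by
  have key : ∀ k l, conv N e (k - 1) * conv N e l - p' • (conv N e k * conv N e (l - 1)) =
      dressLeft N (fun k l => a • (e (k - 1) * e l - p • (e k * e (l - 1)))) k l := by
    intro k l
    have hK : ∀ k l, nop (↑u⁻¹ : R⟦X⟧) e e k l ∈ pc R (k + l) := fun k l =>
      tsum_mem_pc (deep_nop _ he he k l).mem
    have d1 := (deep_dressLeft hN hp hK (k - 1) l).summable
    have d2 := (deep_dressLeft hN hp hK k (l - 1)).summable
    rw [conv_mul_conv_left he hN hp hu, conv_mul_conv_left he hN hp hu, dressLeft, dressLeft,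
      ← tsum_smulLeft _ d2, ← d1.tsum_sub (hasSum_smul p' d2.hasSum).summable, dressLeft]
    refine tsum_congr fun i => ?_
    rw [← nop_sub_smul he ha, mul_sub, mul_smul_comm, sub_right_comm k, sub_right_comm l]
  rw [quad_iff] at h ⊢
  intro k l
  rw [key, key, ← dressLeft_swap hc, dressLeft, dressLeft, ← tsum_neg]
  refine tsum_congr fun i => ?_
  rw [h, smul_neg, mul_neg]

lemma Quad.neg {p : R} (h : Quad p e) : Quad p fun k => -e k := fun k l => by
  simpa only [neg_mul_neg] using h k l

lemma quad_one_of_commute (h : ∀ k l, e k * e l = e l * e k) : Quad (1 : R) e := fun k l => by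
  rw [h k, h (k - 1), one_smul, one_smul]

/-- A quadratic relation makes `e(z) e(w) (z - p w) / (z - w)` symmetric. -/
lemma Quad.nop_symm {p a : R} {μ : R⟦X⟧} (h2 : ∀ x : E, x + x = 0 → x = 0)
    (h : Quad p e) (he : IsCurrent R e)
    (hμ : μ = PowerSeries.mk 1 * (C a * (PowerSeries.X - C p))) (k l : ℤ) :
    nop μ e e k l = nop μ e e l k := by
  let G : ℤ → ℤ → E := fun k l => a • (e (k - 1) * e (l + 1) - p • (e k * e l))
  have hG : act (C a * (PowerSeries.X - C p)) (fun k l => e k * e l) = G := by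
    funext k l
    rw [act_C_mul (reg_mul he he), act_X_sub_C]
  have hanti : ∀ k l, G k l = -G (l + 1) (k - 1) := by
    intro k l
    have := quad_iff.1 h k (l + 1)
    simp only [G]
    rw [add_sub_cancel_right] at this
    rw [← smul_neg, this, add_sub_cancel_right, sub_add_cancel]
  let g : ℤ → E := fun m => G (k - m) (l + m)
  have hgs : ∀ m, g m = -g (k - l - 1 - m) := by
    intro m
    simp only [g]
    rw [hanti]
    congr 2 <;> ring
  have hJ : ∀ N m, N ≤ l + m → g m ∈ deepPart R (k + l) N := by
    intro N m hm
    refine Submodule.smul_mem _ _ (Submodule.sub_mem _ ?_ (Submodule.smul_mem _ _ ?_))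
    · exact mul_mem_deepPart (he _) (he _) (by ring) (by omega)
    · exact mul_mem_deepPart (he _) (he _) (by ring) (by omega)
  have hd : Deep R (k + l) g := by
    refine ⟨fun m => ?_, fun N => ?_⟩
    · refine Submodule.smul_mem _ _ (Submodule.sub_mem _ ?_ (Submodule.smul_mem _ _ ?_))
      · exact mul_mem_pc' (he _) (he _) (by ring)
      · exact mul_mem_pc' (he _) (he _) (by ring)
    · refine (Set.finite_Icc (k - 1 - N) (N - l)).subset fun m hm => ?_
      by_contra hc
      simp only [Set.mem_Icc] at hc
      refine hm ?_
      by_cases h1 : N ≤ l + m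
      · exact hJ N m h1
      · rw [hgs]
        exact neg_mem (hJ N _ (by omega))
  have hsum : ∑' m, g m = 0 := by
    apply h2
    have e1 : ∑' m, g m = -∑' m, g m := by
      conv_lhs => rw [tsum_congr hgs, tsum_neg, ← (Equiv.subLeft (k - l - 1)).tsum_eq]
      simp only [Equiv.subLeft_apply, sub_sub_cancel]
    nth_rewrite 1 [e1]
    exact neg_add_cancel _
  have hact : ∀ k l, nop μ e e k l = ∑' n : ℕ, G (k - n) (l + n) := by
    intro k l
    rw [nop_eq_act, hμ, ← act_act (reg_mul he he), hG, act]
    simp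
  have i1 : Function.Injective fun n : ℕ => (n : ℤ) := Nat.cast_injective
  have i2 : Function.Injective fun n : ℕ => -((n : ℤ) + 1) := fun a b h => by
    simp only at h; omega
  have hs := HasSum.of_nat_of_neg_add_one (f := g) (hd.comp_injective i1).summable.hasSum
    (hd.comp_injective i2).summable.hasSum
  rw [hs.tsum_eq] at hsum
  rw [hact, hact, eq_neg_of_add_eq_zero_left hsum, ← tsum_neg]
  refine tsum_congr fun n => ?_
  simp only [g]
  rw [hanti, neg_neg]
  congr 1 <;> ring

lemma commute_conv_right {u : R⟦X⟧ˣ} (he : IsCurrent R e)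
    (hY : IsCurrent R Y) (hp : Plus Y) (hc : ∀ k l, Y k * Y l = Y l * Y k)
    (hu : NExch (u : R⟦X⟧) Y e)
    (hs : ∀ k l, nop (↑u⁻¹ : R⟦X⟧) e e k l = nop (↑u⁻¹ : R⟦X⟧) e e l k)
    (k l : ℤ) : conv e Y k * conv e Y l = conv e Y l * conv e Y k := by
  rw [conv_mul_conv_right he hY hp hu, conv_mul_conv_right he hY hp hu, ← dressRight_swap hc]
  congr 1
  funext k l
  exact (hs k l).symm

lemma commute_conv_left {u : R⟦X⟧ˣ} (he : IsCurrent R e)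
    (hN : IsCurrent R N) (hp : Minus N) (hc : ∀ k l, N k * N l = N l * N k)
    (hu : NExch (u : R⟦X⟧) e N)
    (hs : ∀ k l, nop (↑u⁻¹ : R⟦X⟧) e e k l = nop (↑u⁻¹ : R⟦X⟧) e e l k)
    (k l : ℤ) : conv N e k * conv N e l = conv N e l * conv N e k := by
  rw [conv_mul_conv_left he hN hp hu, conv_mul_conv_left he hN hp hu, ← dressLeft_swap hc]
  congr 1
  funext k l
  exact (hs k l).symm

end Quadratic

section Delta

variable {D P N X Y : ℤ → E} {ρ c : R⟦X⟧}

/-- The coefficients of `δ(u z/w) D(w)`. -/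
def deltaTerm (u : Rˣ) (D : ℤ → E) (k l : ℤ) : E := (↑(u ^ k) : R) • D (k + l)

lemma hasSum_deltaTerm_first (u : Rˣ) (hD : IsCurrent R D) (hP : IsCurrent R P) (hp : Plus P)
    (k l : ℤ) : HasSum (fun i : ℤ => deltaTerm u D (k - i) l * P i)
      (deltaTerm u (conv D (shift u⁻¹ P)) k l) := by
  refine (hasSum_smul (↑(u ^ k) : R) (summable_conv hD (isCurrent_shift u⁻¹ hP)
    (Or.inl (hp.shift _)) (k + l)).hasSum).congr_fun fun i => ?_
  rw [deltaTerm, shift, smul_mul_assoc, mul_smul_comm, smul_smul, inv_zpow',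
    zpow_mul_zpow_of_add u (sub_eq_add_neg k i).symm, sub_add_eq_add_sub]

lemma hasSum_deltaTerm_second (u : Rˣ) (hD : IsCurrent R D) (hN : IsCurrent R N) (hp : Minus N)
    (k l : ℤ) : HasSum (fun j : ℤ => N (l - j) * deltaTerm u D k j)
      (deltaTerm u (conv N D) k l) := by
  refine ((Equiv.addLeft k).hasSum_iff.2 (hasSum_smul (↑(u ^ k) : R) (summable_conv hN hD
    (Or.inr hp) (k + l)).hasSum)).congr_fun fun i => ?_
  rw [deltaTerm, mul_smul_comm, Function.comp_apply, Equiv.coe_addLeft, add_sub_add_left_eq_sub]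

lemma NRel.conv_first_delta {D' : ℤ → E} {u v : Rˣ} {s : R} (hX : IsCurrent R X)
    (hY : IsCurrent R Y) (hP : IsCurrent R P) (hD : IsCurrent R D) (hD' : IsCurrent R D')
    (hp : Plus P)
    (h : NRel c X Y fun k l => s • (deltaTerm u D k l - deltaTerm v D' k l))
    (hPY : NExch ρ P Y) :
    NRel (c * ρ) (conv X P) Y fun k l => s • (deltaTerm u (conv D (shift u⁻¹ P)) k l -
      deltaTerm v (conv D' (shift v⁻¹ P)) k l) := by
  have hs : ∀ k l, HasSum (fun i => s • (deltaTerm u D (k - i) l - deltaTerm v D' (k - i) l) * P i)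
      (s • (deltaTerm u (conv D (shift u⁻¹ P)) k l - deltaTerm v (conv D' (shift v⁻¹ P)) k l)) :=
    fun k l => by
      simpa only [smul_mul_assoc, sub_mul] using hasSum_smul s
        ((hasSum_deltaTerm_first u hD hP hp k l).sub (hasSum_deltaTerm_first v hD' hP hp k l))
  have := h.conv_first hX hY hP (Or.inl hp) hPY fun k l => (hs k l).summable
  intro k l
  rw [this k l]
  exact congrArg _ (hs k l).tsum_eq

lemma NRel.conv_second_delta {D' : ℤ → E} {u v : Rˣ} {s : R} (hX : IsCurrent R X)
    (hY : IsCurrent R Y) (hN : IsCurrent R N) (hD : IsCurrent R D) (hD' : IsCurrent R D')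
    (hp : Minus N)
    (h : NRel c X Y fun k l => s • (deltaTerm u D k l - deltaTerm v D' k l))
    (hNX : NExch ρ X N) :
    NRel (c * ρ) X (conv N Y) fun k l => s • (deltaTerm u (conv N D) k l -
      deltaTerm v (conv N D') k l) := by
  have hs : ∀ k l, HasSum (fun j => N (l - j) * s • (deltaTerm u D k j - deltaTerm v D' k j))
      (s • (deltaTerm u (conv N D) k l - deltaTerm v (conv N D') k l)) :=
    fun k l => by
      simpa only [mul_smul_comm, mul_sub] using hasSum_smul s
        ((hasSum_deltaTerm_second u hD hN hp k l).sub (hasSum_deltaTerm_second v hD' hN hp k l))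
  have := h.conv_second hX hY hN (Or.inr hp) hNX fun k l => (hs k l).summable
  intro k l
  rw [this k l]
  exact congrArg _ (hs k l).tsum_eq

end Delta

/-! ### Structure functions over an extension of the ground ring -/

section Scalars

variable (R : Type*) [CommRing R] [Algebra B R]

/-- The power `q ^ t` as a unit. -/
def qu (t : ℂ) : Rˣ :=
  Units.map (algebraMap B R).toMonoidHom ⟨qp t, qp (-t), by rw [← qp_add, add_neg_cancel, qp_zero],
    by rw [← qp_add, neg_add_cancel, qp_zero]⟩

variable {R}

lemma val_qu (t : ℂ) : (qu R t : R) = algebraMap B R (qp t) := rfl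

lemma qu_add (s t : ℂ) : qu R (s + t) = qu R s * qu R t := by
  ext
  rw [Units.val_mul, val_qu, val_qu, val_qu, qp_add, map_mul]

lemma qu_zero : qu R 0 = 1 := by
  ext
  rw [val_qu, qp_zero, map_one, Units.val_one]

lemma qu_neg (t : ℂ) : qu R (-t) = (qu R t)⁻¹ :=
  eq_inv_of_mul_eq_one_left (by rw [← qu_add, neg_add_cancel, qu_zero])

lemma qu_zpow (t : ℂ) (k : ℤ) : qu R t ^ k = qu R (t * k) := by
  induction k using Int.induction_on with
  | zero => simp [qu_zero]
  | succ n ih => rw [zpow_add_one, ih, ← qu_add]; congr 1; push_cast; ring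
  | pred n ih => rw [zpow_sub_one, ih, ← qu_neg, ← qu_add]; congr 1; push_cast; ring

lemma qp_smul {E : Type*} [Ring E] [Algebra B E] [Algebra R E] [IsScalarTower B R E] (k : ℤ)
    (x : E) : qp (2 * (k : ℂ)) • x = (↑(qu R 2 ^ k) : R) • x := by
  rw [qu_zpow, val_qu, algebraMap_smul]

def ud : B⟦X⟧ˣ := isUnit_d.unit
def udq : B⟦X⟧ˣ := isUnit_dq.unit
def ug' : B⟦X⟧ˣ := isUnit_g.unit
def uf : B⟦X⟧ˣ := isUnit_f.unit

lemma inverse_d : Ring.inverse d = (ud⁻¹ : B⟦X⟧ˣ) := Ring.inverse_unit ud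
lemma inverse_dq : Ring.inverse dq = (udq⁻¹ : B⟦X⟧ˣ) := Ring.inverse_unit udq
lemma inverse_g : Ring.inverse g = (ug'⁻¹ : B⟦X⟧ˣ) := Ring.inverse_unit ug'
lemma inverse_f : Ring.inverse f = (uf⁻¹ : B⟦X⟧ˣ) := Ring.inverse_unit uf

/-- The substitution `x ↦ c x` for a unit `c`. -/
def rs (c : Rˣ) : R⟦X⟧ˣ →* R⟦X⟧ˣ := Units.map (rescale (c : R)).toMonoidHom

lemma val_rs (c : Rˣ) (u : R⟦X⟧ˣ) :
    ((rs c u : R⟦X⟧ˣ) : R⟦X⟧) = rescale (c : R) u := rfl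

lemma rs_rs (c c' : Rˣ) (u : R⟦X⟧ˣ) : rs c (rs c' u) = rs (c * c') u := by
  ext1
  rw [val_rs, val_rs, val_rs, rescale_rescale, Units.val_mul, mul_comm]

lemma rs_one (u : R⟦X⟧ˣ) : rs 1 u = u := by
  ext1
  rw [val_rs, Units.val_one, rescale_one, RingHom.id_apply]

variable (R) in
/-- Extension of scalars for units. -/
def ev : B⟦X⟧ˣ →* R⟦X⟧ˣ :=
  Units.map (PowerSeries.map (algebraMap B R)).toMonoidHom

lemma val_ev (u : B⟦X⟧ˣ) :
    ((ev R u : R⟦X⟧ˣ) : R⟦X⟧) = PowerSeries.map (algebraMap B R) u := rfl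

lemma rescale_map (b : B) (p : B⟦X⟧) :
    rescale (algebraMap B R b) (PowerSeries.map (algebraMap B R) p) =
      PowerSeries.map (algebraMap B R) (rescale b p) := by
  ext n
  simp [coeff_rescale]

lemma rs_ev (t : ℂ) (u : B⟦X⟧ˣ) : rs (qu R t) (ev R u) = ev R (rs (qu B t) u) := by
  ext1
  rw [val_rs, val_ev, val_ev, val_rs, val_qu, val_qu, rescale_map]
  rfl

lemma C_qp_mul (s t : ℂ) : C (qp s) * C (qp t) = C (qp (s + t)) := by
  rw [← map_mul, qp_add]

lemma C_qp_one_mul : C (qp 1) * C (qp (-1)) = 1 := by rw [C_qp_mul]; norm_num [qp_zero]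

lemma C_qp_two_mul : C (qp 2) * C (qp (-1)) = C (qp 1) := by rw [C_qp_mul]; norm_num

lemma dq_eq : dq * (1 - X) = C (qp (-1)) - C (qp 1) * X := by
  have h := congrArg (rescale (qp 2)) d_eq
  rw [map_mul, map_sub, map_sub, map_mul, map_one, rescale_X, rescale_const,
    rescale_const, ← mul_assoc, ← map_mul, ← qp_add, show (-1 + 2 : ℂ) = 1 by norm_num] at h
  rw [← dq] at h
  linear_combination (C (qp (-1))) * h - dq * (1 - X) * C_qp_one_mul - X * C_qp_two_mul

lemma linear_ne_zero (s t : ℂ) : C (qp s) - C (qp t) * X ≠ 0 := fun h => by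
  have := congrArg constantCoeff h
  simp only [map_sub, map_mul, constantCoeff_C, constantCoeff_X, mul_zero, sub_zero, map_zero] at this
  exact (isUnit_qp s).ne_zero this

lemma inv_d_eq : (↑ud⁻¹ : B⟦X⟧) * (1 - X) = C (qp 1) - C (qp (-1)) * X := by
  rw [← d_eq, ← mul_assoc, show (↑ud⁻¹ : B⟦X⟧) * d = 1 from Units.inv_mul ud, one_mul]

lemma one_sub_X_ne_zero : (1 - X : B⟦X⟧) ≠ 0 := by
  simpa [qp_zero] using linear_ne_zero 0 0

lemma d_mul_dq : d * dq = g := by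
  have h1 := d_eq
  have h2 := dq_eq
  have h3 := g_eq
  have n1 := linear_ne_zero 1 (-1)
  have n2 := one_sub_X_ne_zero
  have n3 := linear_ne_zero 2 0
  rw [qp_zero, map_one, one_mul] at n3
  apply mul_right_cancel₀ n1
  apply mul_right_cancel₀ n2
  apply mul_right_cancel₀ n3
  linear_combination (dq * (1 - X) * (C (qp 2) - X)) * h1 + (1 - X) * (C (qp 2) - X) * h2 -
    (1 - X) * (C (qp 1) - C (qp (-1)) * X) * h3 +
    (1 - X) * C_qp_two_mul - (1 - X) * X ^ 2 * C_qp_two_mul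

lemma ud_mul_udq : ud * udq = ug' := Units.ext d_mul_dq

lemma rs_ud : rs (qu B 2) ud = udq := Units.ext rfl

lemma rs_uf : uf * rs (qu B 2) uf = udq⁻¹ :=
  eq_inv_of_mul_eq_one_left (Units.ext f_difference)

lemma rs_uf_inv : uf * rs (qu B (-2)) uf = ud⁻¹ := by
  have h := congrArg (rs (qu B (-2))) rs_uf
  rw [map_mul, rs_rs, ← qu_add, ← rs_ud, map_inv, rs_rs, ← qu_add, neg_add_cancel, qu_zero, rs_one,
    rs_one] at h
  rw [← h, mul_comm]

lemma coeff_of_mul_one_sub_X {p : B⟦X⟧} {a b : B} (h : p * (1 - X) = C a - C b * X)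
    (n : ℕ) : coeff (n + 1) p = a - b ∧ coeff 0 p = a := by
  have h0 : coeff 0 p = a := by simpa using congrArg constantCoeff h
  have hs : ∀ n, coeff (n + 1) p - coeff n p = if n = 0 then -b else 0 := fun n => by
    have := congrArg (coeff (n + 1)) h
    rw [mul_sub, mul_one, map_sub, coeff_succ_mul_X, map_sub, coeff_C, if_neg n.succ_ne_zero,
      coeff_succ_mul_X, coeff_C, zero_sub] at this
    rw [this]
    split_ifs <;> simp
  refine ⟨?_, h0⟩
  induction n with
  | zero => rw [← h0, sub_eq_add_neg, ← sub_eq_iff_eq_add', hs, if_pos rfl]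
  | succ n ih => rw [← ih, ← sub_eq_zero, hs, if_neg n.succ_ne_zero]

lemma C_qp_map (t : ℂ) : PowerSeries.map (algebraMap B R) (C (qp t)) = C (qu R t : R) := by
  rw [map_C, val_qu]

lemma ev_identity {p : B⟦X⟧} {a b c : ℂ} (h : (X - C (qp b)) * p = C (qp a) * (X - C (qp c)))
    : (X - C (qu R b : R)) * PowerSeries.map (algebraMap B R) p =
      C (qu R a : R) * (X - C (qu R c : R)) := by
  have := congrArg (PowerSeries.map (algebraMap B R)) h
  rwa [map_mul, map_mul, map_sub, map_sub, map_X, C_qp_map, C_qp_map, C_qp_map] at this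

lemma X_sub_mul_g : (X - C (qp 2)) * g = C (qp 2) * (X - C (qp (-2))) := by
  have e1 : C (qp 2) * C (qp (-2)) = 1 := by rw [C_qp_mul]; norm_num [qp_zero]
  linear_combination (-1 : B⟦X⟧) * g_eq + e1

lemma X_sub_mul_inv_g : (X - C (qp (-2))) * (↑ug'⁻¹ : B⟦X⟧) =
    C (qp (-2)) * (X - C (qp 2)) := by
  have h : g * (↑ug'⁻¹ : B⟦X⟧) = 1 := ug'.mul_inv
  have e1 : C (qp 2) * C (qp (-2)) = 1 := by rw [C_qp_mul]; norm_num [qp_zero]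
  linear_combination (-(↑ug'⁻¹ : B⟦X⟧) * C (qp (-2))) * X_sub_mul_g +
    (C (qp (-2)) * (X - C (qp 2))) * h + (C (qp (-2)) - X) * (↑ug'⁻¹ : B⟦X⟧) * e1

lemma X_sub_mul_d : (X - C (qp 2)) * d = C (qp 1) * (X - C (qp 0)) := by
  have e3 : C (qp 1) * C (qp 1) = C (qp 2) := by rw [C_qp_mul]; norm_num
  rw [qp_zero, map_one]
  linear_combination (-C (qp 1)) * d_eq + d * e3 - X * d * C_qp_one_mul

lemma X_sub_mul_inv_dq : (X - C (qp (-2))) * (↑udq⁻¹ : B⟦X⟧) =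
    C (qp (-1)) * (X - C (qp 0)) := by
  have h : dq * (↑udq⁻¹ : B⟦X⟧) = 1 := udq.mul_inv
  have e3 : C (qp (-1)) * C (qp (-1)) = C (qp (-2)) := by rw [C_qp_mul]; norm_num
  rw [qp_zero, map_one]
  linear_combination (C (qp (-1)) * (↑udq⁻¹ : B⟦X⟧)) * dq_eq -
    C (qp (-1)) * (1 - X) * h + (↑udq⁻¹ : B⟦X⟧) * e3 - X * (↑udq⁻¹ : B⟦X⟧) * C_qp_one_mul

lemma mk_one_mul : (PowerSeries.mk 1 : B⟦X⟧) * (1 - X) = 1 := mk_one_mul_one_sub_eq_one B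

lemma inv_d_eq_mk : (↑ud⁻¹ : B⟦X⟧) =
    PowerSeries.mk 1 * (C (-qp (-1)) * (X - C (qp 2))) := by
  apply mul_right_cancel₀ one_sub_X_ne_zero
  rw [inv_d_eq, map_neg]
  linear_combination (C (qp (-1)) * (X - C (qp 2))) * mk_one_mul - C_qp_two_mul

lemma dq_eq_mk : dq = PowerSeries.mk 1 * (C (-qp 1) * (X - C (qp (-2)))) := by
  have e2 : C (qp 1) * C (qp (-2)) = C (qp (-1)) := by rw [C_qp_mul]; norm_num
  apply mul_right_cancel₀ one_sub_X_ne_zero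
  rw [dq_eq, map_neg]
  linear_combination (C (qp 1) * (X - C (qp (-2)))) * mk_one_mul - e2

lemma map_mk_one (a b : B) (p : B⟦X⟧)
    (h : p = PowerSeries.mk 1 * (C a * (X - C b))) : PowerSeries.map (algebraMap B R) p =
      PowerSeries.mk 1 * (C (algebraMap B R a) * (X - C (algebraMap B R b))) := by
  rw [h, map_mul, map_mul, map_sub, map_C, map_C, map_X]
  congr 1
  ext n
  simp

/-- The series `u(x κ⁻¹) v(x κ)`. -/
def tw (κ : Rˣ) (u v : B⟦X⟧) : R⟦X⟧ :=
  rescale (↑κ⁻¹ : R) (PowerSeries.map (algebraMap B R) u) *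
    rescale (κ : R) (PowerSeries.map (algebraMap B R) v)

lemma tw_units (κ : Rˣ) (u v : B⟦X⟧ˣ) : tw κ (u : B⟦X⟧) v =
    ((rs κ⁻¹ (ev R u) * rs κ (ev R v) : R⟦X⟧ˣ) : R⟦X⟧) := rfl

variable {E : Type*} [Ring E] [Algebra B E] [Algebra R E] [IsScalarTower B R E]

lemma kpow_units (κ : Rˣ) (n : ℤ) :
    kpow (algebraMap R E (κ : R)) (algebraMap R E (↑κ⁻¹ : R)) n =
      algebraMap R E (↑(κ ^ n) : R) := by
  rw [kpow, ← map_pow, ← map_pow, ← map_mul]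
  congr 1
  rcases le_total 0 n with h | h
  · obtain ⟨m, rfl⟩ := Int.eq_ofNat_of_zero_le h
    simp
  · obtain ⟨m, hm⟩ := Int.eq_ofNat_of_zero_le (neg_nonneg.2 h)
    obtain rfl : n = -(m : ℤ) := by omega
    simp

lemma twist_units (κ : Rˣ) (u v : B⟦X⟧) (n : ℕ) :
    twist (algebraMap R E (κ : R)) (algebraMap R E (↑κ⁻¹ : R)) u v n =
      algebraMap R E (coeff n (tw κ u v)) := by
  rw [twist, tw, coeff_mul, map_sum]
  refine Finset.sum_congr rfl fun p _ => ?_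
  rw [kpow_units, coeff_rescale_units, coeff_rescale_units, coeff_map, coeff_map,
    ← algebraMap_smul R, Algebra.smul_def, ← map_mul]
  congr 1
  rw [sub_eq_add_neg, zpow_add, zpow_neg, inv_zpow', Units.val_mul, map_mul, ← zpow_neg]
  ring

end Scalars

section

/-! ### Invertible currents -/

/-- A series in nonnegative or nonpositive powers of `z`. -/
def Bd {E : Type*} [Zero E] : Sgn → (ℤ → E) → Prop
  | .pos, X => Plus X
  | .neg, X => Minus X

lemma Bd.shift {s : Sgn} {X : ℤ → E} (c : Rˣ) (h : Bd s X) : Bd s (shift c X) := by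
  cases s
  · exact Plus.shift c h
  · exact Minus.shift c h

lemma Bd.conv {s : Sgn} {X Y : ℤ → E} (h : Bd s X) (h' : Bd s Y) : Bd s (conv X Y) := by
  cases s
  · exact Plus.conv h h'
  · exact Minus.conv h h'

lemma Bd.or {s : Sgn} {X Y : ℤ → E} (h : Bd s X) (h' : Bd s Y) : Plus Y ∨ Minus X := by
  cases s
  · exact Or.inl h'
  · exact Or.inr h

lemma conv_assoc_bd {s : Sgn} {X Y Z : ℤ → E} (hX : IsCurrent R X) (hY : IsCurrent R Y)
    (hZ : IsCurrent R Z) (h1 : Bd s X) (h2 : Bd s Y) (h3 : Bd s Z) :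
    conv (conv X Y) Z = conv X (conv Y Z) := by
  cases s
  · exact conv_assoc hX hY hZ (Or.inl ⟨h2, h3⟩)
  · exact conv_assoc hX hY hZ (Or.inr (Or.inl ⟨h1, h2⟩))

lemma commute_conv {X Y : ℤ → E} {y : E} (hX : IsCurrent R X) (hY : IsCurrent R Y)
    (h : Plus Y ∨ Minus X) (h1 : ∀ k, Commute y (X k)) (h2 : ∀ k, Commute y (Y k)) (k : ℤ) :
    Commute y (conv X Y k) := by
  rw [commute_iff_eq, conv, ← tsum_mulLeft _ (deep_conv hX hY h k).summable,
    ← tsum_mulRight _ (deep_conv hX hY h k).summable]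
  exact tsum_congr fun n => ((h1 _).mul_right (h2 _)).eq

lemma commute_shift {X : ℤ → E} {y : E} (c : Rˣ) (h1 : ∀ k, Commute y (X k)) (k : ℤ) :
    Commute y (shift c X k) := (h1 k).smul_right _

variable (R) in
/-- A current `X(z)` in powers of `z` or of `z⁻¹` with commuting modes, and its inverse. -/
structure InvPair (s : Sgn) (X X' : ℤ → E) : Prop where
  cur : IsCurrent R X
  cur' : IsCurrent R X'
  bd : Bd s X
  bd' : Bd s X'
  mul : conv X X' = oneCurrent E
  mul' : conv X' X = oneCurrent E
  comm : ∀ k l, Commute (X k) (X l)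

namespace InvPair

variable {s : Sgn} {X X' Y : ℤ → E}

lemma commute_inv (h : InvPair R s X X') (hY : IsCurrent R Y)
    (hc : ∀ k l, Commute (X k) (Y l)) (k l : ℤ) : Commute (X' k) (Y l) := by
  cases s
  · have : NExch ((1 : R⟦X⟧ˣ) : R⟦X⟧) X Y := nexch_one_iff.2 fun k l => (hc k l).symm
    have := this.inv_first h.cur hY h.cur' h.bd h.bd' h.mul h.mul'
    rw [inv_one] at this
    have h2 := nexch_one_iff (R := R).1 this k l
    exact h2.symm
  · have : NExch ((1 : R⟦X⟧ˣ) : R⟦X⟧) Y X := nexch_one_iff.2 fun k l => hc l k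
    have := this.inv_second hY h.cur h.cur' h.bd h.bd' h.mul h.mul'
    rw [inv_one] at this
    exact nexch_one_iff (R := R).1 this l k

lemma comm_mixed (h : InvPair R s X X') (k l : ℤ) : Commute (X' k) (X l) :=
  h.commute_inv h.cur h.comm k l

lemma symm (h : InvPair R s X X') : InvPair R s X' X :=
  ⟨h.cur', h.cur, h.bd', h.bd, h.mul', h.mul,
    h.commute_inv h.cur' fun k l => (h.comm_mixed l k).symm⟩

lemma shift (h : InvPair R s X X') (c : Rˣ) : InvPair R s (shift c X) (shift c X') :=
  ⟨isCurrent_shift c h.cur, isCurrent_shift c h.cur', h.bd.shift c, h.bd'.shift c,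
    by rw [← shift_conv c h.cur h.cur' (h.bd.or h.bd'), h.mul, shift_oneCurrent],
    by rw [← shift_conv c h.cur' h.cur (h.bd'.or h.bd), h.mul', shift_oneCurrent],
    fun k l => (commute_shift c (fun l => (commute_shift c (fun k => h.comm l k) k).symm) l)⟩

lemma conv {Y' : ℤ → E} (h : InvPair R s X X') (h' : InvPair R s Y Y')
    (hc : ∀ k l, Commute (X k) (Y l)) : InvPair R s (conv X Y) (conv X' Y') := by
  have c1 : ∀ k l, Commute (X' k) (Y l) := h.commute_inv h'.cur hc
  have c2 : ∀ k l, Commute (X k) (Y' l) := fun k l =>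
    (h'.commute_inv h.cur (fun k l => (hc l k).symm) l k).symm
  have key : ∀ {X X' Y Y' : ℤ → E}, InvPair R s X X' → InvPair R s Y Y' →
      (∀ k l, Commute (Y k) (X' l)) →
      QCurrent.conv (QCurrent.conv X Y) (QCurrent.conv X' Y') = oneCurrent E := by
    intro X X' Y Y' h h' hc
    rw [conv_assoc_bd h.cur h'.cur (isCurrent_conv h.cur' h'.cur') h.bd h'.bd (h.bd'.conv h'.bd'),
      ← conv_assoc_bd h'.cur h.cur' h'.cur' h'.bd h.bd' h'.bd', conv_comm hc,
      conv_assoc_bd h.cur' h'.cur h'.cur' h.bd' h'.bd h'.bd', h'.mul, conv_one, h.mul]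
  refine ⟨isCurrent_conv h.cur h'.cur, isCurrent_conv h.cur' h'.cur', h.bd.conv h'.bd,
    h.bd'.conv h'.bd', key h h' fun k l => (c1 l k).symm, key h.symm h'.symm fun k l => (c2 l k).symm,
    fun k l => commute_conv h.cur h'.cur (h.bd.or h'.bd) (fun l => ?_) (fun l => ?_) l⟩
  · exact (commute_conv h.cur h'.cur (h.bd.or h'.bd) (fun k => h.comm l k) (fun k => hc l k) k).symm
  · exact (commute_conv h.cur h'.cur (h.bd.or h'.bd) (fun k => (hc k l).symm)
      (fun k => h'.comm l k) k).symm

lemma nexch_first {u : R⟦X⟧ˣ} (h : InvPair R .pos X X') (hY : IsCurrent R Y)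
    (hu : NExch (u : R⟦X⟧) X Y) : NExch (↑u⁻¹ : R⟦X⟧) X' Y :=
  hu.inv_first h.cur hY h.cur' h.bd h.bd' h.mul h.mul'

lemma nexch_second {u : R⟦X⟧ˣ} (h : InvPair R .neg X X') (hY : IsCurrent R Y)
    (hu : NExch (u : R⟦X⟧) Y X) : NExch (↑u⁻¹ : R⟦X⟧) Y X' :=
  hu.inv_second hY h.cur h.cur' h.bd h.bd' h.mul h.mul'

end InvPair

variable [Algebra B R]

variable (R) in
/-- The modes of `X(z) X(q² z)`. -/
def dblc (X : ℤ → E) : ℤ → E := conv X (shift (qu R 2) X)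

namespace InvPair

variable {s : Sgn} {X X' Y : ℤ → E}

lemma dblc (h : InvPair R s X X') : InvPair R s (dblc R X) (dblc R X') :=
  h.conv (h.shift _) fun k => commute_shift _ (h.comm k)

lemma nexch_dblc_first {u : R⟦X⟧ˣ} (h : InvPair R .pos X X') (hY : IsCurrent R Y)
    (hu : NExch (u : R⟦X⟧) X Y) :
    NExch (↑(u * rs (qu R 2) u) : R⟦X⟧) (QCurrent.dblc R X) Y :=
  hu.conv_first h.cur hY (h.shift _).cur (h.bd.or (h.bd.shift _)) (hu.shift_first _ h.cur hY)

lemma nexch_dblc_second {u : R⟦X⟧ˣ} (h : InvPair R .neg X X') (hY : IsCurrent R Y)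
    (hu : NExch (u : R⟦X⟧) Y X) :
    NExch (↑(u * rs (qu R (-2)) u) : R⟦X⟧) Y (QCurrent.dblc R X) := by
  have := (hu.shift_second (qu R 2) hY h.cur).conv_second hY (h.shift _).cur h.cur
    (h.bd.or (h.bd.shift _)) hu
  rw [mul_comm, qu_neg]
  exact this

end InvPair

/-! ### The extended Drinfeld relations in terms of currents -/

/-- The opposite sign. -/
def Sgn.flip : Sgn → Sgn
  | .pos => .neg
  | .neg => .pos

variable (R) in
/-- The current `φ(z)^{±1}`, where `φ(z) = α(z)⁻¹ α(q² z)⁻¹`. -/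
def Phi (τ : Sgn) (A A' : Sgn → ℤ → E) (s : Sgn) : ℤ → E :=
  match τ with
  | .pos => dblc R (A' s)
  | .neg => dblc R (A s)

variable (R) in
/-- The constant `q - q⁻¹`. -/
def cq : R := algebraMap B R (qp 1 - qp (-1))

/-- The relations of the extended Drinfeld algebra for `σ = 1`, and of the algebra with the opposite
multiplication for `σ = -1`, in normally ordered form. -/
structure Core (σ : Sgn) (κ : Rˣ) (A A' e : Sgn → ℤ → E) : Prop where
  pair : ∀ s, InvPair R s (A s) (A' s)
  cur : ∀ s, IsCurrent R (e s)
  A_A : NExch (↑(rs κ⁻¹ (ev R uf) * (rs κ (ev R uf))⁻¹) : R⟦X⟧) (A .pos) (A .neg)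
  pos_pos : NExch (↑(ev R ud) : R⟦X⟧) (A .pos) (e .pos)
  pos_neg : NExch (↑(rs (κ ^ σ.int) (ev R ud))⁻¹ : R⟦X⟧) (A .pos) (e .neg)
  neg_neg : NExch (↑(ev R udq)⁻¹ : R⟦X⟧) (e .neg) (A .neg)
  neg_pos : NExch (↑(rs (κ ^ (-σ.int)) (ev R udq)) : R⟦X⟧) (e .pos) (A .neg)
  quad : ∀ s, Quad ((qu R (2 * (σ.int * s.int : ℤ)) : Rˣ) : R) (e s)
  comm : NRel (1 : R⟦X⟧) (e .pos) (e .neg) fun k l => (-(σ.int : R) * cq R) •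
    (deltaTerm (κ ^ (-σ.int)) (Phi R σ A A' .neg) k l -
      deltaTerm (κ ^ σ.int) (shift (κ ^ (-σ.int)) (Phi R σ A A' .pos)) k l)

namespace Core

variable {σ : Sgn} {κ : Rˣ} {A A' e : Sgn → ℤ → E}

lemma pairPhi (h : Core σ κ A A' e) (τ s : Sgn) :
    InvPair R s (Phi R τ A A' s) (Phi R τ.flip A A' s) := by
  cases τ
  · exact (h.pair s).symm.dblc
  · exact (h.pair s).dblc

lemma commute_A_Phi (h : Core σ κ A A' e) (τ s : Sgn) (k l : ℤ) :
    Commute (A s k) (Phi R τ A A' s l) := by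
  have hp := (h.pair s).dblc
  have h1 : ∀ k l, Commute (QCurrent.dblc R (A s) l) (A s k) := fun k l =>
    (commute_conv (h.pair s).cur ((h.pair s).shift _).cur ((h.pair s).bd.or ((h.pair s).bd.shift _))
      (fun l => (h.pair s).comm k l) (fun l => commute_shift _ (fun l => (h.pair s).comm k l) l)
      l).symm
  cases τ
  · exact (hp.commute_inv (h.pair s).cur (fun k l => h1 l k) l k).symm
  · exact (h1 k l).symm

lemma ev_ud_dbl : ev R ud * rs (qu R 2) (ev R ud) = ev R ug' := by
  rw [rs_ev, rs_ud, ← map_mul, ud_mul_udq]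

lemma ev_udq_dbl : ev R udq * rs (qu R (-2)) (ev R udq) = ev R ug' := by
  rw [rs_ev, ← rs_ud, rs_rs, ← qu_add, neg_add_cancel, qu_zero, rs_one, rs_ud, ← map_mul, mul_comm,
    ud_mul_udq]

lemma rs_comm (c c' : Rˣ) (u : R⟦X⟧ˣ) : rs c (rs c' u) = rs c' (rs c u) := by
  rw [rs_rs, rs_rs, mul_comm]

lemma ev_uf_dbl : ev R uf * rs (qu R 2) (ev R uf) = (ev R udq)⁻¹ := by
  rw [rs_ev, ← map_mul, rs_uf, map_inv]

lemma ev_uf_dbl' : ev R uf * rs (qu R (-2)) (ev R uf) = (ev R ud)⁻¹ := by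
  rw [rs_ev, ← map_mul, rs_uf_inv, map_inv]

/-- An exchange relation for `φ(z)` gives one for both signs of the exponent. -/
lemma exch_Phi_first (h : Core σ κ A A' e) {Y : ℤ → E} (hY : IsCurrent R Y)
    {u v : R⟦X⟧ˣ} (hu : NExch (u : R⟦X⟧) (A .pos) Y)
    (hv : u * rs (qu R 2) u = v) (τ : Sgn) :
    NExch (↑(v ^ (-τ.int)) : R⟦X⟧) (Phi R τ A A' .pos) Y := by
  have h1 := (h.pair .pos).nexch_dblc_first hY hu
  rw [hv] at h1
  cases τ
  · have := (h.pair .pos).dblc.nexch_first hY h1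
    show NExch _ (dblc R (A' .pos)) Y
    simpa [Sgn.int] using this
  · show NExch _ (dblc R (A .pos)) Y
    simpa [Sgn.int] using h1

lemma exch_Phi_second (h : Core σ κ A A' e) {Y : ℤ → E} (hY : IsCurrent R Y)
    {u v : R⟦X⟧ˣ} (hu : NExch (u : R⟦X⟧) Y (A .neg))
    (hv : u * rs (qu R (-2)) u = v) (τ : Sgn) :
    NExch (↑(v ^ (-τ.int)) : R⟦X⟧) Y (Phi R τ A A' .neg) := by
  have h1 := (h.pair .neg).nexch_dblc_second hY hu
  rw [hv] at h1
  cases τ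
  · have := (h.pair .neg).dblc.nexch_second hY h1
    show NExch _ Y (dblc R (A' .neg))
    simpa [Sgn.int] using this
  · show NExch _ Y (dblc R (A .neg))
    simpa [Sgn.int] using h1

lemma Phi_A (h : Core σ κ A A' e) (τ : Sgn) :
    NExch (↑((rs κ⁻¹ (ev R udq) * (rs κ (ev R udq))⁻¹) ^ τ.int) : R⟦X⟧)
      (Phi R τ A A' .pos) (A .neg) := by
  have := h.exch_Phi_first (h.pair .neg).cur h.A_A (v := (rs κ⁻¹ (ev R udq))⁻¹ * rs κ (ev R udq))
    (by rw [map_mul, map_inv, rs_comm _ κ, rs_comm _ κ⁻¹, mul_mul_mul_comm, ← map_mul, ← mul_inv,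
      ← map_mul, ev_uf_dbl, map_inv, map_inv, inv_inv]) τ
  rwa [zpow_neg, ← inv_zpow, mul_inv, inv_inv] at this

lemma A_Phi (h : Core σ κ A A' e) (τ : Sgn) :
    NExch (↑((rs κ⁻¹ (ev R ud) * (rs κ (ev R ud))⁻¹) ^ τ.int) : R⟦X⟧)
      (A .pos) (Phi R τ A A' .neg) := by
  have := h.exch_Phi_second (h.pair .pos).cur h.A_A (v := (rs κ⁻¹ (ev R ud))⁻¹ * rs κ (ev R ud))
    (by rw [map_mul, map_inv, rs_comm _ κ, rs_comm _ κ⁻¹, mul_mul_mul_comm, ← map_mul, ← mul_inv,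
      ← map_mul, ev_uf_dbl', map_inv, map_inv, inv_inv]) τ
  rwa [zpow_neg, ← inv_zpow, mul_inv, inv_inv] at this

lemma Phi_Phi (h : Core σ κ A A' e) (τ : Sgn) :
    NExch (↑((rs κ⁻¹ (ev R ug'))⁻¹ * rs κ (ev R ug')) : R⟦X⟧)
      (Phi R τ A A' .pos) (Phi R τ A A' .neg) := by
  have := h.exch_Phi_second (h.pairPhi τ .pos).cur (h.Phi_A τ)
    (v := (rs κ⁻¹ (ev R ug') * (rs κ (ev R ug'))⁻¹) ^ τ.int)
    (by rw [map_zpow, ← mul_zpow, map_mul, map_inv, rs_comm _ κ, rs_comm _ κ⁻¹, mul_mul_mul_comm,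
      ← map_mul, ← mul_inv, ← map_mul, ev_udq_dbl]) τ
  cases τ
  · simpa [Sgn.int, mul_comm] using this
  · simpa [Sgn.int, mul_comm] using this

lemma Phi_pos_pos (h : Core σ κ A A' e) (τ : Sgn) :
    NExch (↑(ev R ug' ^ (-τ.int)) : R⟦X⟧) (Phi R τ A A' .pos) (e .pos) :=
  h.exch_Phi_first (h.cur _) h.pos_pos ev_ud_dbl τ

lemma Phi_pos_neg (h : Core σ κ A A' e) (τ : Sgn) :
    NExch (↑(rs (κ ^ σ.int) (ev R ug') ^ τ.int) : R⟦X⟧) (Phi R τ A A' .pos) (e .neg) := by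
  have := h.exch_Phi_first (h.cur _) h.pos_neg (v := (rs (κ ^ σ.int) (ev R ug'))⁻¹)
    (by rw [map_inv, ← mul_inv, rs_comm, ← map_mul, ev_ud_dbl]) τ
  rwa [zpow_neg, ← inv_zpow, inv_inv] at this

lemma Phi_neg_neg (h : Core σ κ A A' e) (τ : Sgn) :
    NExch (↑(ev R ug' ^ τ.int) : R⟦X⟧) (e .neg) (Phi R τ A A' .neg) := by
  have := h.exch_Phi_second (h.cur _) h.neg_neg (v := (ev R ug')⁻¹)
    (by rw [map_inv, ← mul_inv, ev_udq_dbl]) τ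
  rwa [zpow_neg, ← inv_zpow, inv_inv] at this

lemma Phi_neg_pos (h : Core σ κ A A' e) (τ : Sgn) :
    NExch (↑(rs (κ ^ (-σ.int)) (ev R ug') ^ (-τ.int)) : R⟦X⟧) (e .pos)
      (Phi R τ A A' .neg) :=
  h.exch_Phi_second (h.cur _) h.neg_pos (by rw [rs_comm, ← map_mul, ev_udq_dbl]) τ

/-- The generators `ξ^±` multiplied by `φ^±` or its inverse. -/
def dress (σ : Sgn) (A A' e : Sgn → ℤ → E) : Sgn → ℤ → E
  | .pos => fun k => -conv (e .pos) (Phi R σ.flip A A' .pos) k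
  | .neg => fun k => -conv (Phi R σ.flip A A' .neg) (e .neg) k

lemma int_flip (σ : Sgn) : (σ.flip).int = -σ.int := by cases σ <;> rfl

lemma ev_X_sub_mul_g : (X - C (qu R 2 : R)) * ((ev R ug' : R⟦X⟧ˣ) : R⟦X⟧) =
    C (qu R 2 : R) * (X - C (qu R (-2) : R)) := ev_identity X_sub_mul_g

lemma ev_X_sub_mul_inv_g : (X - C (qu R (-2) : R)) *
    (((ev R ug')⁻¹ : R⟦X⟧ˣ) : R⟦X⟧) =
    C (qu R (-2) : R) * (X - C (qu R 2 : R)) := by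
  rw [← map_inv]
  exact ev_identity X_sub_mul_inv_g

lemma dress_core (h : Core σ κ A A' e) : Core σ.flip κ A A' (dress (R := R) σ A A' e) := by
  have hP := h.pairPhi σ.flip
  have cA : ∀ s, NExch (1 : R⟦X⟧) (A s) (Phi R σ.flip A A' s) := fun s =>
    nexch_one_iff.2 fun k l => (h.commute_A_Phi σ.flip s k l).symm.eq
  have cA' : ∀ s, NExch (1 : R⟦X⟧) (Phi R σ.flip A A' s) (A s) := fun s =>
    nexch_one_iff.2 fun k l => (h.commute_A_Phi σ.flip s l k).eq
  have cp : IsCurrent R (conv (e .pos) (Phi R σ.flip A A' .pos)) :=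
    isCurrent_conv (h.cur _) (hP .pos).cur
  have cn : IsCurrent R (conv (Phi R σ.flip A A' .neg) (e .neg)) :=
    isCurrent_conv (hP .neg).cur (h.cur _)
  refine ⟨h.pair, ?_, h.A_A, ?_, ?_, ?_, ?_, ?_, ?_⟩
  · rintro (_ | _)
    · exact cp.neg
    · exact cn.neg
  · have := ((cA .pos).conv_second (h.pair .pos).cur (hP .pos).cur (h.cur .pos)
      (Or.inl (hP .pos).bd) h.pos_pos).neg_second
    rwa [one_mul] at this
  · have := (h.pos_neg.conv_second (h.pair .pos).cur (h.cur .neg) (hP .neg).cur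
      (Or.inr (hP .neg).bd) (h.A_Phi σ.flip)).neg_second
    have e1 : (rs (κ ^ σ.flip.int) (ev R ud))⁻¹ = (rs (κ ^ σ.int) (ev R ud))⁻¹ *
        (rs κ⁻¹ (ev R ud) * (rs κ (ev R ud))⁻¹) ^ σ.flip.int := by
      cases σ <;> simp [Sgn.flip, Sgn.int]
    rw [e1]
    exact this
  · have := ((cA' .neg).conv_first (hP .neg).cur (h.pair .neg).cur (h.cur .neg)
      (Or.inr (hP .neg).bd) h.neg_neg).neg_first
    rwa [one_mul] at this
  · have := (h.neg_pos.conv_first (h.cur .pos) (h.pair .neg).cur (hP .pos).cur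
      (Or.inl (hP .pos).bd) (h.Phi_A σ.flip)).neg_first
    have e1 : rs (κ ^ (-σ.flip.int)) (ev R udq) = rs (κ ^ (-σ.int)) (ev R udq) *
        (rs κ⁻¹ (ev R udq) * (rs κ (ev R udq))⁻¹) ^ σ.flip.int := by
      cases σ <;> simp [Sgn.flip, Sgn.int]
    rw [e1]
    exact this
  · rintro (_ | _)
    · have hu := h.Phi_pos_pos σ.flip
      refine ((h.quad .pos).conv_right (h.cur .pos) (hP .pos).cur (hP .pos).bd
        (fun k l => ((hP .pos).comm k l).eq) hu
        (p' := ((qu R (2 * (σ.flip.int * Sgn.pos.int : ℤ)) : Rˣ) : R))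
        (a := ((qu R (2 * (σ.flip.int * Sgn.pos.int : ℤ)) : Rˣ) : R)) ?_).neg
      cases σ
      · simpa [Sgn.flip, Sgn.int] using ev_X_sub_mul_inv_g (R := R)
      · simpa [Sgn.flip, Sgn.int] using ev_X_sub_mul_g (R := R)
    · have hu := h.Phi_neg_neg σ.flip
      refine ((h.quad .neg).conv_left (h.cur .neg) (hP .neg).cur (hP .neg).bd
        (fun k l => ((hP .neg).comm k l).eq) hu
        (p' := ((qu R (2 * (σ.flip.int * Sgn.neg.int : ℤ)) : Rˣ) : R))
        (a := ((qu R (2 * (σ.flip.int * Sgn.neg.int : ℤ)) : Rˣ) : R)) ?_).neg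
      cases σ
      · simpa [Sgn.flip, Sgn.int] using ev_X_sub_mul_g (R := R)
      · simpa [Sgn.flip, Sgn.int] using ev_X_sub_mul_inv_g (R := R)
  · have hF := h.pairPhi σ
    have h1 := h.comm.conv_first_delta (h.cur .pos) (h.cur .neg) (hP .pos).cur (hF .neg).cur
      ((hF .pos).shift _).cur (hP .pos).bd (h.Phi_pos_neg σ.flip)
    have hX : NExch (↑(rs (κ ^ (-σ.int)) (ev R ug') ^ (-σ.flip.int) *
        ((rs κ⁻¹ (ev R ug'))⁻¹ * rs κ (ev R ug'))) : R⟦X⟧)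
        (conv (e .pos) (Phi R σ.flip A A' .pos)) (Phi R σ.flip A A' .neg) :=
      (h.Phi_neg_pos σ.flip).conv_first (h.cur .pos) (hP .neg).cur (hP .pos).cur
        (Or.inl (hP .pos).bd) (h.Phi_Phi σ.flip)
    have e1 : conv (shift (κ ^ (-σ.int)) (Phi R σ A A' .pos))
        (shift (κ ^ σ.int)⁻¹ (Phi R σ.flip A A' .pos)) = oneCurrent E := by
      rw [← zpow_neg]
      exact ((hF .pos).shift _).mul
    rw [e1] at h1
    have h2 := h1.conv_second_delta cp (h.cur .neg) (hP .neg).cur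
      (isCurrent_conv (hF .neg).cur ((hP .pos).shift _).cur) isCurrent_one (hP .neg).bd hX
    rw [conv_one, ← conv_assoc (hP .neg).cur (hF .neg).cur ((hP .pos).shift _).cur
      (Or.inr (Or.inl ⟨(hP .neg).bd, (hF .neg).bd⟩)), (hF .neg).mul', one_conv, one_mul,
      ← Units.val_mul] at h2
    have e2 : rs (κ ^ σ.int) (ev R ug') ^ σ.flip.int * (rs (κ ^ (-σ.int)) (ev R ug') ^ (-σ.flip.int) *
        ((rs κ⁻¹ (ev R ug'))⁻¹ * rs κ (ev R ug'))) = 1 := by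
      cases σ <;> simp [Sgn.flip, Sgn.int]
    rw [e2, Units.val_one] at h2
    intro k l
    have h3 := h2 k l
    change -conv (Phi R σ.flip A A' .neg) (e .neg) l * -conv (e .pos) (Phi R σ.flip A A' .pos) k =
      nop 1 (fun k => -conv (e .pos) (Phi R σ.flip A A' .pos) k)
        (fun k => -conv (Phi R σ.flip A A' .neg) (e .neg) k) k l + _
    rw [neg_mul_neg, h3, nop_neg_second, nop_neg_first, _root_.neg_neg, int_flip, _root_.neg_neg]
    beta_reduce
    rw [zpow_neg, inv_inv]
    push_cast
    rw [neg_mul, neg_mul, neg_mul, _root_.neg_neg, neg_smul, ← smul_neg, neg_sub]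

end Core

end

section

section Plain

variable {E : Type*} [Ring E]

lemma op_finsum {ι : Type*} (F : ι → E) : op (∑ᶠ i, F i) = ∑ᶠ i, op (F i) :=
  (opAddEquiv : E ≃+ Eᵐᵒᵖ).toAddMonoidHom.map_finsum_of_injective opAddEquiv.injective F

variable {R : Type*} [CommRing R] [Algebra B R] [Algebra B E] [Algebra R E] [IsScalarTower B R E]

lemma sc_eq (u : B⟦X⟧ˣ) (n : ℕ) :
    (sc (u : B⟦X⟧) n : E) =
      algebraMap R E (coeff n ((ev R u : R⟦X⟧ˣ) : R⟦X⟧)) := by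
  rw [sc, val_ev, coeff_map, ← IsScalarTower.algebraMap_apply]

end Plain

section Conversion

variable {X Y : ℤ → E} {u : R⟦X⟧ˣ}

lemma tsum_eq_finsum_nat (F : ℕ → E) (N : ℕ) (h : ∀ n, N < n → F n = 0) :
    ∑' n, F n = ∑ᶠ n, F n :=
  tsum_eq_finsum ((Set.finite_Iic N).subset fun n hn => by
    by_contra h'
    exact hn (h n (not_le.1 h')))

lemma exchFwd_iff (hX : IsCurrent R X) (hY : IsCurrent R Y) (hp : Plus X) {ρ : ℕ → E}
    (hρ : ∀ n, ρ n = algebraMap R E (coeff n (u : R⟦X⟧))) :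
    ExchFwd ρ X Y ↔ NExch (↑u⁻¹ : R⟦X⟧) X Y := by
  rw [nexch_iff hX hY (Or.inl hp), inv_inv]
  refine forall₂_congr fun k l => ?_
  rw [act, tsum_eq_finsum_nat _ k.toNat fun n hn => by rw [hp _ (by omega), mul_zero, smul_zero]]
  simp only [hρ, mul_assoc, Algebra.smul_def]

lemma exchFwd_op_iff (hp : Plus X) {ρ : ℕ → Eᵐᵒᵖ}
    (hρ : ∀ n, ρ n = algebraMap R Eᵐᵒᵖ (coeff n (u : R⟦X⟧))) :
    ExchFwd ρ (fun k => op (X k)) (fun k => op (Y k)) ↔ NExch (u : R⟦X⟧) X Y := by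
  refine forall₂_congr fun k l => ?_
  rw [nop, tsum_eq_finsum_nat _ k.toNat fun n hn => by rw [hp _ (by omega), zero_mul, smul_zero],
    ← (op_injective (α := E)).eq_iff, op_finsum]
  simp only [hρ, smul_mul_assoc, ← Algebra.smul_def, op_mul, op_smul]

lemma exchBwd_iff (hp : Minus X) {ρ : ℕ → E}
    (hρ : ∀ n, ρ n = algebraMap R E (coeff n (u : R⟦X⟧))) :
    ExchBwd ρ X Y ↔ NExch (u : R⟦X⟧) Y X := by
  rw [ExchBwd, NExch, forall_comm]
  refine forall₂_congr fun l k => ?_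
  rw [nop, tsum_eq_finsum_nat _ (-k).toNat fun n hn => by rw [hp _ (by omega), mul_zero, smul_zero]]
  simp only [hρ, mul_assoc, Algebra.smul_def]

lemma exchBwd_op_iff (hX : IsCurrent R X) (hY : IsCurrent R Y) (hp : Minus X) {ρ : ℕ → Eᵐᵒᵖ}
    (hρ : ∀ n, ρ n = algebraMap R Eᵐᵒᵖ (coeff n (u : R⟦X⟧))) :
    ExchBwd ρ (fun k => op (X k)) (fun k => op (Y k)) ↔ NExch (↑u⁻¹ : R⟦X⟧) Y X := by
  rw [nexch_iff hY hX (Or.inr hp), inv_inv, ExchBwd, forall_comm]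
  refine forall₂_congr fun l k => ?_
  rw [act, tsum_eq_finsum_nat _ (-k).toNat fun n hn => by rw [hp _ (by omega), zero_mul, smul_zero],
    ← (op_injective (α := E)).eq_iff, op_finsum]
  simp only [hρ, smul_mul_assoc, ← Algebra.smul_def, op_mul, op_smul]

lemma tsum_eq_finsum_bd {s : Sgn} (hX : Bd s X) (hY : Bd s Y) (F : ℤ → E) (k : ℤ)
    (h : ∀ i, X i = 0 ∨ Y (k - i) = 0 → F i = 0) : ∑' i, F i = ∑ᶠ i, F i := by
  cases s
  · refine tsum_eq_finsum ((Set.finite_Icc 0 k).subset fun i hi => ?_)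
    by_contra h'
    refine hi (h i ?_)
    rcases lt_or_ge i 0 with h1 | h1
    · exact Or.inl (hX i h1)
    · exact Or.inr (hY _ (by simp only [Set.mem_Icc] at h'; omega))
  · refine tsum_eq_finsum ((Set.finite_Icc k 0).subset fun i hi => ?_)
    by_contra h'
    refine hi (h i ?_)
    rcases lt_or_ge 0 i with h1 | h1
    · exact Or.inl (hX i h1)
    · exact Or.inr (hY _ (by simp only [Set.mem_Icc] at h'; omega))

lemma conv_eq_finsum {s : Sgn} (hX : Bd s X) (hY : Bd s Y) (k : ℤ) :
    conv X Y k = ∑ᶠ i, X i * Y (k - i) := by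
  rw [← tsum_eq_finsum_bd hX hY _ k fun i hi => by
    rcases hi with h | h <;> rw [h] <;> simp, conv, ← (Equiv.subLeft k).tsum_eq]
  simp

lemma op_conv_eq_finsum {s : Sgn} (hX : Bd s X) (hY : Bd s Y) (k : ℤ) :
    op (conv X Y k) = ∑ᶠ i, op (Y i) * op (X (k - i)) := by
  rw [conv, tsum_eq_finsum_bd hY hX _ k fun i hi => by
    rcases hi with h | h <;> rw [h] <;> simp, op_finsum]
  simp only [op_mul]

variable [Algebra B R] [Algebra B E] [IsScalarTower B R E]

lemma qp_smul' (t : ℂ) (x : E) : qp t • x = (qu R t : R) • x := by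
  rw [val_qu, algebraMap_smul]

variable (R) in
lemma dbl_eq_dblc {s : Sgn} (hX : Bd s X) (k : ℤ) : dbl X k = dblc R X k := by
  rw [dblc, conv_eq_finsum hX (hX.shift _), dbl]
  refine finsum_congr fun i => ?_
  rw [qp_smul (R := R), shift, mul_smul_comm]

variable (R) in
lemma dbl_op_eq_dblc {s : Sgn} (hX : Bd s X) (hc : ∀ k l, Commute (X k) (X l)) (k : ℤ) :
    dbl (fun k => op (X k)) k = op (dblc R X k) := by
  rw [← dbl_eq_dblc R hX, dbl, dbl, op_finsum]
  refine finsum_congr fun i => ?_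
  rw [op_smul, ← op_mul, (hc _ _).eq]

end Conversion

variable [Algebra B R] [Algebra B E] [IsScalarTower B R E]

/-- The generators of the Drinfeld algebra are homogeneous elements of a current ring. -/
structure UGraded (κ : Rˣ) (a : UGen → E) : Prop where
  mem : ∀ x, a x ∈ pc R x.deg
  qc : a .qc = algebraMap R E κ
  qc' : a .qc' = algebraMap R E (↑κ⁻¹ : R)

/-- The normalization of the zero modes. -/
def ZeroModes (ζ : Bool) (A : Sgn → ℤ → E) : Prop :=
  ζ = true → A .pos 0 ^ 2 * A .neg 0 ^ 2 = 1 ∧ A .neg 0 ^ 2 * A .pos 0 ^ 2 = 1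

lemma conv_zero_bd {s : Sgn} {X Y : ℤ → E} (hX : Bd s X) (hY : Bd s Y) :
    conv X Y 0 = X 0 * Y 0 := by
  rw [conv, tsum_eq_single 0, sub_zero]
  intro n hn
  cases s
  · rcases lt_or_gt_of_ne hn with h | h
    · rw [hY n h, mul_zero]
    · rw [hX _ (by omega), zero_mul]
  · rcases lt_or_gt_of_ne hn with h | h
    · rw [hX _ (by omega), zero_mul]
    · rw [hY n h, mul_zero]

lemma dblc_zero {s : Sgn} {X : ℤ → E} (hX : Bd s X) : dblc R X 0 = X 0 ^ 2 := by
  rw [dblc, conv_zero_bd hX (hX.shift _), shift, zpow_zero, Units.val_one, one_smul, sq]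

lemma ZeroModes.inv {ζ : Bool} {A A' : Sgn → ℤ → E} (hp : ∀ s, InvPair R s (A s) (A' s))
    (h : ZeroModes ζ A) : ZeroModes ζ A' := by
  intro hζ
  obtain ⟨h1, h2⟩ := h hζ
  have h3 : ∀ s, A s 0 * A' s 0 = 1 := fun s => by
    rw [← conv_zero_bd (hp s).bd (hp s).bd', (hp s).mul, oneCurrent, if_pos rfl]
  have h4 : ∀ s, A' s 0 * A s 0 = 1 := fun s => by
    rw [← conv_zero_bd (hp s).bd' (hp s).bd, (hp s).mul', oneCurrent, if_pos rfl]
  have h5 : ∀ s, A s 0 ^ 2 * A' s 0 ^ 2 = 1 := fun s => by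
    rw [sq, sq, mul_assoc, ← mul_assoc (A s 0) (A' s 0), h3, one_mul, h3]
  have h6 : ∀ s, A' s 0 ^ 2 * A s 0 ^ 2 = 1 := fun s => by
    rw [sq, sq, mul_assoc, ← mul_assoc (A' s 0) (A s 0), h4, one_mul, h4]
  have h7 : A .pos 0 ^ 2 = A' .neg 0 ^ 2 := (left_inv_eq_right_inv (h6 .neg) h2).symm
  have h8 : A .neg 0 ^ 2 = A' .pos 0 ^ 2 := left_inv_eq_right_inv h2 (h5 .pos)
  rw [← h7, ← h8]
  exact ⟨h2, h1⟩

namespace UGraded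

variable {κ : Rˣ} {a : UGen → E} {ζ : Bool}

lemma cur_al (h : UGraded κ a) (s : Sgn) : IsCurrent R fun k => a (.al s k) := fun k => h.mem (.al s k)
lemma cur_be (h : UGraded κ a) (s : Sgn) : IsCurrent R fun k => a (.be s k) := fun k => h.mem (.be s k)
lemma cur_xi (h : UGraded κ a) (s : Sgn) : IsCurrent R fun k => a (.xi s k) := fun k => h.mem (.xi s k)

lemma twist_eq (h : UGraded κ a) (u v : B⟦X⟧ˣ) (n : ℕ) :
    twist (a .qc) (a .qc') (u : B⟦X⟧) v n = algebraMap R E (coeff n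
      ((rs κ⁻¹ (ev R u) * rs κ (ev R v) : R⟦X⟧ˣ) : R⟦X⟧)) := by
  rw [h.qc, h.qc', twist_units, tw_units]

lemma twist_op_eq (h : UGraded κ a) (u v : B⟦X⟧ˣ) (n : ℕ) :
    twist (op (a .qc)) (op (a .qc')) (u : B⟦X⟧) v n = algebraMap R Eᵐᵒᵖ (coeff n
      ((rs κ⁻¹ (ev R u) * rs κ (ev R v) : R⟦X⟧ˣ) : R⟦X⟧)) := by
  rw [h.qc, h.qc', ← tw_units, ← twist_units]
  rfl

lemma pair_of_urel (h : UGraded κ a) (hu : URel ζ a) (s : Sgn) :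
    InvPair R s (fun k => a (.al s k)) fun k => a (.be s k) := by
  have b1 : Bd s fun k => a (.al s k) := by
    cases s
    · exact hu.al_pos
    · exact hu.al_neg
  have b2 : Bd s fun k => a (.be s k) := by
    cases s
    · exact hu.be_pos
    · exact hu.be_neg
  exact ⟨h.cur_al s, h.cur_be s, b1, b2, funext fun k => (conv_eq_finsum b1 b2 k).trans (hu.al_be s k),
    funext fun k => (conv_eq_finsum b2 b1 k).trans (hu.be_al s k), hu.al_comm s⟩

lemma pair_of_urel_op (h : UGraded κ a) (hu : URel ζ fun x => op (a x)) (s : Sgn) :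
    InvPair R s (fun k => a (.al s k)) fun k => a (.be s k) := by
  have b1 : Bd s fun k => a (.al s k) := by
    cases s
    · exact fun k hk => op_injective (hu.al_pos k hk)
    · exact fun k hk => op_injective (hu.al_neg k hk)
  have b2 : Bd s fun k => a (.be s k) := by
    cases s
    · exact fun k hk => op_injective (hu.be_pos k hk)
    · exact fun k hk => op_injective (hu.be_neg k hk)
  refine ⟨h.cur_al s, h.cur_be s, b1, b2, funext fun k => op_injective ?_,
    funext fun k => op_injective ?_, fun k l => ?_⟩
  · rw [op_conv_eq_finsum b1 b2 k, hu.be_al s k, oneCurrent]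
    split_ifs <;> rfl
  · rw [op_conv_eq_finsum b2 b1 k, hu.al_be s k, oneCurrent]
    split_ifs <;> rfl
  · exact op_injective (hu.al_comm s l k)

lemma cq_smul (x : E) : (qp 1 - qp (-1)) • x = cq R • x := (algebraMap_smul R _ _).symm

lemma kpow_eq (h : UGraded κ a) (n : ℤ) :
    kpow (a .qc) (a .qc') n = algebraMap R E (↑(κ ^ n) : R) := by
  rw [h.qc, h.qc', kpow_units]

lemma kpow_op_eq (h : UGraded κ a) (n : ℤ) :
    kpow (op (a .qc)) (op (a .qc')) n = algebraMap R Eᵐᵒᵖ (↑(κ ^ n) : R) := by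
  rw [h.qc, h.qc', ← kpow_units]
  rfl

lemma deltaTerm_shift (κ : Rˣ) (D : ℤ → E) (k l : ℤ) :
    deltaTerm κ (shift κ⁻¹ D) k l = (↑(κ ^ (-l)) : R) • D (k + l) := by
  rw [deltaTerm, shift, smul_smul, inv_zpow', zpow_mul_zpow_of_add κ]
  ring

lemma core_of_urel (h : UGraded κ a) (hu : URel ζ a) :
    Core .pos κ (fun s k => a (.al s k)) (fun s k => a (.be s k)) (fun s k => a (.xi s k)) := by
  have hp := h.pair_of_urel hu
  refine ⟨hp, h.cur_xi, ?_, ?_, ?_, ?_, ?_, ?_, ?_⟩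
  · have := (exchFwd_iff (h.cur_al .pos) (h.cur_al .neg) (hp .pos).bd
      (by rw [inverse_f]; exact h.twist_eq uf⁻¹ uf)).1 hu.al_al
    simpa [mul_comm] using this
  · have := (exchFwd_iff (h.cur_al .pos) (h.cur_xi .pos) (hp .pos).bd
      (by rw [inverse_d]; exact sc_eq (R := R) ud⁻¹)).1 hu.al_xi_pos_pos
    simpa using this
  · have := (exchFwd_iff (h.cur_al .pos) (h.cur_xi .neg) (hp .pos).bd
      (h.twist_eq 1 ud)).1 hu.al_xi_pos_neg
    simpa [Sgn.int] using this
  · have := (exchBwd_iff (Y := fun k => a (.xi .neg k)) (hp .neg).bd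
      (by rw [inverse_dq]; exact sc_eq (R := R) udq⁻¹)).1 hu.al_xi_neg_neg
    simpa using this
  · have := (exchBwd_iff (Y := fun k => a (.xi .pos k)) (hp .neg).bd
      (h.twist_eq udq 1)).1 hu.al_xi_neg_pos
    simpa [Sgn.int] using this
  · intro s k l
    have := hu.xi_xi s k l
    rw [qp_smul' (R := R), qp_smul' (R := R)] at this
    simpa [Sgn.int] using this
  · intro k l
    have := hu.xi_pos_xi_neg k l
    rw [cq_smul (R := R), h.kpow_eq, h.kpow_eq, ← Algebra.smul_def, ← Algebra.smul_def, phi, phi,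
      dbl_eq_dblc R (hp .pos).bd', dbl_eq_dblc R (hp .neg).bd'] at this
    beta_reduce
    rw [nop_one]
    have e1 : κ ^ (-Sgn.pos.int) = κ⁻¹ := by simp [Sgn.int]
    have e2 : κ ^ Sgn.pos.int = κ := by simp [Sgn.int]
    have e3 : (Sgn.pos.int : R) = 1 := by simp [Sgn.int]
    rw [e1, e2, e3, deltaTerm_shift, deltaTerm, inv_zpow', neg_one_mul, neg_smul]
    change _ = _ + -(cq R • ((↑(κ ^ (-k)) : R) • dblc R (fun k => a (.be .neg k)) (k + l) -
      (↑(κ ^ (-l)) : R) • dblc R (fun k => a (.be .pos k)) (k + l)))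
    rw [← this]
    abel

lemma core_of_urel_op (h : UGraded κ a) (hu : URel ζ fun x => op (a x)) :
    Core .neg κ⁻¹ (fun s k => a (.be s k)) (fun s k => a (.al s k)) (fun s k => a (.xi s k)) := by
  have hp := h.pair_of_urel_op hu
  refine ⟨fun s => (hp s).symm, h.cur_xi, ?_, ?_, ?_, ?_, ?_, ?_, ?_⟩
  · have := (exchFwd_op_iff (X := fun k => a (.al .pos k)) (Y := fun k => a (.al .neg k)) (hp .pos).bd
      (by rw [inverse_f]; exact h.twist_op_eq uf⁻¹ uf)).1 hu.al_al
    have := (hp .neg).nexch_second (h.cur_be _) ((hp .pos).nexch_first (h.cur_al _) this)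
    simpa [mul_comm] using this
  · have := (exchFwd_op_iff (X := fun k => a (.al .pos k)) (Y := fun k => a (.xi .pos k)) (hp .pos).bd
      (by rw [inverse_d]; exact sc_eq (R := R) ud⁻¹)).1 hu.al_xi_pos_pos
    have := (hp .pos).nexch_first (h.cur_xi _) this
    simpa using this
  · have := (exchFwd_op_iff (X := fun k => a (.al .pos k)) (Y := fun k => a (.xi .neg k)) (hp .pos).bd
      (h.twist_op_eq 1 ud)).1 hu.al_xi_pos_neg
    have := (hp .pos).nexch_first (h.cur_xi _) this
    simpa [Sgn.int] using this
  · have := (exchBwd_op_iff (h.cur_al _) (h.cur_xi .neg) (hp .neg).bd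
      (by rw [inverse_dq]; exact sc_eq (R := R) udq⁻¹)).1 hu.al_xi_neg_neg
    have := (hp .neg).nexch_second (h.cur_xi _) this
    simpa using this
  · have := (exchBwd_op_iff (h.cur_al _) (h.cur_xi .pos) (hp .neg).bd
      (h.twist_op_eq udq 1)).1 hu.al_xi_neg_pos
    have := (hp .neg).nexch_second (h.cur_xi _) this
    simpa [Sgn.int] using this
  · intro s k l
    have := hu.xi_xi s k l
    rw [← op_mul, ← op_mul, ← op_mul, ← op_mul, ← op_smul, ← op_smul, ← op_sub, ← op_sub,
      op_injective.eq_iff, qp_smul' (R := R), qp_smul' (R := R)] at this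
    have e : qu R (2 * (((Sgn.neg.int * s.int : ℤ)) : ℂ)) = (qu R (2 * ((s.int : ℤ) : ℂ)))⁻¹ := by
      rw [← qu_neg]; congr 1; simp [Sgn.int]
    rw [e]
    generalize qu R (2 * ((s.int : ℤ) : ℂ)) = p at *
    have h2 := congrArg (fun x => (↑p⁻¹ : R) • x) this
    simp only [smul_sub, smul_smul, Units.inv_mul, one_smul] at h2
    exact h2.symm
  · intro k l
    have := hu.xi_pos_xi_neg k l
    rw [phi, phi, dbl_op_eq_dblc R (hp .pos).bd' (hp .pos).symm.comm,
      dbl_op_eq_dblc R (hp .neg).bd' (hp .neg).symm.comm, h.kpow_op_eq, h.kpow_op_eq,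
      ← Algebra.smul_def, ← Algebra.smul_def, ← op_mul, ← op_mul, ← op_smul, ← op_smul, ← op_sub,
      ← op_sub, ← op_smul, op_injective.eq_iff, cq_smul (R := R)] at this
    beta_reduce
    rw [nop_one]
    have e1 : κ⁻¹ ^ (-Sgn.neg.int) = κ⁻¹ := by simp [Sgn.int]
    have e2 : κ⁻¹ ^ Sgn.neg.int = κ := by simp [Sgn.int]
    have e3 : (Sgn.neg.int : R) = -1 := by simp [Sgn.int]
    rw [e1, e2, e3, deltaTerm_shift, deltaTerm, inv_zpow', neg_neg, one_mul]
    change _ = _ + (cq R • ((↑(κ ^ (-k)) : R) • dblc R (fun k => a (.be .neg k)) (k + l) -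
      (↑(κ ^ (-l)) : R) • dblc R (fun k => a (.be .pos k)) (k + l)))
    rw [← this]
    abel

lemma phi_eq (h : UGraded κ a) (hp : ∀ s, InvPair R s (fun k => a (.al s k)) fun k => a (.be s k))
    (s : Sgn) : phi a s = dblc R fun k => a (.be s k) :=
  funext fun k => dbl_eq_dblc R (hp s).bd' k

lemma phi_op_eq (h : UGraded κ a)
    (hp : ∀ s, InvPair R s (fun k => a (.al s k)) fun k => a (.be s k))
    (s : Sgn) : phi (fun x => op (a x)) s = fun k => op (dblc R (fun k => a (.be s k)) k) :=
  funext fun k => dbl_op_eq_dblc R (hp s).bd' (hp s).symm.comm k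

lemma zeroModes_iff (h : UGraded κ a)
    (hp : ∀ s, InvPair R s (fun k => a (.al s k)) fun k => a (.be s k)) :
    ZeroModes ζ (fun s k => a (.al s k)) ↔
      (ζ = true → phi a .pos 0 * phi a .neg 0 = 1 ∧ phi a .neg 0 * phi a .pos 0 = 1) := by
  rw [h.phi_eq hp, h.phi_eq hp, dblc_zero (hp .pos).bd', dblc_zero (hp .neg).bd']
  exact ⟨fun h => ZeroModes.inv hp h, fun h =>
    ZeroModes.inv (A := fun s k => a (.be s k)) (fun s => (hp s).symm) h⟩

lemma zeroModes_op_iff (h : UGraded κ a)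
    (hp : ∀ s, InvPair R s (fun k => a (.al s k)) fun k => a (.be s k)) :
    ZeroModes ζ (fun s k => a (.al s k)) ↔
      (ζ = true → phi (fun x => op (a x)) .pos 0 * phi (fun x => op (a x)) .neg 0 = 1 ∧
        phi (fun x => op (a x)) .neg 0 * phi (fun x => op (a x)) .pos 0 = 1) := by
  rw [h.zeroModes_iff hp, h.phi_op_eq hp, h.phi_op_eq hp, h.phi_eq hp, h.phi_eq hp]
  refine imp_congr_right fun _ => ?_
  rw [and_comm, ← op_mul, ← op_mul, ← op_one, op_inj, op_inj]

lemma urel_of_core (h : UGraded κ a)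
    (hc : Core .pos κ (fun s k => a (.al s k)) (fun s k => a (.be s k)) (fun s k => a (.xi s k)))
    (hz : ZeroModes ζ fun s k => a (.al s k)) : URel ζ a := by
  have hp := hc.pair
  have hP : ∀ s, Phi R .pos (fun s k => a (.al s k)) (fun s k => a (.be s k)) s = phi a s := fun s =>
    (h.phi_eq hp s).symm
  have hF : ∀ s, InvPair R s (phi a s) _ := fun s => hP s ▸ hc.pairPhi .pos s
  refine ⟨?_, fun x => ?_, fun x => ?_, (hp .pos).bd, (hp .neg).bd, (hp .pos).bd', (hp .neg).bd',
    fun s k => ?_, fun s k => ?_, (h.zeroModes_iff hp).1 hz, fun s => (hF s).comm,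
    ?_, ?_, ?_, ?_, ?_, ?_, ?_, fun s => (hp s).comm, ?_, ?_, ?_, ?_, ?_⟩
  · rw [h.qc, h.qc', ← map_mul, Units.mul_inv, map_one]
  · rw [h.qc]; exact Algebra.commutes _ _
  · rw [h.qc']; exact Algebra.commutes _ _
  · rw [← conv_eq_finsum (hp s).bd (hp s).bd', (hp s).mul, oneCurrent]
  · rw [← conv_eq_finsum (hp s).bd' (hp s).bd, (hp s).mul', oneCurrent]
  · refine (exchFwd_iff (hF .pos).cur (hF .neg).cur (hF .pos).bd
      (by rw [inverse_g]; exact h.twist_eq ug' ug'⁻¹)).2 ?_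
    have := hc.Phi_Phi .pos
    rw [hP, hP] at this
    simpa [mul_comm] using this
  · refine (exchFwd_iff (hF .pos).cur (h.cur_xi .pos) (hF .pos).bd (sc_eq (R := R) ug')).2 ?_
    have := hc.Phi_pos_pos .pos
    rw [hP] at this
    simpa [Sgn.int] using this
  · refine (exchBwd_iff (hF .neg).bd (sc_eq (R := R) ug')).2 ?_
    have := hc.Phi_neg_neg .pos
    rw [hP] at this
    simpa [Sgn.int] using this
  · refine (exchFwd_iff (hF .pos).cur (h.cur_xi .neg) (hF .pos).bd
      (by rw [inverse_g]; exact h.twist_eq 1 ug'⁻¹)).2 ?_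
    have := hc.Phi_pos_neg .pos
    rw [hP] at this
    simpa [Sgn.int] using this
  · refine (exchBwd_iff (hF .neg).bd (by rw [inverse_g]; exact h.twist_eq ug'⁻¹ 1)).2 ?_
    have := hc.Phi_neg_pos .pos
    rw [hP] at this
    simpa [Sgn.int] using this
  · intro s k l
    rw [qp_smul' (R := R), qp_smul' (R := R)]
    simpa [Sgn.int] using hc.quad s k l
  · intro k l
    have := hc.comm k l
    beta_reduce at this
    rw [nop_one] at this
    have e1 : κ ^ (-Sgn.pos.int) = κ⁻¹ := by simp [Sgn.int]
    have e2 : κ ^ Sgn.pos.int = κ := by simp [Sgn.int]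
    have e3 : (Sgn.pos.int : R) = 1 := by simp [Sgn.int]
    rw [e1, e2, e3, deltaTerm_shift, deltaTerm, inv_zpow', neg_one_mul, neg_smul, hP, hP] at this
    rw [cq_smul (R := R), h.kpow_eq, h.kpow_eq, ← Algebra.smul_def, ← Algebra.smul_def, this]
    abel
  · refine (exchFwd_iff (h.cur_al .pos) (h.cur_xi .pos) (hp .pos).bd
      (by rw [inverse_d]; exact sc_eq (R := R) ud⁻¹)).2 ?_
    simpa using hc.pos_pos
  · refine (exchBwd_iff (hp .neg).bd
      (by rw [inverse_dq]; exact sc_eq (R := R) udq⁻¹)).2 ?_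
    simpa using hc.neg_neg
  · refine (exchFwd_iff (h.cur_al .pos) (h.cur_xi .neg) (hp .pos).bd (h.twist_eq 1 ud)).2 ?_
    simpa [Sgn.int] using hc.pos_neg
  · refine (exchBwd_iff (hp .neg).bd (h.twist_eq udq 1)).2 ?_
    simpa [Sgn.int] using hc.neg_pos
  · refine (exchFwd_iff (h.cur_al .pos) (h.cur_al .neg) (hp .pos).bd
      (by rw [inverse_f]; exact h.twist_eq uf⁻¹ uf)).2 ?_
    simpa [mul_comm] using hc.A_A

lemma urel_op_of_core (h : UGraded κ a)
    (hc : Core .neg κ⁻¹ (fun s k => a (.be s k)) (fun s k => a (.al s k)) (fun s k => a (.xi s k)))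
    (hz : ZeroModes ζ fun s k => a (.al s k)) : URel ζ fun x => op (a x) := by
  have hp : ∀ s, InvPair R s (fun k => a (.al s k)) fun k => a (.be s k) := fun s => (hc.pair s).symm
  have hP : ∀ s, Phi R .neg (fun s k => a (.be s k)) (fun s k => a (.al s k)) s =
    dblc R fun k => a (.be s k) := fun s => rfl
  have hF : ∀ s, InvPair R s (dblc R fun k => a (.be s k)) _ := fun s => hc.pairPhi .neg s
  refine ⟨?_, fun x => ?_, fun x => ?_, ?_, ?_, ?_, ?_,
    fun s k => ?_, fun s k => ?_, (h.zeroModes_op_iff hp).1 hz, fun s k l => ?_,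
    ?_, ?_, ?_, ?_, ?_, ?_, ?_, fun s k l => ?_, ?_, ?_, ?_, ?_, ?_⟩
  · rw [h.qc, h.qc', ← op_mul, ← map_mul, Units.inv_mul, map_one, op_one]
  · rw [h.qc]
    exact Commute.op (Algebra.commutes _ _)
  · rw [h.qc']
    exact Commute.op (Algebra.commutes _ _)
  · exact fun k hk => congrArg op ((hp .pos).bd k hk)
  · exact fun k hk => congrArg op ((hp .neg).bd k hk)
  · exact fun k hk => congrArg op ((hp .pos).bd' k hk)
  · exact fun k hk => congrArg op ((hp .neg).bd' k hk)
  · rw [← op_conv_eq_finsum (hp s).bd' (hp s).bd, (hp s).mul', oneCurrent]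
    split_ifs <;> rfl
  · rw [← op_conv_eq_finsum (hp s).bd (hp s).bd', (hp s).mul, oneCurrent]
    split_ifs <;> rfl
  · rw [h.phi_op_eq hp]
    exact Commute.op ((hF s).comm k l)
  · rw [h.phi_op_eq hp, h.phi_op_eq hp]
    refine (exchFwd_op_iff (hF .pos).bd
      (by rw [inverse_g]; exact h.twist_op_eq ug' ug'⁻¹)).2 ?_
    have := hc.Phi_Phi .neg
    rw [hP, hP] at this
    simpa [mul_comm] using this
  · rw [h.phi_op_eq hp]
    refine (exchFwd_op_iff (hF .pos).bd (sc_eq (R := R) ug')).2 ?_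
    have := hc.Phi_pos_pos .neg
    rw [hP] at this
    simpa [Sgn.int] using this
  · rw [h.phi_op_eq hp]
    refine (exchBwd_op_iff (hF .neg).cur (h.cur_xi .neg) (hF .neg).bd (sc_eq (R := R) ug')).2 ?_
    have := hc.Phi_neg_neg .neg
    rw [hP] at this
    simpa [Sgn.int] using this
  · rw [h.phi_op_eq hp]
    refine (exchFwd_op_iff (hF .pos).bd
      (by rw [inverse_g]; exact h.twist_op_eq 1 ug'⁻¹)).2 ?_
    have := hc.Phi_pos_neg .neg
    rw [hP] at this
    simpa [Sgn.int] using this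
  · rw [h.phi_op_eq hp]
    refine (exchBwd_op_iff (hF .neg).cur (h.cur_xi .pos) (hF .neg).bd
      (by rw [inverse_g]; exact h.twist_op_eq ug'⁻¹ 1)).2 ?_
    have := hc.Phi_neg_pos .neg
    rw [hP] at this
    simpa [Sgn.int] using this
  · intro s k l
    have this := hc.quad s k l
    have e : qu R (2 * (((Sgn.neg.int * s.int : ℤ)) : ℂ)) = (qu R (2 * ((s.int : ℤ) : ℂ)))⁻¹ := by
      rw [← qu_neg]; congr 1; simp [Sgn.int]
    rw [e] at this
    rw [← op_mul, ← op_mul, ← op_mul, ← op_mul, ← op_smul, ← op_smul, ← op_sub, ← op_sub,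
      op_injective.eq_iff, qp_smul' (R := R), qp_smul' (R := R)]
    generalize qu R (2 * ((s.int : ℤ) : ℂ)) = p at *
    have h2 := congrArg (fun x => ((p : Rˣ) : R) • x) this
    simp only [smul_sub, smul_smul, Units.mul_inv, one_smul] at h2
    exact h2.symm
  · intro k l
    have := hc.comm k l
    beta_reduce at this
    rw [nop_one] at this
    have e1 : κ⁻¹ ^ (-Sgn.neg.int) = κ⁻¹ := by simp [Sgn.int]
    have e2 : κ⁻¹ ^ Sgn.neg.int = κ := by simp [Sgn.int]
    have e3 : (Sgn.neg.int : R) = -1 := by simp [Sgn.int]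
    rw [e1, e2, e3, deltaTerm_shift, deltaTerm, inv_zpow', neg_neg, one_mul, hP, hP] at this
    rw [h.phi_op_eq hp, h.phi_op_eq hp, h.kpow_op_eq, h.kpow_op_eq,
      ← Algebra.smul_def, ← Algebra.smul_def, ← op_mul, ← op_mul, ← op_smul, ← op_smul, ← op_sub,
      ← op_sub, ← op_smul, op_injective.eq_iff, cq_smul (R := R), this]
    abel
  · exact Commute.op ((hp s).comm k l)
  · refine (exchFwd_op_iff (X := fun k => a (.al .pos k)) (Y := fun k => a (.xi .pos k)) (hp .pos).bd
      (by rw [inverse_d]; exact sc_eq (R := R) ud⁻¹)).2 ?_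
    have := (hp .pos).symm.nexch_first (h.cur_xi _) hc.pos_pos
    simpa using this
  · refine (exchBwd_op_iff (h.cur_al _) (h.cur_xi .neg) (hp .neg).bd
      (by rw [inverse_dq]; exact sc_eq (R := R) udq⁻¹)).2 ?_
    have := (hp .neg).symm.nexch_second (h.cur_xi _) hc.neg_neg
    simpa using this
  · refine (exchFwd_op_iff (X := fun k => a (.al .pos k)) (Y := fun k => a (.xi .neg k)) (hp .pos).bd
      (h.twist_op_eq 1 ud)).2 ?_
    have := (hp .pos).symm.nexch_first (h.cur_xi _) hc.pos_neg
    simpa [Sgn.int] using this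
  · refine (exchBwd_op_iff (h.cur_al _) (h.cur_xi .pos) (hp .neg).bd (h.twist_op_eq udq 1)).2 ?_
    have := (hp .neg).symm.nexch_second (h.cur_xi _) hc.neg_pos
    simpa [Sgn.int] using this
  · refine (exchFwd_op_iff (X := fun k => a (.al .pos k)) (Y := fun k => a (.al .neg k)) (hp .pos).bd
      (by rw [inverse_f]; exact h.twist_op_eq uf⁻¹ uf)).2 ?_
    have := (hp .neg).symm.nexch_second (h.cur_al _) ((hp .pos).symm.nexch_first (h.cur_be _) hc.A_A)
    simpa [mul_comm] using this

variable (R) in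
/-- The generators of the algebra with opposite multiplication: `ξ^±(z)` is replaced by
`-ξ^+(z) φ^+(z)⁻¹` and `-φ^-(z)⁻¹ ξ^-(z)`, and the other generators by their inverses. -/
def antip (a : UGen → E) : UGen → E
  | .xi .pos k => -conv (fun k => a (.xi .pos k)) (dblc R fun k => a (.al .pos k)) k
  | .xi .neg k => -conv (dblc R fun k => a (.al .neg k)) (fun k => a (.xi .neg k)) k
  | .al s k => a (.be s k)
  | .be s k => a (.al s k)
  | .qc => a .qc'
  | .qc' => a .qc

lemma isCurrent_dblc {X : ℤ → E} (h : IsCurrent R X) : IsCurrent R (dblc R X) :=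
  isCurrent_conv h (isCurrent_shift _ h)

lemma graded_antip (h : UGraded κ a) : UGraded κ⁻¹ (antip R a) where
  mem x := match x with
    | .xi .pos k => neg_mem (isCurrent_conv (h.cur_xi .pos) (isCurrent_dblc (h.cur_al .pos)) k)
    | .xi .neg k => neg_mem (isCurrent_conv (isCurrent_dblc (h.cur_al .neg)) (h.cur_xi .neg) k)
    | .al s k => h.mem (.be s k)
    | .be s k => h.mem (.al s k)
    | .qc => h.mem .qc'
    | .qc' => h.mem .qc
  qc := h.qc'
  qc' := by rw [inv_inv]; exact h.qc

lemma urel_antip (h : UGraded κ a) (hu : URel ζ fun x => op (a x)) : URel ζ (UGraded.antip R a) := by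
  have hc := h.core_of_urel_op hu
  refine h.graded_antip.urel_of_core ?_ (((h.zeroModes_op_iff fun s => (hc.pair s).symm).2
    hu.phi_zero).inv fun s => (hc.pair s).symm)
  have := hc.dress_core
  convert this using 1
  · rfl
  · rfl
  · rfl
  · funext s
    cases s <;> rfl

lemma urel_op_antip (h : UGraded κ a) (hu : URel ζ a) :
    URel ζ fun x => op (UGraded.antip R a x) := by
  have hc := h.core_of_urel hu
  refine h.graded_antip.urel_op_of_core ?_ (((h.zeroModes_iff fun s => hc.pair s).2
    hu.phi_zero).inv fun s => hc.pair s)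
  have := hc.dress_core
  rw [inv_inv]
  convert this using 1
  · rfl
  · rfl
  · rfl
  · funext s
    cases s <;> rfl

lemma antip_antip (h : UGraded κ a)
    (hp : ∀ s, InvPair R s (fun k => a (.al s k)) fun k => a (.be s k)) :
    UGraded.antip R (UGraded.antip R a) = a := by
  funext x
  match x with
  | .xi .pos k =>
    change -conv (fun k => -conv _ _ k) (dblc R fun k => a (.be .pos k)) k = _
    rw [conv_neg_left, neg_neg, conv_assoc (h.cur_xi .pos) (hp .pos).dblc.cur (hp .pos).dblc.cur'
      (Or.inl ⟨(hp .pos).dblc.bd, (hp .pos).dblc.bd'⟩), (hp .pos).dblc.mul, conv_one]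
  | .xi .neg k =>
    change -conv (dblc R fun k => a (.be .neg k)) (fun k => -conv _ _ k) k = _
    rw [conv_neg_right, neg_neg, ← conv_assoc (hp .neg).dblc.cur' (hp .neg).dblc.cur (h.cur_xi .neg)
      (Or.inr (Or.inl ⟨(hp .neg).dblc.bd', (hp .neg).dblc.bd⟩)), (hp .neg).dblc.mul', one_conv]
  | .al s k => rfl
  | .be s k => rfl
  | .qc => rfl
  | .qc' => rfl

end UGraded

end

section

/-! ### The relations of the `L`-matrix algebra in terms of currents -/

/-- The diagonal entries of `R(x)`. -/
def rf (a : Ix) : B⟦X⟧ˣ :=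
  if a = (0, 1) then uf * ud else if a = (1, 0) then uf * udq else uf

lemma R0_apply (a s : Ix) : R0 a s = if s = a then (rf a : B⟦X⟧) else 0 := by
  rw [R0, Matrix.diagonal_apply]
  by_cases h : a = s
  · rw [if_pos h, if_pos h.symm, rf]
    split_ifs <;> rfl
  · rw [if_neg h, if_neg (Ne.symm h)]

lemma Q0_apply (t b : Ix) : Q0 t b = if t = b then (↑(rf b)⁻¹ : B⟦X⟧) else 0 := by
  rw [Q0, Matrix.diagonal_apply]
  by_cases h : t = b
  · subst h
    rw [if_pos rfl, if_pos rfl, rf]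
    split_ifs
    · exact Ring.inverse_unit (uf * ud)
    · exact Ring.inverse_unit (uf * udq)
    · exact Ring.inverse_unit uf
  · rw [if_neg h, if_neg h]

lemma R1_apply (a s : Ix) : R1 a s = if a = (1, 0) ∧ s = (0, 1) then
    C (qp 1 - qp (-1)) * (rf (0, 1) : B⟦X⟧) else 0 := by
  rw [R1, Matrix.single_apply]
  by_cases h : a = (1, 0) ∧ s = (0, 1)
  · rw [if_pos h, if_pos ⟨h.1.symm, h.2.symm⟩, gam, rf, if_pos rfl, mul_left_comm]
    rfl
  · rw [if_neg h, if_neg fun h' => h ⟨h'.1.symm, h'.2.symm⟩]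

lemma Q1_apply (t b : Ix) : Q1 t b = if b = (0, 1) ∧ t = (1, 0) then
    C (-(qp 1 - qp (-1))) * (↑(rf (1, 0))⁻¹ : B⟦X⟧) else 0 := by
  rw [Q1, Matrix.single_apply]
  by_cases h : b = (0, 1) ∧ t = (1, 0)
  · rw [if_pos h, if_pos ⟨h.2.symm, h.1.symm⟩, gam, rf, if_neg (by decide), if_pos rfl,
      show Ring.inverse (f * dq) = (↑(uf * udq)⁻¹ : B⟦X⟧) from Ring.inverse_unit (uf * udq)]
    have h2 := Ring.mul_inverse_cancel (f * d) (isUnit_f.mul isUnit_d)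
    rw [map_neg]
    linear_combination (-C (qp 1 - qp (-1)) * (↑(uf * udq)⁻¹ : B⟦X⟧)) * h2
  · rw [if_neg h, if_neg fun h' => h ⟨h'.2.symm, h'.1.symm⟩]

section Module

variable {M : Type} [AddCommGroup M] [Module B M] {κ κ' : Module.End B M}
  {u v : B⟦X⟧} {XY : ℤ → ℤ → Module.End B M}

lemma twist_zero_left (v : B⟦X⟧) (n : ℕ) : twist κ κ' 0 v n = 0 := by
  rw [twist]; simp

lemma twist_zero_right (u : B⟦X⟧) (n : ℕ) : twist κ κ' u 0 n = 0 := by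
  rw [twist]; simp

lemma nprod_zero_left : nprod κ κ' 0 v XY = 0 := by
  funext m k l
  rw [nprod]
  simp [twist_zero_left]

lemma nprod_zero_right : nprod κ κ' u 0 XY = 0 := by
  funext m k l
  rw [nprod]
  simp [twist_zero_right]

lemma dterm_zero (k l n : ℤ) : dterm κ κ' (0 : ℤ → ℤ → M) k l n = 0 := by
  rw [dterm]; simp

lemma finsum_dterm_zero (k l : ℤ) : ∑ᶠ n, dterm κ κ' (0 : ℤ → ℤ → M) k l n = 0 :=
  finsum_eq_zero_of_forall_eq_zero (dterm_zero k l)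

lemma finite_support_dterm_zero (k l : ℤ) :
    (Function.support (dterm κ κ' (0 : ℤ → ℤ → M) k l)).Finite :=
  Set.finite_empty.subset fun n hn => hn (dterm_zero k l n)

lemma nprod_zero : nprod κ κ' u v (fun _ _ => 0) = 0 := by
  funext m k l
  rw [nprod]
  simp

/-- The right hand side of the relation, with the zero terms removed. -/
lemma rll_rhs (comp : Module.End B M → Module.End B M → Module.End B M)
    (κ κ' : Module.End B M) (X Y : Fin 2 → Fin 2 → ℤ → Module.End B M) (a b : Ix) (m : M) (k l : ℤ) :
    ∑ s : Ix, ∑ t : Ix,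
        (nprod κ κ' (R0 a s) (Q0 t b) (fun i j => comp (X s.1 t.1 i) (Y s.2 t.2 j)) m k l
        + ∑ᶠ n : ℤ, dterm κ' κ (nprod κ κ' (R1 a s) (Q0 t b)
            (fun i j => comp (X s.1 t.1 i) (Y s.2 t.2 j)) m) k l n
        + ∑ᶠ n : ℤ, dterm κ κ' (nprod κ κ' (R0 a s) (Q1 t b)
            (fun i j => comp (X s.1 t.1 i) (Y s.2 t.2 j)) m) k l n) =
      nprod κ κ' (rf a) (↑(rf b)⁻¹ : B⟦X⟧)
          (fun i j => comp (X a.1 b.1 i) (Y a.2 b.2 j)) m k l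
        + (if a = (1, 0) then ∑ᶠ n : ℤ, dterm κ' κ
          (nprod κ κ' (C (qp 1 - qp (-1)) * (rf (0, 1) : B⟦X⟧)) (↑(rf b)⁻¹ : B⟦X⟧)
            (fun i j => comp (X 0 b.1 i) (Y 1 b.2 j)) m) k l n else 0)
        + (if b = (0, 1) then ∑ᶠ n : ℤ, dterm κ κ'
          (nprod κ κ' (rf a) (C (-(qp 1 - qp (-1))) * (↑(rf (1, 0))⁻¹ : B⟦X⟧))
            (fun i j => comp (X a.1 1 i) (Y a.2 0 j)) m) k l n else 0) := by
  simp only [Finset.sum_add_distrib]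
  congr 1
  · congr 1
    · rw [Finset.sum_eq_single a _ (by simp), Finset.sum_eq_single b _ (by simp)]
      · rw [R0_apply, Q0_apply, if_pos rfl, if_pos rfl]
      · intro t _ ht
        rw [Q0_apply, if_neg ht, nprod_zero_right]; rfl
      · intro s _ hs
        refine Finset.sum_eq_zero fun t _ => ?_
        rw [R0_apply, if_neg hs, nprod_zero_left]; rfl
    · split_ifs with h
      · rw [Finset.sum_eq_single (0, 1) _ (by simp), Finset.sum_eq_single b _ (by simp)]
        · rw [R1_apply, Q0_apply, if_pos ⟨h, rfl⟩, if_pos rfl]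
        · intro t _ ht
          rw [Q0_apply, if_neg ht, nprod_zero_right]
          exact finsum_dterm_zero k l
        · intro s _ hs
          refine Finset.sum_eq_zero fun t _ => ?_
          rw [R1_apply, if_neg fun h' => hs h'.2, nprod_zero_left]
          exact finsum_dterm_zero k l
      · refine Finset.sum_eq_zero fun s _ => Finset.sum_eq_zero fun t _ => ?_
        rw [R1_apply, if_neg fun h' => h h'.1, nprod_zero_left]
        exact finsum_dterm_zero k l
  · split_ifs with h
    · rw [Finset.sum_eq_single a _ (by simp), Finset.sum_eq_single (1, 0) _ (by simp)]
      · rw [R0_apply, Q1_apply, if_pos rfl, if_pos ⟨h, rfl⟩]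
      · intro t _ ht
        rw [Q1_apply, if_neg fun h' => ht h'.2, nprod_zero_right]
        exact finsum_dterm_zero k l
      · intro s _ hs
        refine Finset.sum_eq_zero fun t _ => ?_
        rw [R0_apply, if_neg hs, nprod_zero_left]
        exact finsum_dterm_zero k l
    · refine Finset.sum_eq_zero fun s _ => Finset.sum_eq_zero fun t _ => ?_
      rw [Q1_apply, if_neg fun h' => h h'.1, nprod_zero_right]
      exact finsum_dterm_zero k l

end Module

variable [Algebra B R]

/-- The relation `R(κ⁻¹ z/w) X₁(z) Y₂(w) = Y₂(w) X₁(z) R(κ z/w)` with the products that are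
multiplied by `δ` put into convergent order. -/
def SRLL (κ : Rˣ) (X Y : Fin 2 → Fin 2 → ℤ → E) : Prop := ∀ (a b : Ix) (k l : ℤ),
  Y a.2 b.2 l * X a.1 b.1 k =
    nop (↑(rs κ⁻¹ (ev R (rf a)) * (rs κ (ev R (rf b)))⁻¹) : R⟦X⟧) (X a.1 b.1) (Y a.2 b.2) k l
    + (if a = (1, 0) then cq R • deltaTerm κ⁻¹ (conv (Y 1 b.2) (shift κ (X 0 b.1))) k l else 0)
    - (if b = (0, 1) then cq R • deltaTerm κ (conv (Y a.2 0) (shift κ⁻¹ (X a.1 1))) k l else 0)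

/-- A lower triangular matrix of currents. -/
structure LPos (R : Type*) {E : Type*} [CommRing R] [Ring E] [Algebra R E] [TopologicalSpace E]
    [CurrentRing R E] (X : Fin 2 → Fin 2 → ℤ → E) : Prop where
  cur : ∀ i j, IsCurrent R (X i j)
  zero : ∀ k, X 0 1 k = 0
  bd : ∀ i, Plus (X i i)

/-- An upper triangular matrix of currents. -/
structure LNeg (R : Type*) {E : Type*} [CommRing R] [Ring E] [Algebra R E] [TopologicalSpace E]
    [CurrentRing R E] (X : Fin 2 → Fin 2 → ℤ → E) : Prop where
  cur : ∀ i j, IsCurrent R (X i j)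
  zero : ∀ k, X 1 0 k = 0
  bd : ∀ i, Minus (X i i)

lemma hasSum_delta (u : Rˣ) {X Y : ℤ → E} (hX : IsCurrent R X) (hY : IsCurrent R Y)
    (h : Plus X ∨ Minus Y) (k l : ℤ) :
    HasSum (fun n : ℤ => (↑(u ^ n) : R) • (Y (l + n) * X (k - n)))
      (deltaTerm u (conv Y (shift u⁻¹ X)) k l) := by
  refine ((Equiv.subLeft k).hasSum_iff.2 (hasSum_smul (↑(u ^ k) : R) (summable_conv hY
    (isCurrent_shift u⁻¹ hX) (h.imp (Plus.shift _) id) (k + l)).hasSum)).congr_fun fun n => ?_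
  rw [Function.comp_apply, Equiv.subLeft_apply, shift, mul_smul_comm, smul_smul, inv_zpow',
    zpow_mul_zpow_of_add u (show k + -(k - n) = n by ring), show k + l - (k - n) = l + n by ring]

/-- Conditions under which the products of two matrices of currents converge. -/
def Tri (R : Type*) {E : Type*} [CommRing R] [Ring E] [Algebra R E] [TopologicalSpace E]
    [CurrentRing R E] (X Y : Fin 2 → Fin 2 → ℤ → E) : Prop :=
  (∀ i j, IsCurrent R (X i j)) ∧ (∀ i j, IsCurrent R (Y i j)) ∧
    (((∀ k, X 0 1 k = 0) ∧ ∀ i, Plus (X i i)) ∨ ((∀ k, Y 1 0 k = 0) ∧ ∀ i, Minus (Y i i)))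

lemma Tri.left {X Y : Fin 2 → Fin 2 → ℤ → E} (h : Tri R X Y) (i j : Fin 2) :
    Plus (X 0 i) ∨ Minus (Y 1 j) := by
  rcases h.2.2 with h | h
  · left
    fin_cases i
    · exact h.2 0
    · exact fun k _ => h.1 k
  · right
    fin_cases j
    · exact fun k _ => h.1 k
    · exact h.2 1

lemma Tri.right {X Y : Fin 2 → Fin 2 → ℤ → E} (h : Tri R X Y) (i j : Fin 2) :
    Plus (X i 1) ∨ Minus (Y j 0) := by
  rcases h.2.2 with h | h
  · left
    fin_cases i
    · exact fun k _ => h.1 k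
    · exact h.2 1
  · right
    fin_cases j
    · exact h.2 0
    · exact fun k _ => h.1 k

lemma Tri.prod_zero {X Y : Fin 2 → Fin 2 → ℤ → E} (h : Tri R X Y) (i j : ℤ) :
    X 0 1 i * Y 1 0 j = 0 ∧ Y 1 0 j * X 0 1 i = 0 := by
  rcases h.2.2 with h | h
  · rw [h.1 i, mul_zero, zero_mul]; exact ⟨rfl, rfl⟩
  · rw [h.1 j, mul_zero, zero_mul]; exact ⟨rfl, rfl⟩

lemma tw_C_mul_left (κ : Rˣ) (c : B) (u v : B⟦X⟧) :
    tw κ (C c * u) v = C (algebraMap B R c) * tw κ u v := by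
  rw [tw, tw, map_mul, map_mul, map_C, mul_assoc]
  congr 1
  ext n
  simp only [coeff_rescale, coeff_C]
  split_ifs with h <;> simp [h]

lemma tw_C_mul_right (κ : Rˣ) (c : B) (u v : B⟦X⟧) :
    tw κ u (C c * v) = C (algebraMap B R c) * tw κ u v := by
  rw [tw, tw, map_mul, map_mul, map_C, mul_left_comm]
  congr 1
  ext n
  simp only [coeff_rescale, coeff_C]
  split_ifs with h <;> simp [h]

lemma nop_C_mul {X Y : ℤ → E} (hX : IsCurrent R X) (hY : IsCurrent R Y) (c : R)
    (ρ : R⟦X⟧) (k l : ℤ) : nop (C c * ρ) X Y k l = c • nop ρ X Y k l := by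
  rw [nop_eq_act, act_C_mul (reg_mul hX hY)]
  rfl

/-- An action of a current ring, or of the opposite ring, on a module. -/
structure Eval (R E : Type*) [CommRing R] [Ring E] [Algebra R E] [TopologicalSpace E]
    [Algebra B R] (D : Dir) (M : Type) [AddCommGroup M] [Module B M] where
  π : E →+ Module.End B M
  πR : R →+* Module.End B M
  map_mul : ∀ x y, π (x * y) = D.comp (π x) (π y)
  map_smul : ∀ r x, π (r • x) = πR r * π x
  map_algebraMap : ∀ b, πR (algebraMap B R b) = algebraMap B _ b
  hasSum : ∀ {ι : Type} {f : ι → E} {x : E}, HasSum f x → ∀ m,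
    (Function.support fun i => π (f i) m).Finite ∧ ∑ᶠ i, π (f i) m = π x m

namespace Eval

variable {D : Dir} {M : Type} [AddCommGroup M] [Module B M] (P : Eval R E D M)

lemma map_kpow (κ : Rˣ) (n : ℤ) :
    kpow (P.πR κ) (P.πR ↑κ⁻¹) n = P.πR (↑(κ ^ n) : R) := by
  have := kpow_units (R := R) (E := R) κ n
  simp only [Algebra.algebraMap_self_apply] at this
  rw [← this, kpow, kpow, _root_.map_mul, map_pow, map_pow]

lemma map_twist (κ : Rˣ) (u v : B⟦X⟧) (n : ℕ) :
    twist (P.πR κ) (P.πR ↑κ⁻¹) u v n = P.πR (coeff n (tw κ u v)) := by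
  have := twist_units (R := R) (E := R) κ u v n
  simp only [Algebra.algebraMap_self_apply] at this
  rw [← this, twist, twist, map_sum]
  refine Finset.sum_congr rfl fun p _ => ?_
  have h2 := kpow_units (R := R) (E := R) κ (p.2 - p.1)
  simp only [Algebra.algebraMap_self_apply] at h2
  rw [h2, P.map_kpow, Algebra.smul_def, Algebra.smul_def, _root_.map_mul P.πR, P.map_algebraMap]

lemma nprod_eq (κ : Rˣ) (u v : B⟦X⟧) {X Y : ℤ → E} (hX : IsCurrent R X)
    (hY : IsCurrent R Y) (m : M) (k l : ℤ) :
    nprod (P.πR κ) (P.πR ↑κ⁻¹) u v (fun i j => D.comp (P.π (X i)) (P.π (Y j))) m k l =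
      P.π (nop (tw κ u v) X Y k l) m := by
  rw [nop, ← (P.hasSum (deep_nop (tw κ u v) hX hY k l).summable.hasSum m).2, nprod]
  refine finsum_congr fun n => ?_
  rw [P.map_twist, P.map_smul, P.map_mul]
  rfl

lemma dterm_eq (κ : Rˣ) (F : ℤ → ℤ → E) (m : M) (k l n : ℤ) :
    dterm (P.πR κ) (P.πR ↑κ⁻¹) (fun k l => P.π (F k l) m) k l n =
      P.π ((↑(κ ^ n) : R) • F (k - n) (l + n)) m := by
  rw [dterm, P.map_kpow, P.map_smul]
  rfl

lemma dterm_eq' (κ : Rˣ) (F : ℤ → ℤ → E) (m : M) (k l n : ℤ) :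
    dterm (P.πR ↑κ⁻¹) (P.πR κ) (fun k l => P.π (F k l) m) k l n =
      P.π ((↑(κ⁻¹ ^ n) : R) • F (k - n) (l + n)) m := by
  have := P.dterm_eq κ⁻¹ F m k l n
  rwa [inv_inv] at this

lemma left_terms {κ : Rˣ} {X Y : Fin 2 → Fin 2 → ℤ → E} (ht : Tri R X Y) (b : Ix)
    (h : NExch (↑(rs κ⁻¹ (ev R (rf (0, 1))) * (rs κ (ev R (rf b)))⁻¹) : R⟦X⟧) (X 0 b.1)
      (Y 1 b.2)) (m : M) (k l : ℤ) :
    (Function.support (dterm (P.πR ↑κ⁻¹) (P.πR κ) (nprod (P.πR κ) (P.πR ↑κ⁻¹)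
        (C (qp 1 - qp (-1)) * (rf (0, 1) : B⟦X⟧)) (↑(rf b)⁻¹ : B⟦X⟧)
        (fun i j => D.comp (P.π (X 0 b.1 i)) (P.π (Y 1 b.2 j))) m) k l)).Finite ∧
    ∑ᶠ n : ℤ, dterm (P.πR ↑κ⁻¹) (P.πR κ) (nprod (P.πR κ) (P.πR ↑κ⁻¹)
        (C (qp 1 - qp (-1)) * (rf (0, 1) : B⟦X⟧)) (↑(rf b)⁻¹ : B⟦X⟧)
        (fun i j => D.comp (P.π (X 0 b.1 i)) (P.π (Y 1 b.2 j))) m) k l n =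
      P.π (cq R • deltaTerm κ⁻¹ (conv (Y 1 b.2) (shift κ (X 0 b.1))) k l) m := by
  have e : nprod (P.πR κ) (P.πR ↑κ⁻¹) (C (qp 1 - qp (-1)) * (rf (0, 1) : B⟦X⟧))
      (↑(rf b)⁻¹ : B⟦X⟧) (fun i j => D.comp (P.π (X 0 b.1 i)) (P.π (Y 1 b.2 j))) m =
        fun k l => P.π (cq R • (Y 1 b.2 l * X 0 b.1 k)) m := by
    funext k l
    rw [P.nprod_eq κ _ _ (ht.1 _ _) (ht.2.1 _ _), tw_C_mul_left, nop_C_mul (ht.1 _ _) (ht.2.1 _ _),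
      tw_units, map_inv, map_inv, ← h]
    rfl
  have hs := P.hasSum ((hasSum_smul (cq R) (hasSum_delta κ⁻¹ (ht.1 0 b.1) (ht.2.1 1 b.2)
    (ht.left _ _) k l)).congr_fun fun n => smul_comm _ _ _) m
  rw [e, show dterm (P.πR ↑κ⁻¹) (P.πR κ) _ k l = _ from funext (P.dterm_eq' κ _ m k l)]
  simpa only [inv_inv] using hs

lemma right_terms {κ : Rˣ} {X Y : Fin 2 → Fin 2 → ℤ → E} (ht : Tri R X Y) (a : Ix)
    (h : NExch (↑(rs κ⁻¹ (ev R (rf a)) * (rs κ (ev R (rf (1, 0))))⁻¹) : R⟦X⟧) (X a.1 1)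
      (Y a.2 0)) (m : M) (k l : ℤ) :
    (Function.support (dterm (P.πR κ) (P.πR ↑κ⁻¹) (nprod (P.πR κ) (P.πR ↑κ⁻¹)
        (rf a : B⟦X⟧) (C (-(qp 1 - qp (-1))) * (↑(rf (1, 0))⁻¹ : B⟦X⟧))
        (fun i j => D.comp (P.π (X a.1 1 i)) (P.π (Y a.2 0 j))) m) k l)).Finite ∧
    ∑ᶠ n : ℤ, dterm (P.πR κ) (P.πR ↑κ⁻¹) (nprod (P.πR κ) (P.πR ↑κ⁻¹)
        (rf a : B⟦X⟧) (C (-(qp 1 - qp (-1))) * (↑(rf (1, 0))⁻¹ : B⟦X⟧))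
        (fun i j => D.comp (P.π (X a.1 1 i)) (P.π (Y a.2 0 j))) m) k l n =
      P.π (-(cq R • deltaTerm κ (conv (Y a.2 0) (shift κ⁻¹ (X a.1 1))) k l)) m := by
  have e : nprod (P.πR κ) (P.πR ↑κ⁻¹) (rf a : B⟦X⟧)
      (C (-(qp 1 - qp (-1))) * (↑(rf (1, 0))⁻¹ : B⟦X⟧))
        (fun i j => D.comp (P.π (X a.1 1 i)) (P.π (Y a.2 0 j))) m =
        fun k l => P.π ((-cq R) • (Y a.2 0 l * X a.1 1 k)) m := by
    funext k l
    rw [P.nprod_eq κ _ _ (ht.1 _ _) (ht.2.1 _ _), tw_C_mul_right, nop_C_mul (ht.1 _ _) (ht.2.1 _ _),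
      tw_units, map_inv, map_inv, ← h, map_neg]
    rfl
  have hs := P.hasSum ((hasSum_smul (-cq R) (hasSum_delta κ (ht.1 a.1 1) (ht.2.1 a.2 0)
    (ht.right _ _) k l)).congr_fun fun n => smul_comm _ _ _) m
  rw [e, show dterm (P.πR κ) (P.πR ↑κ⁻¹) _ k l = _ from funext (P.dterm_eq κ _ m k l)]
  rwa [neg_smul] at hs

end Eval

lemma conv_eq_zero {X Y : ℤ → E} (h : ∀ i j, X i * Y j = 0) (k : ℤ) : conv X Y k = 0 := by
  rw [conv]
  simp [h]

lemma deltaTerm_zero (u : Rˣ) {D : ℤ → E} (h : ∀ k, D k = 0) (k l : ℤ) :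
    deltaTerm u D k l = 0 := by
  rw [deltaTerm, h, smul_zero]

lemma SRLL.exch_left {κ : Rˣ} {X Y : Fin 2 → Fin 2 → ℤ → E} (ht : Tri R X Y) (h : SRLL κ X Y)
    (b : Ix) : NExch (↑(rs κ⁻¹ (ev R (rf (0, 1))) * (rs κ (ev R (rf b)))⁻¹) : R⟦X⟧) (X 0 b.1)
      (Y 1 b.2) := by
  intro k l
  have := h (0, 1) b k l
  rw [if_neg (by decide), add_zero] at this
  rw [this]
  split_ifs with hb
  · rw [deltaTerm_zero, smul_zero, sub_zero]
    exact conv_eq_zero fun i j => by rw [shift, mul_smul_comm, (ht.prod_zero _ _).2, smul_zero]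
  · rw [sub_zero]

lemma SRLL.exch_right {κ : Rˣ} {X Y : Fin 2 → Fin 2 → ℤ → E} (ht : Tri R X Y) (h : SRLL κ X Y)
    (a : Ix) : NExch (↑(rs κ⁻¹ (ev R (rf a)) * (rs κ (ev R (rf (1, 0))))⁻¹) : R⟦X⟧) (X a.1 1)
      (Y a.2 0) := by
  intro k l
  have := h a (1, 0) k l
  rw [if_neg (show ¬((1, 0) : Ix) = (0, 1) by decide), sub_zero] at this
  rw [this]
  split_ifs with hb
  · rw [deltaTerm_zero, smul_zero, add_zero]
    exact conv_eq_zero fun i j => by rw [shift, mul_smul_comm, (ht.prod_zero _ _).2, smul_zero]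
  · rw [add_zero]

lemma SRLL.rll {κ : Rˣ} {X Y : Fin 2 → Fin 2 → ℤ → E} (ht : Tri R X Y) (h : SRLL κ X Y)
    {D : Dir} {M : Type} [AddCommGroup M] [Module B M] (P : Eval R E D M) :
    RLL D.comp (P.πR κ) (P.πR ↑κ⁻¹) (fun i j k => P.π (X i j k))
      (fun i j k => P.π (Y i j k)) := by
  refine ⟨fun a b s t m k l => ?_, fun a b s t m k l => ?_, fun a b m k l => ?_⟩
  · rw [R1_apply, Q0_apply]
    split_ifs with h1 h2
    · subst h2
      obtain ⟨rfl, rfl⟩ := h1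
      exact (P.left_terms ht t (h.exch_left ht t) m k l).1
    all_goals
      first | rw [nprod_zero_right] | rw [nprod_zero_left]
      exact finite_support_dterm_zero k l
  · rw [R0_apply, Q1_apply]
    split_ifs with h1 h2
    · subst h1
      obtain ⟨rfl, rfl⟩ := h2
      exact (P.right_terms ht s (h.exch_right ht s) m k l).1
    all_goals
      first | rw [nprod_zero_right] | rw [nprod_zero_left]
      exact finite_support_dterm_zero k l
  · refine Eq.trans ?_ (rll_rhs D.comp _ _ (fun i j k => P.π (X i j k)) (fun i j k => P.π (Y i j k))
      a b m k l).symm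
    rw [← P.map_mul, h a b k l, (P.left_terms ht b (h.exch_left ht b) m k l).2,
      (P.right_terms ht a (h.exch_right ht a) m k l).2, P.nprod_eq κ _ _ (ht.1 _ _) (ht.2.1 _ _),
      tw_units, map_inv, map_inv, map_sub, map_add, LinearMap.sub_apply, LinearMap.add_apply,
      sub_eq_add_neg]
    congr 1
    · split_ifs
      · rfl
      · rw [map_zero]; rfl
    · split_ifs
      · rw [map_neg]; rfl
      · rw [map_zero]; exact neg_zero

lemma srll_of_rll {κ : Rˣ} {X Y : Fin 2 → Fin 2 → ℤ → E} (ht : Tri R X Y) {D : Dir} {ι : Type*}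
    (M : ι → Type) [∀ i, AddCommGroup (M i)] [∀ i, Module B (M i)] (P : ∀ i, Eval R E D (M i))
    (hinj : ∀ x y : E, (∀ i m, (P i).π x m = (P i).π y m) → x = y)
    (h : ∀ i, RLL D.comp ((P i).πR κ) ((P i).πR (↑κ⁻¹ : R)) (fun j j' k => (P i).π (X j j' k))
      (fun j j' k => (P i).π (Y j j' k))) : SRLL κ X Y := by
  have hz : ∀ i p q, D.comp ((P i).π (X 0 1 p)) ((P i).π (Y 1 0 q)) = 0 := fun i p q => by
    rw [← (P i).map_mul, (ht.prod_zero p q).1, map_zero]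
  have key := fun i (a b : Ix) m k l => ((h i).eq a b m k l).trans (rll_rhs D.comp _ _
    (fun j j' k => (P i).π (X j j' k)) (fun j j' k => (P i).π (Y j j' k)) a b m k l)
  have e1 : ∀ b : Ix, NExch (↑(rs κ⁻¹ (ev R (rf (0, 1))) * (rs κ (ev R (rf b)))⁻¹) : R⟦X⟧)
      (X 0 b.1) (Y 1 b.2) := by
    intro b k l
    refine hinj _ _ fun i m => ?_
    have := key i (0, 1) b m k l
    beta_reduce at this
    rw [if_neg (by decide), add_zero, ← (P i).map_mul,
      (P i).nprod_eq κ _ _ (ht.1 _ _) (ht.2.1 _ _), tw_units, map_inv, map_inv] at this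
    rw [this]
    simp only [hz i, nprod_zero, Pi.zero_apply]
    rw [finsum_dterm_zero, ite_self, add_zero]
  have e2 : ∀ a : Ix, NExch (↑(rs κ⁻¹ (ev R (rf a)) * (rs κ (ev R (rf (1, 0))))⁻¹) : R⟦X⟧)
      (X a.1 1) (Y a.2 0) := by
    intro a k l
    refine hinj _ _ fun i m => ?_
    have := key i a (1, 0) m k l
    beta_reduce at this
    rw [if_neg (show ¬((1, 0) : Ix) = (0, 1) by decide), add_zero, ← (P i).map_mul,
      (P i).nprod_eq κ _ _ (ht.1 _ _) (ht.2.1 _ _), tw_units, map_inv, map_inv] at this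
    rw [this]
    simp only [hz i, nprod_zero, Pi.zero_apply]
    rw [finsum_dterm_zero, ite_self, add_zero]
  intro a b k l
  refine hinj _ _ fun i m => ?_
  have := key i a b m k l
  beta_reduce at this
  rw [← (P i).map_mul, ((P i).left_terms ht b (e1 b) m k l).2,
    ((P i).right_terms ht a (e2 a) m k l).2, (P i).nprod_eq κ _ _ (ht.1 _ _) (ht.2.1 _ _),
    tw_units, map_inv, map_inv] at this
  rw [this, map_sub, map_add, LinearMap.sub_apply, LinearMap.add_apply, sub_eq_add_neg]
  congr 1
  · split_ifs
    · rfl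
    · rw [map_zero]; rfl
  · split_ifs
    · rw [map_neg]; rfl
    · rw [map_zero]; exact neg_zero.symm

end

section

variable [Algebra B R]

section Entries

variable {X Y : Fin 2 → Fin 2 → ℤ → E} {κ : Rˣ}

lemma conv_zero_left' (Y : ℤ → E) : conv 0 Y = 0 := by
  funext k; simp [conv]

lemma conv_zero_right' (Y : ℤ → E) : conv Y 0 = 0 := by
  funext k; simp [conv]

lemma shift_zero' (c : Rˣ) : shift c (0 : ℤ → E) = 0 := by
  funext k; simp [shift]

lemma deltaTerm_zero' (c : Rˣ) (k l : ℤ) : deltaTerm c (0 : ℤ → E) k l = 0 := by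
  simp [deltaTerm]

lemma nop_zero_left' (ρ : R⟦X⟧) (Y : ℤ → E) (k l : ℤ) : nop ρ 0 Y k l = 0 := by
  simp [nop]

lemma nop_zero_right' (ρ : R⟦X⟧) (Y : ℤ → E) (k l : ℤ) : nop ρ Y 0 k l = 0 := by
  simp [nop]

lemma deltaTerm_one (D : ℤ → E) (k l : ℤ) : deltaTerm (1 : Rˣ) D k l = D (k + l) := by
  simp [deltaTerm]

lemma ratio_one (a b : Ix) : rs (1 : Rˣ)⁻¹ (ev R (rf a)) * (rs 1 (ev R (rf b)))⁻¹ =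
    ev R (rf a * (rf b)⁻¹) := by
  rw [inv_one, rs_one, rs_one, map_mul, map_inv]

lemma srll_pos_iff (h : LPos R X) (h1 : ∀ i j k l, Commute (X i i k) (X j j l))
    (h4 : ∀ k l, X 0 0 l * X 1 0 k = nop (↑(ev R udq) : R⟦X⟧) (X 1 0) (X 0 0) k l +
      cq R • conv (X 1 0) (X 0 0) (k + l))
    (h5 : ∀ k l, X 1 1 l * X 1 0 k = nop (↑(ev R ud)⁻¹ : R⟦X⟧) (X 1 0) (X 1 1) k l -
      cq R • conv (X 1 0) (X 1 1) (k + l))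
    (h2 : NExch (↑(ev R ud) : R⟦X⟧) (X 0 0) (X 1 0))
    (h3 : NExch (↑(ev R udq)⁻¹ : R⟦X⟧) (X 1 1) (X 1 0))
    (h6 : ∀ k l, X 1 0 k * X 1 0 l = X 1 0 l * X 1 0 k) :
    SRLL (1 : Rˣ) X X := by
  have hz : X 0 1 = 0 := funext h.zero
  rintro ⟨a1, a2⟩ ⟨b1, b2⟩ k l
  rw [ratio_one]
  simp only [inv_one, shift_one, deltaTerm_one]
  match a1, a2, b1, b2 with
  | 0, 0, 0, 0 => simpa [rf, nop_one] using (h1 0 0 l k).eq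
  | 0, 0, 0, 1 => simp [hz, conv_zero_right', nop_zero_right']
  | 0, 0, 1, 0 => simp [hz, nop_zero_left']
  | 0, 0, 1, 1 => simp [hz, nop_zero_left']
  | 0, 1, 0, 0 => simpa [rf] using h2 k l
  | 0, 1, 0, 1 => simpa [rf, nop_one, hz, conv_zero_right'] using (h1 1 0 l k).eq
  | 0, 1, 1, 0 => simp [hz, nop_zero_left']
  | 0, 1, 1, 1 => simp [hz, nop_zero_left']
  | 1, 0, 0, 0 => simpa [rf] using h4 k l
  | 1, 0, 0, 1 =>
    have : conv (X 1 1) (X 0 0) = conv (X 0 0) (X 1 1) := conv_comm fun k l => (h1 1 0 k l).eq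
    simp [hz, nop_zero_right', this]
  | 1, 0, 1, 0 => simpa [rf, nop_one, hz, conv_zero_right'] using (h1 0 1 l k).eq
  | 1, 0, 1, 1 => simp [hz, conv_zero_right', nop_zero_right']
  | 1, 1, 0, 0 => simpa [rf, nop_one] using h6 l k
  | 1, 1, 0, 1 => simpa [rf] using h5 k l
  | 1, 1, 1, 0 => simpa [rf] using h3 k l
  | 1, 1, 1, 1 => simpa [rf, nop_one] using (h1 1 1 l k).eq

lemma srll_neg_iff (h : LNeg R X) (h1 : ∀ i j k l, Commute (X i i k) (X j j l))
    (h4 : ∀ k l, X 0 1 l * X 0 0 k = nop (↑(ev R ud)⁻¹ : R⟦X⟧) (X 0 0) (X 0 1) k l -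
      cq R • conv (X 0 0) (X 0 1) (k + l))
    (h5 : ∀ k l, X 0 1 l * X 1 1 k = nop (↑(ev R udq) : R⟦X⟧) (X 1 1) (X 0 1) k l +
      cq R • conv (X 1 1) (X 0 1) (k + l))
    (h2 : NExch (↑(ev R udq)⁻¹ : R⟦X⟧) (X 0 1) (X 0 0))
    (h3 : NExch (↑(ev R ud) : R⟦X⟧) (X 0 1) (X 1 1))
    (h6 : ∀ k l, X 0 1 k * X 0 1 l = X 0 1 l * X 0 1 k) :
    SRLL (1 : Rˣ) X X := by
  have hz : X 1 0 = 0 := funext h.zero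
  rintro ⟨a1, a2⟩ ⟨b1, b2⟩ k l
  rw [ratio_one]
  simp only [inv_one, shift_one, deltaTerm_one]
  match a1, a2, b1, b2 with
  | 0, 0, 0, 0 => simpa [rf, nop_one] using (h1 0 0 l k).eq
  | 0, 0, 0, 1 => simpa [rf] using h4 k l
  | 0, 0, 1, 0 => simpa [rf] using h2 k l
  | 0, 0, 1, 1 => simpa [rf, nop_one] using h6 l k
  | 0, 1, 0, 0 => simp [hz, nop_zero_right']
  | 0, 1, 0, 1 => simpa [rf, nop_one, hz, conv_zero_left'] using (h1 1 0 l k).eq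
  | 0, 1, 1, 0 => simp [hz, nop_zero_right']
  | 0, 1, 1, 1 => simpa [rf] using h3 k l
  | 1, 0, 0, 0 => simp [hz, conv_zero_left', nop_zero_left']
  | 1, 0, 0, 1 =>
    have : conv (X 1 1) (X 0 0) = conv (X 0 0) (X 1 1) := conv_comm fun k l => (h1 1 0 k l).eq
    simp [hz, nop_zero_left', this]
  | 1, 0, 1, 0 => simpa [rf, nop_one, hz, conv_zero_left'] using (h1 0 1 l k).eq
  | 1, 0, 1, 1 => simpa [rf] using h5 k l
  | 1, 1, 0, 0 => simp [hz, nop_zero_right']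
  | 1, 1, 0, 1 => simp [hz, conv_zero_left', nop_zero_left']
  | 1, 1, 1, 0 => simp [hz, nop_zero_right']
  | 1, 1, 1, 1 => simpa [rf, nop_one] using (h1 1 1 l k).eq

/-- The coefficient `f_a(x κ⁻¹) / f_b(x κ)`. -/
def rat (κ : Rˣ) (a b : B⟦X⟧ˣ) : R⟦X⟧ˣ := rs κ⁻¹ (ev R a) * (rs κ (ev R b))⁻¹

lemma srll_mixed (h : LPos R X) (h' : LNeg R Y)
    (h1 : NExch (↑(rat κ uf uf) : R⟦X⟧) (X 0 0) (Y 0 0))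
    (h2 : NExch (↑(rat κ uf (uf * ud)) : R⟦X⟧) (X 0 0) (Y 0 1))
    (h3 : NExch (↑(rat κ (uf * ud) (uf * ud)) : R⟦X⟧) (X 0 0) (Y 1 1))
    (h4 : NExch (↑(rat κ (uf * udq) uf) : R⟦X⟧) (X 1 0) (Y 0 0))
    (h5 : NExch (↑(rat κ (uf * udq) (uf * udq)) : R⟦X⟧) (X 1 1) (Y 0 0))
    (h6 : NExch (↑(rat κ (uf * udq) uf) : R⟦X⟧) (X 1 1) (Y 0 1))
    (h7 : NExch (↑(rat κ uf (uf * ud)) : R⟦X⟧) (X 1 0) (Y 1 1))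
    (h8 : NExch (↑(rat κ uf uf) : R⟦X⟧) (X 1 1) (Y 1 1))
    (h9 : NRel (↑(rat κ (uf * udq) (uf * ud)) : R⟦X⟧) (X 1 0) (Y 0 1) fun k l => cq R •
      (deltaTerm κ⁻¹ (conv (Y 1 1) (shift κ (X 0 0))) k l -
        deltaTerm κ (conv (Y 0 0) (shift κ⁻¹ (X 1 1))) k l)) :
    SRLL κ X Y := by
  have hz : X 0 1 = 0 := funext h.zero
  have hz' : Y 1 0 = 0 := funext h'.zero
  rintro ⟨a1, a2⟩ ⟨b1, b2⟩ k l
  match a1, a2, b1, b2 with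
  | 0, 0, 0, 0 => simpa [rf, rat] using h1 k l
  | 0, 0, 0, 1 => simpa [rf, rat, hz, conv_zero_right', shift_zero', deltaTerm_zero'] using h2 k l
  | 0, 0, 1, 0 => simp [hz, nop_zero_left']
  | 0, 0, 1, 1 => simp [hz, nop_zero_left']
  | 0, 1, 0, 0 => simp [hz', nop_zero_right']
  | 0, 1, 0, 1 => simpa [rf, rat, hz, conv_zero_right', shift_zero', deltaTerm_zero'] using h3 k l
  | 0, 1, 1, 0 => simp [hz, nop_zero_left']
  | 0, 1, 1, 1 => simp [hz, nop_zero_left']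
  | 1, 0, 0, 0 => simpa [rf, rat, hz', conv_zero_left', deltaTerm_zero'] using h4 k l
  | 1, 0, 0, 1 =>
    have := h9 k l
    beta_reduce at this
    rw [smul_sub, ← add_sub_assoc] at this
    simpa [rf, rat] using this
  | 1, 0, 1, 0 => simpa [rf, rat, hz', conv_zero_left', deltaTerm_zero'] using h5 k l
  | 1, 0, 1, 1 => simpa [rf, rat, hz, conv_zero_right', shift_zero', deltaTerm_zero'] using h6 k l
  | 1, 1, 0, 0 => simp [hz', nop_zero_right']
  | 1, 1, 0, 1 => simpa [rf, rat, hz', conv_zero_left', deltaTerm_zero'] using h7 k l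
  | 1, 1, 1, 0 => simp [hz', nop_zero_right']
  | 1, 1, 1, 1 => simpa [rf, rat] using h8 k l

lemma rat_mul (a b a' b' : B⟦X⟧ˣ) : (rat κ a b : R⟦X⟧ˣ) * rat κ a' b' =
    rat κ (a * a') (b * b') := by
  simp only [rat, map_mul]
  rw [mul_mul_mul_comm, mul_inv]

lemma rat_inv (a b : B⟦X⟧ˣ) : (rat κ a b : R⟦X⟧ˣ)⁻¹ = rat κ a⁻¹ b⁻¹ := by
  simp only [rat, map_inv, mul_inv]

lemma rs_rat (t : ℂ) (a b : B⟦X⟧ˣ) : rs (qu R t) (rat κ a b) =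
    rat κ (rs (qu B t) a) (rs (qu B t) b) := by
  rw [rat, rat, map_mul, map_inv, Core.rs_comm _ κ⁻¹, Core.rs_comm _ κ, rs_ev, rs_ev]

lemma rs_uf' : rs (qu B 2) uf = uf⁻¹ * udq⁻¹ := by
  rw [← rs_uf, inv_mul_cancel_left]

lemma rs_uf_inv' : rs (qu B (-2)) uf = uf⁻¹ * ud⁻¹ := by
  rw [← rs_uf_inv, inv_mul_cancel_left]

lemma rs_udq : rs (qu B (-2)) udq = ud := by
  rw [← rs_ud, rs_rs, ← qu_add, neg_add_cancel, qu_zero, rs_one]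

end Entries

variable {κ : Rˣ} {A A' e : Sgn → ℤ → E}

variable (R) in
/-- The matrix `L^+(z)` in terms of Drinfeld currents. -/
def lpos (A A' e : Sgn → ℤ → E) (i j : Fin 2) : ℤ → E :=
  match i, j with
  | 0, 0 => A .pos
  | 0, 1 => 0
  | 1, 0 => conv (e .pos) (A .pos)
  | 1, 1 => shift (qu R 2) (A' .pos)

variable (R) in
/-- The matrix `L^-(z)` in terms of Drinfeld currents. -/
def lneg (A A' e : Sgn → ℤ → E) (i j : Fin 2) : ℤ → E :=
  match i, j with
  | 0, 0 => A .neg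
  | 0, 1 => fun k => -conv (A .neg) (e .neg) k
  | 1, 0 => 0
  | 1, 1 => shift (qu R 2) (A' .neg)

lemma val_rs_eq (t : ℂ) (u : R⟦X⟧ˣ) :
    rescale (qu R t : R) (u : R⟦X⟧) = ((rs (qu R t) u : R⟦X⟧ˣ) : R⟦X⟧) :=
  rfl

lemma val_rs_eq' (t : ℂ) (u : R⟦X⟧ˣ) :
    rescale (↑(qu R t)⁻¹ : R) (u : R⟦X⟧) =
      ((rs (qu R (-t)) u : R⟦X⟧ˣ) : R⟦X⟧) := by
  rw [qu_neg]; rfl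

namespace Core

lemma lPos (h : Core .pos κ A A' e) : LPos R (lpos R A A' e) where
  cur i j := match i, j with
    | 0, 0 => (h.pair .pos).cur
    | 0, 1 => fun _ => zero_mem _
    | 1, 0 => isCurrent_conv (h.cur .pos) (h.pair .pos).cur
    | 1, 1 => isCurrent_shift _ (h.pair .pos).cur'
  zero _ := rfl
  bd i := match i with
    | 0 => (h.pair .pos).bd
    | 1 => Plus.shift _ (h.pair .pos).bd'

lemma lNeg (h : Core .pos κ A A' e) : LNeg R (lneg R A A' e) where
  cur i j := match i, j with
    | 0, 0 => (h.pair .neg).cur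
    | 0, 1 => (isCurrent_conv (h.pair .neg).cur (h.cur .neg)).neg
    | 1, 0 => fun _ => zero_mem _
    | 1, 1 => isCurrent_shift _ (h.pair .neg).cur'
  zero _ := rfl
  bd i := match i with
    | 0 => (h.pair .neg).bd
    | 1 => Minus.shift _ (h.pair .neg).bd'

lemma ev_inv_d_eq_mk : (↑(ev R ud)⁻¹ : R⟦X⟧) = PowerSeries.mk 1 *
    (C (algebraMap B R (-qp (-1))) * (X - C (qu R 2 : R))) := by
  rw [← map_inv, val_ev, map_mk_one _ _ _ inv_d_eq_mk]
  rfl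

lemma ev_dq_eq_mk : ((ev R udq : R⟦X⟧ˣ) : R⟦X⟧) = PowerSeries.mk 1 *
    (C (algebraMap B R (-qp 1)) * (X - C (qu R (-2) : R))) := by
  rw [val_ev]
  exact map_mk_one _ _ _ dq_eq_mk

lemma coeff_inv_d (n : ℕ) : coeff (n + 1) (↑(ev R ud)⁻¹ : R⟦X⟧) = cq R ∧
    coeff 0 (↑(ev R ud)⁻¹ : R⟦X⟧) = algebraMap B R (qp 1) := by
  have := coeff_of_mul_one_sub_X inv_d_eq n
  rw [← map_inv, val_ev, coeff_map, coeff_map, this.1, this.2]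
  exact ⟨rfl, rfl⟩

lemma coeff_dq (n : ℕ) : coeff (n + 1) ((ev R udq : R⟦X⟧ˣ) : R⟦X⟧) = -cq R ∧
    coeff 0 ((ev R udq : R⟦X⟧ˣ) : R⟦X⟧) = algebraMap B R (qp (-1)) := by
  have := coeff_of_mul_one_sub_X (show (udq : B⟦X⟧) * (1 - X) = _ from dq_eq) n
  rw [val_ev, coeff_map, coeff_map, this.1, this.2, cq, ← map_neg, neg_sub]
  exact ⟨rfl, rfl⟩

lemma commute_diag {s : Sgn} (h : Core .pos κ A A' e) (k l : ℤ) :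
    Commute (A s k) (shift (qu R 2) (A' s) l) :=
  commute_shift _ (fun l => ((h.pair s).comm_mixed l k).symm) l

lemma two_smul_eq_zero [Algebra B E] (x : E) (h : x + x = 0) : x = 0 := by
  have h2 : (C (2⁻¹ : ℂ) : B) • (x + x) = 0 := by rw [h, smul_zero]
  rw [← two_smul B x, smul_smul, show (C (2⁻¹ : ℂ) : B) * 2 = 1 from ?_, one_smul] at h2
  · exact h2
  · rw [show (2 : B) = C (2 : ℂ) from (map_ofNat C 2).symm, ← map_mul]
    norm_num

lemma srll_pos [Algebra B E] (h : Core .pos κ A A' e) :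
    SRLL (1 : Rˣ) (lpos R A A' e) (lpos R A A' e) := by
  have hp := h.pair .pos
  have hL := h.lPos
  have c1 : NExch (1 : R⟦X⟧) (A .pos) (A .pos) := nexch_one_iff.2 fun k l => (hp.comm l k).eq
  have c2 : NExch (1 : R⟦X⟧) (shift (qu R 2) (A' .pos)) (A .pos) :=
    nexch_one_iff.2 fun k l => (h.commute_diag l k).eq
  have x1 : NExch (↑(ev R ud) : R⟦X⟧) (A .pos) (conv (e .pos) (A .pos)) := by
    have := c1.conv_second hp.cur hp.cur (h.cur .pos) (Or.inl hp.bd) h.pos_pos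
    rwa [one_mul] at this
  have x2 : NExch (↑(ev R udq)⁻¹ : R⟦X⟧) (shift (qu R 2) (A' .pos))
      (conv (e .pos) (A .pos)) := by
    have h2 := (hp.nexch_first (h.cur .pos) h.pos_pos).shift_first (qu R 2) hp.cur' (h.cur .pos)
    rw [val_rs_eq, map_inv, rs_ev, rs_ud] at h2
    have := c2.conv_second (isCurrent_shift _ hp.cur') hp.cur (h.cur .pos) (Or.inl hp.bd) h2
    rwa [one_mul] at this
  refine srll_pos_iff hL ?_ ?_ ?_ x1 x2 ?_
  · intro i j k l
    match i, j with
    | 0, 0 => exact hp.comm k l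
    | 0, 1 => exact h.commute_diag k l
    | 1, 0 => exact (h.commute_diag l k).symm
    | 1, 1 => exact (hp.symm.shift (qu R 2)).comm k l
  · intro k l
    refine x1.delta_plus (cq R) hp.cur (hL.cur 1 0) hp.bd (fun n => (coeff_dq n).1)
      (fun n => (coeff_inv_d n).1) ?_ k l
    rw [(coeff_inv_d 0).2, (coeff_dq 0).2, cq, map_sub]
  · intro k l
    have := x2.delta_plus (σ := (↑(ev R ud)⁻¹ : R⟦X⟧)) (-cq R) (hL.cur 1 1) (hL.cur 1 0)
      (hL.bd 1) (fun n => by rw [(coeff_inv_d n).1, _root_.neg_neg])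
      (fun n => by rw [inv_inv, (coeff_dq n).1]) ?_ k l
    · rw [neg_smul, ← sub_eq_add_neg] at this
      exact this
    · rw [inv_inv, (coeff_inv_d 0).2, (coeff_dq 0).2, cq, map_sub, neg_sub]
  · have hq := h.quad .pos
    refine commute_conv_right (h.cur .pos) hp.cur hp.bd (fun k l => (hp.comm k l).eq) h.pos_pos
      (hq.nop_symm two_smul_eq_zero (h.cur .pos) (a := algebraMap B R (-qp (-1))) ?_)
    rw [ev_inv_d_eq_mk]
    simp [Sgn.int]

lemma srll_neg [Algebra B E] (h : Core .pos κ A A' e) :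
    SRLL (1 : Rˣ) (lneg R A A' e) (lneg R A A' e) := by
  have hp := h.pair .neg
  have hL := h.lNeg
  have c1 : NExch (1 : R⟦X⟧) (A .neg) (A .neg) := nexch_one_iff.2 fun k l => (hp.comm l k).eq
  have c2 : NExch (1 : R⟦X⟧) (A .neg) (shift (qu R 2) (A' .neg)) :=
    nexch_one_iff.2 fun k l => (h.commute_diag k l).symm.eq
  have x1 : NExch (↑(ev R udq)⁻¹ : R⟦X⟧) (lneg R A A' e 0 1) (A .neg) := by
    have := (c1.conv_first hp.cur hp.cur (h.cur .neg) (Or.inr hp.bd) h.neg_neg).neg_first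
    rwa [one_mul] at this
  have x2 : NExch (↑(ev R ud) : R⟦X⟧) (lneg R A A' e 0 1) (shift (qu R 2) (A' .neg)) := by
    have h2 := (hp.nexch_second (h.cur .neg) h.neg_neg).shift_second (qu R 2) (h.cur .neg) hp.cur'
    rw [inv_inv, val_rs_eq', rs_ev, rs_udq] at h2
    have := (c2.conv_first hp.cur (isCurrent_shift _ hp.cur') (h.cur .neg) (Or.inr hp.bd) h2).neg_first
    rwa [one_mul] at this
  refine srll_neg_iff hL ?_ ?_ ?_ x1 x2 ?_
  · intro i j k l
    match i, j with
    | 0, 0 => exact hp.comm k l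
    | 0, 1 => exact h.commute_diag k l
    | 1, 0 => exact (h.commute_diag l k).symm
    | 1, 1 => exact (hp.symm.shift (qu R 2)).comm k l
  · intro k l
    have := x1.delta_minus (σ := (↑(ev R ud)⁻¹ : R⟦X⟧)) (-cq R) (hL.cur 0 0) (hL.cur 0 1)
      (hL.bd 0) (fun n => by rw [(coeff_inv_d n).1, _root_.neg_neg])
      (fun n => by rw [inv_inv, (coeff_dq n).1]) ?_ k l
    · rw [neg_smul, ← sub_eq_add_neg] at this
      exact this
    · rw [inv_inv, (coeff_inv_d 0).2, (coeff_dq 0).2, cq, map_sub, neg_sub]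
  · intro k l
    refine x2.delta_minus (cq R) (hL.cur 1 1) (hL.cur 0 1) (hL.bd 1) (fun n => (coeff_dq n).1)
      (fun n => (coeff_inv_d n).1) ?_ k l
    rw [(coeff_inv_d 0).2, (coeff_dq 0).2, cq, map_sub]
  · have hq := h.quad .neg
    intro k l
    change -conv (A .neg) (e .neg) k * -conv (A .neg) (e .neg) l =
      -conv (A .neg) (e .neg) l * -conv (A .neg) (e .neg) k
    rw [neg_mul_neg, neg_mul_neg]
    refine commute_conv_left (h.cur .neg) hp.cur hp.bd (fun k l => (hp.comm k l).eq) h.neg_neg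
      (hq.nop_symm two_smul_eq_zero (h.cur .neg) (a := algebraMap B R (-qp 1)) ?_) k l
    rw [inv_inv, ev_dq_eq_mk]
    simp [Sgn.int]

lemma srll_mixed (h : Core .pos κ A A' e) : SRLL κ (lpos R A A' e) (lneg R A A' e) := by
  have hp := h.pair .pos
  have hn := h.pair .neg
  have hL := h.lPos
  have hL' := h.lNeg
  have e1 : κ ^ Sgn.pos.int = κ := by simp [Sgn.int]
  have e2 : κ ^ (-Sgn.pos.int) = κ⁻¹ := by simp [Sgn.int]
  have y1 : NExch (↑(rat κ uf uf) : R⟦X⟧) (A .pos) (A .neg) := h.A_A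
  have y2 : NExch (↑(rat κ 1 ud) : R⟦X⟧) (A .pos) (e .neg) := by
    have := h.pos_neg
    rw [e1] at this
    simpa [rat] using this
  have y3 : NExch (↑(rat κ udq 1) : R⟦X⟧) (e .pos) (A .neg) := by
    have := h.neg_pos
    rw [e2] at this
    simpa [rat] using this
  have y4 : NExch (↑(rat κ (uf * ud) (uf * ud)) : R⟦X⟧) (A .pos)
      (shift (qu R 2) (A' .neg)) := by
    have := (hn.nexch_second hp.cur y1).shift_second (qu R 2) hp.cur hn.cur'
    rwa [rat_inv, val_rs_eq', rs_rat, map_inv, rs_uf_inv', mul_inv, inv_inv, inv_inv] at this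
  have y5 : NExch (↑(rat κ (uf * udq) (uf * udq)) : R⟦X⟧) (shift (qu R 2) (A' .pos))
      (A .neg) := by
    have := (hp.nexch_first hn.cur y1).shift_first (qu R 2) hp.cur' hn.cur
    rwa [rat_inv, val_rs_eq, rs_rat, map_inv, rs_uf', mul_inv, inv_inv, inv_inv] at this
  have y6 : NExch (↑(rat κ 1 udq⁻¹) : R⟦X⟧) (shift (qu R 2) (A' .pos)) (e .neg) := by
    have := (hp.nexch_first (h.cur .neg) y2).shift_first (qu R 2) hp.cur' (h.cur .neg)
    rwa [rat_inv, val_rs_eq, rs_rat, map_inv, map_inv, map_one, inv_one, rs_ud] at this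
  have y7 : NExch (↑(rat κ ud⁻¹ 1) : R⟦X⟧) (e .pos) (shift (qu R 2) (A' .neg)) := by
    have := (hn.nexch_second (h.cur .pos) y3).shift_second (qu R 2) (h.cur .pos) hn.cur'
    rwa [rat_inv, val_rs_eq', rs_rat, map_inv, map_inv, map_one, inv_one, rs_udq] at this
  have y8 : NExch (↑(rat κ uf uf) : R⟦X⟧) (shift (qu R 2) (A' .pos))
      (shift (qu R 2) (A' .neg)) := by
    have := (hn.nexch_second (isCurrent_shift _ hp.cur') y5).shift_second (qu R 2)
      (isCurrent_shift _ hp.cur') hn.cur'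
    rw [rat_inv, val_rs_eq', rs_rat, map_inv, map_mul, rs_uf_inv', rs_udq] at this
    simpa using this
  have z1 : NExch (↑(rat κ uf (uf * ud)) : R⟦X⟧) (A .pos) (lneg R A A' e 0 1) := by
    have := (y2.conv_second hp.cur (h.cur .neg) hn.cur (Or.inr hn.bd) y1).neg_second
    rw [← Units.val_mul, rat_mul, one_mul, mul_comm ud] at this
    exact this
  have z2 : NExch (↑(rat κ (uf * udq) uf) : R⟦X⟧) (conv (e .pos) (A .pos)) (A .neg) := by
    have := y3.conv_first (h.cur .pos) hn.cur hp.cur (Or.inl hp.bd) y1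
    rwa [← Units.val_mul, rat_mul, one_mul, mul_comm udq] at this
  have z3 : NExch (↑(rat κ (uf * udq) uf) : R⟦X⟧) (shift (qu R 2) (A' .pos))
      (lneg R A A' e 0 1) := by
    have := (y6.conv_second (isCurrent_shift _ hp.cur') (h.cur .neg) hn.cur (Or.inr hn.bd)
      y5).neg_second
    rw [← Units.val_mul, rat_mul, one_mul, mul_comm uf udq, inv_mul_cancel_left,
      mul_comm udq uf] at this
    exact this
  have z4 : NExch (↑(rat κ uf (uf * ud)) : R⟦X⟧) (conv (e .pos) (A .pos))
      (shift (qu R 2) (A' .neg)) := by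
    have := y7.conv_first (h.cur .pos) (isCurrent_shift _ hn.cur') hp.cur (Or.inl hp.bd) y4
    rwa [← Units.val_mul, rat_mul, one_mul, mul_comm uf ud, inv_mul_cancel_left,
      mul_comm ud uf] at this
  refine QCurrent.srll_mixed hL hL' y1 z1 y4 z2 y5 z3 z4 y8 ?_
  have hc := h.comm
  rw [e1, e2] at hc
  have hP := h.pairPhi .pos
  have h1 := hc.conv_first_delta (h.cur .pos) (h.cur .neg) hp.cur (hP .neg).cur
      ((hP .pos).shift _).cur hp.bd y2
  have h2 := h1.conv_second_delta (isCurrent_conv (h.cur .pos) hp.cur) (h.cur .neg) hn.cur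
      (isCurrent_conv (hP .neg).cur (hp.shift _).cur)
      (isCurrent_conv ((hP .pos).shift _).cur (hp.shift _).cur) hn.bd z2
  have cP : ∀ s, conv (A s) (Phi R .pos A A' s) = shift (qu R 2) (A' s) := fun s => by
    have hs := h.pair s
    change conv (A s) (conv (A' s) (shift (qu R 2) (A' s))) = _
    rw [← conv_assoc_bd hs.cur hs.cur' (hs.symm.shift _).cur hs.bd hs.bd' (hs.symm.shift _).bd,
      hs.mul, one_conv]
  have cP' : ∀ s, conv (Phi R .pos A A' s) (A s) = shift (qu R 2) (A' s) := fun s => by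
    rw [← cP s]
    exact (conv_comm fun k l => (h.commute_A_Phi .pos s k l).eq).symm
  have d1 : conv (A .neg) (conv (Phi R .pos A A' .neg) (shift κ⁻¹⁻¹ (A .pos))) =
      conv (shift (qu R 2) (A' .neg)) (shift κ (A .pos)) := by
    rw [inv_inv, ← cP .neg, conv_assoc hn.cur (hP .neg).cur (hp.shift _).cur
      (Or.inr (Or.inl ⟨hn.bd, (hP .neg).bd⟩))]
  have d2 : conv (shift κ⁻¹ (Phi R .pos A A' .pos)) (shift κ⁻¹ (A .pos)) =
      shift κ⁻¹ (shift (qu R 2) (A' .pos)) := by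
    rw [← shift_conv _ (hP .pos).cur hp.cur (Or.inl hp.bd), cP']
  rw [d1, d2, ← Units.val_one, ← Units.val_mul, ← Units.val_mul,
    show (1 * rat κ 1 ud * rat κ (uf * udq) uf : R⟦X⟧ˣ) = rat κ (uf * udq) (uf * ud) by
      rw [one_mul, rat_mul, one_mul, mul_comm ud]] at h2
  intro k l
  change -conv (A .neg) (e .neg) l * _ = nop _ (conv (e .pos) (A .pos))
    (fun k => -conv (A .neg) (e .neg) k) k l + _
  rw [nop_neg_second, neg_mul, show (lpos R A A' e 1 0) = conv (e .pos) (A .pos) from rfl, h2 k l,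
    neg_add]
  congr 1
  beta_reduce
  rw [← neg_smul]
  simp [Sgn.int, lneg, lpos]

end Core

end

section

variable [Algebra B R]

/-- The relations of the `L`-matrix algebra in terms of currents. -/
structure LCore (κ : Rˣ) (X Y : Fin 2 → Fin 2 → ℤ → E) : Prop where
  lpos : LPos R X
  lneg : LNeg R Y
  srll_pos : SRLL (1 : Rˣ) X X
  srll_neg : SRLL (1 : Rˣ) Y Y
  srll_mixed : SRLL κ X Y
  qdet_pos : conv (X 0 0) (shift (qu R (-2)) (X 1 1)) = oneCurrent E
  qdet_neg : conv (Y 0 0) (shift (qu R (-2)) (Y 1 1)) = oneCurrent E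

/-- The currents `α^±(z)` in terms of `L^±(z)`. -/
def lal (X Y : Fin 2 → Fin 2 → ℤ → E) : Sgn → ℤ → E
  | .pos => X 0 0
  | .neg => Y 0 0

variable (R) in
/-- The currents `α^±(z)⁻¹` in terms of `L^±(z)`. -/
def lbe (X Y : Fin 2 → Fin 2 → ℤ → E) : Sgn → ℤ → E
  | .pos => shift (qu R (-2)) (X 1 1)
  | .neg => shift (qu R (-2)) (Y 1 1)

variable (R) in
/-- The currents `ξ^±(z)` in terms of `L^±(z)`. -/
def lxi (X Y : Fin 2 → Fin 2 → ℤ → E) : Sgn → ℤ → E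
  | .pos => conv (X 1 0) (lbe R X Y .pos)
  | .neg => fun k => -conv (lbe R X Y .neg) (Y 0 1) k

lemma shift_two_neg_two (X : ℤ → E) : shift (qu R 2) (shift (qu R (-2)) X) = X := by
  rw [shift_shift, ← qu_add, add_neg_cancel, qu_zero, shift_one]

lemma shift_neg_two_two (X : ℤ → E) : shift (qu R (-2)) (shift (qu R 2) X) = X := by
  rw [shift_shift, ← qu_add, neg_add_cancel, qu_zero, shift_one]

namespace LCore

variable {κ : Rˣ} {X Y : Fin 2 → Fin 2 → ℤ → E}

lemma pair (h : LCore κ X Y) : ∀ s, InvPair R s (lal X Y s) (lbe R X Y s)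
  | .pos => by
    have hc : ∀ k l, Commute (X 0 0 k) (X 1 1 l) := fun k l => by
      have := h.srll_pos (0, 1) (0, 1) k l
      rw [ratio_one, mul_inv_cancel, map_one, Units.val_one,
        nop_one] at this
      simp only [funext h.lpos.zero] at this
      simpa [show (fun _ => 0 : ℤ → E) = 0 from rfl, shift_zero', conv_zero_right', deltaTerm_zero',
        commute_iff_eq] using this.symm
    refine ⟨h.lpos.cur _ _, isCurrent_shift _ (h.lpos.cur _ _), h.lpos.bd 0,
      Plus.shift _ (h.lpos.bd 1), h.qdet_pos, ?_, fun k l => ?_⟩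
    · exact (conv_comm fun k l => ((hc l k).smul_right _).symm.eq).trans h.qdet_pos
    · have := h.srll_pos (0, 0) (0, 0) k l
      rw [ratio_one, mul_inv_cancel, map_one, Units.val_one,
        nop_one] at this
      simpa [lal, commute_iff_eq] using this.symm
  | .neg => by
    have hc : ∀ k l, Commute (Y 0 0 k) (Y 1 1 l) := fun k l => by
      have := h.srll_neg (0, 1) (0, 1) k l
      rw [ratio_one, mul_inv_cancel, map_one, Units.val_one,
        nop_one] at this
      simp only [funext h.lneg.zero] at this
      simpa [show (fun _ => 0 : ℤ → E) = 0 from rfl, shift_zero', conv_zero_left', deltaTerm_zero',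
        commute_iff_eq] using this.symm
    refine ⟨h.lneg.cur _ _, isCurrent_shift _ (h.lneg.cur _ _), h.lneg.bd 0,
      Minus.shift _ (h.lneg.bd 1), h.qdet_neg, ?_, fun k l => ?_⟩
    · exact (conv_comm fun k l => ((hc l k).smul_right _).symm.eq).trans h.qdet_neg
    · have := h.srll_neg (0, 0) (0, 0) k l
      rw [ratio_one, mul_inv_cancel, map_one, Units.val_one,
        nop_one] at this
      simpa [lal, commute_iff_eq] using this.symm

lemma core (h : LCore κ X Y) : Core .pos κ (lal X Y) (lbe R X Y) (lxi R X Y) := by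
  have hp := h.pair .pos
  have hn := h.pair .neg
  have cX := h.lpos.cur
  have cY := h.lneg.cur
  have e1 : κ ^ Sgn.pos.int = κ := by simp [Sgn.int]
  have e2 : κ ^ (-Sgn.pos.int) = κ⁻¹ := by simp [Sgn.int]
  have hzX : X 0 1 = 0 := funext h.lpos.zero
  have hzY : Y 1 0 = 0 := funext h.lneg.zero
  have x1 : NExch (↑(ev R ud) : R⟦X⟧) (lal X Y .pos) (X 1 0) := fun k l => by
    have := h.srll_pos (0, 1) (0, 0) k l
    rw [ratio_one] at this
    simpa [rf, lal] using this
  have x2 : NExch (↑(ev R udq)⁻¹ : R⟦X⟧) (Y 0 1) (lal X Y .neg) := fun k l => by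
    have := h.srll_neg (0, 0) (1, 0) k l
    rw [ratio_one] at this
    simpa [rf, lal] using this
  have y1 : NExch (↑(rat κ uf uf) : R⟦X⟧) (lal X Y .pos) (lal X Y .neg) := fun k l => by
    simpa [rf, lal, rat] using h.srll_mixed (0, 0) (0, 0) k l
  have y2 : NExch (↑(rat κ uf (uf * ud)) : R⟦X⟧) (lal X Y .pos) (Y 0 1) := fun k l => by
    simpa [rf, lal, rat, hzX, conv_zero_right', shift_zero', deltaTerm_zero'] using
      h.srll_mixed (0, 0) (0, 1) k l
  have y3 : NExch (↑(rat κ (uf * udq) uf) : R⟦X⟧) (X 1 0) (lal X Y .neg) := fun k l => by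
    simpa [rf, lal, rat, hzY, conv_zero_left', deltaTerm_zero'] using h.srll_mixed (1, 0) (0, 0) k l
  have z1 : NExch (↑(rat κ 1 ud) : R⟦X⟧) (lal X Y .pos) (lxi R X Y .neg) := by
    have := (y2.conv_second hp.cur (cY _ _) hn.cur' (Or.inr hn.bd')
      (hn.nexch_second hp.cur y1)).neg_second
    rw [rat_inv, ← Units.val_mul, rat_mul, mul_inv_cancel, mul_comm uf,
      mul_inv_cancel_right] at this
    exact this
  have z2 : NExch (↑(rat κ udq 1) : R⟦X⟧) (lxi R X Y .pos) (lal X Y .neg) := by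
    have := y3.conv_first (cX _ _) hn.cur hp.cur' (Or.inl hp.bd') (hp.nexch_first hn.cur y1)
    rw [rat_inv, ← Units.val_mul, rat_mul, mul_inv_cancel, mul_comm uf,
      mul_inv_cancel_right] at this
    exact this
  have c1 : NExch (1 : R⟦X⟧) (lal X Y .pos) (lbe R X Y .pos) :=
    nexch_one_iff.2 fun k l => (hp.comm_mixed l k).eq
  have c2 : NExch (1 : R⟦X⟧) (lbe R X Y .neg) (lal X Y .neg) :=
    nexch_one_iff.2 fun k l => (hn.comm_mixed k l).symm.eq
  refine ⟨h.pair, ?_, y1, ?_, ?_, ?_, ?_, ?_, ?_⟩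
  · rintro (_ | _)
    · exact isCurrent_conv (cX _ _) hp.cur'
    · exact (isCurrent_conv hn.cur' (cY _ _)).neg
  · have := c1.conv_second hp.cur hp.cur' (cX _ _) (Or.inl hp.bd') x1
    rwa [one_mul] at this
  · rw [e1]
    simpa [rat] using z1
  · have := (c2.conv_first hn.cur' hn.cur (cY _ _) (Or.inr hn.bd') x2).neg_first
    rwa [one_mul] at this
  · rw [e2]
    simpa [rat] using z2
  · rintro (_ | _)
    · have hq : Quad (qu R 0 : R) (X 1 0) := by
        rw [qu_zero, Units.val_one]
        refine quad_one_of_commute fun k l => ?_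
        have := h.srll_pos (1, 1) (0, 0) l k
        rw [ratio_one] at this
        simpa [rf, nop_one] using this
      refine hq.conv_right (cX _ _) hp.cur' hp.bd' (fun k l => (hp.symm.comm k l).eq)
        (hp.nexch_first (cX _ _) x1) (a := (qu R 1 : R)) ?_
      rw [inv_inv, show (2 * ((Sgn.pos.int * Sgn.pos.int : ℤ) : ℂ)) = 2 by simp [Sgn.int]]
      exact ev_identity X_sub_mul_d
    · have hq : Quad (qu R 0 : R) (Y 0 1) := by
        rw [qu_zero, Units.val_one]
        refine quad_one_of_commute fun k l => ?_
        have := h.srll_neg (0, 0) (1, 1) l k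
        rw [ratio_one] at this
        simpa [rf, nop_one] using this
      refine (hq.conv_left (cY _ _) hn.cur' hn.bd' (fun k l => (hn.symm.comm k l).eq)
        (hn.nexch_second (cY _ _) x2) (a := (qu R (-1) : R)) ?_).neg
      rw [inv_inv, ← map_inv,
        show (2 * ((Sgn.pos.int * Sgn.neg.int : ℤ) : ℂ)) = -2 by simp [Sgn.int]]
      exact ev_identity X_sub_mul_inv_dq
  · have hrel : NRel (↑(rat κ (uf * udq) (uf * ud)) : R⟦X⟧) (X 1 0) (Y 0 1) fun k l => cq R •
        (deltaTerm κ⁻¹ (conv (Y 1 1) (shift κ (X 0 0))) k l -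
          deltaTerm κ (conv (Y 0 0) (shift κ⁻¹ (X 1 1))) k l) := fun k l => by
      have := h.srll_mixed (1, 0) (0, 1) k l
      beta_reduce
      rw [smul_sub, ← add_sub_assoc]
      simpa [rf, lal, rat] using this
    have h1 := hrel.conv_first_delta (cX _ _) (cY _ _) hp.cur'
      (isCurrent_conv (cY _ _) (isCurrent_shift _ (cX _ _)))
      (isCurrent_conv (cY _ _) (isCurrent_shift _ (cX _ _))) hp.bd' (hp.nexch_first (cY _ _) y2)
    have p0 : conv (conv (Y 1 1) (shift κ (X 0 0))) (shift κ⁻¹⁻¹ (lbe R X Y .pos)) = Y 1 1 := by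
      rw [inv_inv, conv_assoc (cY _ _) (isCurrent_shift κ (cX _ _)) (hp.shift _).cur'
        (Or.inl ⟨(hp.shift κ).bd, (hp.shift κ).bd'⟩)]
      exact (congrArg _ (hp.shift κ).mul).trans (conv_one _)
    have cX11 : shift (qu R 2) (lbe R X Y .pos) = X 1 1 := shift_two_neg_two _
    have cY11 : shift (qu R 2) (lbe R X Y .neg) = Y 1 1 := shift_two_neg_two _
    have p1 : conv (conv (Y 0 0) (shift κ⁻¹ (X 1 1))) (shift κ⁻¹ (lbe R X Y .pos)) =
        conv (Y 0 0) (shift κ⁻¹ (Phi R .pos (lal X Y) (lbe R X Y) .pos)) := by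
      have h2 := (hp.symm.shift (qu R 2)).shift κ⁻¹
      rw [cX11] at h2
      rw [conv_assoc (cY _ _) h2.cur (hp.shift _).cur' (Or.inl ⟨h2.bd, (hp.shift _).bd'⟩),
        ← shift_conv _ (cX _ _) hp.cur' (Or.inl hp.bd')]
      congr 2
      change _ = conv (lbe R X Y .pos) (shift (qu R 2) (lbe R X Y .pos))
      rw [cX11]
      have h3 := hp.symm.shift (qu R 2)
      refine conv_comm fun k l => ?_
      rw [← cX11]
      exact (commute_shift (qu R 2) (fun m => hp.symm.comm l m) k).symm.eq
    rw [p0, p1] at h1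
    have hPhi : InvPair R .pos (shift κ⁻¹ (Phi R .pos (lal X Y) (lbe R X Y) .pos))
      (shift κ⁻¹ (dblc R (lal X Y .pos))) := (hp.symm.dblc).shift κ⁻¹
    have h2 := h1.conv_second_delta (isCurrent_conv (cX _ _) hp.cur') (cY _ _) hn.cur' (cY _ _)
      (isCurrent_conv (cY _ _) hPhi.cur) hn.bd'
      (hn.nexch_second (isCurrent_conv (cX _ _) hp.cur') z2)
    have p2 : conv (lbe R X Y .neg) (Y 1 1) = Phi R .pos (lal X Y) (lbe R X Y) .neg := by
      change _ = conv (lbe R X Y .neg) (shift (qu R 2) (lbe R X Y .neg))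
      rw [cY11]
    have p3 : conv (lbe R X Y .neg)
        (conv (Y 0 0) (shift κ⁻¹ (Phi R .pos (lal X Y) (lbe R X Y) .pos))) =
        shift κ⁻¹ (Phi R .pos (lal X Y) (lbe R X Y) .pos) := by
      rw [← conv_assoc hn.cur' (cY _ _) hPhi.cur (Or.inr (Or.inl ⟨hn.bd', hn.bd⟩))]
      exact (congrArg (fun Z => conv Z _) hn.mul').trans (one_conv _)
    rw [p2, p3, ← Units.val_mul, ← Units.val_mul,
      show (rat κ (uf * udq) (uf * ud) * (rat κ uf (uf * ud))⁻¹ * (rat κ udq 1)⁻¹ :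
        R⟦X⟧ˣ) = 1 by
        rw [rat_inv, rat_inv, rat_mul, rat_mul]
        rw [inv_one, mul_one, mul_inv_cancel, mul_comm uf udq, mul_inv_cancel_right, mul_inv_cancel]
        simp [rat], Units.val_one] at h2
    intro k l
    have h3 := h2 k l
    change -conv (lbe R X Y .neg) (Y 0 1) l * _ = nop _ _
      (fun k => -conv (lbe R X Y .neg) (Y 0 1) k) k l + _
    rw [nop_neg_second, neg_mul, show lxi R X Y .pos = conv (X 1 0) (lbe R X Y .pos) from rfl, h3,
      neg_add, e1, e2]
    congr 1
    beta_reduce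
    rw [← neg_smul]
    simp [Sgn.int]

end LCore

lemma lal_lpos (A A' e : Sgn → ℤ → E) : lal (lpos R A A' e) (lneg R A A' e) = A := by
  funext s; cases s <;> rfl

lemma lbe_lpos (A A' e : Sgn → ℤ → E) : lbe R (lpos R A A' e) (lneg R A A' e) = A' := by
  funext s; cases s
  · exact shift_neg_two_two _
  · exact shift_neg_two_two _

lemma conv_neg' (X Y : ℤ → E) : conv X (fun k => -Y k) = fun k => -conv X Y k := by
  funext k
  rw [conv, conv, ← tsum_neg]
  simp only [mul_neg]

lemma neg_conv' (X Y : ℤ → E) : conv (fun k => -X k) Y = fun k => -conv X Y k := by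
  funext k
  rw [conv, conv, ← tsum_neg]
  simp only [neg_mul]

lemma Core.lxi_lpos {κ : Rˣ} {A A' e : Sgn → ℤ → E} (h : Core .pos κ A A' e) :
    lxi R (lpos R A A' e) (lneg R A A' e) = e := by
  have hp := h.pair .pos
  have hn := h.pair .neg
  funext s; cases s
  · change conv (conv (e .pos) (A .pos)) (lbe R (lpos R A A' e) (lneg R A A' e) .pos) = _
    rw [lbe_lpos, conv_assoc (h.cur _) hp.cur hp.cur' (Or.inl ⟨hp.bd, hp.bd'⟩), hp.mul, conv_one]
  · change (fun k => -conv (lbe R (lpos R A A' e) (lneg R A A' e) .neg)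
      (fun k => -conv (A .neg) (e .neg) k) k) = _
    rw [lbe_lpos, conv_neg', ← conv_assoc hn.cur' hn.cur (h.cur _)
      (Or.inr (Or.inl ⟨hn.bd', hn.bd⟩)), hn.mul', one_conv]
    simp only [_root_.neg_neg]

lemma Core.lcore [Algebra B E] {κ : Rˣ} {A A' e : Sgn → ℤ → E} (h : Core .pos κ A A' e) :
    LCore κ (lpos R A A' e) (lneg R A A' e) where
  lpos := h.lPos
  lneg := h.lNeg
  srll_pos := h.srll_pos
  srll_neg := h.srll_neg
  srll_mixed := h.srll_mixed
  qdet_pos := (congrArg _ (shift_neg_two_two _)).trans (h.pair .pos).mul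
  qdet_neg := (congrArg _ (shift_neg_two_two _)).trans (h.pair .neg).mul

lemma LCore.lpos_lal {κ : Rˣ} {X Y : Fin 2 → Fin 2 → ℤ → E} (h : LCore κ X Y) :
    QCurrent.lpos R (lal X Y) (lbe R X Y) (lxi R X Y) = X := by
  have hp := h.pair .pos
  funext i j
  match i, j with
  | 0, 0 => rfl
  | 0, 1 => exact (funext h.lpos.zero).symm
  | 1, 0 =>
    change conv (conv (X 1 0) (lbe R X Y .pos)) (lal X Y .pos) = _
    rw [conv_assoc (h.lpos.cur _ _) hp.cur' hp.cur (Or.inl ⟨hp.bd', hp.bd⟩), hp.mul', conv_one]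
  | 1, 1 => exact shift_two_neg_two _

lemma LCore.lneg_lal {κ : Rˣ} {X Y : Fin 2 → Fin 2 → ℤ → E} (h : LCore κ X Y) :
    QCurrent.lneg R (lal X Y) (lbe R X Y) (lxi R X Y) = Y := by
  have hn := h.pair .neg
  funext i j
  match i, j with
  | 0, 0 => rfl
  | 1, 0 => exact (funext h.lneg.zero).symm
  | 0, 1 =>
    change (fun k => -conv (lal X Y .neg) (fun k => -conv (lbe R X Y .neg) (Y 0 1) k) k) = _
    rw [conv_neg', ← conv_assoc hn.cur hn.cur' (h.lneg.cur _ _)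
      (Or.inr (Or.inl ⟨hn.bd, hn.bd'⟩)), hn.mul, one_conv]
    simp only [_root_.neg_neg]
  | 1, 1 => exact shift_two_neg_two _

end

/-! ### Homogeneous pieces of the completed algebras -/

section Pieces

variable {T : Theory} {n : ℕ}

variable (T n) in
/-- The vectors of all representations. -/
abbrev Pt : Type 1 := Σ V : Rep T n, V.carrier

lemma homog_mul {j k : ℤ} {x y : FreeAlgebra B (Fin n × T.Gen)} (hx : x ∈ homog T n j)
    (hy : y ∈ homog T n k) : x * y ∈ homog T n (j + k) := by
  have h := Submodule.mul_mem_mul hx hy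
  rw [homog, homog, Submodule.span_mul_span] at h
  refine Submodule.span_le.2 ?_ h
  rintro _ ⟨_, ⟨w, rfl, rfl⟩, _, ⟨w', rfl, rfl⟩, rfl⟩
  exact Submodule.subset_span ⟨w ++ w', by simp, by simp⟩

lemma one_mem_homog : (1 : FreeAlgebra B (Fin n × T.Gen)) ∈ homog T n 0 :=
  Submodule.subset_span ⟨[], by simp, by simp⟩

variable (T n) in
/-- The homogeneous elements of degree `k`. -/
def pieceSub (k : ℤ) : Submodule B ((V : Rep T n) → Module.End B V.carrier) where
  carrier := piece T n k
  zero_mem' S := ⟨0, zero_mem _, fun p _ => by rw [map_zero]; rfl⟩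
  add_mem' {η θ} hη hθ S := by
    obtain ⟨x, hx, h1⟩ := hη S
    obtain ⟨y, hy, h2⟩ := hθ S
    refine ⟨x + y, add_mem hx hy, fun p hp => ?_⟩
    rw [map_add, LinearMap.add_apply, ← h1 p hp, ← h2 p hp]
    rfl
  smul_mem' c η hη S := by
    obtain ⟨x, hx, h1⟩ := hη S
    refine ⟨c • x, Submodule.smul_mem _ _ hx, fun p hp => ?_⟩
    rw [map_smul, LinearMap.smul_apply, ← h1 p hp]
    rfl

lemma piece_mul {j k : ℤ} {η θ : (V : Rep T n) → Module.End B V.carrier} (hη : η ∈ piece T n j)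
    (hθ : θ ∈ piece T n k) : η * θ ∈ piece T n (j + k) := by
  classical
  intro S
  obtain ⟨y, hy, h2⟩ := hθ S
  obtain ⟨x, hx, h1⟩ := hη (S.image fun p : Pt T n => (⟨p.1, p.1.eval y p.2⟩ : Pt T n))
  refine ⟨x * y, homog_mul hx hy, fun p hp => ?_⟩
  rw [map_mul, Module.End.mul_apply, Pi.mul_apply, Module.End.mul_apply, h2 p hp]
  exact h1 ⟨p.1, p.1.eval y p.2⟩ (Finset.mem_image_of_mem _ hp)

lemma one_mem_piece : (1 : (V : Rep T n) → Module.End B V.carrier) ∈ piece T n 0 :=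
  fun S => ⟨1, one_mem_homog, fun p _ => by rw [map_one]; rfl⟩

lemma act_mem_piece (i : Fin n) (x : T.Gen) : (gen T i x).1 ∈ piece T n (T.deg x) := by
  intro S
  refine ⟨FreeAlgebra.ι B (i, x), Submodule.subset_span ⟨[(i, x)], by simp, by simp⟩, ?_⟩
  intro p _
  simp [Rep.eval, gen]

lemma piece_of_forall {k : ℤ} {η : (V : Rep T n) → Module.End B V.carrier}
    (h : ∀ S : Finset (Pt T n), ∃ θ ∈ piece T n k, ∀ p ∈ S, η p.1 p.2 = θ p.1 p.2) :
    η ∈ piece T n k := fun S => by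
  obtain ⟨θ, hθ, h1⟩ := h S
  obtain ⟨x, hx, h2⟩ := hθ S
  exact ⟨x, hx, fun p hp => (h1 p hp).trans (h2 p hp)⟩

lemma piece_subset_completed {k : ℤ} {η : (V : Rep T n) → Module.End B V.carrier}
    (h : η ∈ piece T n k) : η ∈ completed T n :=
  Algebra.subset_adjoin (Set.mem_iUnion.2 ⟨k, h⟩)

lemma completed_eq : Subalgebra.toSubmodule (completed T n) = ⨆ k, pieceSub T n k := by
  refine le_antisymm (fun η hη => ?_) (iSup_le fun k η hη => piece_subset_completed hη)
  refine Algebra.adjoin_induction (p := fun η _ => η ∈ ⨆ k, pieceSub T n k) ?_ ?_ ?_ ?_ hη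
  · intro η h
    obtain ⟨k, hk⟩ := Set.mem_iUnion.1 h
    exact Submodule.mem_iSup_of_mem k hk
  · intro r
    refine Submodule.mem_iSup_of_mem 0 ?_
    rw [Algebra.algebraMap_eq_smul_one]
    exact (pieceSub T n 0).smul_mem r one_mem_piece
  · exact fun _ _ _ _ => Submodule.add_mem _
  · intro η θ _ _ h1 h2
    refine Submodule.iSup_induction _ (motive := fun η => η * θ ∈ ⨆ k, pieceSub T n k) h1
      (fun j η hj => ?_) (by rw [zero_mul]; exact zero_mem _)
      (fun _ _ h h' => by rw [add_mul]; exact add_mem h h')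
    refine Submodule.iSup_induction _ (motive := fun θ => η * θ ∈ ⨆ k, pieceSub T n k) h2
      (fun k θ hk => ?_) (by rw [mul_zero]; exact zero_mem _)
      (fun _ _ h h' => by rw [mul_add]; exact add_mem h h')
    exact Submodule.mem_iSup_of_mem (j + k) (piece_mul hj hk)

lemma completed_induction {P : Completed T n → Prop}
    (h : ∀ k (η : Completed T n), η.1 ∈ piece T n k → P η) (h0 : P 0)
    (hadd : ∀ η θ, P η → P θ → P (η + θ)) (η : Completed T n) : P η := by
  have key : ∀ η ∈ ⨆ k, pieceSub T n k, ∃ hη : η ∈ completed T n, P ⟨η, hη⟩ := by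
    intro η hη
    refine Submodule.iSup_induction _ (motive := fun η => ∃ hη : η ∈ completed T n, P ⟨η, hη⟩) hη
      (fun j η hj => ⟨piece_subset_completed hj, h j ⟨η, piece_subset_completed hj⟩ hj⟩)
      ⟨Subalgebra.zero_mem _, h0⟩ ?_
    rintro η θ ⟨h1, h2⟩ ⟨h3, h4⟩
    exact ⟨Subalgebra.add_mem _ h1 h3, hadd _ _ h2 h4⟩
  exact (key η.1 (completed_eq ▸ η.2)).2

lemma Rep.split (V : Rep T n) (i : Fin n) (w : List (Fin n × T.Gen)) :
    (w.map fun p => V.act p.1 p.2).prod =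
      ((w.filter fun p => p.1 ≠ i).map fun p => V.act p.1 p.2).prod *
        (((w.filter fun p => p.1 = i).map Prod.snd).map (V.act i)).prod := by
  induction w with
  | nil => simp
  | cons p w ih =>
    obtain ⟨j, x⟩ := p
    by_cases h : j = i
    · subst h
      simp only [List.map_cons, List.prod_cons, ih, ne_eq, not_true_eq_false, decide_false,
        Bool.false_eq_true, not_false_eq_true, List.filter_cons_of_neg, decide_true,
        List.filter_cons_of_pos]
      rw [← mul_assoc, ← mul_assoc]
      congr 1
      refine (Commute.list_prod_right _ _ fun y hy => ?_).eq
      obtain ⟨q, hq, rfl⟩ := List.mem_map.1 hy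
      have := (List.mem_filter.1 hq).2
      simp only [ne_eq, decide_not, Bool.not_eq_eq_eq_not, Bool.not_true,
        decide_eq_false_iff_not] at this
      exact V.comm _ _ (Ne.symm this) _ _
    · simp [h, ih, mul_assoc]

lemma sum_deg_split (w : List (Fin n × T.Gen)) : (w.map fun p => T.deg p.2).sum =
    ∑ i : Fin n, (((w.filter fun p => p.1 = i).map Prod.snd).map T.deg).sum := by
  induction w with
  | nil => simp
  | cons p w ih =>
    rw [List.map_cons, List.sum_cons, ih, ← Finset.sum_erase_add _ _ (Finset.mem_univ p.1),
      ← Finset.sum_erase_add _ _ (Finset.mem_univ p.1)]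
    simp only [decide_true, List.filter_cons_of_pos, List.map_cons, List.sum_cons]
    rw [add_comm (T.deg p.2), add_assoc, add_comm (T.deg p.2)]
    congr 1
    refine Finset.sum_congr rfl fun i hi => ?_
    rw [List.filter_cons_of_neg]
    simpa using (Finset.ne_of_mem_erase hi).symm

lemma Rep.eval_prod (V : Rep T n) (w : List (Fin n × T.Gen)) :
    V.eval (w.map (FreeAlgebra.ι B)).prod = (w.map fun p => V.act p.1 p.2).prod := by
  rw [map_list_prod, List.map_map]
  congr 1
  exact List.map_congr_left fun p _ => by simp [Rep.eval]

lemma Rep.exists_bound (V : Rep T n) (v : V.carrier) : ∃ N : ℤ, ∀ k, N ≤ T.sgn * k →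
    ∀ x ∈ homog T n k, V.eval x v = 0 := by
  choose N hN using fun i => V.bounded i v
  refine ⟨∑ i, N i + 1, fun k hk x hx => ?_⟩
  suffices h : homog T n k ≤ LinearMap.ker ((LinearMap.applyₗ v).comp V.eval.toLinearMap) from h hx
  refine Submodule.span_le.2 ?_
  rintro _ ⟨w, rfl, rfl⟩
  rw [sum_deg_split, Finset.mul_sum] at hk
  obtain ⟨i, -, hi⟩ := Finset.exists_lt_of_sum_lt (Int.add_one_le_iff.1 hk)
  change V.eval _ v = 0
  rw [V.eval_prod, V.split i, Module.End.mul_apply, hN i _ hi.le, map_zero]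

lemma exists_bound_piece (V : Rep T n) (v : V.carrier) : ∃ N : ℤ, ∀ k, N ≤ T.sgn * k →
    ∀ η ∈ piece T n k, η V v = 0 := by
  classical
  obtain ⟨N, hN⟩ := V.exists_bound v
  refine ⟨N, fun k hk η hη => ?_⟩
  obtain ⟨x, hx, h⟩ := hη {⟨V, v⟩}
  rw [h ⟨V, v⟩ (Finset.mem_singleton_self _)]
  exact hN k hk x hx

/-! ### Topology -/

lemma mem_nhds_completed {η : Completed T n} {U : Set (Completed T n)} :
    U ∈ 𝓝 η ↔ ∃ S : Finset (Pt T n), {θ | ∀ p ∈ S, θ.1 p.1 p.2 = η.1 p.1 p.2} ⊆ U := by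
  have h : 𝓝 η = ⨅ p : Pt T n, 𝓟 {θ : Completed T n | θ.1 p.1 p.2 = η.1 p.1 p.2} := by
    rw [nhds_iInf]
    refine iInf_congr fun p => ?_
    letI : TopologicalSpace p.1.carrier := ⊥
    haveI : DiscreteTopology p.1.carrier := ⟨rfl⟩
    rw [nhds_induced, nhds_discrete, ← principal_singleton, comap_principal]
    rfl
  rw [h, (hasBasis_iInf_principal_finite _).mem_iff]
  constructor
  · rintro ⟨t, ht, hU⟩
    refine ⟨ht.toFinset, fun θ hθ => hU ?_⟩
    simp only [Set.mem_iInter]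
    exact fun p hp => hθ p (ht.mem_toFinset.2 hp)
  · rintro ⟨S, hU⟩
    refine ⟨S, S.finite_toSet, fun θ hθ => hU ?_⟩
    simp only [Set.mem_iInter] at hθ
    exact hθ

lemma tendsto_completed_iff {α : Type*} {l : Filter α} {F : α → Completed T n}
    {η : Completed T n} : Tendsto F l (𝓝 η) ↔ ∀ V v, ∀ᶠ a in l, (F a).1 V v = η.1 V v := by
  constructor
  · intro h V v
    exact h (mem_nhds_completed.2 ⟨{⟨V, v⟩}, fun θ hθ => hθ ⟨V, v⟩ (Finset.mem_singleton_self _)⟩)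
  · intro h U hU
    obtain ⟨S, hS⟩ := mem_nhds_completed.1 hU
    have : ∀ᶠ a in l, ∀ p ∈ S, (F a).1 p.1 p.2 = η.1 p.1 p.2 :=
      (Filter.eventually_all_finset S).2 fun p _ => h p.1 p.2
    exact this.mono fun a ha => hS ha

lemma continuous_completed_iff {α : Type*} [TopologicalSpace α] {F : α → Completed T n} :
    Continuous F ↔ ∀ a V v, ∀ᶠ b in 𝓝 a, (F b).1 V v = (F a).1 V v := by
  rw [continuous_iff_continuousAt]
  exact forall_congr' fun a => tendsto_completed_iff

lemma eventually_eval (η : Completed T n) (V : Rep T n) (v : V.carrier) :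
    ∀ᶠ θ in 𝓝 η, θ.1 V v = η.1 V v := tendsto_completed_iff.1 tendsto_id V v

lemma completed_ext {η θ : Completed T n} (h : ∀ V v, η.1 V v = θ.1 V v) : η = θ :=
  Subtype.ext (funext fun V => LinearMap.ext (h V))

instance : T2Space (Completed T n) := by
  refine t2_iff_nhds.2 fun {η θ} h => ?_
  refine completed_ext fun V v => ?_
  obtain ⟨ζ, h1, h2⟩ := (h.nonempty_of_mem (inter_mem_inf (eventually_eval η V v)
    (eventually_eval θ V v)))
  exact h1.symm.trans h2

instance : IsTopologicalAddGroup (Completed T n) where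
  continuous_add := continuous_completed_iff.2 fun a V v => by
    rw [nhds_prod_eq]
    filter_upwards [(eventually_eval a.1 V v).prod_mk (eventually_eval a.2 V v)] with b hb
    exact congrArg₂ (· + ·) hb.1 hb.2
  continuous_neg := continuous_completed_iff.2 fun a V v => by
    filter_upwards [eventually_eval a V v] with b hb
    exact congrArg Neg.neg hb

instance : SeparatelyContinuousMul (Completed T n) where
  continuous_const_mul {a} := continuous_completed_iff.2 fun b V v => by
    filter_upwards [eventually_eval b V v] with c hc
    exact congrArg (a.1 V) hc
  continuous_mul_const {a} := continuous_completed_iff.2 fun b V v =>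
    (eventually_eval b V (a.1 V v)).mono fun c hc => hc

lemma isClosed_piece (k : ℤ) : IsClosed {η : Completed T n | η.1 ∈ piece T n k} := by
  refine isClosed_of_closure_subset fun η hη => piece_of_forall fun S => ?_
  obtain ⟨θ, h1, h2⟩ := mem_closure_iff_nhds.1 hη _ (mem_nhds_completed.2 ⟨S, le_rfl⟩)
  exact ⟨θ.1, h2, fun p hp => (h1 p hp).symm⟩

lemma hasSum_completed_iff {ι : Type} {F : ι → Completed T n} {η : Completed T n} :
    HasSum F η ↔ ∀ V v, (∃ t : Finset ι, ∀ s, t ⊆ s → ∑ i ∈ s, (F i).1 V v = η.1 V v) := by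
  rw [HasSum, tendsto_completed_iff]
  refine forall₂_congr fun V v => ?_
  rw [SummationFilter.unconditional_filter, eventually_atTop]
  have : ∀ s : Finset ι, (∑ i ∈ s, F i).1 V v = ∑ i ∈ s, (F i).1 V v := fun s => by
    rw [← Subalgebra.coe_val, map_sum, Finset.sum_apply, LinearMap.sum_apply]
    try rfl
  simp only [this]

/-- A family of homogeneous elements which vanish at every vector up to finitely many exceptions is
summable. -/
lemma summable_completed {k : ℤ} {ι : Type} {F : ι → Completed T n}
    (hF : ∀ i, (F i).1 ∈ piece T n k) (h0 : Tendsto F cofinite (𝓝 0)) : Summable F := by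
  classical
  have hfin : ∀ V v, (Function.support fun i => (F i).1 V v).Finite := fun V v =>
    tendsto_completed_iff.1 h0 V v
  let η : (V : Rep T n) → Module.End B V.carrier := fun V =>
    { toFun := fun v => ∑ᶠ i, (F i).1 V v
      map_add' := fun v v' => by
        rw [← finsum_add_distrib (hfin V v) (hfin V v')]
        simp only [map_add]
      map_smul' := fun c v => by
        rw [RingHom.id_apply, smul_finsum' c (hfin V v)]
        simp only [map_smul] }
  have hη : η ∈ piece T n k := by
    refine piece_of_forall fun S => ?_
    let t : Finset ι := S.biUnion fun p => (hfin p.1 p.2).toFinset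
    refine ⟨∑ i ∈ t, (F i).1, (pieceSub T n k).sum_mem fun i _ => hF i, fun p hp => ?_⟩
    change ∑ᶠ i, (F i).1 p.1 p.2 = _
    rw [Finset.sum_apply, LinearMap.sum_apply]
    refine finsum_eq_sum_of_support_subset _ fun i hi => ?_
    exact Finset.mem_biUnion.2 ⟨p, hp, (hfin p.1 p.2).mem_toFinset.2 hi⟩
  refine ⟨⟨η, piece_subset_completed hη⟩, hasSum_completed_iff.2 fun V v => ?_⟩
  refine ⟨(hfin V v).toFinset, fun s hs => (finsum_eq_sum_of_support_subset _ fun i hi => ?_).symm⟩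
  exact hs ((hfin V v).mem_toFinset.2 hi)

lemma hasSum_eval {ι : Type} {F : ι → Completed T n} {η : Completed T n} (h : HasSum F η)
    (V : Rep T n) (v : V.carrier) : (Function.support fun i => (F i).1 V v).Finite ∧
      ∑ᶠ i, (F i).1 V v = η.1 V v := by
  classical
  obtain ⟨t, ht⟩ := hasSum_completed_iff.1 h V v
  have h1 : ∀ i, i ∉ t → (F i).1 V v = 0 := fun i hi => by
    have := ht (insert i t) (Finset.subset_insert _ _)
    rw [Finset.sum_insert hi, ht t le_rfl] at this
    exact add_eq_right.1 this
  have h2 : (Function.support fun i => (F i).1 V v) ⊆ t := fun i hi => by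
    by_contra h'
    exact hi (h1 i h')
  exact ⟨t.finite_toSet.subset h2, by rw [finsum_eq_sum_of_support_subset _ h2, ht t le_rfl]⟩

/-! ### Central elements -/

lemma commute_of_gens {x : Completed T n} (h : ∀ i y, Commute x (gen T i y)) (η : Completed T n) :
    Commute x η := by
  classical
  refine completed_induction (P := Commute x) (fun k η hη => ?_) (Commute.zero_right x)
    (fun _ _ => Commute.add_right) η
  refine completed_ext fun V v => ?_
  obtain ⟨p, -, hp⟩ := hη {⟨V, v⟩, ⟨V, x.1 V v⟩}
  have hc : ∀ p, Commute (x.1 V) (V.eval p) := by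
    intro p
    induction p using FreeAlgebra.induction with
    | grade0 r => rw [AlgHom.commutes]; exact (Algebra.commutes r _).symm
    | grade1 y =>
      rw [Rep.eval, FreeAlgebra.lift_ι_apply]
      exact congrFun (congrArg Subtype.val (h y.1 y.2)) V
    | mul a b ha hb => rw [map_mul]; exact ha.mul_right hb
    | add a b ha hb => rw [map_add]; exact ha.add_right hb
  change x.1 V (η.1 V v) = η.1 V (x.1 V v)
  rw [hp ⟨V, v⟩ (by simp), hp ⟨V, x.1 V v⟩ (by simp)]
  exact LinearMap.congr_fun (hc p).eq v

variable (T n) in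
/-- The central elements of degree zero. -/
def centSub : Subalgebra B (Completed T n) where
  carrier := {x | x.1 ∈ piece T n 0 ∧ ∀ y, Commute x y}
  mul_mem' h h' := ⟨by simpa using piece_mul h.1 h'.1, fun y => (h.2 y).mul_left (h'.2 y)⟩
  add_mem' h h' := ⟨(pieceSub T n 0).add_mem h.1 h'.1, fun y => (h.2 y).add_left (h'.2 y)⟩
  algebraMap_mem' r := ⟨by
    rw [Algebra.algebraMap_eq_smul_one]
    exact (pieceSub T n 0).smul_mem r one_mem_piece, Algebra.commutes r⟩

variable (T n) in
/-- The ring of central elements of degree zero. -/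
def Cent : Type 1 := centSub T n

instance : CommRing (Cent T n) :=
  { (inferInstance : Ring (centSub T n)) with
    mul_comm := fun x y => Subtype.ext (x.2.2 y.1) }

instance : Algebra B (Cent T n) := inferInstanceAs (Algebra B (centSub T n))

instance : Algebra (Cent T n) (Completed T n) :=
  RingHom.toAlgebra' (centSub T n).val.toRingHom fun x y => x.2.2 y

instance : IsScalarTower B (Cent T n) (Completed T n) where
  smul_assoc b x y := smul_mul_assoc b x.1 y

variable (T n) in
/-- The homogeneous elements of degree `k`. -/
def gradingC (k : ℤ) : Submodule (Cent T n) (Completed T n) where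
  carrier := {η | η.1 ∈ piece T n k}
  zero_mem' := (pieceSub T n k).zero_mem
  add_mem' h h' := (pieceSub T n k).add_mem h h'
  smul_mem' r η h := by
    have := piece_mul r.2.1 h
    rwa [zero_add] at this

variable (T n) in
/-- The elements that vanish on a finite set of vectors. -/
def vanishing (S : Finset (Pt T n)) : Submodule (Cent T n) (Completed T n) where
  carrier := {η | ∀ p ∈ S, η.1 p.1 p.2 = 0}
  zero_mem' _ _ := rfl
  add_mem' h h' p hp := by
    rename_i a b
    change a.1 p.1 p.2 + b.1 p.1 p.2 = 0
    rw [h p hp, h' p hp, add_zero]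
  smul_mem' r η h p hp := by
    change r.1.1 p.1 (η.1 p.1 p.2) = 0
    rw [h p hp, map_zero]

lemma exists_bound_finset (S : Finset (Pt T n)) : ∃ N : ℤ, ∀ k, N ≤ T.sgn * k →
    ∀ η ∈ piece T n k, ∀ p ∈ S, η p.1 p.2 = 0 := by
  choose N hN using fun p : Pt T n => exists_bound_piece p.1 p.2
  refine ⟨∑ p ∈ S, |N p|, fun k hk η hη p hp => hN p k ?_ η hη⟩
  exact (le_abs_self _).trans ((Finset.single_le_sum (fun p _ => abs_nonneg (N p)) hp).trans hk)

instance [hT : Fact (T.sgn = 1)] : CurrentRing (Cent T n) (Completed T n) where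
  grading := gradingC T n
  one_mem_grading := one_mem_piece
  mul_mem_grading := piece_mul
  isClosed_grading := isClosed_piece
  exists_small s U hU := by
    obtain ⟨S, hS⟩ := mem_nhds_completed.1 hU
    obtain ⟨N, hN⟩ := exists_bound_finset S
    refine ⟨vanishing T n S, hS, N, fun i j _ hj x _ y hy p hp => ?_⟩
    change x.1 p.1 (y.1 p.1 p.2) = 0
    rw [hN j (by rw [hT.out, one_mul]; exact hj) y.1 hy p hp, map_zero]
  summable_of_tendsto s ι F hF h := summable_completed hF h

/-- The opposite of a submodule. -/
def opSub {R E : Type*} [CommRing R] [Ring E] [Algebra R E] (S : Submodule R E) :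
    Submodule R Eᵐᵒᵖ where
  carrier := {x | x.unop ∈ S}
  zero_mem' := S.zero_mem
  add_mem' h h' := S.add_mem h h'
  smul_mem' r _ h := S.smul_mem r h

instance [hT : Fact (T.sgn = -1)] : CurrentRing (Cent T n) (Completed T n)ᵐᵒᵖ where
  grading k := opSub (gradingC T n k)
  one_mem_grading := one_mem_piece
  mul_mem_grading {i j} _ _ hx hy := by
    rw [add_comm]
    exact piece_mul hy hx
  isClosed_grading k := (isClosed_piece k).preimage continuous_unop
  exists_small s U hU := by
    obtain ⟨S, hS⟩ := mem_nhds_completed.1 (show op ⁻¹' U ∈ 𝓝 (0 : Completed T n) from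
      continuous_op.continuousAt.preimage_mem_nhds hU)
    obtain ⟨N, hN⟩ := exists_bound_finset S
    refine ⟨opSub (vanishing T n S), fun x hx => hS (a := x.unop) hx, N + s, ?_⟩
    intro i j hij hj x hx y _ p hp
    change y.unop.1 p.1 (x.unop.1 p.1 p.2) = 0
    rw [hN i (by rw [hT.out]; omega) _ hx p hp, map_zero]
  summable_of_tendsto s ι F hF h := by
    have := summable_completed (F := fun i => (F i).unop) (k := s) hF
      ((continuous_unop.tendsto _).comp h)
    exact this.map (opAddEquiv : Completed T n ≃+ (Completed T n)ᵐᵒᵖ) continuous_op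

end Pieces

/-! ### Maps of current rings -/

section CurrentMaps

variable {R E R' E' : Type*} [CommRing R] [Ring E] [Algebra R E] [TopologicalSpace E]
  [T2Space E] [IsTopologicalAddGroup E] [SeparatelyContinuousMul E] [CurrentRing R E]
  [Algebra B R] [Algebra B E] [IsScalarTower B R E]
  [CommRing R'] [Ring E'] [Algebra R' E'] [TopologicalSpace E']
  [T2Space E'] [IsTopologicalAddGroup E'] [SeparatelyContinuousMul E'] [CurrentRing R' E']
  [Algebra B R'] [Algebra B E'] [IsScalarTower B R' E'] {F : E →ₐ[B] E'}

variable (R) in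
/-- A map which is compatible with convergent sums of homogeneous elements. -/
def MapsSums (F : E →ₐ[B] E') : Prop := ∀ {f : ℤ → E} {a : E} {k : ℤ}, (∀ i, f i ∈ pc R k) →
  HasSum f a → HasSum (fun i => F (f i)) (F a)

lemma mapsSums_of_continuous (h : Continuous F) : MapsSums R F :=
  fun _ hf => hf.map (F : E →+ E') h

lemma MapsSums.map_conv (hF : MapsSums R F) {X Y : ℤ → E} (hX : IsCurrent R X) (hY : IsCurrent R Y)
    (h : Plus Y ∨ Minus X) : (fun k => F (conv X Y k)) = conv (fun k => F (X k)) fun k => F (Y k) := by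
  funext k
  have := (hF (fun n => mul_mem_pc' (hX (k - n)) (hY n) (sub_add_cancel k n))
    (summable_conv hX hY h k).hasSum).tsum_eq
  simp only [map_mul] at this
  exact this.symm

lemma map_shift {κ : Rˣ} {κ' : R'ˣ} (h : F (algebraMap R E κ) = algebraMap R' E' κ') (X : ℤ → E) :
    (fun k => F (shift κ X k)) = shift κ' fun k => F (X k) := by
  have h1 : Units.map ((F : E →* E').comp (algebraMap R E : R →* E)) κ =
      Units.map (algebraMap R' E' : R' →* E') κ' := Units.ext h
  funext k
  have h2 := congrArg Units.val (congrArg (· ^ k) h1)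
  simp only [← map_zpow] at h2
  rw [shift, shift, Algebra.smul_def, Algebra.smul_def, map_mul]
  exact congrArg (· * F (X k)) h2

lemma map_qu (t : ℂ) : F (algebraMap R E (qu R t : R)) =
    algebraMap R' E' ((qu R' t : R'ˣ) : R') := by
  rw [val_qu, val_qu, ← IsScalarTower.algebraMap_apply, ← IsScalarTower.algebraMap_apply,
    AlgHom.commutes]

lemma MapsSums.map_dblc (hF : MapsSums R F) {s : Sgn} {X : ℤ → E} (hX : IsCurrent R X)
    (h : Bd s X) : (fun k => F (dblc R X k)) = dblc R' fun k => F (X k) := by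
  rw [dblc, dblc, ← map_shift (map_qu (R := R) (R' := R') 2)]
  exact hF.map_conv hX (isCurrent_shift _ hX) (h.or (h.shift _))

variable {κ : Rˣ} {A A' e : Sgn → ℤ → E}

lemma MapsSums.map_lpos (hF : MapsSums R F) (h : Core .pos κ A A' e) (i j : Fin 2) :
    (fun k => F (lpos R A A' e i j k)) = lpos R' (fun s k => F (A s k)) (fun s k => F (A' s k))
      (fun s k => F (e s k)) i j :=
  match i, j with
  | 0, 0 => rfl
  | 0, 1 => funext fun _ => map_zero F
  | 1, 0 => hF.map_conv (h.cur .pos) (h.pair .pos).cur (Or.inl (h.pair .pos).bd)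
  | 1, 1 => map_shift (map_qu 2) _

lemma MapsSums.map_lneg (hF : MapsSums R F) (h : Core .pos κ A A' e) (i j : Fin 2) :
    (fun k => F (lneg R A A' e i j k)) = lneg R' (fun s k => F (A s k)) (fun s k => F (A' s k))
      (fun s k => F (e s k)) i j :=
  match i, j with
  | 0, 0 => rfl
  | 1, 0 => funext fun _ => map_zero F
  | 0, 1 => by
    have := hF.map_conv (h.pair .neg).cur (h.cur .neg) (Or.inr (h.pair .neg).bd)
    funext k
    change F (-conv (A .neg) (e .neg) k) = -conv _ _ k
    rw [map_neg, ← this]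
  | 1, 1 => map_shift (map_qu 2) _

end CurrentMaps

/-! ### Maps of completed algebras -/

section Hom

variable {T T' : Theory} {m n n' : ℕ}

lemma completed_closed_induction {P : Completed T n → Prop} (hc : IsClosed {η | P η})
    (hr : ∀ r : B, P (algebraMap B _ r)) (hadd : ∀ η θ, P η → P θ → P (η + θ))
    (hmul : ∀ η θ, P η → P θ → P (η * θ)) (hgen : ∀ i x, P (gen T i x)) (η : Completed T n) :
    P η := by
  have key : ∀ x : FreeAlgebra B (Fin n × T.Gen),
      P (FreeAlgebra.lift B (fun p => gen T p.1 p.2) x) := by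
    intro x
    induction x using FreeAlgebra.induction with
    | grade0 r => rw [AlgHom.commutes]; exact hr r
    | grade1 y => rw [FreeAlgebra.lift_ι_apply]; exact hgen _ _
    | mul a b ha hb => rw [map_mul]; exact hmul _ _ ha hb
    | add a b ha hb => rw [map_add]; exact hadd _ _ ha hb
  have hev : ∀ (V : Rep T n) x,
      (FreeAlgebra.lift B (fun p : Fin n × T.Gen => gen T p.1 p.2) x).1 V = V.eval x := by
    intro V x
    have : ((Pi.evalAlgHom B _ V).comp (completed T n).val).comp
        (FreeAlgebra.lift B fun p : Fin n × T.Gen => gen T p.1 p.2) = V.eval := by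
      apply FreeAlgebra.hom_ext
      funext p
      simp only [Function.comp_apply, AlgHom.coe_comp, FreeAlgebra.lift_ι_apply, Rep.eval]
      rfl
    exact DFunLike.congr_fun this x
  refine completed_induction (fun k η hη => ?_) (by simpa using hr 0) hadd η
  refine hc.closure_subset (mem_closure_iff_nhds.2 fun U hU => ?_)
  obtain ⟨S, hS⟩ := mem_nhds_completed.1 hU
  obtain ⟨x, -, hx⟩ := hη S
  exact ⟨_, hS fun p hp => by rw [hev, hx p hp], key x⟩

lemma completed_algHom_ext {A : Type*} [Ring A] [Algebra B A] [TopologicalSpace A] [T2Space A]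
    {f g : Completed T n →ₐ[B] A} (hf : Continuous f) (hg : Continuous g)
    (h : ∀ i x, f (gen T i x) = g (gen T i x)) : f = g :=
  AlgHom.ext (completed_closed_induction (isClosed_eq hf hg)
    (fun r => by rw [AlgHom.commutes, AlgHom.commutes])
    (fun η θ h1 h2 => by rw [map_add, map_add, h1, h2])
    (fun η θ h1 h2 => by rw [map_mul, map_mul, h1, h2]) h)

/-- Generators of one algebra realized in another one. -/
structure ActData (T : Theory) (n : ℕ) (T' : Theory) (n' : ℕ) where
  act : Fin n → T.Gen → Completed T' n'
  mem : ∀ i x, (act i x).1 ∈ piece T' n' (T.deg x)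
  rel : ∀ (V : Rep T' n') i, T.Rel V.carrier fun x => (act i x).1 V
  comm : ∀ i j, i ≠ j → ∀ x y, Commute (act i x) (act j y)
  sgn : T.sgn = T'.sgn

namespace ActData

variable (D : ActData T n T' n')

lemma prod_mem (w : List (Fin n × T.Gen)) :
    ((w.map fun p => D.act p.1 p.2).prod).1 ∈ piece T' n' (w.map fun p => T.deg p.2).sum := by
  induction w with
  | nil => exact one_mem_piece
  | cons p w ih =>
    simp only [List.map_cons, List.prod_cons, List.sum_cons]
    exact piece_mul (D.mem _ _) ih

/-- The evaluation of elements at a representation. -/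
def _root_.QCurrent.evalAt (V : Rep T n) : Completed T n →ₐ[B] Module.End B V.carrier :=
  (Pi.evalAlgHom B _ V).comp (completed T n).val

/-- A representation of the second algebra as a representation of the first one. -/
def pull (V : Rep T' n') : Rep T n where
  carrier := V.carrier
  act i x := (D.act i x).1 V
  rel i := D.rel V i
  bounded i v := by
    obtain ⟨N, hN⟩ := exists_bound_piece V v
    refine ⟨N, fun w hw => ?_⟩
    have h := D.prod_mem (w.map fun x => (i, x))
    rw [List.map_map, List.map_map] at h
    have h2 := hN _ (by rw [← D.sgn]; exact hw) _ h
    have h3 := map_list_prod (evalAt V) (w.map fun x => D.act i x)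
    rw [List.map_map] at h3
    exact (LinearMap.congr_fun h3 v).symm.trans h2
  comm i j h x y := (D.comm i j h x y).map (evalAt V)

lemma eval_pull (V : Rep T' n') (x : FreeAlgebra B (Fin n × T.Gen)) :
    (D.pull V).eval x = (FreeAlgebra.lift B (fun p => D.act p.1 p.2) x).1 V := by
  have : (evalAt V).comp (FreeAlgebra.lift B fun p : Fin n × T.Gen => D.act p.1 p.2) =
      (D.pull V).eval := by
    apply FreeAlgebra.hom_ext
    funext p
    simp only [Function.comp_apply, AlgHom.coe_comp, FreeAlgebra.lift_ι_apply, Rep.eval]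
    exact (FreeAlgebra.lift_ι_apply (R := B) (fun p => (D.pull V).act p.1 p.2) p).symm
  exact (DFunLike.congr_fun this x).symm

lemma lift_mem {k : ℤ} {x : FreeAlgebra B (Fin n × T.Gen)} (hx : x ∈ homog T n k) :
    (FreeAlgebra.lift B (fun p => D.act p.1 p.2) x).1 ∈ piece T' n' k := by
  have hle : homog T n k ≤ (pieceSub T' n' k).comap ((completed T' n').val.comp
      (FreeAlgebra.lift B fun p : Fin n × T.Gen => D.act p.1 p.2)).toLinearMap := by
    refine Submodule.span_le.2 ?_
    rintro _ ⟨w, rfl, rfl⟩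
    change (FreeAlgebra.lift B (fun p : Fin n × T.Gen => D.act p.1 p.2) _).1 ∈ piece T' n' _
    rw [map_list_prod, List.map_map, show (FreeAlgebra.lift B fun p : Fin n × T.Gen =>
      D.act p.1 p.2) ∘ FreeAlgebra.ι B = fun p => D.act p.1 p.2 from
      funext fun p => FreeAlgebra.lift_ι_apply _ p]
    exact D.prod_mem w
  exact hle hx

def homAux : ((V : Rep T n) → Module.End B V.carrier) →ₐ[B]
    ((V : Rep T' n') → Module.End B V.carrier) where
  toFun η V := η (D.pull V)
  map_one' := rfl
  map_mul' _ _ := rfl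
  map_zero' := rfl
  map_add' _ _ := rfl
  commutes' _ := rfl

lemma homAux_piece {k : ℤ} {η : (V : Rep T n) → Module.End B V.carrier} (h : η ∈ piece T n k) :
    D.homAux η ∈ piece T' n' k := by
  classical
  refine piece_of_forall fun S => ?_
  obtain ⟨x, hx, hS⟩ := h (S.image fun p : Pt T' n' => (⟨D.pull p.1, p.2⟩ : Pt T n))
  refine ⟨_, D.lift_mem hx, fun p hp => ?_⟩
  rw [← D.eval_pull]
  exact hS ⟨D.pull p.1, p.2⟩ (Finset.mem_image_of_mem _ hp)

lemma homAux_mem (η : Completed T n) : D.homAux η.1 ∈ completed T' n' :=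
  completed_induction (P := fun η => D.homAux η.1 ∈ completed T' n')
    (fun _ _ h => piece_subset_completed (D.homAux_piece h)) (Subalgebra.zero_mem _)
    (fun _ _ h h' => Subalgebra.add_mem _ h h') η

/-- The homomorphism with the given values on the generators. -/
def hom : Completed T n →ₐ[B] Completed T' n' :=
  (D.homAux.comp (completed T n).val).codRestrict (completed T' n') D.homAux_mem

lemma continuous_hom : Continuous D.hom := continuous_completed_iff.2 fun a V v =>
  eventually_eval a (D.pull V) v

lemma hom_mem {k : ℤ} {η : Completed T n} (h : η.1 ∈ piece T n k) : (D.hom η).1 ∈ piece T' n' k :=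
  D.homAux_piece h

end ActData

lemma continuous_emb (e : Fin m ↪ Fin n) : Continuous (emb T e) :=
  continuous_completed_iff.2 fun a V v => eventually_eval a (V.restrict e) v

lemma emb_mem (e : Fin m ↪ Fin n) {k : ℤ} {η : Completed T m} (h : η.1 ∈ piece T m k) :
    (emb T e η).1 ∈ piece T n k := embAux_piece T e k η.1 h

lemma continuous_leg (i : Fin n) : Continuous (leg T i) := continuous_emb _

lemma gen_commute {i j : Fin n} (h : i ≠ j) (x y : T.Gen) : Commute (gen T i x) (gen T j y) :=
  completed_ext fun V v => LinearMap.congr_fun (V.comm i j h x y).eq v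

lemma commute_hom_of_gens {A : Type*} [Ring A] [Algebra B A] [TopologicalSpace A] [T2Space A]
    [SeparatelyContinuousMul A] {f : Completed T n →ₐ[B] A} (hf : Continuous f) {a : A}
    (h : ∀ i x, Commute a (f (gen T i x))) (η : Completed T n) : Commute a (f η) :=
  completed_closed_induction (P := fun η => Commute a (f η))
    (isClosed_eq ((continuous_const_mul a).comp hf) ((continuous_mul_const a).comp hf))
    (fun r => by rw [AlgHom.commutes]; exact (Algebra.commutes r a).symm)
    (fun η θ h1 h2 => by rw [map_add]; exact h1.add_right h2)
    (fun η θ h1 h2 => by rw [map_mul]; exact h1.mul_right h2) h η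

lemma leg_commute {i j : Fin n} (h : i ≠ j) (η θ : Completed T 1) :
    Commute (leg T i η) (leg T j θ) :=
  commute_hom_of_gens (continuous_leg j) (fun _ x => (commute_hom_of_gens (continuous_leg i)
    (fun _ y => (gen_commute h.symm x y)) η).symm) θ

namespace ActData

/-- The tensor powers of a homomorphism. -/
def pow (D : ActData T 1 T' 1) (n : ℕ) : ActData T n T' n where
  act i x := leg T' i (D.act 0 x)
  mem i x := emb_mem _ (D.mem 0 x)
  rel V i := D.rel (V.restrict _) 0
  comm i j h x y := leg_commute h _ _
  sgn := D.sgn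

lemma pow_leg (D : ActData T 1 T' 1) (i : Fin n) (η : Completed T 1) :
    (D.pow n).hom (leg T i η) = leg T' i (D.hom η) := by
  have : (D.pow n).hom.comp (leg T i) = (leg T' i).comp D.hom := by
    refine completed_algHom_ext ((D.pow n).continuous_hom.comp (continuous_leg i))
      ((continuous_leg i).comp D.continuous_hom) fun j x => ?_
    obtain rfl : j = 0 := Subsingleton.elim _ _
    rfl
  exact DFunLike.congr_fun this η

lemma pow_emb (D : ActData T 1 T' 1) (e : Fin m ↪ Fin n) (η : Completed T m) :
    (D.pow n).hom (emb T e η) = emb T' e ((D.pow m).hom η) := by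
  have : (D.pow n).hom.comp (emb T e) = (emb T' e).comp (D.pow m).hom :=
    completed_algHom_ext ((D.pow n).continuous_hom.comp (continuous_emb e))
      ((continuous_emb e).comp (D.pow m).continuous_hom) fun j x => rfl
  exact DFunLike.congr_fun this η

lemma pow_hom_pow_hom (D : ActData T 1 T' 1) (D' : ActData T' 1 T 1)
    (h : ∀ x, D'.hom (D.act 0 x) = gen T 0 x) (η : Completed T n) :
    (D'.pow n).hom ((D.pow n).hom η) = η := by
  have : (D'.pow n).hom.comp (D.pow n).hom = AlgHom.id B _ := by
    refine completed_algHom_ext ((D'.pow n).continuous_hom.comp (D.pow n).continuous_hom)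
      continuous_id fun i x => ?_
    change (D'.pow n).hom (leg T' i (D.act 0 x)) = _
    rw [pow_leg, h]
    rfl
  exact DFunLike.congr_fun this η

lemma hom_hom (D : ActData T 1 T' 1) (D' : ActData T' 1 T 1)
    (h : ∀ x, D'.hom (D.act 0 x) = gen T 0 x) (η : Completed T 1) : D'.hom (D.hom η) = η := by
  have : D'.hom.comp D.hom = AlgHom.id B _ := by
    refine completed_algHom_ext (D'.continuous_hom.comp D.continuous_hom)
      continuous_id fun i x => ?_
    obtain rfl : i = 0 := Subsingleton.elim _ _
    exact h x
  exact DFunLike.congr_fun this η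

/-- The isomorphism of tensor powers given by inverse maps on generators. -/
def powEquiv (D : ActData T 1 T' 1) (D' : ActData T' 1 T 1)
    (h : ∀ x, D'.hom (D.act 0 x) = gen T 0 x) (h' : ∀ x, D.hom (D'.act 0 x) = gen T' 0 x) (n : ℕ) :
    Completed T n ≃ₐ[B] Completed T' n :=
  AlgEquiv.ofAlgHom (D.pow n).hom (D'.pow n).hom
    (AlgHom.ext fun η => pow_hom_pow_hom D' D h' η) (AlgHom.ext fun η => pow_hom_pow_hom D D' h η)

lemma isHomeomorph_powEquiv (D : ActData T 1 T' 1) (D' : ActData T' 1 T 1)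
    (h : ∀ x, D'.hom (D.act 0 x) = gen T 0 x) (h' : ∀ x, D.hom (D'.act 0 x) = gen T' 0 x) (n : ℕ) :
    IsHomeomorph (powEquiv D D' h h' n) :=
  isHomeomorph_iff_exists_inverse.2 ⟨(D.pow n).continuous_hom, (D'.pow n).hom,
    fun η => pow_hom_pow_hom D D' h η, fun η => pow_hom_pow_hom D' D h' η,
    (D'.pow n).continuous_hom⟩

end ActData

/-! ### Evaluation at representations -/

/-- Highest weight representations as modules over the completed algebra. -/
def evalHigh (V : Rep T n) : Eval (Cent T n) (Completed T n) .high V.carrier where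
  π := (evalAt V : Completed T n →+ Module.End B V.carrier)
  πR := (evalAt V : Completed T n →+* Module.End B V.carrier).comp (algebraMap _ _)
  map_mul x y := map_mul (evalAt V) x y
  map_smul r x := map_mul (evalAt V) r.1 x
  map_algebraMap b := (evalAt V).commutes b
  hasSum h m := hasSum_eval h V m

/-- Lowest weight representations as modules over the completed algebra. -/
def evalLow (V : Rep T n) : Eval (Cent T n) (Completed T n)ᵐᵒᵖ .low V.carrier where
  π := (evalAt V : Completed T n →+ Module.End B V.carrier).comp
    (opAddEquiv.symm : (Completed T n)ᵐᵒᵖ ≃+ Completed T n).toAddMonoidHom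
  πR := (evalAt V : Completed T n →+* Module.End B V.carrier).comp (algebraMap _ _)
  map_mul x y := map_mul (evalAt V) y.unop x.unop
  map_smul r x := map_mul (evalAt V) r.1 x.unop
  map_algebraMap b := (evalAt V).commutes b
  hasSum h m := hasSum_eval (h.map (opAddEquiv.symm : (Completed T n)ᵐᵒᵖ ≃+ Completed T n)
    continuous_unop) V m

end Hom

/-! ### The extended Drinfeld relations under homomorphisms -/

section Map

variable {E F : Type*} [Ring E] [Algebra B E] [Ring F] [Algebra B F] (φ : E →ₐ[B] F)
  {X Y : ℤ → E} {ρ : ℕ → E}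

lemma finite_support_bd {s : Sgn} (hX : Bd s X) (hY : Bd s Y) (G : ℤ → E) (k : ℤ)
    (h : ∀ i, X i * Y (k - i) = 0 → G i = 0) : (Function.support G).Finite := by
  cases s
  · refine (Set.finite_Icc 0 k).subset fun i hi => ?_
    by_contra h'
    refine hi (h i ?_)
    rcases lt_or_ge i 0 with h1 | h1
    · rw [hX i h1, zero_mul]
    · rw [hY _ (by simp only [Set.mem_Icc] at h'; omega), mul_zero]
  · refine (Set.finite_Icc k 0).subset fun i hi => ?_
    by_contra h'
    refine hi (h i ?_)
    rcases lt_or_ge 0 i with h1 | h1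
    · rw [hX i h1, zero_mul]
    · rw [hY _ (by simp only [Set.mem_Icc] at h'; omega), mul_zero]

lemma map_finsum_conv {s : Sgn} (hX : Bd s X) (hY : Bd s Y) (k : ℤ) :
    φ (∑ᶠ i, X i * Y (k - i)) = ∑ᶠ i, φ (X i) * φ (Y (k - i)) := by
  have := (φ : E →+ F).map_finsum (finite_support_bd hX hY (fun i => X i * Y (k - i)) k fun _ h => h)
  simpa using this

lemma map_dbl {s : Sgn} (hX : Bd s X) (k : ℤ) : φ (dbl X k) = dbl (fun k => φ (X k)) k := by
  have := (φ : E →+ F).map_finsum (finite_support_bd hX hX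
    (fun i => qp (2 * ((k - i : ℤ) : ℂ)) • (X i * X (k - i))) k fun _ h => by rw [h, smul_zero])
  simpa [dbl] using this

lemma bd_dbl {s : Sgn} (hX : Bd s X) : Bd s (dbl X) := by
  cases s
  · intro k hk
    refine finsum_eq_zero_of_forall_eq_zero fun i => ?_
    rcases lt_or_ge i 0 with h | h
    · rw [hX i h, zero_mul, smul_zero]
    · rw [hX (k - i) (by omega), mul_zero, smul_zero]
  · intro k hk
    refine finsum_eq_zero_of_forall_eq_zero fun i => ?_
    rcases lt_or_ge 0 i with h | h
    · rw [hX i h, zero_mul, smul_zero]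
    · rw [hX (k - i) (by omega), mul_zero, smul_zero]

lemma map_finsum_fwd (hX : Plus X) (k l : ℤ) : φ (∑ᶠ n : ℕ, ρ n * Y (l + n) * X (k - n)) =
    ∑ᶠ n : ℕ, φ (ρ n) * φ (Y (l + n)) * φ (X (k - n)) := by
  have := (φ : E →+ F).map_finsum (f := fun n : ℕ => ρ n * Y (l + n) * X (k - n))
    ((Set.finite_Iic k.toNat).subset fun n hn => by
      by_contra h
      exact hn (by dsimp only; rw [hX _ (by simp only [Set.mem_Iic] at h; omega), mul_zero]))
  simpa using this

lemma map_finsum_bwd (hX : Minus X) (k l : ℤ) : φ (∑ᶠ n : ℕ, ρ n * Y (l - n) * X (k + n)) =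
    ∑ᶠ n : ℕ, φ (ρ n) * φ (Y (l - n)) * φ (X (k + n)) := by
  have := (φ : E →+ F).map_finsum (f := fun n : ℕ => ρ n * Y (l - n) * X (k + n))
    ((Set.finite_Iic (-k).toNat).subset fun n hn => by
      by_contra h
      exact hn (by dsimp only; rw [hX _ (by simp only [Set.mem_Iic] at h; omega), mul_zero]))
  simpa using this

lemma map_kpow (κ κ' : E) (n : ℤ) : φ (kpow κ κ' n) = kpow (φ κ) (φ κ') n := by
  simp [kpow]

lemma map_sc (u : B⟦X⟧) (n : ℕ) : φ (sc u n) = sc u n := by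
  simp [sc]

lemma map_twist (κ κ' : E) (u v : B⟦X⟧) (n : ℕ) :
    φ (twist κ κ' u v n) = twist (φ κ) (φ κ') u v n := by
  simp [twist, map_kpow]

lemma _root_.QCurrent.ExchFwd.map (hX : Plus X) (h : ExchFwd ρ X Y) :
    ExchFwd (fun n => φ (ρ n)) (fun k => φ (X k)) fun k => φ (Y k) := fun k l => by
  rw [← map_finsum_fwd φ hX, ← map_mul, h k l]

lemma _root_.QCurrent.ExchBwd.map (hX : Minus X) (h : ExchBwd ρ X Y) :
    ExchBwd (fun n => φ (ρ n)) (fun k => φ (X k)) fun k => φ (Y k) := fun k l => by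
  rw [← map_finsum_bwd φ hX, ← map_mul, h k l]

variable {ζ : Bool} {a : UGen → E}

lemma _root_.QCurrent.URel.bd_al (h : URel ζ a) (s : Sgn) : Bd s fun k => a (.al s k) := by
  cases s
  · exact h.al_pos
  · exact h.al_neg

lemma _root_.QCurrent.URel.bd_be (h : URel ζ a) (s : Sgn) : Bd s fun k => a (.be s k) := by
  cases s
  · exact h.be_pos
  · exact h.be_neg

lemma map_phi {s : Sgn} (h : Bd s fun k => a (.be s k)) (k : ℤ) :
    φ (phi a s k) = phi (fun x => φ (a x)) s k := map_dbl φ h k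

lemma _root_.QCurrent.URel.map (h : URel ζ a) : URel ζ fun x => φ (a x) := by
  have hb := h.bd_be
  have hphi : ∀ s, phi (fun x => φ (a x)) s = fun k => φ (phi a s k) := fun s =>
    funext fun k => (map_phi φ (hb s) k).symm
  have hp : ∀ s, Bd s (phi a s) := fun s => bd_dbl (hb s)
  refine ⟨by rw [← map_mul, h.qc_mul, map_one], fun x => (h.qc_central x).map φ,
    fun x => (h.qc'_central x).map φ, fun k hk => by rw [h.al_pos k hk, map_zero],
    fun k hk => by rw [h.al_neg k hk, map_zero], fun k hk => by rw [h.be_pos k hk, map_zero],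
    fun k hk => by rw [h.be_neg k hk, map_zero], fun s k => ?_, fun s k => ?_, fun hζ => ?_,
    fun s k l => ?_, ?_, ?_, ?_, ?_, ?_, fun s k l => ?_, fun k l => ?_, fun s k l => ?_, ?_, ?_, ?_,
    ?_, ?_⟩
  · rw [← map_finsum_conv φ (h.bd_al s) (hb s), h.al_be]
    split_ifs <;> simp
  · rw [← map_finsum_conv φ (hb s) (h.bd_al s), h.be_al]
    split_ifs <;> simp
  · simp only [hphi, ← map_mul, (h.phi_zero hζ).1, (h.phi_zero hζ).2, map_one, and_self]
  · simp only [hphi]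
    exact (h.phi_comm s k l).map φ
  · have := h.phi_phi.map φ (hp .pos)
    simp only [map_twist] at this
    simp only [hphi]
    exact this
  · have := h.phi_xi_pos_pos.map φ (hp .pos)
    simp only [map_sc] at this
    simp only [hphi]
    exact this
  · have := h.phi_xi_neg_neg.map φ (hp .neg)
    simp only [map_sc] at this
    simp only [hphi]
    exact this
  · have := h.phi_xi_pos_neg.map φ (hp .pos)
    simp only [map_twist] at this
    simp only [hphi]
    exact this
  · have := h.phi_xi_neg_pos.map φ (hp .neg)
    simp only [map_twist] at this
    simp only [hphi]
    exact this
  · have := congrArg φ (h.xi_xi s k l)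
    simpa only [map_sub, map_mul, map_smul] using this
  · have := congrArg φ (h.xi_pos_xi_neg k l)
    simpa only [map_sub, map_mul, map_smul, hphi, map_kpow] using this
  · exact (h.al_comm s k l).map φ
  · have := h.al_xi_pos_pos.map φ h.al_pos
    simp only [map_sc] at this
    exact this
  · have := h.al_xi_neg_neg.map φ h.al_neg
    simp only [map_sc] at this
    exact this
  · have := h.al_xi_pos_neg.map φ h.al_pos
    simp only [map_twist] at this
    exact this
  · have := h.al_xi_neg_pos.map φ h.al_neg
    simp only [map_twist] at this
    exact this
  · have := h.al_al.map φ h.al_pos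
    simp only [map_twist] at this
    exact this

end Map

section Joint

variable {E : Type*} [Ring E] [Algebra B E] {ι : Type*} {F : ι → Type*} [∀ i, Ring (F i)]
  [∀ i, Algebra B (F i)] (φ : ∀ i, E →ₐ[B] F i) {X Y : ℤ → E} {ρ : ℕ → E}

lemma ExchFwd.of_forall (hinj : ∀ x y, (∀ i, φ i x = φ i y) → x = y) (hX : Plus X)
    (h : ∀ i, ExchFwd (fun n => φ i (ρ n)) (fun k => φ i (X k)) fun k => φ i (Y k)) :
    ExchFwd ρ X Y := fun k l => hinj _ _ fun i => by
  rw [map_finsum_fwd (φ i) hX, map_mul, h i k l]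

lemma ExchBwd.of_forall (hinj : ∀ x y, (∀ i, φ i x = φ i y) → x = y) (hX : Minus X)
    (h : ∀ i, ExchBwd (fun n => φ i (ρ n)) (fun k => φ i (X k)) fun k => φ i (Y k)) :
    ExchBwd ρ X Y := fun k l => hinj _ _ fun i => by
  rw [map_finsum_bwd (φ i) hX, map_mul, h i k l]

variable {ζ : Bool} {a : UGen → E}

lemma URel.of_forall (hinj : ∀ x y, (∀ i, φ i x = φ i y) → x = y)
    (h : ∀ i, URel ζ fun x => φ i (a x)) : URel ζ a := by
  have h0 : ∀ x, (∀ i, φ i x = 0) → x = 0 := fun x hx => hinj _ _ fun i => by rw [hx, map_zero]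
  have ha : ∀ s, Bd s fun k => a (.al s k) := by
    rintro (_ | _)
    · exact fun k hk => h0 _ fun i => (h i).al_pos k hk
    · exact fun k hk => h0 _ fun i => (h i).al_neg k hk
  have hb : ∀ s, Bd s fun k => a (.be s k) := by
    rintro (_ | _)
    · exact fun k hk => h0 _ fun i => (h i).be_pos k hk
    · exact fun k hk => h0 _ fun i => (h i).be_neg k hk
  have hphi : ∀ i s, (fun k => φ i (phi a s k)) = phi (fun x => φ i (a x)) s := fun i s =>
    funext fun k => map_phi (φ i) (hb s) k
  have hphi' : ∀ i s k, φ i (phi a s k) = phi (fun x => φ i (a x)) s k := fun i s k =>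
    map_phi (φ i) (hb s) k
  have hp : ∀ s, Bd s (phi a s) := fun s => bd_dbl (hb s)
  refine ⟨hinj _ _ fun i => by rw [map_mul, map_one, (h i).qc_mul],
    fun x => hinj _ _ fun i => by rw [map_mul, map_mul]; exact (h i).qc_central x,
    fun x => hinj _ _ fun i => by rw [map_mul, map_mul]; exact (h i).qc'_central x,
    ha .pos, ha .neg, hb .pos, hb .neg, fun s k => hinj _ _ fun i => ?_,
    fun s k => hinj _ _ fun i => ?_, fun hζ => ⟨hinj _ _ fun i => ?_, hinj _ _ fun i => ?_⟩,
    fun s k l => hinj _ _ fun i => ?_, ExchFwd.of_forall φ hinj (hp .pos) fun i => ?_,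
    ExchFwd.of_forall φ hinj (hp .pos) fun i => ?_, ExchBwd.of_forall φ hinj (hp .neg) fun i => ?_,
    ExchFwd.of_forall φ hinj (hp .pos) fun i => ?_, ExchBwd.of_forall φ hinj (hp .neg) fun i => ?_,
    fun s k l => hinj _ _ fun i => ?_, fun k l => hinj _ _ fun i => ?_,
    fun s k l => hinj _ _ fun i => by rw [map_mul, map_mul]; exact (h i).al_comm s k l,
    ExchFwd.of_forall φ hinj (ha .pos) fun i => ?_, ExchBwd.of_forall φ hinj (ha .neg) fun i => ?_,
    ExchFwd.of_forall φ hinj (ha .pos) fun i => ?_, ExchBwd.of_forall φ hinj (ha .neg) fun i => ?_,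
    ExchFwd.of_forall φ hinj (ha .pos) fun i => ?_⟩
  · rw [map_finsum_conv (φ i) (ha s) (hb s), (h i).al_be]
    split_ifs <;> simp
  · rw [map_finsum_conv (φ i) (hb s) (ha s), (h i).be_al]
    split_ifs <;> simp
  · rw [map_mul, map_one, hphi', hphi', ((h i).phi_zero hζ).1]
  · rw [map_mul, map_one, hphi', hphi', ((h i).phi_zero hζ).2]
  · rw [map_mul, map_mul, hphi', hphi']
    exact (h i).phi_comm s k l
  · simp only [hphi', map_twist]
    exact (h i).phi_phi
  · simp only [hphi', map_sc]
    exact (h i).phi_xi_pos_pos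
  · simp only [hphi', map_sc]
    exact (h i).phi_xi_neg_neg
  · simp only [hphi', map_twist]
    exact (h i).phi_xi_pos_neg
  · simp only [hphi', map_twist]
    exact (h i).phi_xi_neg_pos
  · simp only [map_sub, map_mul, map_smul]
    exact (h i).xi_xi s k l
  · simp only [map_sub, map_mul, map_smul, hphi', map_kpow]
    exact (h i).xi_pos_xi_neg k l
  · simp only [map_sc]
    exact (h i).al_xi_pos_pos
  · simp only [map_sc]
    exact (h i).al_xi_neg_neg
  · simp only [map_twist]
    exact (h i).al_xi_pos_neg
  · simp only [map_twist]
    exact (h i).al_xi_neg_pos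
  · simp only [map_twist]
    exact (h i).al_al

end Joint

/-! ### Rescaling by a central unit -/

section Rescale

variable {E : Type*} [Ring E] [Algebra B E] (c : Eˣ)

lemma finsum_units_mul {ι : Type*} (f : ι → E) : ∑ᶠ i, (c : E) * f i = c * ∑ᶠ i, f i :=
  ((AddMonoidHom.mulLeft (c : E)).map_finsum_of_injective
    (fun x y h => (Units.mul_right_inj c).1 h) f).symm

variable {c} {X Y : ℤ → E} {ρ : ℕ → E}

lemma units_mul_mul {x : E} (hx : Commute (c : E) x) (i j : ℤ) (y : E) :
    ((c ^ i : Eˣ) : E) * x * (((c ^ j : Eˣ) : E) * y) = ((c ^ (i + j) : Eˣ) : E) * (x * y) := by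
  have h : Commute x ((c ^ j : Eˣ) : E) := (hx.symm.units_zpow_right j)
  rw [mul_assoc, ← mul_assoc x, h.eq, zpow_add, Units.val_mul]
  simp only [mul_assoc]

/-- The modes of `X(c z)` for a central unit `c`. -/
def rescl (c : Eˣ) (X : ℤ → E) (k : ℤ) : E := ((c ^ k : Eˣ) : E) * X k

lemma bd_rescl {s : Sgn} (h : Bd s X) : Bd s (rescl c X) := by
  cases s
  · exact fun k hk => by rw [rescl, h k hk, mul_zero]
  · exact fun k hk => by rw [rescl, h k hk, mul_zero]

lemma dbl_rescl (hX : ∀ k, Commute (c : E) (X k)) : dbl (rescl c X) = rescl c (dbl X) := by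
  funext k
  rw [rescl, dbl, dbl, ← finsum_units_mul]
  refine finsum_congr fun i => ?_
  rw [rescl, rescl, units_mul_mul (hX i), mul_smul_comm, add_sub_cancel]

lemma ExchFwd.rescl (hρ : ∀ n, Commute (c : E) (ρ n)) (hX : ∀ k, Commute (c : E) (X k))
    (hY : ∀ k, Commute (c : E) (Y k)) (h : ExchFwd ρ X Y) :
    ExchFwd ρ (rescl c X) (rescl c Y) := fun k l => by
  rw [QCurrent.rescl, QCurrent.rescl, units_mul_mul (hX k), h k l, ← finsum_units_mul]
  refine finsum_congr fun n => ?_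
  rw [QCurrent.rescl, QCurrent.rescl, mul_assoc, mul_assoc (ρ n), units_mul_mul (hY _),
    show l + n + (k - n) = k + l by ring, ← mul_assoc, ← mul_assoc (ρ n),
    ((hρ n).symm.units_zpow_right (k + l)).eq]

lemma ExchBwd.rescl (hρ : ∀ n, Commute (c : E) (ρ n)) (hX : ∀ k, Commute (c : E) (X k))
    (hY : ∀ k, Commute (c : E) (Y k)) (h : ExchBwd ρ X Y) :
    ExchBwd ρ (rescl c X) (rescl c Y) := fun k l => by
  rw [QCurrent.rescl, QCurrent.rescl, units_mul_mul (hX k), h k l, ← finsum_units_mul]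
  refine finsum_congr fun n => ?_
  rw [QCurrent.rescl, QCurrent.rescl, mul_assoc, mul_assoc (ρ n), units_mul_mul (hY _),
    show l - n + (k + n) = k + l by ring, ← mul_assoc, ← mul_assoc (ρ n),
    ((hρ n).symm.units_zpow_right (k + l)).eq]

lemma commute_sc (u : B⟦X⟧) (n : ℕ) : Commute (c : E) (sc u n) :=
  (Algebra.commutes _ _).symm

lemma commute_kpow {κ κ' : E} (h : Commute (c : E) κ) (h' : Commute (c : E) κ') (n : ℤ) :
    Commute (c : E) (kpow κ κ' n) := (h.pow_right _).mul_right (h'.pow_right _)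

lemma commute_twist {κ κ' : E} (h : Commute (c : E) κ) (h' : Commute (c : E) κ')
    (u v : B⟦X⟧) (n : ℕ) : Commute (c : E) (twist κ κ' u v n) :=
  Commute.sum_right _ _ _ fun _ _ => (commute_kpow h h' _).smul_right _

lemma commute_dbl {s : Sgn} (hb : Bd s X) (hX : ∀ k, Commute (c : E) (X k)) (k : ℤ) :
    Commute (c : E) (dbl X k) := by
  refine ((AddMonoidHom.mulLeft (c : E)).map_finsum (finite_support_bd hb hb
    (fun i => qp (2 * ((k - i : ℤ) : ℂ)) • (X i * X (k - i))) k fun _ h => by rw [h, smul_zero])).trans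
    (Eq.trans ?_ ((AddMonoidHom.mulRight (c : E)).map_finsum (finite_support_bd hb hb
    (fun i => qp (2 * ((k - i : ℤ) : ℂ)) • (X i * X (k - i))) k fun _ h => by
      rw [h, smul_zero])).symm)
  exact finsum_congr fun i => (((hX _).mul_right (hX _)).smul_right _).eq

variable {ζ : Bool} {a : UGen → E}

lemma URel.rescl (hc : ∀ x, Commute (c : E) (a x)) (h : URel ζ a) :
    URel ζ fun x => ((c ^ x.deg : Eˣ) : E) * a x := by
  set b : UGen → E := fun x => ((c ^ x.deg : Eˣ) : E) * a x with hb
  have hq : b .qc = a .qc := by simp [hb, UGen.deg]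
  have hq' : b .qc' = a .qc' := by simp [hb, UGen.deg]
  have hal : ∀ s, (fun k => b (.al s k)) = QCurrent.rescl c fun k => a (.al s k) := fun _ => rfl
  have hbe : ∀ s, (fun k => b (.be s k)) = QCurrent.rescl c fun k => a (.be s k) := fun _ => rfl
  have hxi : ∀ s, (fun k => b (.xi s k)) = QCurrent.rescl c fun k => a (.xi s k) := fun _ => rfl
  have hphi : ∀ s, phi b s = QCurrent.rescl c (phi a s) := fun s => by
    rw [phi, phi, hbe, dbl_rescl fun k => hc _]
  have hcp : ∀ s k, Commute (c : E) (phi a s k) := fun s k => commute_dbl (h.bd_be s) (fun _ => hc _) k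
  have hone : ∀ (k : ℤ), ((c ^ k : Eˣ) : E) * (if k = 0 then 1 else 0) = if k = 0 then 1 else 0 := by
    intro k
    split_ifs with h
    · rw [h]; simp
    · rw [mul_zero]
  have hcc : ∀ (i j : ℤ) (x y : E), Commute (c : E) x → Commute (c : E) y → Commute x y →
      Commute (((c ^ i : Eˣ) : E) * x) (((c ^ j : Eˣ) : E) * y) := fun i j x y hx hy hxy => by
    rw [commute_iff_eq, units_mul_mul hx, units_mul_mul hy, hxy.eq, add_comm]
  refine ⟨by rw [hq, hq', h.qc_mul], fun x => ?_, fun x => ?_, ?_, ?_, ?_, ?_, fun s k => ?_,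
    fun s k => ?_, fun hζ => ?_, fun s k l => ?_, ?_, ?_, ?_, ?_, ?_, fun s k l => ?_,
    fun k l => ?_, fun s k l => hcc k l _ _ (hc _) (hc _) (h.al_comm s k l), ?_, ?_, ?_, ?_, ?_⟩
  · rw [hq]
    exact ((hc .qc).symm.units_zpow_right _).mul_right (h.qc_central x)
  · rw [hq']
    exact ((hc .qc').symm.units_zpow_right _).mul_right (h.qc'_central x)
  · exact bd_rescl (h.bd_al .pos)
  · exact bd_rescl (h.bd_al .neg)
  · exact bd_rescl (h.bd_be .pos)
  · exact bd_rescl (h.bd_be .neg)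
  · rw [← hone, ← h.al_be s, ← finsum_units_mul]
    refine finsum_congr fun i => ?_
    simp only [hb, UGen.deg]
    rw [units_mul_mul (hc _), add_sub_cancel]
  · rw [← hone, ← h.be_al s, ← finsum_units_mul]
    refine finsum_congr fun i => ?_
    simp only [hb, UGen.deg]
    rw [units_mul_mul (hc _), add_sub_cancel]
  · simpa [hphi, QCurrent.rescl] using h.phi_zero hζ
  · rw [hphi]
    exact hcc _ _ _ _ (hcp _ _) (hcp _ _) (h.phi_comm s k l)
  · rw [hphi, hphi, hq, hq']
    exact h.phi_phi.rescl (commute_twist (hc _) (hc _) _ _) (hcp _) (hcp _)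
  · rw [hphi, hxi]
    exact h.phi_xi_pos_pos.rescl (commute_sc _) (hcp _) fun _ => hc _
  · rw [hphi, hxi]
    exact h.phi_xi_neg_neg.rescl (commute_sc _) (hcp _) fun _ => hc _
  · rw [hphi, hxi, hq, hq']
    exact h.phi_xi_pos_neg.rescl (commute_twist (hc _) (hc _) _ _) (hcp _) fun _ => hc _
  · rw [hphi, hxi, hq, hq']
    exact h.phi_xi_neg_pos.rescl (commute_twist (hc _) (hc _) _ _) (hcp _) fun _ => hc _
  · have h2 := congrArg (((c ^ (k + l - 1) : Eˣ) : E) * ·) (h.xi_xi s k l)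
    simp only [mul_sub, mul_smul_comm] at h2
    simp only [hb, UGen.deg]
    rw [units_mul_mul (hc _), units_mul_mul (hc _), units_mul_mul (hc _), units_mul_mul (hc _)]
    convert h2 using 6 <;> ring
  · have h2 := congrArg (((c ^ (k + l) : Eˣ) : E) * ·) (h.xi_pos_xi_neg k l)
    simp only [mul_sub, mul_smul_comm] at h2
    rw [hphi, hphi, hq, hq']
    simp only [hb, UGen.deg]
    rw [units_mul_mul (hc _), units_mul_mul (hc _), add_comm l k, h2, QCurrent.rescl,
      QCurrent.rescl, ← mul_assoc, ← mul_assoc, ← mul_assoc, ← mul_assoc,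
      ((commute_kpow (hc _) (hc _) _).symm.units_zpow_right _).eq,
      ((commute_kpow (hc _) (hc _) _).symm.units_zpow_right _).eq]
  · rw [hal, hxi]
    exact h.al_xi_pos_pos.rescl (commute_sc _) (fun _ => hc _) fun _ => hc _
  · rw [hal, hxi]
    exact h.al_xi_neg_neg.rescl (commute_sc _) (fun _ => hc _) fun _ => hc _
  · rw [hal, hxi, hq, hq']
    exact h.al_xi_pos_neg.rescl (commute_twist (hc _) (hc _) _ _) (fun _ => hc _) fun _ => hc _
  · rw [hal, hxi, hq, hq']
    exact h.al_xi_neg_pos.rescl (commute_twist (hc _) (hc _) _ _) (fun _ => hc _) fun _ => hc _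
  · rw [hal, hal, hq, hq']
    exact h.al_al.rescl (commute_twist (hc _) (hc _) _ _) (fun _ => hc _) fun _ => hc _

end Rescale

/-! ### The trivial representation -/

/-- The trivial one-dimensional representation. -/
def triv : UGen → B
  | .xi _ _ => 0
  | .al _ k => if k = 0 then 1 else 0
  | .be _ k => if k = 0 then 1 else 0
  | .qc => 1
  | .qc' => 1

lemma phi_triv (s : Sgn) : phi triv s = fun k => if k = 0 then 1 else 0 := by
  funext k
  rw [phi, dbl, finsum_eq_single _ 0]
  · by_cases hk : k = 0
    · simp [hk, triv, qp_zero]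
    · simp [hk, triv]
  · intro i hi
    simp [triv, hi]

lemma twist_triv {u v : B⟦X⟧} (h : u * v = 1) (n : ℕ) :
    twist (1 : B) 1 u v n = if n = 0 then 1 else 0 := by
  rw [← coeff_one, ← h, PowerSeries.coeff_mul, twist]
  simp [kpow]

lemma exchFwd_one {ρ : ℕ → B} (hρ : ∀ n, ρ n = if n = 0 then 1 else 0) (X Y : ℤ → B) :
    ExchFwd ρ X Y := fun k l => by
  rw [finsum_eq_single _ 0]
  · simp [hρ, mul_comm]
  · intro n hn
    simp [hρ, hn]

lemma urel_triv (ζ : Bool) : URel ζ triv := by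
  have hg : g * Ring.inverse g = 1 := Ring.mul_inverse_cancel g isUnit_g
  have hf : Ring.inverse f * f = 1 := Ring.inverse_mul_cancel f isUnit_f
  have hsum : ∀ k : ℤ, (∑ᶠ i : ℤ, (if i = 0 then (1 : B) else 0) * if k - i = 0 then 1 else 0) =
      if k = 0 then 1 else 0 := fun k => by
    rw [finsum_eq_single _ 0]
    · simp
    · intro i hi
      simp [hi]
  have hx : ∀ s : Sgn, (fun k => triv (.xi s k)) = fun _ => 0 := fun _ => rfl
  refine ⟨mul_one 1, fun x => mul_comm _ _, fun x => mul_comm _ _, fun k hk => if_neg hk.ne,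
    fun k hk => if_neg hk.ne', fun k hk => if_neg hk.ne,
    fun k hk => if_neg hk.ne', fun _ => hsum, fun _ => hsum, fun _ => ?_, fun s k l => mul_comm _ _,
    exchFwd_one (twist_triv hg) _ _, ?_, ?_, ?_, ?_, ?_, ?_, fun s k l => mul_comm _ _, ?_, ?_, ?_, ?_,
    exchFwd_one (twist_triv hf) _ _⟩
  · simp [phi_triv]
  all_goals intro k l; try intro m
  all_goals simp [triv, phi_triv, kpow]

/-! ### Passing between the two families of generators -/

section Generators

variable [Algebra B R] [Algebra B E] [IsScalarTower B R E]

variable (R) in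
/-- The generators of the `L`-matrix algebra in terms of those of the Drinfeld algebra. -/
def lof (a : UGen → E) : AGen → E
  | .L .pos i j k => lpos R (fun s k => a (.al s k)) (fun s k => a (.be s k)) (fun s k => a (.xi s k)) i j k
  | .L .neg i j k => lneg R (fun s k => a (.al s k)) (fun s k => a (.be s k)) (fun s k => a (.xi s k)) i j k
  | .qc => a .qc
  | .qc' => a .qc'

variable (R) in
/-- The generators of the Drinfeld algebra in terms of those of the `L`-matrix algebra. -/
def uof (b : AGen → E) : UGen → E
  | .al s k => lal (fun i j k => b (.L .pos i j k)) (fun i j k => b (.L .neg i j k)) s k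
  | .be s k => lbe R (fun i j k => b (.L .pos i j k)) (fun i j k => b (.L .neg i j k)) s k
  | .xi s k => lxi R (fun i j k => b (.L .pos i j k)) (fun i j k => b (.L .neg i j k)) s k
  | .qc => b .qc
  | .qc' => b .qc'

/-- The relations of the Drinfeld algebra for a family of generators. -/
abbrev UCore (κ : Rˣ) (a : UGen → E) : Prop :=
  Core .pos κ (fun s k => a (.al s k)) (fun s k => a (.be s k)) fun s k => a (.xi s k)

/-- The relations of the `L`-matrix algebra for a family of generators. -/
abbrev LGenCore (κ : Rˣ) (b : AGen → E) : Prop :=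
  LCore κ (fun i j k => b (.L .pos i j k)) fun i j k => b (.L .neg i j k)

variable {κ : Rˣ} {a : UGen → E} {b : AGen → E}

lemma UCore.lof (h : UCore κ a) : LGenCore κ (lof R a) := Core.lcore h

lemma LGenCore.uof (h : LGenCore κ b) : UCore κ (uof R b) := LCore.core h

lemma uof_lof (h : UCore κ a) : uof R (lof R a) = a := by
  funext x
  match x with
  | .al s k => exact congrFun (congrFun (lal_lpos (R := R) (fun s k => a (.al s k)) (fun s k => a (.be s k))
      fun s k => a (.xi s k)) s) k
  | .be s k => exact congrFun (congrFun (lbe_lpos (R := R) (fun s k => a (.al s k)) (fun s k => a (.be s k))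
      fun s k => a (.xi s k)) s) k
  | .xi s k => exact congrFun (congrFun (Core.lxi_lpos h) s) k
  | .qc => rfl
  | .qc' => rfl

lemma lof_uof (h : LGenCore κ b) : lof R (uof R b) = b := by
  funext x
  match x with
  | .L .pos i j k => exact congrFun (congrFun (congrFun (LCore.lpos_lal h) i) j) k
  | .L .neg i j k => exact congrFun (congrFun (congrFun (LCore.lneg_lal h) i) j) k
  | .qc => rfl
  | .qc' => rfl

/-- A family of homogeneous elements indexed by the generators of the `L`-matrix algebra. -/
structure LGraded (κ : Rˣ) (b : AGen → E) : Prop where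
  mem : ∀ x, b x ∈ pc R x.deg
  qc : b .qc = algebraMap R E κ
  qc' : b .qc' = algebraMap R E (↑κ⁻¹ : R)

lemma UGraded.lof (hg : UGraded κ a) (h : UCore κ a) : LGraded κ (lof R a) where
  mem x := match x with
    | .L .pos i j k => h.lof.lpos.cur i j k
    | .L .neg i j k => h.lof.lneg.cur i j k
    | .qc => hg.mem .qc
    | .qc' => hg.mem .qc'
  qc := hg.qc
  qc' := hg.qc'

lemma LGraded.uof (hg : LGraded κ b) (h : LGenCore κ b) : UGraded κ (uof R b) where
  mem x := match x with
    | .al s k => (h.pair s).cur k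
    | .be s k => (h.pair s).cur' k
    | .xi s k => h.core.cur s k
    | .qc => hg.mem .qc
    | .qc' => hg.mem .qc'
  qc := hg.qc
  qc' := hg.qc'

section Maps

variable {R' E' : Type*} [CommRing R'] [Ring E'] [Algebra R' E'] [TopologicalSpace E']
  [T2Space E'] [IsTopologicalAddGroup E'] [SeparatelyContinuousMul E'] [CurrentRing R' E']
  [Algebra B R'] [Algebra B E'] [IsScalarTower B R' E'] {F : E →ₐ[B] E'}

lemma MapsSums.map_lof (hF : MapsSums R F) (h : UCore κ a) :
    (fun x => F (lof R a x)) = lof R' fun x => F (a x) := by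
  funext x
  match x with
  | .L .pos i j k => exact congrFun (hF.map_lpos (R' := R') h i j) k
  | .L .neg i j k => exact congrFun (hF.map_lneg (R' := R') h i j) k
  | .qc => rfl
  | .qc' => rfl

lemma MapsSums.map_uof (hF : MapsSums R F) (h : LGenCore κ b) :
    (fun x => F (uof R b x)) = uof R' fun x => F (b x) := by
  have hbe : ∀ s, (fun k => F (uof R b (.be s k))) = lbe R' (fun i j k => F (b (.L .pos i j k)))
      (fun i j k => F (b (.L .neg i j k))) s := by
    rintro (_ | _)
    · exact map_shift (map_qu (-2)) _
    · exact map_shift (map_qu (-2)) _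
  funext x
  match x with
  | .al .pos k => rfl
  | .al .neg k => rfl
  | .be s k => exact congrFun (hbe s) k
  | .xi .pos k =>
    refine (congrFun (hF.map_conv (h.lpos.cur 1 0) (h.pair .pos).cur' (Or.inl (h.pair .pos).bd')) k).trans ?_
    exact congrFun (congrArg (conv _) (hbe .pos)) k
  | .xi .neg k =>
    refine (map_neg F _).trans (congrArg Neg.neg ?_)
    refine (congrFun (hF.map_conv (h.pair .neg).cur' (h.lneg.cur 0 1) (Or.inr (h.pair .neg).bd')) k).trans ?_
    exact congrFun (congrArg (fun Z => conv Z _) (hbe .neg)) k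
  | .qc => rfl
  | .qc' => rfl

lemma MapsSums.map_antip (hF : MapsSums R F) (hg : UGraded κ a)
    (hp : ∀ s, InvPair R s (fun k => a (.al s k)) fun k => a (.be s k)) :
    (fun x => F (UGraded.antip R a x)) = UGraded.antip R' fun x => F (a x) := by
  funext x
  match x with
  | .xi .pos k =>
    refine (map_neg F _).trans (congrArg Neg.neg ?_)
    refine (congrFun (hF.map_conv (hg.cur_xi .pos) (hp .pos).dblc.cur (Or.inl (hp .pos).dblc.bd)) k).trans ?_
    exact congrFun (congrArg (conv _) (hF.map_dblc (hp .pos).cur (hp .pos).bd)) k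
  | .xi .neg k =>
    refine (map_neg F _).trans (congrArg Neg.neg ?_)
    refine (congrFun (hF.map_conv (hp .neg).dblc.cur (hg.cur_xi .neg) (Or.inr (hp .neg).dblc.bd)) k).trans ?_
    exact congrFun (congrArg (fun Z => conv Z _) (hF.map_dblc (hp .neg).cur (hp .neg).bd)) k
  | .al s k => rfl
  | .be s k => rfl
  | .qc => rfl
  | .qc' => rfl

end Maps

/-- Exchange of `q^c` and `q^(-c)`. -/
def swapqc {E : Type*} (b : AGen → E) : AGen → E
  | .L s i j k => b (.L s i j k)
  | .qc => b .qc'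
  | .qc' => b .qc

/-! ### The `L`-matrix relations on modules -/

lemma zeroModes_map {ζ : Bool} {A : Sgn → ℤ → E} {D : Dir} {M : Type} [AddCommGroup M]
    [Module B M] (P : Eval R E D M) (h1 : P.π 1 = 1) (h : ZeroModes ζ A) :
    ZeroModes ζ fun s k => P.π (A s k) := fun hζ => by
  have hsq : ∀ x, P.π x ^ 2 = P.π (x ^ 2) := fun x => by
    rw [sq, sq, P.map_mul]; cases D <;> rfl
  obtain ⟨h2, h3⟩ := h hζ
  have h2 := congrArg P.π h2
  have h3 := congrArg P.π h3
  rw [P.map_mul, h1] at h2 h3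
  simp only [hsq]
  cases D
  · exact ⟨h2, h3⟩
  · exact ⟨h3, h2⟩

lemma qdet_map {s : Sgn} {X Y : ℤ → E} (hX : Bd s X) (hY : Bd s Y) {D : Dir} {M : Type}
    [AddCommGroup M] [Module B M] (P : Eval R E D M) (k : ℤ) :
    P.π (conv X (shift (qu R (-2)) Y) k) =
      ∑ᶠ i : ℤ, qp (-(2 * ((k - i : ℤ) : ℂ))) • D.comp (P.π (X i)) (P.π (Y (k - i))) := by
  rw [conv_eq_finsum hX (hY.shift _), P.π.map_finsum (finite_support_bd hX (hY.shift (qu R (-2)))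
    (fun i => X i * shift (qu R (-2)) Y (k - i)) k fun _ h => h)]
  refine finsum_congr fun i => ?_
  rw [shift, mul_smul_comm, P.map_smul, qu_zpow, val_qu, P.map_algebraMap, P.map_mul,
    Algebra.smul_def, neg_mul]

lemma LGenCore.arel {ζ : Bool} (h : LGenCore κ b) (hz : ZeroModes ζ (fun s k => QCurrent.uof R b (.al s k)))
    {D : Dir} {M : Type} [AddCommGroup M] [Module B M] (P : Eval R E D M) (h1 : P.π 1 = 1)
    (hq : D.pick (P.π (b .qc)) (P.π (b .qc')) = P.πR κ)
    (hq' : D.pick (P.π (b .qc')) (P.π (b .qc)) = P.πR (↑κ⁻¹ : R))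
    (hc : ∀ r x, Commute (P.πR r) (P.π x)) : ARel ζ D fun x => P.π (b x) := by
  have hmul : P.πR κ * P.πR (↑κ⁻¹ : R) = 1 := by
    rw [← _root_.map_mul, Units.mul_inv, map_one]
  have hmul' : P.πR (↑κ⁻¹ : R) * P.πR κ = 1 := by
    rw [← _root_.map_mul, Units.inv_mul, map_one]
  have t1 : ∀ k : ℤ, P.π (oneCurrent E k) = if k = 0 then 1 else 0 := fun k => by
    rw [oneCurrent]; split_ifs
    · exact h1
    · exact map_zero _
  have hr1 : P.πR ((1 : Rˣ) : R) = 1 := by rw [Units.val_one, map_one]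
  have hr1' : P.πR (((1 : Rˣ)⁻¹ : Rˣ) : R) = 1 := by rw [inv_one, hr1]
  refine ⟨?_, fun x => ?_, fun x => ?_, fun k => ?_, fun k => ?_, fun i k hk => ?_, fun i k hk => ?_,
    fun s => ?_, ?_, fun s k => ?_, ?_⟩
  · cases D
    · exact (congrArg₂ (· * ·) hq hq').trans hmul
    · exact (congrArg₂ (· * ·) hq' hq).trans hmul'
  · cases D
    · exact (show P.π (b .qc) = _ from hq) ▸ hc _ _
    · exact (show P.π (b .qc) = _ from hq') ▸ hc _ _
  · cases D
    · exact (show P.π (b .qc') = _ from hq') ▸ hc _ _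
    · exact (show P.π (b .qc') = _ from hq) ▸ hc _ _
  · exact (congrArg P.π (h.lpos.zero k)).trans (map_zero _)
  · exact (congrArg P.π (h.lneg.zero k)).trans (map_zero _)
  · exact (congrArg P.π (h.lpos.bd i k hk)).trans (map_zero _)
  · exact (congrArg P.π (h.lneg.bd i k hk)).trans (map_zero _)
  · cases s
    · have := h.srll_pos.rll ⟨h.lpos.cur, h.lpos.cur, Or.inl ⟨h.lpos.zero, h.lpos.bd⟩⟩ P
      rwa [hr1, hr1'] at this
    · have := h.srll_neg.rll ⟨h.lneg.cur, h.lneg.cur, Or.inr ⟨h.lneg.zero, h.lneg.bd⟩⟩ P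
      rwa [hr1, hr1'] at this
  · have := h.srll_mixed.rll ⟨h.lpos.cur, h.lneg.cur, Or.inl ⟨h.lpos.zero, h.lpos.bd⟩⟩ P
    rwa [← hq, ← hq'] at this
  · cases s
    · exact (qdet_map (s := .pos) (h.lpos.bd 0) (h.lpos.bd 1) P k).symm.trans
        ((congrArg P.π (congrFun h.qdet_pos k)).trans (t1 k))
    · exact (qdet_map (s := .neg) (h.lneg.bd 0) (h.lneg.bd 1) P k).symm.trans
        ((congrArg P.π (congrFun h.qdet_neg k)).trans (t1 k))
  · exact zeroModes_map P h1 hz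

lemma lcore_of_arel {ζ : Bool} (hm : ∀ x, b x ∈ pc R x.deg) {D : Dir} {ι : Type*} (M : ι → Type)
    [∀ i, AddCommGroup (M i)] [∀ i, Module B (M i)] (P : ∀ i, Eval R E D (M i))
    (hinj : ∀ x y : E, (∀ i m, (P i).π x m = (P i).π y m) → x = y) (h1 : ∀ i, (P i).π 1 = 1)
    (hq : ∀ i, D.pick ((P i).π (b .qc)) ((P i).π (b .qc')) = (P i).πR κ)
    (hq' : ∀ i, D.pick ((P i).π (b .qc')) ((P i).π (b .qc)) = (P i).πR (↑κ⁻¹ : R))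
    (h : ∀ i, ARel ζ D fun x => (P i).π (b x)) :
    LGenCore κ b ∧ ZeroModes ζ (fun s k => uof R b (.al s k)) := by
  have hz : ∀ x, (∀ i, (P i).π x = 0) → x = 0 := fun x hx => hinj _ _ fun i m => by
    rw [hx, map_zero]
  have hr1 : ∀ i, (P i).πR ((1 : Rˣ) : R) = 1 := fun i => by rw [Units.val_one, map_one]
  have hr1' : ∀ i, (P i).πR (((1 : Rˣ)⁻¹ : Rˣ) : R) = 1 := fun i => by rw [inv_one, hr1]
  have t1 : ∀ i (k : ℤ), (P i).π (oneCurrent E k) = if k = 0 then 1 else 0 := fun i k => by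
    rw [oneCurrent]; split_ifs
    · exact h1 i
    · exact map_zero _
  have hp : LPos R fun i j k => b (.L .pos i j k) := ⟨fun i j k => hm (.L .pos i j k),
    fun k => hz _ fun i => (h i).lower k, fun j k hk => hz _ fun i => (h i).diag_pos j k hk⟩
  have hn : LNeg R fun i j k => b (.L .neg i j k) := ⟨fun i j k => hm (.L .neg i j k),
    fun k => hz _ fun i => (h i).upper k, fun j k hk => hz _ fun i => (h i).diag_neg j k hk⟩
  refine ⟨⟨hp, hn, ?_, ?_, ?_, ?_, ?_⟩, fun hζ => ?_⟩
  · refine srll_of_rll ⟨hp.cur, hp.cur, Or.inl ⟨hp.zero, hp.bd⟩⟩ M P hinj fun i => ?_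
    rw [hr1, hr1']
    exact (h i).rll_same .pos
  · refine srll_of_rll ⟨hn.cur, hn.cur, Or.inr ⟨hn.zero, hn.bd⟩⟩ M P hinj fun i => ?_
    rw [hr1, hr1']
    exact (h i).rll_same .neg
  · refine srll_of_rll ⟨hp.cur, hn.cur, Or.inl ⟨hp.zero, hp.bd⟩⟩ M P hinj fun i => ?_
    rw [← hq, ← hq']
    exact (h i).rll_mixed
  · refine funext fun k => hinj _ _ fun i m => ?_
    rw [qdet_map (s := .pos) (hp.bd 0) (hp.bd 1) (P i) k, t1]
    exact LinearMap.congr_fun ((h i).qdet .pos k) m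
  · refine funext fun k => hinj _ _ fun i m => ?_
    rw [qdet_map (s := .neg) (hn.bd 0) (hn.bd 1) (P i) k, t1]
    exact LinearMap.congr_fun ((h i).qdet .neg k) m
  · have hsq : ∀ i x, (P i).π (x ^ 2) = (P i).π x ^ 2 := fun i x => by
      rw [sq, sq, (P i).map_mul]; cases D <;> rfl
    constructor
    · refine hinj _ _ fun i m => LinearMap.congr_fun ?_ m
      rw [(P i).map_mul, hsq, hsq, h1]
      cases D
      · exact ((h i).zero_modes hζ).1
      · exact ((h i).zero_modes hζ).2
    · refine hinj _ _ fun i m => LinearMap.congr_fun ?_ m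
      rw [(P i).map_mul, hsq, hsq, h1]
      cases D
      · exact ((h i).zero_modes hζ).2
      · exact ((h i).zero_modes hζ).1

end Generators

/-! ### The generators of the completed algebras -/

section Generators

variable (ζ : Bool) {n : ℕ}

instance : Fact ((UTh ζ .high).sgn = 1) := ⟨rfl⟩
instance : Fact ((UTh ζ .low).sgn = -1) := ⟨rfl⟩
instance : Fact ((ATh ζ .high).sgn = 1) := ⟨rfl⟩
instance : Fact ((ATh ζ .low).sgn = -1) := ⟨rfl⟩

instance {T : Theory} : T2Space (Completed T n)ᵐᵒᵖ := inferInstance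
instance {T : Theory} : IsTopologicalAddGroup (Completed T n)ᵐᵒᵖ where
  continuous_add := continuous_op.comp
    ((continuous_unop.comp continuous_fst).add (continuous_unop.comp continuous_snd))
  continuous_neg := continuous_op.comp continuous_unop.neg
instance {T : Theory} : SeparatelyContinuousMul (Completed T n)ᵐᵒᵖ := inferInstance
instance {T : Theory} : IsScalarTower B (Cent T n) (Completed T n)ᵐᵒᵖ := inferInstance

variable (D : Dir) (i : Fin n)

lemma urel_gen : URel ζ (ug ζ D i) :=
  URel.of_forall (fun V => evalAt V) (fun _ _ h => Subtype.ext (funext h)) fun V => V.rel i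

/-- A central unit of degree zero given by generators. -/
def centUnit (T : Theory) (i : Fin n) (x y : T.Gen) (hx : T.deg x = 0) (hy : T.deg y = 0)
    (h1 : gen T i x * gen T i y = 1) (h2 : ∀ z, Commute (gen T i x) (gen T i z))
    (h3 : ∀ z, Commute (gen T i y) (gen T i z)) : (Cent T n)ˣ where
  val := ⟨gen T i x, hx ▸ act_mem_piece i x, commute_of_gens fun j z =>
    (eq_or_ne i j).elim (fun h => h ▸ h2 z) fun h => gen_commute h _ _⟩
  inv := ⟨gen T i y, hy ▸ act_mem_piece i y, commute_of_gens fun j z =>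
    (eq_or_ne i j).elim (fun h => h ▸ h3 z) fun h => gen_commute h _ _⟩
  val_inv := Subtype.ext h1
  inv_val := Subtype.ext ((h2 y).eq.symm.trans h1)

/-- The central element `q^c` in the `i`-th tensor factor. -/
def ukap : (Cent (UTh ζ D) n)ˣ := centUnit (UTh ζ D) i UGen.qc UGen.qc' rfl rfl
  (urel_gen ζ D i).qc_mul (urel_gen ζ D i).qc_central (urel_gen ζ D i).qc'_central

lemma agen_qc (D : Dir) (i : Fin n) : ag ζ D i .qc * ag ζ D i .qc' = 1 ∧
    (∀ x, Commute (ag ζ D i .qc) (ag ζ D i x)) ∧ ∀ x, Commute (ag ζ D i .qc') (ag ζ D i x) :=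
  ⟨completed_ext fun V => LinearMap.congr_fun (V.rel i).qc_mul,
    fun x => completed_ext fun V => LinearMap.congr_fun ((V.rel i).qc_central x).eq,
    fun x => completed_ext fun V => LinearMap.congr_fun ((V.rel i).qc'_central x).eq⟩

/-- The central element `q^c` in the `i`-th tensor factor. -/
def akap : (Cent (ATh ζ D) n)ˣ := centUnit (ATh ζ D) i AGen.qc AGen.qc' rfl rfl
  (agen_qc ζ D i).1 (agen_qc ζ D i).2.1 (agen_qc ζ D i).2.2

lemma ugraded_high : UGraded (ukap ζ .high i) (ug ζ .high i) :=
  ⟨fun x => act_mem_piece (T := UTh ζ .high) i x, rfl, rfl⟩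

lemma ucore_high : UCore (ukap ζ .high i) (ug ζ .high i) :=
  (ugraded_high ζ i).core_of_urel (urel_gen ζ .high i)

lemma zeroModes_high : ZeroModes ζ fun s k => ug ζ .high i (.al s k) :=
  ((ugraded_high ζ i).zeroModes_iff (ucore_high ζ i).pair).2 (urel_gen ζ .high i).phi_zero

/-- The generators on lowest weight representations, in the opposite algebra. -/
def ugo (x : UGen) : (Completed (UTh ζ .low) n)ᵐᵒᵖ := op (ug ζ .low i x)

lemma ugraded_low : UGraded (ukap ζ .low i) (ugo ζ i) :=
  ⟨fun x => act_mem_piece (T := UTh ζ .low) i x, rfl, rfl⟩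

lemma urel_low : URel ζ fun x => op (ugo ζ i x) :=
  (urel_gen ζ .low i).map (AlgEquiv.opOp B (Completed (UTh ζ .low) n)).toAlgHom

lemma pair_low (s : Sgn) : InvPair (Cent (UTh ζ .low) n) s (fun k => ugo ζ i (.al s k))
    fun k => ugo ζ i (.be s k) := (ugraded_low ζ i).pair_of_urel_op (urel_low ζ i) s

/-- The generators of the lowest weight theory, turned by the antipode into generators of the
opposite algebra that satisfy the relations of the highest weight theory. -/
def uga : UGen → (Completed (UTh ζ .low) n)ᵐᵒᵖ := UGraded.antip (Cent (UTh ζ .low) n) (ugo ζ i)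

lemma ugraded_uga : UGraded (ukap ζ .low i)⁻¹ (uga ζ i) := (ugraded_low ζ i).graded_antip

lemma urel_uga : URel ζ (uga ζ i) := (ugraded_low ζ i).urel_antip (urel_low ζ i)

lemma ucore_uga : UCore (ukap ζ .low i)⁻¹ (uga ζ i) :=
  (ugraded_uga ζ i).core_of_urel (urel_uga ζ i)

lemma zeroModes_uga : ZeroModes ζ fun s k => uga ζ i (.al s k) :=
  ((ugraded_uga ζ i).zeroModes_iff (ucore_uga ζ i).pair).2 (urel_uga ζ i).phi_zero

lemma evalHigh_commute {T : Theory} (V : Rep T n) (r : Cent T n) (x : Completed T n) :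
    Commute ((evalHigh V).πR r) ((evalHigh V).π x) := (r.2.2 x).map (evalAt V)

lemma evalLow_commute {T : Theory} (V : Rep T n) (r : Cent T n) (x : (Completed T n)ᵐᵒᵖ) :
    Commute ((evalLow V).πR r) ((evalLow V).π x) := (r.2.2 x.unop).map (evalAt V)

lemma lgraded_high : LGraded (akap ζ .high i) (ag ζ .high i) :=
  ⟨fun x => act_mem_piece (T := ATh ζ .high) i x, rfl, rfl⟩

lemma lcore_high : LGenCore (akap ζ .high i) (ag ζ .high i) ∧
    ZeroModes ζ fun s k => uof (Cent (ATh ζ .high) n) (ag ζ .high i) (.al s k) :=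
  lcore_of_arel (lgraded_high ζ i).mem (fun V : Rep (ATh ζ .high) n => V.carrier) (fun V => evalHigh V)
    (fun _ _ h => completed_ext h) (fun _ => rfl) (fun _ => rfl) (fun _ => rfl) fun V => V.rel i

/-- The generators on lowest weight representations, in the opposite algebra. -/
def ago : AGen → (Completed (ATh ζ .low) n)ᵐᵒᵖ := swapqc fun x => op (ag ζ .low i x)

lemma lgraded_low : LGraded (akap ζ .low i)⁻¹ (ago ζ i) :=
  ⟨fun x => match x with
    | .L s j k l => act_mem_piece (T := ATh ζ .low) i (AGen.L s j k l)
    | .qc => act_mem_piece (T := ATh ζ .low) i AGen.qc'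
    | .qc' => act_mem_piece (T := ATh ζ .low) i AGen.qc, rfl, rfl⟩

lemma lcore_low : LGenCore (akap ζ .low i)⁻¹ (ago ζ i) ∧
    ZeroModes ζ fun s k => uof (Cent (ATh ζ .low) n) (ago ζ i) (.al s k) := by
  have := lcore_of_arel (R := Cent (ATh ζ .low) n) (κ := (akap ζ .low i)⁻¹)
    (b := fun x => op (ag ζ .low i x)) (ζ := ζ)
    (fun x => act_mem_piece (T := ATh ζ .low) i x) (fun V : Rep (ATh ζ .low) n => V.carrier)
    (fun V => evalLow V) (fun _ _ h => unop_injective (completed_ext h)) (fun _ => rfl) (fun _ => rfl)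
    (fun _ => by rw [inv_inv]; rfl) fun V => V.rel i
  refine ⟨this.1, fun hζ => this.2 hζ⟩

/-- The generators of the Drinfeld algebra, on lowest weight representations, in terms of those of
the `L`-matrix algebra. -/
def ualow : UGen → (Completed (ATh ζ .low) n)ᵐᵒᵖ := uof (Cent (ATh ζ .low) n) (ago ζ i)

lemma ugraded_ualow : UGraded (akap ζ .low i)⁻¹ (ualow ζ i) :=
  (lgraded_low ζ i).uof (lcore_low ζ i).1

lemma ucore_ualow : UCore (akap ζ .low i)⁻¹ (ualow ζ i) := (lcore_low ζ i).1.uof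

/-! ### The isomorphism -/

section Evaluation

variable {ζ} {T T' : Theory} {m : ℕ} (V : Rep T n)

lemma URel.eval {a : UGen → Completed T n} (h : URel ζ a) : URel ζ fun x => (a x).1 V :=
  h.map (evalAt V)

lemma URel.eval_op {a : UGen → (Completed T n)ᵐᵒᵖ} (h : URel ζ fun x => op (a x)) :
    URel ζ fun x => (a x).unop.1 V :=
  (h.map (AlgEquiv.opOp B (Completed T n)).symm.toAlgHom).map (evalAt V)

lemma LGenCore.arel_high [Fact (T.sgn = 1)] {b : AGen → Completed T n} {κ : (Cent T n)ˣ}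
    (hg : LGraded κ b) (h : LGenCore κ b)
    (hz : ZeroModes ζ (fun s k => QCurrent.uof (Cent T n) b (.al s k))) :
    ARel ζ .high fun x => (b x).1 V :=
  h.arel hz (evalHigh V) rfl (congrArg (evalHigh V).π hg.qc) (congrArg (evalHigh V).π hg.qc')
    (evalHigh_commute V)

lemma LGenCore.arel_low [Fact (T.sgn = -1)] {b : AGen → (Completed T n)ᵐᵒᵖ} {κ : (Cent T n)ˣ}
    (hg : LGraded κ b) (h : LGenCore κ b)
    (hz : ZeroModes ζ (fun s k => QCurrent.uof (Cent T n) b (.al s k))) :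
    ARel ζ .low fun x => (swapqc b x).unop.1 V :=
  LGenCore.arel (b := swapqc b) h hz (evalLow V) rfl (congrArg (evalLow V).π hg.qc)
    (congrArg (evalLow V).π hg.qc') (evalLow_commute V)

lemma mapsSums_high [Fact (T.sgn = 1)] [Fact (T'.sgn = 1)] (D : ActData T m T' n) :
    MapsSums (Cent T m) D.hom := mapsSums_of_continuous D.continuous_hom

lemma mapsSums_low [Fact (T.sgn = -1)] [Fact (T'.sgn = -1)] (D : ActData T m T' n) :
    MapsSums (Cent T m) (AlgHom.op D.hom) :=
  mapsSums_of_continuous (continuous_op.comp (D.continuous_hom.comp continuous_unop))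

lemma LGenCore.urel_uof [Fact (T.sgn = 1)] {b : AGen → Completed T n} {κ : (Cent T n)ˣ}
    (hg : LGraded κ b) (h : LGenCore κ b)
    (hz : ZeroModes ζ (fun s k => QCurrent.uof (Cent T n) b (.al s k))) :
    URel ζ fun x => (QCurrent.uof (Cent T n) b x).1 V :=
  ((hg.uof h).urel_of_core h.uof hz).eval V

lemma LGenCore.urel_op_uof [Fact (T.sgn = -1)] {b : AGen → (Completed T n)ᵐᵒᵖ} {κ : (Cent T n)ˣ}
    (hg : LGraded κ b) (h : LGenCore κ b)
    (hz : ZeroModes ζ (fun s k => QCurrent.uof (Cent T n) b (.al s k))) :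
    URel ζ fun x => (UGraded.antip (Cent T n) (QCurrent.uof (Cent T n) b) x).unop.1 V :=
  URel.eval_op V ((hg.uof h).urel_op_antip ((hg.uof h).urel_of_core h.uof hz))

lemma UCore.arel_high [Fact (T.sgn = 1)] {a : UGen → Completed T n} {κ : (Cent T n)ˣ}
    (hg : UGraded κ a) (h : UCore κ a) (hz : ZeroModes ζ fun s k => a (.al s k)) :
    ARel ζ .high fun x => (QCurrent.lof (Cent T n) a x).1 V :=
  h.lof.arel_high V (hg.lof h) (by rw [uof_lof h]; exact hz)

lemma UCore.arel_low [Fact (T.sgn = -1)] {a : UGen → (Completed T n)ᵐᵒᵖ} {κ : (Cent T n)ˣ}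
    (hg : UGraded κ a) (h : UCore κ a) (hz : ZeroModes ζ fun s k => a (.al s k)) :
    ARel ζ .low fun x => (swapqc (QCurrent.lof (Cent T n) a) x).unop.1 V :=
  h.lof.arel_low V (hg.lof h) (by rw [uof_lof h]; exact hz)

end Evaluation

lemma arel_mu (V : Rep (UTh ζ .high) 1) : ARel ζ .high fun x =>
    (lof (Cent (UTh ζ .high) 1) (ug ζ .high (n := 1) 0) x).1 V :=
  UCore.arel_high V (ugraded_high (n := 1) ζ 0) (ucore_high (n := 1) ζ 0) (zeroModes_high (n := 1) ζ 0)

lemma urel_muInv (V : Rep (ATh ζ .high) 1) : URel ζ fun x =>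
    (uof (Cent (ATh ζ .high) 1) (ag ζ .high (n := 1) 0) x).1 V :=
  LGenCore.urel_uof V (lgraded_high (n := 1) ζ 0) (lcore_high (n := 1) ζ 0).1 (lcore_high (n := 1) ζ 0).2

lemma arel_muLow (V : Rep (UTh ζ .low) 1) : ARel ζ .low fun x =>
    (swapqc (lof (Cent (UTh ζ .low) 1) (uga (n := 1) ζ 0)) x).unop.1 V :=
  UCore.arel_low V (ugraded_uga (n := 1) ζ 0) (ucore_uga (n := 1) ζ 0) (zeroModes_uga (n := 1) ζ 0)

lemma urel_muLowInv (V : Rep (ATh ζ .low) 1) : URel ζ fun x =>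
    (UGraded.antip (Cent (ATh ζ .low) 1) (ualow (n := 1) ζ 0) x).unop.1 V :=
  LGenCore.urel_op_uof V (lgraded_low (n := 1) ζ 0) (lcore_low (n := 1) ζ 0).1 (lcore_low (n := 1) ζ 0).2

/-- The map `μ` on generators. -/
def muData : ActData (ATh ζ .high) 1 (UTh ζ .high) 1 where
  act _ := lof (Cent (UTh ζ .high) 1) (ug ζ .high 0)
  mem _ := ((ugraded_high (n := 1) ζ 0).lof (ucore_high (n := 1) ζ 0)).mem
  rel V _ := arel_mu ζ V
  comm i j h := absurd (Subsingleton.elim i j) h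
  sgn := rfl

/-- The inverse of `μ` on generators. -/
def muInvData : ActData (UTh ζ .high) 1 (ATh ζ .high) 1 where
  act _ := uof (Cent (ATh ζ .high) 1) (ag ζ .high 0)
  mem _ := ((lgraded_high (n := 1) ζ 0).uof (lcore_high (n := 1) ζ 0).1).mem
  rel V _ := urel_muInv ζ V
  comm i j h := absurd (Subsingleton.elim i j) h
  sgn := rfl

lemma muInv_mu (x : AGen) : (muInvData ζ).hom ((muData ζ).act 0 x) = ag ζ .high 0 x := by
  have hF : MapsSums (Cent (UTh ζ .high) 1) (muInvData ζ).hom :=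
    mapsSums_high (muInvData ζ)
  have := hF.map_lof (R' := Cent (ATh ζ .high) 1) (ucore_high (n := 1) ζ 0)
  refine (congrFun this x).trans (congrFun (lof_uof (lcore_high (n := 1) ζ 0).1) x)

lemma mu_muInv (x : UGen) : (muData ζ).hom ((muInvData ζ).act 0 x) = ug ζ .high 0 x := by
  have hF : MapsSums (Cent (ATh ζ .high) 1) (muData ζ).hom :=
    mapsSums_high (muData ζ)
  have := hF.map_uof (R' := Cent (UTh ζ .high) 1) (lcore_high (n := 1) ζ 0).1
  refine (congrFun this x).trans (congrFun (uof_lof (ucore_high (n := 1) ζ 0)) x)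

/-- The map `μ` on lowest weight representations on generators. -/
def muLowData : ActData (ATh ζ .low) 1 (UTh ζ .low) 1 where
  act _ x := (swapqc (lof (Cent (UTh ζ .low) 1) (uga ζ 0)) x).unop
  mem _ x := match x with
    | .L s i j k => ((ugraded_uga (n := 1) ζ 0).lof (ucore_uga (n := 1) ζ 0)).mem (.L s i j k)
    | .qc => ((ugraded_uga (n := 1) ζ 0).lof (ucore_uga (n := 1) ζ 0)).mem .qc'
    | .qc' => ((ugraded_uga (n := 1) ζ 0).lof (ucore_uga (n := 1) ζ 0)).mem .qc
  rel V _ := arel_muLow ζ V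
  comm i j h := absurd (Subsingleton.elim i j) h
  sgn := rfl

/-- The inverse of `μ` on lowest weight representations on generators. -/
def muLowInvData : ActData (UTh ζ .low) 1 (ATh ζ .low) 1 where
  act _ x := (UGraded.antip (Cent (ATh ζ .low) 1) (ualow ζ 0) x).unop
  mem _ := (ugraded_ualow (n := 1) ζ 0).graded_antip.mem
  rel V _ := urel_muLowInv ζ V
  comm i j h := absurd (Subsingleton.elim i j) h
  sgn := rfl

lemma muLow_muLowInv (x : UGen) : (muLowData ζ).hom ((muLowInvData ζ).act 0 x) = ug ζ .low 0 x := by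
  have hF : MapsSums (Cent (ATh ζ .low) 1) (AlgHom.op (muLowData ζ).hom) :=
    mapsSums_low (muLowData ζ)
  have h1 : (fun x => AlgHom.op (muLowData ζ).hom (ago ζ 0 x)) = lof (Cent (UTh ζ .low) 1) (uga ζ 0) := by
    funext x
    match x with
    | .L s i j k => rfl
    | .qc => rfl
    | .qc' => rfl
  have h2 := (hF.map_uof (R' := Cent (UTh ζ .low) 1) (lcore_low (n := 1) ζ 0).1).trans
    ((congrArg _ h1).trans (uof_lof (ucore_uga (n := 1) ζ 0)))
  have h3 := (hF.map_antip (R' := Cent (UTh ζ .low) 1) (ugraded_ualow (n := 1) ζ 0)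
    (ucore_ualow (n := 1) ζ 0).pair).trans ((congrArg _ h2).trans
    ((ugraded_low (n := 1) ζ 0).antip_antip (pair_low (n := 1) ζ 0)))
  exact congrArg unop (congrFun h3 x)

lemma muLowInv_muLow (x : AGen) : (muLowInvData ζ).hom ((muLowData ζ).act 0 x) = ag ζ .low 0 x := by
  have hG : MapsSums (Cent (UTh ζ .low) 1) (AlgHom.op (muLowInvData ζ).hom) :=
    mapsSums_low (muLowInvData ζ)
  have h2 := (hG.map_antip (R' := Cent (ATh ζ .low) 1) (ugraded_low (n := 1) ζ 0) (pair_low (n := 1) ζ 0)).trans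
    ((ugraded_ualow (n := 1) ζ 0).antip_antip (ucore_ualow (n := 1) ζ 0).pair)
  have h3 := (hG.map_lof (R' := Cent (ATh ζ .low) 1) (ucore_uga (n := 1) ζ 0)).trans
    ((congrArg _ h2).trans (lof_uof (lcore_low (n := 1) ζ 0).1))
  match x with
  | .L s i j k => exact congrArg unop (congrFun h3 (.L s i j k))
  | .qc => exact congrArg unop (congrFun h3 .qc')
  | .qc' => exact congrArg unop (congrFun h3 .qc)

/-- The isomorphism given by inverse maps on generators. -/
def ActData.equiv {T T' : Theory} (D : ActData T 1 T' 1) (D' : ActData T' 1 T 1)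
    (h : ∀ x, D'.hom (D.act 0 x) = gen T 0 x) (h' : ∀ x, D.hom (D'.act 0 x) = gen T' 0 x) :
    Completed T 1 ≃ₐ[B] Completed T' 1 :=
  AlgEquiv.ofAlgHom D.hom D'.hom (AlgHom.ext fun η => ActData.hom_hom D' D h' η)
    (AlgHom.ext fun η => ActData.hom_hom D D' h η)

lemma ActData.isHomeomorph_equiv {T T' : Theory} (D : ActData T 1 T' 1) (D' : ActData T' 1 T 1)
    (h : ∀ x, D'.hom (D.act 0 x) = gen T 0 x) (h' : ∀ x, D.hom (D'.act 0 x) = gen T' 0 x) :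
    IsHomeomorph (ActData.equiv D D' h h') :=
  isHomeomorph_iff_exists_inverse.2 ⟨D.continuous_hom, D'.hom,
    fun η => ActData.hom_hom D D' h η, fun η => ActData.hom_hom D' D h' η, D'.continuous_hom⟩

end Generators

section

/-! ### Calculus for the coproduct -/

lemma Quad.add {p p' : R} {μ : R⟦X⟧} {X Z : ℤ → E} (hX : IsCurrent R X)
    (hZ : IsCurrent R Z) (h1 : Quad p X) (h2 : Quad p Z) (hp : p * p' = 1)
    (hμ : (PowerSeries.X - C p') * μ =
      C p' * (PowerSeries.X - C p)) (h : NExch μ X Z) :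
    Quad p fun k => X k + Z k := by
  have key : ∀ k l, X (k - 1) * Z l - p • (X k * Z (l - 1)) =
      p • (Z l * X (k - 1)) - Z (l - 1) * X k := fun k l => by
    have h3 : act (PowerSeries.X - C p') (nop μ X Z) k (l - 1) =
        act (C p' * (PowerSeries.X - C p)) (fun k l => X k * Z l) k (l - 1) := by
      rw [nop_eq_act, act_act (reg_mul hX hZ), hμ]
    rw [act_C_mul (reg_mul hX hZ), act_X_sub_C, act_X_sub_C, sub_add_cancel, ← h, ← h] at h3
    have h4 := congrArg (p • ·) h3
    simp only [smul_smul, hp, one_smul, smul_sub p (Z l * X (k - 1))] at h4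
    exact h4.symm
  intro k l
  have e1 := h1 k l
  have e2 := h2 k l
  have e3 := key k l
  have e4 := key l k
  simp only [add_mul, mul_add, smul_add]
  linear_combination (norm := module) e1 + e2 + e3 + e4

lemma NExch.shift_first' {u : R⟦X⟧ˣ} {X Y : ℤ → E} (c : Rˣ) (hX : IsCurrent R X)
    (hY : IsCurrent R Y) (h : NExch (u : R⟦X⟧) X Y) :
    NExch ((rs c u : R⟦X⟧ˣ) : R⟦X⟧) (shift c X) Y := h.shift_first c hX hY

lemma NExch.shift_second' {u : R⟦X⟧ˣ} {X Y : ℤ → E} (c : Rˣ) (hX : IsCurrent R X)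
    (hY : IsCurrent R Y) (h : NExch (u : R⟦X⟧) X Y) :
    NExch ((rs c⁻¹ u : R⟦X⟧ˣ) : R⟦X⟧) X (shift c Y) := h.shift_second c hX hY

lemma nexch_of_commute {X Y : ℤ → E} (h : ∀ k l, Commute (X k) (Y l)) :
    NExch ((1 : R⟦X⟧ˣ) : R⟦X⟧) X Y := nexch_one_iff.2 fun k l => (h k l).symm

lemma NExch.prod_first {u v w : R⟦X⟧ˣ} {X P Y : ℤ → E} (hX : IsCurrent R X)
    (hY : IsCurrent R Y) (hP : IsCurrent R P) (hc : Plus P ∨ Minus X)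
    (h : NExch (u : R⟦X⟧) X Y) (h' : NExch (v : R⟦X⟧) P Y) (hw : u * v = w) :
    NExch (w : R⟦X⟧) (conv X P) Y := hw ▸ h.conv_first hX hY hP hc h'

lemma NExch.prod_second {u v w : R⟦X⟧ˣ} {X P Y : ℤ → E} (hX : IsCurrent R X)
    (hP : IsCurrent R P) (hY : IsCurrent R Y) (hc : Plus Y ∨ Minus P)
    (h' : NExch (v : R⟦X⟧) X P) (h : NExch (u : R⟦X⟧) X Y) (hw : v * u = w) :
    NExch (w : R⟦X⟧) X (conv P Y) := by
  rw [← hw, mul_comm]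
  exact h.conv_second hX hY hP hc h'

lemma smul_deltaTerm_first (c u : Rˣ) (D : ℤ → E) (k l : ℤ) :
    (↑(c ^ k) : R) • deltaTerm u D k l = deltaTerm (c * u) D k l := by
  rw [deltaTerm, deltaTerm, smul_smul, ← Units.val_mul, mul_zpow]

lemma smul_deltaTerm_second (c u : Rˣ) (D : ℤ → E) (k l : ℤ) :
    (↑(c ^ l) : R) • deltaTerm u D k l = deltaTerm (c⁻¹ * u) (shift c D) k l := by
  rw [deltaTerm, deltaTerm, shift, smul_smul, smul_smul, ← Units.val_mul, ← Units.val_mul, mul_zpow,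
    zpow_add, inv_zpow]
  congr 2
  rw [mul_mul_mul_comm, inv_mul_cancel, one_mul, mul_comm]

lemma Quad.shift {p : R} {X : ℤ → E} (c : Rˣ) (h : Quad p X) : Quad p (shift c X) := by
  intro k l
  have e : ∀ i j : ℤ, QCurrent.shift c X i * QCurrent.shift c X j =
      (↑(c ^ (i + j)) : R) • (X i * X j) := fun i j => by
    rw [QCurrent.shift, QCurrent.shift, smul_mul_smul_comm, ← Units.val_mul, zpow_add]
  have h1 := congrArg ((↑(c ^ (k + l - 1)) : R) • ·) (h k l)
  simp only [e, smul_sub, smul_comm p] at h1 ⊢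
  convert h1 using 5 <;> ring_nf

lemma NRel.shift_first {X Y D D' : ℤ → E} {u v : Rˣ} {s : R} (c : Rˣ) (hX : IsCurrent R X)
    (hY : IsCurrent R Y)
    (h : NRel (1 : R⟦X⟧) X Y fun k l => s • (deltaTerm u D k l - deltaTerm v D' k l)) :
    NRel (1 : R⟦X⟧) (shift c X) Y fun k l => s • (deltaTerm (c * u) D k l - deltaTerm (c * v) D' k l) := by
  intro k l
  have h1 := h k l
  rw [nop_one] at h1
  rw [nop_one]
  beta_reduce at h1 ⊢
  rw [← smul_deltaTerm_first, ← smul_deltaTerm_first, shift,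
    mul_smul_comm, h1, smul_add, smul_mul_assoc, ← smul_sub, smul_comm s]

lemma NRel.shift_second {X Y D D' : ℤ → E} {u v : Rˣ} {s : R} (c : Rˣ) (hX : IsCurrent R X)
    (hY : IsCurrent R Y)
    (h : NRel (1 : R⟦X⟧) X Y fun k l => s • (deltaTerm u D k l - deltaTerm v D' k l)) :
    NRel (1 : R⟦X⟧) X (shift c Y) fun k l =>
      s • (deltaTerm (c⁻¹ * u) (shift c D) k l - deltaTerm (c⁻¹ * v) (shift c D') k l) := by
  intro k l
  have h1 := h k l
  rw [nop_one] at h1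
  rw [nop_one]
  beta_reduce at h1 ⊢
  rw [← smul_deltaTerm_second, ← smul_deltaTerm_second, shift,
    smul_mul_assoc, h1, smul_add, mul_smul_comm, ← smul_sub, smul_comm s]

variable [Algebra B R]

/-! ### The coproduct of two families of generators -/

section Cop

variable (κ₀ κ₁ : Rˣ) (A₀ A₀' e₀ A₁ A₁' e₁ : Sgn → ℤ → E)

/-- The current `α^±(z)` in the coproduct. -/
def copA (A₀ A₁ : Sgn → ℤ → E) : Sgn → ℤ → E
  | .pos => conv (A₀ .pos) (shift κ₀ (A₁ .pos))
  | .neg => conv (shift κ₁ (A₀ .neg)) (A₁ .neg)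

/-- The current `ξ^±(z)` in the coproduct. -/
def copE : Sgn → ℤ → E
  | .pos => fun k => e₀ .pos k + conv (shift κ₀ (e₁ .pos)) (Phi R .pos A₀ A₀' .pos) k
  | .neg => fun k => e₁ .neg k + conv (Phi R .pos A₁ A₁' .neg) (shift κ₁ (e₀ .neg)) k

variable {κ₀ κ₁ A₀ A₀' e₀ A₁ A₁' e₁}

/-- Two families of currents that commute with each other. -/
structure Cross (A₀ A₀' e₀ A₁ A₁' e₁ : Sgn → ℤ → E) : Prop where
  AA : ∀ s t k l, Commute (A₀ s k) (A₁ t l)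
  AA' : ∀ s t k l, Commute (A₀ s k) (A₁' t l)
  A'A : ∀ s t k l, Commute (A₀' s k) (A₁ t l)
  A'A' : ∀ s t k l, Commute (A₀' s k) (A₁' t l)
  Ae : ∀ s t k l, Commute (A₀ s k) (e₁ t l)
  A'e : ∀ s t k l, Commute (A₀' s k) (e₁ t l)
  eA : ∀ s t k l, Commute (e₀ s k) (A₁ t l)
  eA' : ∀ s t k l, Commute (e₀ s k) (A₁' t l)
  ee : ∀ s t k l, Commute (e₀ s k) (e₁ t l)

lemma commute_dblc {s : Sgn} {X X' : ℤ → E} {y : E} (h : InvPair R s X X')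
    (hc : ∀ k, Commute y (X k)) (k : ℤ) : Commute y (dblc R X k) :=
  commute_conv h.cur (h.shift _).cur (h.bd.or (h.bd.shift _)) hc (commute_shift _ hc) k

lemma commute_shift_left {X : ℤ → E} {y : E} (c : Rˣ) (h1 : ∀ k, Commute (X k) y) (k : ℤ) :
    Commute (shift c X k) y := (h1 k).smul_left _

lemma conv_conv_conv {s : Sgn} {X Y X' Y' : ℤ → E} (hX : IsCurrent R X) (hY : IsCurrent R Y)
    (hX' : IsCurrent R X') (hY' : IsCurrent R Y') (bX : Bd s X) (bY : Bd s Y) (bX' : Bd s X')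
    (bY' : Bd s Y') (hc : ∀ k l, Commute (Y k) (X' l)) :
    conv (conv X Y) (conv X' Y') = conv (conv X X') (conv Y Y') := by
  rw [conv_assoc_bd hX hY (isCurrent_conv hX' hY') bX bY (bX'.conv bY'),
    ← conv_assoc_bd hY hX' hY' bY bX' bY', conv_comm hc, conv_assoc_bd hX' hY hY' bX' bY bY',
    ← conv_assoc_bd hX hX' (isCurrent_conv hY hY') bX bX' (bY.conv bY')]

lemma dblc_conv {s : Sgn} {X Y X' Y' : ℤ → E} (h : InvPair R s X X') (h' : InvPair R s Y Y')
    (hc : ∀ k l, Commute (X k) (Y l)) : dblc R (conv X Y) = conv (dblc R X) (dblc R Y) := by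
  rw [dblc, shift_conv _ h.cur h'.cur (h.bd.or h'.bd)]
  exact conv_conv_conv h.cur h'.cur (h.shift _).cur (h'.shift _).cur h.bd h'.bd (h.shift _).bd
    (h'.shift _).bd fun k l => (commute_shift_left _ (fun l => hc l k) l).symm

lemma dblc_shift {s : Sgn} {X X' : ℤ → E} (h : InvPair R s X X') (c : Rˣ) :
    dblc R (shift c X) = shift c (dblc R X) := by
  rw [dblc, dblc, shift_conv c h.cur (h.shift _).cur (h.bd.or (h.bd.shift _)), shift_shift,
    shift_shift, mul_comm]

section

variable (h₀ : Core .pos κ₀ A₀ A₀' e₀) (h₁ : Core .pos κ₁ A₁ A₁' e₁)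
  (hc : Cross A₀ A₀' e₀ A₁ A₁' e₁)
include h₀ h₁ hc

lemma pair_cop : ∀ s, InvPair R s (copA κ₀ κ₁ A₀ A₁ s) (copA κ₀ κ₁ A₀' A₁' s)
  | .pos => (h₀.pair _).conv ((h₁.pair _).shift _) fun k l => commute_shift _ (hc.AA _ _ k) l
  | .neg => ((h₀.pair _).shift _).conv (h₁.pair _) fun k l =>
      commute_shift_left _ (fun k => hc.AA _ _ k l) k

lemma Phi_cop_pos : Phi R .pos (copA κ₀ κ₁ A₀ A₁) (copA κ₀ κ₁ A₀' A₁') .pos =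
    conv (Phi R .pos A₀ A₀' .pos) (shift κ₀ (Phi R .pos A₁ A₁' .pos)) := by
  refine (dblc_conv (h₀.pair .pos).symm ((h₁.pair .pos).symm.shift κ₀) fun k l =>
    commute_shift _ (hc.A'A' _ _ k) l).trans ?_
  rw [dblc_shift (h₁.pair .pos).symm]
  rfl

lemma Phi_cop_neg : Phi R .pos (copA κ₀ κ₁ A₀ A₁) (copA κ₀ κ₁ A₀' A₁') .neg =
    conv (shift κ₁ (Phi R .pos A₀ A₀' .neg)) (Phi R .pos A₁ A₁' .neg) := by
  refine (dblc_conv ((h₀.pair .neg).symm.shift κ₁) (h₁.pair .neg).symm fun k l =>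
    commute_shift_left _ (fun k => hc.A'A' _ _ k l) k).trans ?_
  rw [dblc_shift (h₀.pair .neg).symm]
  rfl

lemma quad_cop : ∀ s, Quad ((qu R (2 * (Sgn.pos.int * s.int : ℤ)) : Rˣ) : R)
    (copE κ₀ κ₁ A₀ A₀' e₀ A₁ A₁' e₁ s) := by
  have f₀ := h₀.pairPhi .pos
  have f₁ := h₁.pairPhi .pos
  have p₀ := h₀.pair
  have p₁ := h₁.pair
  have eF : ∀ s t k l, Commute (e₀ s k) (Phi R .pos A₁ A₁' t l) := fun s t k l =>
    commute_dblc (p₁ t).symm (hc.eA' s t k) l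
  have Fe : ∀ s t k l, Commute (Phi R .pos A₀ A₀' s k) (e₁ t l) := fun s t k l =>
    (commute_dblc (p₀ s).symm (fun k => (hc.A'e s t k l).symm) k).symm
  have c1 : ∀ p : R, (PowerSeries.X - C p) * ((1⁻¹ : R⟦X⟧ˣ) : R⟦X⟧) =
      C 1 * (PowerSeries.X - C p) := fun p => by simp
  have q0 : ∀ n : ℂ, (qu R n : R) * (qu R (-n) : Rˣ) = 1 := fun n => by
    rw [qu_neg, Units.mul_inv]
  rintro (_ | _)
  · have hs := isCurrent_shift κ₀ (h₁.cur .pos)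
    have hZ := ((h₁.quad .pos).shift κ₀).conv_right hs (f₀ .pos).cur (f₀ .pos).bd
      (fun k l => ((f₀ .pos).comm k l).eq) (nexch_of_commute fun k l =>
        commute_shift _ (Fe .pos .pos k) l) (c1 _)
    have hx : NExch (((ev R ug')⁻¹ : R⟦X⟧ˣ) : R⟦X⟧)
        (conv (shift κ₀ (e₁ .pos)) (Phi R .pos A₀ A₀' .pos)) (e₀ .pos) := by
      refine NExch.prod_first hs (h₀.cur _) (f₀ .pos).cur (Or.inl (f₀ .pos).bd)
        (nexch_of_commute fun k l => (commute_shift κ₀ (fun k => hc.ee _ _ l k) k).symm)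
        (h₀.Phi_pos_pos .pos) ?_
      rw [one_mul, show -Sgn.pos.int = -1 from rfl, zpow_neg_one]
    rw [show copE κ₀ κ₁ A₀ A₀' e₀ A₁ A₁' e₁ .pos = fun k => conv (shift κ₀ (e₁ .pos))
      (Phi R .pos A₀ A₀' .pos) k + e₀ .pos k from funext fun k => add_comm _ _]
    refine hZ.add (isCurrent_conv hs (f₀ .pos).cur) (h₀.cur .pos) (h₀.quad .pos) ?_ ?_ hx
      (p' := (qu R (-2) : R))
    · simpa [Sgn.int] using q0 2
    · simpa [Sgn.int] using Core.ev_X_sub_mul_inv_g (R := R)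
  · have hs := isCurrent_shift κ₁ (h₀.cur .neg)
    have hZ := ((h₀.quad .neg).shift κ₁).conv_left hs (f₁ .neg).cur (f₁ .neg).bd
      (fun k l => ((f₁ .neg).comm k l).eq) (nexch_of_commute fun k l =>
        commute_shift_left _ (fun k => eF .neg .neg k l) k) (c1 _)
    have hx : NExch ((ev R ug' : R⟦X⟧ˣ) : R⟦X⟧) (e₁ .neg)
        (conv (Phi R .pos A₁ A₁' .neg) (shift κ₁ (e₀ .neg))) := by
      refine NExch.prod_second (h₁.cur _) (f₁ .neg).cur hs (Or.inr (f₁ .neg).bd)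
        (h₁.Phi_neg_neg .pos)
        (nexch_of_commute fun k l => (commute_shift_left κ₁ (fun l => hc.ee _ _ l k) l).symm) ?_
      rw [mul_one, show Sgn.pos.int = 1 from rfl, zpow_one]
    refine (h₁.quad .neg).add (h₁.cur .neg) (isCurrent_conv (f₁ .neg).cur hs) hZ ?_ ?_ hx
      (p' := (qu R 2 : R))
    · simpa [Sgn.int] using q0 (-2)
    · simpa [Sgn.int] using Core.ev_X_sub_mul_g (R := R)

lemma comm_cop : NRel (1 : R⟦X⟧) (copE κ₀ κ₁ A₀ A₀' e₀ A₁ A₁' e₁ .pos)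
    (copE κ₀ κ₁ A₀ A₀' e₀ A₁ A₁' e₁ .neg) fun k l => (-(Sgn.pos.int : R) * cq R) •
      (deltaTerm ((κ₀ * κ₁) ^ (-Sgn.pos.int))
        (Phi R .pos (copA κ₀ κ₁ A₀ A₁) (copA κ₀ κ₁ A₀' A₁') .neg) k l -
      deltaTerm ((κ₀ * κ₁) ^ Sgn.pos.int) (shift ((κ₀ * κ₁) ^ (-Sgn.pos.int))
        (Phi R .pos (copA κ₀ κ₁ A₀ A₁) (copA κ₀ κ₁ A₀' A₁') .pos)) k l) := by
  have f₀ := h₀.pairPhi .pos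
  have f₁ := h₁.pairPhi .pos
  have p₀ := h₀.pair
  have p₁ := h₁.pair
  have hn : NExch (((rs (κ₁ ^ (-Sgn.pos.int)) (ev R ug')) ^ (-Sgn.pos.int) : R⟦X⟧ˣ) :
    R⟦X⟧) (e₁ .pos) (Phi R .pos A₁ A₁' .neg) := h₁.Phi_neg_pos .pos
  have hm : NExch (((rs (κ₀ ^ Sgn.pos.int) (ev R ug')) ^ Sgn.pos.int : R⟦X⟧ˣ) :
    R⟦X⟧) (Phi R .pos A₀ A₀' .pos) (e₀ .neg) := h₀.Phi_pos_neg .pos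
  have hC₀ := h₀.comm
  have hC₁ := h₁.comm
  rw [Phi_cop_pos h₀ h₁ hc, Phi_cop_neg h₀ h₁ hc]
  generalize hF₀ : Phi R .pos A₀ A₀' = F₀ at *
  generalize hF₁ : Phi R .pos A₁ A₁' = F₁ at *
  generalize (-(Sgn.pos.int : R) * cq R) = s at *
  simp only [show Sgn.pos.int = 1 from rfl, zpow_neg_one, zpow_one] at *
  have eF : ∀ s t k l, Commute (e₀ s k) (F₁ t l) := fun s t k l => by
    subst hF₁; exact commute_dblc (p₁ t).symm (hc.eA' s t k) l
  have Fe : ∀ s t k l, Commute (F₀ s k) (e₁ t l) := fun s t k l => by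
    subst hF₀; exact (commute_dblc (p₀ s).symm (fun k => (hc.A'e s t k l).symm) k).symm
  have FA' : ∀ s t k l, Commute (F₀ s k) (A₁' t l) := fun s t k l => by
    subst hF₀; exact (commute_dblc (p₀ s).symm (fun k => (hc.A'A' s t k l).symm) k).symm
  have FF : ∀ s t k l, Commute (F₀ s k) (F₁ t l) := fun s t k l => by
    subst hF₁; exact commute_dblc (p₁ t).symm (FA' s t k) l
  have s₀ := isCurrent_shift κ₀ (h₁.cur .pos)
  have s₁ := isCurrent_shift κ₁ (h₀.cur .neg)
  have cp := isCurrent_conv s₀ (f₀ .pos).cur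
  have cn := isCurrent_conv (f₁ .neg).cur s₁
  have c2 := (hC₁.shift_first κ₀ (h₁.cur _) (h₁.cur _)).conv_first_delta s₀ (h₁.cur .neg)
    (f₀ .pos).cur (f₁ .neg).cur ((f₁ .pos).shift _).cur (f₀ .pos).bd
    (nexch_of_commute (Fe .pos .neg))
  have c3 := (hC₀.shift_second κ₁ (h₀.cur _) (h₀.cur _)).conv_second_delta (h₀.cur .pos) s₁
    (f₁ .neg).cur ((f₀ .neg).shift _).cur (((f₀ .pos).shift _).shift _).cur (f₁ .neg).bd
    (nexch_of_commute (eF .pos .neg))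
  have c4 : NExch ((1 : R⟦X⟧ˣ) : R⟦X⟧) (conv (shift κ₀ (e₁ .pos)) (F₀ .pos))
      (conv (F₁ .neg) (shift κ₁ (e₀ .neg))) := by
    refine NExch.prod_second cp (f₁ .neg).cur s₁ (Or.inr (f₁ .neg).bd)
      (NExch.prod_first s₀ (f₁ .neg).cur (f₀ .pos).cur (Or.inl (f₀ .pos).bd)
        (hn.shift_first' κ₀ (h₁.cur _) (f₁ .neg).cur) (nexch_of_commute (FF _ _)) rfl)
      (NExch.prod_first s₀ s₁ (f₀ .pos).cur (Or.inl (f₀ .pos).bd)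
        (nexch_of_commute fun k l => (commute_shift_left _ (fun l => commute_shift _
          (hc.ee _ _ l) k) l).symm) (hm.shift_second' κ₁ (f₀ .pos).cur (h₀.cur _)) rfl) ?_
    simp only [map_inv, rs_rs, mul_one, one_mul]
    rw [mul_comm κ₁⁻¹, inv_mul_cancel]
  intro k l
  have c2 := c2 k l
  have c3 := c3 k l
  have c4 := c4 k l
  have c1 : e₁ .neg l * e₀ .pos k = e₀ .pos k * e₁ .neg l := (hc.ee .pos .neg k l).symm.eq
  rw [Units.val_one, one_mul] at c2 c3
  rw [Units.val_one] at c4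
  rw [nop_one] at c2
  rw [nop_one] at c3
  rw [nop_one] at c4
  have ep : copE κ₀ κ₁ A₀ A₀' e₀ A₁ A₁' e₁ .pos = fun k => e₀ .pos k +
      conv (shift κ₀ (e₁ .pos)) (F₀ .pos) k := by rw [← hF₀]; rfl
  have en : copE κ₀ κ₁ A₀ A₀' e₀ A₁ A₁' e₁ .neg = fun k => e₁ .neg k +
      conv (F₁ .neg) (shift κ₁ (e₀ .neg)) k := by rw [← hF₁]; rfl
  rw [ep, en, nop_one]
  beta_reduce at c2 c3 ⊢
  rw [shift_conv _ (f₀ .pos).cur ((f₁ .pos).shift _).cur (Or.inl ((f₁ .pos).shift _).bd),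
    shift_shift, show (κ₀ * κ₁)⁻¹ * κ₀ = κ₁⁻¹ by rw [mul_inv_rev, inv_mul_cancel_right],
    conv_comm (X := shift (κ₀ * κ₁)⁻¹ (F₀ .pos)) fun k l => commute_shift_left _ (fun k =>
      commute_shift _ (FF .pos .pos k) l) k,
    conv_comm (X := shift κ₁ (F₀ .neg)) fun k l => commute_shift_left _ (fun k => FF .neg .neg k l) k,
    add_mul, mul_add, mul_add, c1, c2, c3, c4, mul_inv_rev, mul_inv_rev, inv_inv, shift_shift,
    mul_comm κ₁⁻¹ κ₀]
  simp only [smul_sub, mul_add, add_mul]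
  abel

lemma core_cop : Core .pos (κ₀ * κ₁) (copA κ₀ κ₁ A₀ A₁) (copA κ₀ κ₁ A₀' A₁')
    (copE κ₀ κ₁ A₀ A₀' e₀ A₁ A₁' e₁) := by
  have p₀ := h₀.pair
  have p₁ := h₁.pair
  have f₀ := h₀.pairPhi .pos
  have f₁ := h₁.pairPhi .pos
  have hp := pair_cop h₀ h₁ hc
  set F₀ := Phi R .pos A₀ A₀' with hF₀
  set F₁ := Phi R .pos A₁ A₁' with hF₁
  have AF : ∀ s t k l, Commute (A₀ s k) (F₁ t l) := fun s t k l =>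
    commute_dblc (p₁ t).symm (hc.AA' s t k) l
  have eF : ∀ s t k l, Commute (e₀ s k) (F₁ t l) := fun s t k l =>
    commute_dblc (p₁ t).symm (hc.eA' s t k) l
  have FA : ∀ s t k l, Commute (F₀ s k) (A₁ t l) := fun s t k l =>
    (commute_dblc (p₀ s).symm (fun k => (hc.A'A s t k l).symm) k).symm
  have FA' : ∀ s t k l, Commute (F₀ s k) (A₁' t l) := fun s t k l =>
    (commute_dblc (p₀ s).symm (fun k => (hc.A'A' s t k l).symm) k).symm
  have Fe : ∀ s t k l, Commute (F₀ s k) (e₁ t l) := fun s t k l =>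
    (commute_dblc (p₀ s).symm (fun k => (hc.A'e s t k l).symm) k).symm
  have FF : ∀ s t k l, Commute (F₀ s k) (F₁ t l) := fun s t k l =>
    commute_dblc (p₁ t).symm (FA' s t k) l
  have AF₀ : ∀ s k l, Commute (A₀ s k) (F₀ s l) := h₀.commute_A_Phi .pos
  have AF₁ : ∀ s k l, Commute (A₁ s k) (F₁ s l) := h₁.commute_A_Phi .pos
  -- the two summands of `ξ^±`
  have cp : IsCurrent R (conv (shift κ₀ (e₁ .pos)) (F₀ .pos)) :=
    isCurrent_conv (isCurrent_shift _ (h₁.cur _)) (f₀ .pos).cur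
  have cn : IsCurrent R (conv (F₁ .neg) (shift κ₁ (e₀ .neg))) :=
    isCurrent_conv (f₁ .neg).cur (isCurrent_shift _ (h₀.cur _))
  have s₀ : ∀ {X : ℤ → E}, IsCurrent R X → IsCurrent R (shift κ₀ X) := fun h => isCurrent_shift _ h
  have s₁ : ∀ {X : ℤ → E}, IsCurrent R X → IsCurrent R (shift κ₁ X) := fun h => isCurrent_shift _ h
  -- exchange of commuting currents
  have x₀ : ∀ {X Y : ℤ → E}, (∀ k l, Commute (X k) (Y l)) →
      NExch ((1 : R⟦X⟧ˣ) : R⟦X⟧) X (shift κ₀ Y) := fun h =>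
    nexch_of_commute fun k l => commute_shift _ (h k) l
  have y₀ : ∀ {X Y : ℤ → E}, (∀ k l, Commute (Y k) (X l)) →
      NExch ((1 : R⟦X⟧ˣ) : R⟦X⟧) (shift κ₀ X) Y := fun h =>
    nexch_of_commute fun k l => (commute_shift _ (fun k => h l k) k).symm
  have x₁ : ∀ {X Y : ℤ → E}, (∀ k l, Commute (Y k) (X l)) →
      NExch ((1 : R⟦X⟧ˣ) : R⟦X⟧) X (shift κ₁ Y) := fun h =>
    nexch_of_commute fun k l => (commute_shift_left _ (fun l => h l k) l).symm
  have y₁ : ∀ {X Y : ℤ → E}, (∀ k l, Commute (X k) (Y l)) →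
      NExch ((1 : R⟦X⟧ˣ) : R⟦X⟧) (shift κ₁ X) Y := fun h =>
    nexch_of_commute fun k l => commute_shift_left _ (fun k => h k l) k
  have z : ∀ {X Y : ℤ → E}, (∀ k l, Commute (Y k) (X l)) →
      NExch ((1 : R⟦X⟧ˣ) : R⟦X⟧) (shift κ₀ X) (shift κ₁ Y) := fun h =>
    x₁ fun k l => commute_shift _ (h k) l
  have σ1 : κ₀ ^ Sgn.pos.int = κ₀ := zpow_one _
  have σ2 : κ₁ ^ Sgn.pos.int = κ₁ := zpow_one _
  have σ3 : κ₀ ^ (-Sgn.pos.int) = κ₀⁻¹ := zpow_neg_one _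
  have σ4 : κ₁ ^ (-Sgn.pos.int) = κ₁⁻¹ := zpow_neg_one _
  have σ5 : (κ₀ * κ₁) ^ Sgn.pos.int = κ₀ * κ₁ := zpow_one _
  have σ6 : (κ₀ * κ₁) ^ (-Sgn.pos.int) = (κ₀ * κ₁)⁻¹ := zpow_neg_one _
  -- multiplication of `A⁺` on the left and of `A⁻` on the right
  have Apos : ∀ {Y : ℤ → E} {u v w : R⟦X⟧ˣ}, IsCurrent R Y →
      NExch (u : R⟦X⟧) (A₀ .pos) Y → NExch (v : R⟦X⟧) (shift κ₀ (A₁ .pos)) Y →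
      u * v = w → NExch (w : R⟦X⟧) (copA κ₀ κ₁ A₀ A₁ .pos) Y := fun hY h h' hw =>
    NExch.prod_first (p₀ .pos).cur hY (s₀ (p₁ .pos).cur)
      ((p₀ .pos).bd.or ((p₁ .pos).shift κ₀).bd) h h' hw
  have Aneg : ∀ {X : ℤ → E} {u v w : R⟦X⟧ˣ}, IsCurrent R X →
      NExch (u : R⟦X⟧) X (shift κ₁ (A₀ .neg)) → NExch (v : R⟦X⟧) X (A₁ .neg) →
      u * v = w → NExch (w : R⟦X⟧) X (copA κ₀ κ₁ A₀ A₁ .neg) := fun hX h h' hw =>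
    NExch.prod_second hX (s₁ (p₀ .neg).cur) (p₁ .neg).cur
      (((p₀ .neg).shift κ₁).bd.or (p₁ .neg).bd) h h' hw
  refine ⟨hp, ?_, ?_, ?_, ?_, ?_, ?_, ?_, ?_⟩
  · rintro (_ | _)
    · exact (h₀.cur _).add cp
    · exact (h₁.cur _).add cn
  · refine Apos (hp .neg).cur
      (Aneg (p₀ .pos).cur (h₀.A_A.shift_second' κ₁ (p₀ .pos).cur (p₀ .neg).cur)
        (nexch_of_commute (hc.AA _ _)) rfl)
      (Aneg (s₀ (p₁ .pos).cur) (z (hc.AA _ _))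
        (h₁.A_A.shift_first' κ₀ (p₁ .pos).cur (p₁ .neg).cur) rfl) ?_
    simp only [map_mul, map_inv, rs_rs, mul_one, one_mul, mul_inv]
    rw [mul_comm κ₁⁻¹ κ₀⁻¹, mul_comm κ₁⁻¹ κ₀, mul_assoc, inv_mul_cancel_left]
  · refine (Apos (h₀.cur _) h₀.pos_pos (y₀ (hc.eA _ _)) (mul_one _)).add_second (hp .pos).cur
      (h₀.cur _) cp (Apos cp (w := ev R ud) (NExch.prod_second (p₀ .pos).cur (s₀ (h₁.cur .pos)) (f₀ .pos).cur
        (Or.inl (f₀ .pos).bd) (x₀ (hc.Ae _ _)) (nexch_of_commute (AF₀ _)) rfl)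
        (NExch.prod_second (s₀ (p₁ .pos).cur) (s₀ (h₁.cur .pos)) (f₀ .pos).cur (Or.inl (f₀ .pos).bd)
          ((h₁.pos_pos.shift_second' κ₀ (p₁ .pos).cur (h₁.cur _)).shift_first' κ₀ (p₁ .pos).cur
            (s₀ (h₁.cur _))) (y₀ (FA _ _)) rfl) ?_)
    simp only [rs_rs, mul_inv_cancel, rs_one, mul_one, one_mul]
  · rw [σ5]
    have h2 := h₁.pos_neg
    have h3 := h₀.pos_neg
    have h4 := h₁.A_Phi .pos
    rw [σ1] at h3
    rw [σ2] at h2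
    rw [show Sgn.pos.int = 1 from rfl, zpow_one] at h4
    refine (Apos (h₁.cur _) (nexch_of_commute (hc.Ae _ _))
        (h2.shift_first' κ₀ (p₁ .pos).cur (h₁.cur .neg)) ?_).add_second (hp .pos).cur
      (h₁.cur _) cn (Apos cn (NExch.prod_second (p₀ .pos).cur (f₁ .neg).cur (s₁ (h₀.cur .neg))
        (Or.inr (f₁ .neg).bd) (nexch_of_commute (AF _ _))
        (h3.shift_second' κ₁ (p₀ .pos).cur (h₀.cur .neg)) rfl)
        (NExch.prod_second (s₀ (p₁ .pos).cur) (f₁ .neg).cur (s₁ (h₀.cur .neg)) (Or.inr (f₁ .neg).bd)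
          (h4.shift_first' κ₀ (p₁ .pos).cur (f₁ .neg).cur) (z (hc.eA _ _)) rfl) ?_)
    · simp only [map_inv, rs_rs, one_mul]
    · simp only [map_mul, map_inv, rs_rs, mul_one, one_mul]
      rw [mul_comm κ₁⁻¹ κ₀, inv_mul_cancel_left]
  · refine (Aneg (h₁.cur _) (x₁ (hc.Ae _ _)) h₁.neg_neg (one_mul _)).add_first (h₁.cur _)
      (hp .neg).cur cn (Aneg cn (w := (ev R udq)⁻¹) (NExch.prod_first (f₁ .neg).cur (s₁ (p₀ .neg).cur)
        (s₁ (h₀.cur .neg)) (Or.inr (f₁ .neg).bd) (x₁ (AF _ _))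
        ((h₀.neg_neg.shift_second' κ₁ (h₀.cur _) (p₀ .neg).cur).shift_first' κ₁ (h₀.cur _)
          (s₁ (p₀ .neg).cur)) rfl)
        (NExch.prod_first (f₁ .neg).cur (p₁ .neg).cur (s₁ (h₀.cur .neg)) (Or.inr (f₁ .neg).bd)
          (nexch_of_commute fun k l => (AF₁ _ l k).symm) (y₁ (hc.eA _ _)) rfl) ?_)
    simp only [rs_rs, mul_inv_cancel, rs_one, mul_one, one_mul]
  · rw [σ6]
    have h2 := h₁.neg_pos
    have h3 := h₀.neg_pos
    have h4 := h₀.Phi_A .pos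
    rw [σ3] at h3
    rw [σ4] at h2
    rw [show Sgn.pos.int = 1 from rfl, zpow_one] at h4
    refine (Aneg (h₀.cur _) (h3.shift_second' κ₁ (h₀.cur _) (p₀ .neg).cur)
        (nexch_of_commute (hc.eA _ _)) ?_).add_first (h₀.cur _)
      (hp .neg).cur cp (Aneg cp (NExch.prod_first (s₀ (h₁.cur .pos)) (s₁ (p₀ .neg).cur) (f₀ .pos).cur
        (Or.inl (f₀ .pos).bd) (z (hc.Ae _ _)) (h4.shift_second' κ₁ (f₀ .pos).cur (p₀ .neg).cur) rfl)
        (NExch.prod_first (s₀ (h₁.cur .pos)) (p₁ .neg).cur (f₀ .pos).cur (Or.inl (f₀ .pos).bd)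
          (h2.shift_first' κ₀ (h₁.cur .pos) (p₁ .neg).cur) (nexch_of_commute (FA _ _)) rfl) ?_)
    · simp only [rs_rs, mul_one, mul_inv_rev]
    · simp only [map_mul, map_inv, rs_rs, mul_one, one_mul, mul_inv_rev]
      rw [mul_comm κ₁⁻¹ κ₀, inv_mul_cancel_right]
  · exact quad_cop h₀ h₁ hc
  · exact comm_cop h₀ h₁ hc

end

end Cop

end

section CopGenerators

lemma hasSum_conv_left {X Y : ℤ → E} (hX : IsCurrent R X) (hY : IsCurrent R Y)
    (h : Plus Y ∨ Minus X) (k : ℤ) : HasSum (fun n => X n * Y (k - n)) (conv X Y k) := by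
  refine ((Equiv.subLeft k).hasSum_iff.1 ?_)
  refine (summable_conv hX hY h k).hasSum.congr_fun fun n => ?_
  rw [Function.comp_apply, Equiv.subLeft_apply, sub_sub_cancel]

lemma hasSum_conv_comm {X Y : ℤ → E} (hX : IsCurrent R X) (hY : IsCurrent R Y)
    (h : Plus X ∨ Minus Y) (hc : ∀ k l, Commute (X k) (Y l)) (k : ℤ) :
    HasSum (fun n => X n * Y (k - n)) (conv Y X k) :=
  (summable_conv hY hX h k).hasSum.congr_fun fun n => (hc n (k - n)).eq

variable [Algebra B R] [Algebra B E] [IsScalarTower B R E]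

/-- The generators of the coproduct of two families of generators of the Drinfeld algebra. -/
def ucop (κ₀ κ₁ : Rˣ) (a₀ a₁ : UGen → E) : UGen → E
  | .al s k => copA κ₀ κ₁ (fun s k => a₀ (.al s k)) (fun s k => a₁ (.al s k)) s k
  | .be s k => copA κ₀ κ₁ (fun s k => a₀ (.be s k)) (fun s k => a₁ (.be s k)) s k
  | .xi s k => copE κ₀ κ₁ (fun s k => a₀ (.al s k)) (fun s k => a₀ (.be s k))
      (fun s k => a₀ (.xi s k)) (fun s k => a₁ (.al s k)) (fun s k => a₁ (.be s k))
      (fun s k => a₁ (.xi s k)) s k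
  | .qc => a₀ .qc * a₁ .qc
  | .qc' => a₀ .qc' * a₁ .qc'

variable {κ₀ κ₁ : Rˣ} {a₀ a₁ : UGen → E}

section

variable (h₀ : UCore κ₀ a₀) (h₁ : UCore κ₁ a₁) (hc : ∀ x y, Commute (a₀ x) (a₁ y))
include h₀ h₁ hc

lemma ucore_ucop : UCore (κ₀ * κ₁) (ucop κ₀ κ₁ a₀ a₁) :=
  core_cop h₀ h₁ ⟨fun _ _ _ _ => hc _ _, fun _ _ _ _ => hc _ _, fun _ _ _ _ => hc _ _,
    fun _ _ _ _ => hc _ _, fun _ _ _ _ => hc _ _, fun _ _ _ _ => hc _ _, fun _ _ _ _ => hc _ _,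
    fun _ _ _ _ => hc _ _, fun _ _ _ _ => hc _ _⟩

lemma phi_ucop_pos : dblc R (fun k => ucop κ₀ κ₁ a₀ a₁ (.be .pos k)) =
    conv (dblc R fun k => a₀ (.be .pos k)) (shift κ₀ (dblc R fun k => a₁ (.be .pos k))) := by
  refine (dblc_conv (h₀.pair .pos).symm ((h₁.pair .pos).symm.shift κ₀) fun k l =>
    commute_shift _ (fun _ => hc _ _) l).trans ?_
  rw [dblc_shift (h₁.pair .pos).symm]

lemma phi_ucop_neg : dblc R (fun k => ucop κ₀ κ₁ a₀ a₁ (.be .neg k)) =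
    conv (shift κ₁ (dblc R fun k => a₀ (.be .neg k))) (dblc R fun k => a₁ (.be .neg k)) := by
  refine (dblc_conv ((h₀.pair .neg).symm.shift κ₁) (h₁.pair .neg).symm fun k l =>
    commute_shift_left _ (fun _ => hc _ _) k).trans ?_
  rw [dblc_shift (h₀.pair .neg).symm]

lemma zeroModes_ucop {ζ : Bool} (z₀ : ZeroModes ζ fun s k => a₀ (.al s k))
    (z₁ : ZeroModes ζ fun s k => a₁ (.al s k)) :
    ZeroModes ζ fun s k => ucop κ₀ κ₁ a₀ a₁ (.al s k) := fun hζ => by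
  have s0 : ∀ (c : Rˣ) (X : ℤ → E), shift c X 0 = X 0 := fun c X => by simp [shift]
  have hp : ucop κ₀ κ₁ a₀ a₁ (.al .pos 0) = a₀ (.al .pos 0) * a₁ (.al .pos 0) :=
    (conv_zero_bd (h₀.pair .pos).bd ((h₁.pair .pos).bd.shift κ₀)).trans (by rw [s0])
  have hn : ucop κ₀ κ₁ a₀ a₁ (.al .neg 0) = a₀ (.al .neg 0) * a₁ (.al .neg 0) :=
    (conv_zero_bd ((h₀.pair .neg).bd.shift κ₁) (h₁.pair .neg).bd).trans (by rw [s0])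
  have key : ∀ x y x' y' : E, (∀ u ∈ ({x, y} : Set E), ∀ v ∈ ({x', y'} : Set E), Commute u v) →
      x ^ 2 * y ^ 2 = 1 → x' ^ 2 * y' ^ 2 = 1 → (x * x') ^ 2 * (y * y') ^ 2 = 1 := by
    intro x y x' y' h h1 h2
    rw [(h x (by simp) x' (by simp)).mul_pow, (h y (by simp) y' (by simp)).mul_pow,
      mul_assoc, ← mul_assoc (x' ^ 2), ((h y (by simp) x' (by simp)).symm.pow_pow 2 2).eq,
      mul_assoc, h2, mul_one, h1]
  have hcs : ∀ s t, ∀ u ∈ ({a₀ (.al s 0), a₀ (.al t 0)} : Set E),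
      ∀ v ∈ ({a₁ (.al s 0), a₁ (.al t 0)} : Set E), Commute u v := by
    rintro s t u (rfl | rfl) v (rfl | rfl) <;> exact hc _ _
  dsimp only
  rw [hp, hn]
  exact ⟨key _ _ _ _ (hcs _ _) (z₀ hζ).1 (z₁ hζ).1, key _ _ _ _ (hcs _ _) (z₀ hζ).2 (z₁ hζ).2⟩

lemma ugraded_ucop (g₀ : UGraded κ₀ a₀) (g₁ : UGraded κ₁ a₁) :
    UGraded (κ₀ * κ₁) (ucop κ₀ κ₁ a₀ a₁) where
  mem x := match x with
    | .al s k => ((ucore_ucop h₀ h₁ hc).pair s).cur k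
    | .be s k => ((ucore_ucop h₀ h₁ hc).pair s).cur' k
    | .xi s k => (ucore_ucop h₀ h₁ hc).cur s k
    | .qc => mul_mem_pc' (g₀.mem .qc) (g₁.mem .qc) (add_zero 0)
    | .qc' => mul_mem_pc' (g₀.mem .qc') (g₁.mem .qc') (add_zero 0)
  qc := by
    change a₀ .qc * a₁ .qc = _
    rw [g₀.qc, g₁.qc, Units.val_mul, map_mul]
  qc' := by
    change a₀ .qc' * a₁ .qc' = _
    rw [g₀.qc', g₁.qc', mul_inv, Units.val_mul, map_mul]

end

section Maps

variable {R' E' : Type*} [CommRing R'] [Ring E'] [Algebra R' E'] [TopologicalSpace E']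
  [T2Space E'] [IsTopologicalAddGroup E'] [SeparatelyContinuousMul E'] [CurrentRing R' E']
  [Algebra B R'] [Algebra B E'] [IsScalarTower B R' E'] {F : E →ₐ[B] E'} {κ₀' κ₁' : R'ˣ}

lemma MapsSums.map_ucop (hF : MapsSums R F) (h₀ : UCore κ₀ a₀) (h₁ : UCore κ₁ a₁)
    (k₀ : F (algebraMap R E κ₀) = algebraMap R' E' κ₀')
    (k₁ : F (algebraMap R E κ₁) = algebraMap R' E' κ₁') (x : UGen) :
    F (ucop κ₀ κ₁ a₀ a₁ x) = ucop κ₀' κ₁' (fun x => F (a₀ x)) (fun x => F (a₁ x)) x := by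
  have p₀ := h₀.pair
  have p₁ := h₁.pair
  have d₀ := fun s => (p₀ s).symm.dblc
  have d₁ := fun s => (p₁ s).symm.dblc
  match x with
  | .al .pos k => exact (congrFun (hF.map_conv (p₀ .pos).cur ((p₁ .pos).shift κ₀).cur
      (Or.inl ((p₁ .pos).shift κ₀).bd)) k).trans (by rw [map_shift k₀]; rfl)
  | .al .neg k => exact (congrFun (hF.map_conv ((p₀ .neg).shift κ₁).cur (p₁ .neg).cur
      (Or.inr ((p₀ .neg).shift κ₁).bd)) k).trans (by rw [map_shift k₁]; rfl)
  | .be .pos k => exact (congrFun (hF.map_conv (p₀ .pos).cur' ((p₁ .pos).shift κ₀).cur'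
      (Or.inl ((p₁ .pos).shift κ₀).bd')) k).trans (by rw [map_shift k₀]; rfl)
  | .be .neg k => exact (congrFun (hF.map_conv ((p₀ .neg).shift κ₁).cur' (p₁ .neg).cur'
      (Or.inr ((p₀ .neg).shift κ₁).bd')) k).trans (by rw [map_shift k₁]; rfl)
  | .xi .pos k =>
    refine (map_add F _ _).trans (congrArg (F (a₀ (.xi .pos k)) + ·) ?_)
    exact (congrFun (hF.map_conv (isCurrent_shift κ₀ (h₁.cur .pos)) (d₀ .pos).cur
      (Or.inl (d₀ .pos).bd)) k).trans
      (by rw [map_shift k₀, hF.map_dblc (R' := R') (p₀ .pos).cur' (p₀ .pos).bd']; rfl)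
  | .xi .neg k =>
    refine (map_add F _ _).trans (congrArg (F (a₁ (.xi .neg k)) + ·) ?_)
    exact (congrFun (hF.map_conv (d₁ .neg).cur (isCurrent_shift κ₁ (h₀.cur .neg))
      (Or.inr (d₁ .neg).bd)) k).trans
      (by rw [map_shift k₁, hF.map_dblc (R' := R') (p₁ .neg).cur' (p₁ .neg).bd']; rfl)
  | .qc => exact map_mul F _ _
  | .qc' => exact map_mul F _ _

end Maps

lemma ucop_ucop {κ₂ : Rˣ} {a₂ : UGen → E} (h₀ : UCore κ₀ a₀) (h₁ : UCore κ₁ a₁) (h₂ : UCore κ₂ a₂)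
    (h01 : ∀ x y, Commute (a₀ x) (a₁ y)) (h12 : ∀ x y, Commute (a₁ x) (a₂ y)) (x : UGen) :
    ucop (κ₀ * κ₁) κ₂ (ucop κ₀ κ₁ a₀ a₁) a₂ x = ucop κ₀ (κ₁ * κ₂) a₀ (ucop κ₁ κ₂ a₁ a₂) x := by
  have pos : ∀ {X₀ X₁ X₂ X₀' X₁' X₂' : ℤ → E}, InvPair R .pos X₀ X₀' → InvPair R .pos X₁ X₁' →
      InvPair R .pos X₂ X₂' → conv (conv X₀ (shift κ₀ X₁)) (shift (κ₀ * κ₁) X₂) =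
        conv X₀ (shift κ₀ (conv X₁ (shift κ₁ X₂))) := fun i₀ i₁ i₂ => by
    rw [shift_conv _ i₁.cur (i₂.shift _).cur (Or.inl (i₂.shift _).bd), shift_shift,
      conv_assoc_bd i₀.cur (i₁.shift _).cur (i₂.shift _).cur i₀.bd (i₁.shift _).bd (i₂.shift _).bd]
  have neg : ∀ {X₀ X₁ X₂ X₀' X₁' X₂' : ℤ → E}, InvPair R .neg X₀ X₀' → InvPair R .neg X₁ X₁' →
      InvPair R .neg X₂ X₂' → conv (shift κ₂ (conv (shift κ₁ X₀) X₁)) X₂ =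
        conv (shift (κ₁ * κ₂) X₀) (conv (shift κ₂ X₁) X₂) := fun i₀ i₁ i₂ => by
    rw [shift_conv _ (i₀.shift _).cur i₁.cur (Or.inr (i₀.shift _).bd), shift_shift, mul_comm κ₁,
      conv_assoc_bd (i₀.shift _).cur (i₁.shift _).cur i₂.cur (i₀.shift _).bd (i₁.shift _).bd i₂.bd]
  have p₀ := h₀.pair
  have p₁ := h₁.pair
  have p₂ := h₂.pair
  have d₀ := fun s => (p₀ s).symm.dblc
  have d₁ := fun s => (p₁ s).symm.dblc
  have d₂ := fun s => (p₂ s).symm.dblc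
  have s₁ : ∀ (c : Rˣ) s, IsCurrent R (shift c fun k => a₁ (.xi s k)) := fun c s =>
    isCurrent_shift c (h₁.cur s)
  match x with
  | .al .pos k => exact congrFun (pos (p₀ .pos) (p₁ .pos) (p₂ .pos)) k
  | .al .neg k => exact congrFun (neg (p₀ .neg) (p₁ .neg) (p₂ .neg)) k
  | .be .pos k => exact congrFun (pos (p₀ .pos).symm (p₁ .pos).symm (p₂ .pos).symm) k
  | .be .neg k => exact congrFun (neg (p₀ .neg).symm (p₁ .neg).symm (p₂ .neg).symm) k
  | .xi .pos k =>
    have hs := isCurrent_shift κ₁ (h₂.cur .pos)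
    change (_ + conv (shift κ₀ fun k => a₁ (.xi .pos k)) (dblc R fun k => a₀ (.be .pos k)) k) +
      conv (shift (κ₀ * κ₁) fun k => a₂ (.xi .pos k))
        (dblc R fun k => ucop κ₀ κ₁ a₀ a₁ (.be .pos k)) k =
      a₀ (.xi .pos k) + conv (shift κ₀ fun k => a₁ (.xi .pos k) +
        conv (shift κ₁ fun k => a₂ (.xi .pos k)) (dblc R fun k => a₁ (.be .pos k)) k)
        (dblc R fun k => a₀ (.be .pos k)) k
    have e1 : (shift κ₀ fun k => a₁ (.xi .pos k) +
        conv (shift κ₁ fun k => a₂ (.xi .pos k)) (dblc R fun k => a₁ (.be .pos k)) k) =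
      fun k => shift κ₀ (fun k => a₁ (.xi .pos k)) k + conv (shift (κ₀ * κ₁) fun k => a₂ (.xi .pos k))
        (shift κ₀ (dblc R fun k => a₁ (.be .pos k))) k := by
      rw [← shift_shift, ← shift_conv κ₀ hs (d₁ .pos).cur (Or.inl (d₁ .pos).bd)]
      exact funext fun k => smul_add _ _ _
    rw [e1, conv_add_left (s₁ _ _) (isCurrent_conv (isCurrent_shift _ (h₂.cur .pos))
      ((d₁ .pos).shift _).cur) (d₀ .pos).cur (Or.inl (d₀ .pos).bd), phi_ucop_pos h₀ h₁ h01,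
      conv_comm fun k l => commute_shift _ (commute_dblc (p₁ .pos).symm fun l =>
        (commute_dblc (p₀ .pos).symm (fun k => (h01 (.be .pos k) (.be .pos l)).symm) k).symm) l,
      ← conv_assoc (isCurrent_shift _ (h₂.cur .pos)) ((d₁ .pos).shift _).cur (d₀ .pos).cur
        (Or.inl ⟨((d₁ .pos).shift _).bd, (d₀ .pos).bd⟩), add_assoc]
  | .xi .neg k =>
    have hs := isCurrent_shift κ₁ (h₀.cur .neg)
    change a₂ (.xi .neg k) + conv (dblc R fun k => a₂ (.be .neg k))
        (shift κ₂ fun k => a₁ (.xi .neg k) + conv (dblc R fun k => a₁ (.be .neg k))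
          (shift κ₁ fun k => a₀ (.xi .neg k)) k) k =
      (_ + conv (dblc R fun k => a₂ (.be .neg k)) (shift κ₂ fun k => a₁ (.xi .neg k)) k) +
      conv (dblc R fun k => ucop κ₁ κ₂ a₁ a₂ (.be .neg k))
        (shift (κ₁ * κ₂) fun k => a₀ (.xi .neg k)) k
    have e1 : (shift κ₂ fun k => a₁ (.xi .neg k) + conv (dblc R fun k => a₁ (.be .neg k))
          (shift κ₁ fun k => a₀ (.xi .neg k)) k) =
      fun k => shift κ₂ (fun k => a₁ (.xi .neg k)) k + conv
        (shift κ₂ (dblc R fun k => a₁ (.be .neg k))) (shift (κ₁ * κ₂) fun k => a₀ (.xi .neg k)) k := by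
      rw [mul_comm, ← shift_shift, ← shift_conv κ₂ (d₁ .neg).cur hs (Or.inr (d₁ .neg).bd)]
      exact funext fun k => smul_add _ _ _
    rw [e1, conv_add_right (d₂ .neg).cur (isCurrent_conv ((d₁ .neg).shift _).cur
      (isCurrent_shift _ (h₀.cur .neg))) (s₁ _ _) (Or.inr (d₂ .neg).bd), phi_ucop_neg h₁ h₂ h12,
      conv_comm (X := shift κ₂ _) fun k l => commute_dblc (p₂ .neg).symm (fun l =>
        commute_shift_left κ₂ (fun k =>
          (commute_dblc (p₁ .neg).symm (fun k => (h12 (.be .neg k) (.be .neg l)).symm) k).symm) k) l,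
      conv_assoc (d₂ .neg).cur ((d₁ .neg).shift _).cur (isCurrent_shift _ (h₀.cur .neg))
        (Or.inr (Or.inl ⟨(d₂ .neg).bd, ((d₁ .neg).shift _).bd⟩)), add_assoc]
  | .qc => exact mul_assoc _ _ _
  | .qc' => exact mul_assoc _ _ _

/-! ### The counit -/

lemma algebraMap_triv_be (s : Sgn) :
    (fun k : ℤ => algebraMap B E (triv (.be s k))) = oneCurrent E :=
  funext fun k => by rw [triv, oneCurrent, apply_ite (algebraMap B E), map_one, map_zero]

lemma shift_triv_xi (s : Sgn) (c : Rˣ) :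
    (shift c fun k : ℤ => algebraMap B E (triv (.xi s k))) = fun _ => 0 :=
  funext fun k => by rw [shift, triv, map_zero, smul_zero]

lemma dblc_triv (s : Sgn) : dblc R (fun k => algebraMap B E (triv (.be s k))) = oneCurrent E := by
  rw [algebraMap_triv_be, dblc, shift_oneCurrent, conv_one]

lemma ucop_triv_left :
    ucop 1 κ₁ (fun x => algebraMap B E (triv x)) a₁ = a₁ := by
  funext x
  match x with
  | .al .pos k => exact congrFun ((congrArg₂ conv (algebraMap_triv_be .pos) (shift_one _)).trans (one_conv _)) k
  | .be .pos k => exact congrFun ((congrArg₂ conv (algebraMap_triv_be .pos) (shift_one _)).trans (one_conv _)) k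
  | .al .neg k => exact congrFun ((congrArg (fun X => conv (shift κ₁ X) fun k => a₁ (.al .neg k)) (algebraMap_triv_be .neg)).trans
      ((congrArg (fun X => conv X _) (shift_oneCurrent κ₁)).trans (one_conv _))) k
  | .be .neg k => exact congrFun ((congrArg (fun X => conv (shift κ₁ X) fun k => a₁ (.be .neg k)) (algebraMap_triv_be .neg)).trans
      ((congrArg (fun X => conv X _) (shift_oneCurrent κ₁)).trans (one_conv _))) k
  | .xi .pos k =>
    refine (congrArg₂ (· + ·) (map_zero _) (congrFun ((congrArg₂ conv (shift_one _)
      (dblc_triv .pos)).trans (conv_one _)) k)).trans (zero_add _)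
  | .xi .neg k =>
    refine (congrArg (a₁ (.xi .neg k) + ·) (congrFun (congrArg (conv _) (shift_triv_xi .neg κ₁)) k)).trans ?_
    simp [conv]
  | .qc => exact (congrArg (· * a₁ .qc) (map_one _)).trans (one_mul _)
  | .qc' => exact (congrArg (· * a₁ .qc') (map_one _)).trans (one_mul _)

lemma ucop_triv_right : ucop κ₀ 1 a₀ (fun x => algebraMap B E (triv x)) = a₀ := by
  funext x
  match x with
  | .al .neg k => exact congrFun ((congrArg₂ conv (shift_one _) (algebraMap_triv_be .neg)).trans (conv_one _)) k
  | .be .neg k => exact congrFun ((congrArg₂ conv (shift_one _) (algebraMap_triv_be .neg)).trans (conv_one _)) k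
  | .al .pos k => exact congrFun ((congrArg (fun X => conv (fun k => a₀ (.al .pos k)) (shift κ₀ X)) (algebraMap_triv_be .pos)).trans
      ((congrArg (conv _) (shift_oneCurrent κ₀)).trans (conv_one _))) k
  | .be .pos k => exact congrFun ((congrArg (fun X => conv (fun k => a₀ (.be .pos k)) (shift κ₀ X)) (algebraMap_triv_be .pos)).trans
      ((congrArg (conv _) (shift_oneCurrent κ₀)).trans (conv_one _))) k
  | .xi .neg k =>
    refine (congrArg₂ (· + ·) (map_zero _) (congrFun ((congrArg₂ conv
      (dblc_triv .neg) (shift_one _)).trans (one_conv _)) k)).trans (zero_add _)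
  | .xi .pos k =>
    refine (congrArg (a₀ (.xi .pos k) + ·) (congrFun (congrArg (fun X => conv X _) (shift_triv_xi .pos κ₀)) k)).trans ?_
    simp [conv]
  | .qc => exact (congrArg (a₀ .qc * ·) (map_one _)).trans (mul_one _)
  | .qc' => exact (congrArg (a₀ .qc' * ·) (map_one _)).trans (mul_one _)

/-! ### The coproduct as convergent sums -/

section Sums

lemma mul_kpow_mul (g₀ : UGraded κ₀ a₀) (x : E) (Y : ℤ → E) (n : ℤ) :
    x * kpow (a₀ .qc) (a₀ .qc') n * Y n = x * shift κ₀ Y n := by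
  rw [g₀.kpow_eq, mul_assoc, ← Algebra.smul_def, shift]

lemma mul_kpow_mul' (g₁ : UGraded κ₁ a₁) (X : ℤ → E) (y : E) (n : ℤ) :
    X n * kpow (a₁ .qc) (a₁ .qc') n * y = shift κ₁ X n * y := by
  rw [g₁.kpow_eq, ← Algebra.commutes, ← Algebra.smul_def, shift]

variable (g₀ : UGraded κ₀ a₀) (g₁ : UGraded κ₁ a₁) (h₀ : UCore κ₀ a₀) (h₁ : UCore κ₁ a₁)
  (hc : ∀ x y, Commute (a₀ x) (a₁ y))
include g₀ h₀ h₁ hc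

lemma hasSum_ucop_xi_pos (k : ℤ) : HasSum (fun n : ℤ => phi a₀ .pos n *
    kpow (a₀ .qc) (a₀ .qc') (k - n) * a₁ (.xi .pos (k - n)))
    (ucop κ₀ κ₁ a₀ a₁ (.xi .pos k) - a₀ (.xi .pos k)) := by
  have d₀ := (h₀.pair .pos).symm.dblc
  have := hasSum_conv_comm d₀.cur (isCurrent_shift κ₀ (h₁.cur .pos)) (Or.inl d₀.bd)
    (fun k l => commute_shift _ (fun l => (commute_dblc (h₀.pair .pos).symm
      (fun k => (hc (.be .pos k) (.xi .pos l)).symm) k).symm) l) k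
  rw [show ucop κ₀ κ₁ a₀ a₁ (.xi .pos k) - a₀ (.xi .pos k) = _ from add_sub_cancel_left _ _]
  refine this.congr_fun fun n => ?_
  rw [mul_kpow_mul g₀ _ (fun k => a₁ (.xi .pos k)), g₀.phi_eq h₀.pair]

lemma hasSum_ucop_al_pos (k : ℤ) : HasSum (fun n : ℤ => a₀ (.al .pos n) *
    kpow (a₀ .qc) (a₀ .qc') (k - n) * a₁ (.al .pos (k - n))) (ucop κ₀ κ₁ a₀ a₁ (.al .pos k)) := by
  refine (hasSum_conv_left (h₀.pair .pos).cur ((h₁.pair .pos).shift κ₀).cur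
    (Or.inl ((h₁.pair .pos).shift κ₀).bd) k).congr_fun fun n => ?_
  rw [mul_kpow_mul g₀ _ (fun k => a₁ (.al .pos k))]

omit g₀
include g₁

lemma hasSum_ucop_xi_neg (k : ℤ) : HasSum (fun n : ℤ => a₀ (.xi .neg n) *
    kpow (a₁ .qc) (a₁ .qc') n * phi a₁ .neg (k - n))
    (ucop κ₀ κ₁ a₀ a₁ (.xi .neg k) - a₁ (.xi .neg k)) := by
  have d₁ := (h₁.pair .neg).symm.dblc
  have := hasSum_conv_comm (isCurrent_shift κ₁ (h₀.cur .neg)) d₁.cur (Or.inr d₁.bd)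
    (fun k l => commute_shift_left _ (fun k => commute_dblc (h₁.pair .neg).symm
      (fun l => hc (.xi .neg k) (.be .neg l)) l) k) k
  rw [show ucop κ₀ κ₁ a₀ a₁ (.xi .neg k) - a₁ (.xi .neg k) = _ from add_sub_cancel_left _ _]
  refine this.congr_fun fun n => ?_
  rw [mul_kpow_mul' g₁ (fun k => a₀ (.xi .neg k)), g₁.phi_eq h₁.pair]

lemma hasSum_ucop_al_neg (k : ℤ) : HasSum (fun n : ℤ => a₀ (.al .neg n) *
    kpow (a₁ .qc) (a₁ .qc') n * a₁ (.al .neg (k - n))) (ucop κ₀ κ₁ a₀ a₁ (.al .neg k)) := by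
  refine (hasSum_conv_left ((h₀.pair .neg).shift κ₁).cur (h₁.pair .neg).cur
    (Or.inr ((h₀.pair .neg).shift κ₁).bd) k).congr_fun fun n => ?_
  rw [mul_kpow_mul' g₁ (fun k => a₀ (.al .neg k))]

end Sums

lemma dblc_conv_inv {s : Sgn} {X X' : ℤ → E} (h : InvPair R s X X') :
    conv (dblc R X') X = shift (qu R 2) X' := by
  have h' := h.symm
  rw [dblc, conv_comm (Y := shift _ _) fun k l => commute_shift _ (fun l => h'.comm k l) l,
    conv_assoc_bd (h'.shift _).cur h'.cur h.cur (h'.shift _).bd h'.bd h.bd, h.mul', conv_one]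

lemma conv_dblc_inv {s : Sgn} {X X' : ℤ → E} (h : InvPair R s X X') :
    conv X (dblc R X') = shift (qu R 2) X' := by
  rw [dblc, ← conv_assoc_bd h.cur h.symm.cur (h.symm.shift _).cur h.bd h.symm.bd (h.symm.shift _).bd,
    h.mul, one_conv]

lemma hasSum_lof_ucop_pos (g₀ : UGraded κ₀ a₀) (h₀ : UCore κ₀ a₀) (h₁ : UCore κ₁ a₁)
    (hc : ∀ x y, Commute (a₀ x) (a₁ y)) (i j : Fin 2) (k : ℤ) :
    HasSum (fun n : ℤ => ∑ p : Fin 2, lof R a₀ (.L .pos i p n) *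
      kpow (lof R a₀ .qc) (lof R a₀ .qc') (k - n) * lof R a₁ (.L .pos p j (k - n)))
    (lof R (ucop κ₀ κ₁ a₀ a₁) (.L .pos i j k)) := by
  have p₀ := h₀.pair .pos
  have p₁ := (h₁.pair .pos).shift κ₀
  have s₁ := isCurrent_shift κ₀ (h₁.cur .pos)
  have q₀ := p₀.symm.shift (qu R 2)
  have d₀ := p₀.symm.dblc
  have tm : ∀ (x : E) p n, x * kpow (lof R a₀ .qc) (lof R a₀ .qc') n * lof R a₁ (.L .pos p j n) =
      x * shift κ₀ (fun m => lof R a₁ (.L .pos p j m)) n := fun x p n =>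
    mul_kpow_mul g₀ x (fun m => lof R a₁ (.L .pos p j m)) n
  simp only [Fin.sum_univ_two, tm]
  match i, j with
  | 0, 0 =>
    refine (hasSum_conv_left p₀.cur p₁.cur (Or.inl p₁.bd) k).congr_fun fun n => ?_
    change _ + 0 * _ = _
    rw [zero_mul, add_zero]
    rfl
  | 0, 1 =>
    refine hasSum_zero.congr_fun fun n => ?_
    change _ * (_ • 0) + 0 * _ = _
    rw [zero_mul, add_zero, smul_zero, mul_zero]
  | 1, 0 =>
    have c₀ := isCurrent_conv (h₀.cur .pos) p₀.cur
    have c₁ := isCurrent_shift κ₀ (isCurrent_conv (h₁.cur .pos) (h₁.pair .pos).cur)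
    have key : conv (ucop κ₀ κ₁ a₀ a₁ ∘ UGen.xi .pos) (ucop κ₀ κ₁ a₀ a₁ ∘ UGen.al .pos) = fun k =>
        conv (conv (fun k => a₀ (.xi .pos k)) fun k => a₀ (.al .pos k))
          (shift κ₀ fun k => a₁ (.al .pos k)) k +
        conv (shift κ₀ (conv (fun k => a₁ (.xi .pos k)) fun k => a₁ (.al .pos k)))
          (shift (qu R 2) fun k => a₀ (.be .pos k)) k := by
      refine (conv_add_left (h₀.cur .pos) (isCurrent_conv s₁ d₀.cur)
        (isCurrent_conv p₀.cur p₁.cur) (Or.inl (p₀.bd.conv p₁.bd))).trans ?_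
      rw [conv_assoc s₁ d₀.cur (isCurrent_conv p₀.cur p₁.cur) (Or.inl ⟨d₀.bd, p₀.bd.conv p₁.bd⟩),
        ← conv_assoc_bd d₀.cur p₀.cur p₁.cur d₀.bd p₀.bd p₁.bd, dblc_conv_inv p₀,
        conv_comm (X := shift (qu R 2) _) fun k l => commute_shift_left _ (fun k =>
          commute_shift _ (fun l => hc (.be .pos k) (.al .pos l)) l) k,
        ← conv_assoc s₁ p₁.cur q₀.cur (Or.inl ⟨p₁.bd, q₀.bd⟩),
        ← shift_conv κ₀ (h₁.cur .pos) (h₁.pair .pos).cur (Or.inl (h₁.pair .pos).bd),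
        ← conv_assoc (h₀.cur .pos) p₀.cur p₁.cur (Or.inl ⟨p₀.bd, p₁.bd⟩)]
    have hk : lof R (ucop κ₀ κ₁ a₀ a₁) (.L .pos 1 0 k) = _ := congrFun key k
    rw [hk]
    exact ((hasSum_conv_left c₀ p₁.cur (Or.inl p₁.bd) k).add
      (hasSum_conv_comm q₀.cur c₁ (Or.inl q₀.bd) (fun k l => commute_shift_left _ (fun k =>
        commute_shift _ (commute_conv (h₁.cur .pos) (h₁.pair .pos).cur (Or.inl (h₁.pair .pos).bd)
          (fun _ => hc _ _) fun _ => hc _ _) l) k) k))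
  | 1, 1 =>
    have key : shift (qu R 2) (ucop κ₀ κ₁ a₀ a₁ ∘ UGen.be .pos) = conv (shift (qu R 2)
        fun k => a₀ (.be .pos k)) (shift κ₀ (shift (qu R 2) fun k => a₁ (.be .pos k))) := by
      refine (shift_conv _ p₀.symm.cur p₁.symm.cur (Or.inl p₁.symm.bd)).trans ?_
      rw [shift_shift, shift_shift, mul_comm]
    have q₁ := ((h₁.pair .pos).symm.shift (qu R 2)).shift κ₀
    have hk : lof R (ucop κ₀ κ₁ a₀ a₁) (.L .pos 1 1 k) = _ := congrFun key k
    rw [hk]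
    refine (hasSum_conv_left q₀.cur q₁.cur (Or.inl q₁.bd) k).congr_fun fun n => ?_
    change _ * (_ • 0) + _ = _
    rw [smul_zero, mul_zero, zero_add]
    rfl

lemma hasSum_lof_ucop_neg (g₁ : UGraded κ₁ a₁) (h₀ : UCore κ₀ a₀) (h₁ : UCore κ₁ a₁)
    (hc : ∀ x y, Commute (a₀ x) (a₁ y)) (i j : Fin 2) (k : ℤ) :
    HasSum (fun n : ℤ => ∑ p : Fin 2, lof R a₀ (.L .neg i p n) *
      kpow (lof R a₁ .qc) (lof R a₁ .qc') n * lof R a₁ (.L .neg p j (k - n)))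
    (lof R (ucop κ₀ κ₁ a₀ a₁) (.L .neg i j k)) := by
  have p₀ := (h₀.pair .neg).shift κ₁
  have p₁ := h₁.pair .neg
  have s₀ := isCurrent_shift κ₁ (h₀.cur .neg)
  have q₁ := p₁.symm.shift (qu R 2)
  have d₁ := p₁.symm.dblc
  have tm : ∀ p (y : E) n, lof R a₀ (.L .neg i p n) * kpow (lof R a₁ .qc) (lof R a₁ .qc') n * y =
      shift κ₁ (fun m => lof R a₀ (.L .neg i p m)) n * y := fun p y n =>
    mul_kpow_mul' g₁ (fun m => lof R a₀ (.L .neg i p m)) y n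
  simp only [Fin.sum_univ_two, tm]
  match i, j with
  | 0, 0 =>
    refine (hasSum_conv_left p₀.cur p₁.cur (Or.inr p₀.bd) k).congr_fun fun n => ?_
    change _ + _ * 0 = _
    rw [mul_zero, add_zero]
    rfl
  | 1, 0 =>
    refine hasSum_zero.congr_fun fun n => ?_
    change (_ • 0) * _ + _ * 0 = _
    rw [mul_zero, add_zero, smul_zero, zero_mul]
  | 0, 1 =>
    have b₀ := isCurrent_conv (h₀.pair .neg).cur (h₀.cur .neg)
    have c₀ := isCurrent_shift κ₁ b₀
    have c₁ := isCurrent_conv p₁.cur (h₁.cur .neg)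
    have key : conv (ucop κ₀ κ₁ a₀ a₁ ∘ UGen.al .neg) (ucop κ₀ κ₁ a₀ a₁ ∘ UGen.xi .neg) = fun k =>
        conv (shift κ₁ fun k => a₀ (.al .neg k))
          (conv (fun k => a₁ (.al .neg k)) fun k => a₁ (.xi .neg k)) k +
        conv (shift (qu R 2) fun k => a₁ (.be .neg k))
          (shift κ₁ (conv (fun k => a₀ (.al .neg k)) fun k => a₀ (.xi .neg k))) k := by
      refine (conv_add_right (isCurrent_conv p₀.cur p₁.cur) (isCurrent_conv d₁.cur s₀)
        (h₁.cur .neg) (Or.inr (p₀.bd.conv p₁.bd))).trans ?_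
      rw [← conv_assoc (isCurrent_conv p₀.cur p₁.cur) d₁.cur s₀ (Or.inr (Or.inl ⟨p₀.bd.conv p₁.bd, d₁.bd⟩)),
        conv_assoc_bd p₀.cur p₁.cur d₁.cur p₀.bd p₁.bd d₁.bd, conv_dblc_inv p₁,
        conv_comm (Y := shift (qu R 2) _) fun k l => commute_shift _ (fun l =>
          commute_shift_left _ (fun k => hc (.al .neg k) (.be .neg l)) k) l,
        conv_assoc q₁.cur p₀.cur s₀ (Or.inr (Or.inl ⟨q₁.bd, p₀.bd⟩)),
        ← shift_conv κ₁ (h₀.pair .neg).cur (h₀.cur .neg) (Or.inr (h₀.pair .neg).bd),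
        conv_assoc p₀.cur p₁.cur (h₁.cur .neg) (Or.inr (Or.inl ⟨p₀.bd, p₁.bd⟩))]
    have hk : lof R (ucop κ₀ κ₁ a₀ a₁) (.L .neg 0 1 k) = _ := congrArg Neg.neg (congrFun key k)
    rw [hk]
    refine ((hasSum_conv_left p₀.cur c₁ (Or.inr p₀.bd) k).add
      (hasSum_conv_comm c₀ q₁.cur (Or.inr q₁.bd) (fun k l => commute_shift_left _ (fun k =>
        commute_shift _ (fun l => (commute_conv (h₀.pair .neg).cur (h₀.cur .neg)
          (Or.inr (h₀.pair .neg).bd) (fun _ => (hc _ _).symm) (fun _ => (hc _ _).symm) k).symm) l) k) k)).neg.congr_fun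
      fun n => ?_
    change _ * -_ + (_ • -_) * _ = _
    rw [mul_neg, smul_neg, neg_mul, ← neg_add]
    rfl
  | 1, 1 =>
    have q₀ := ((h₀.pair .neg).symm.shift (qu R 2)).shift κ₁
    have key : shift (qu R 2) (ucop κ₀ κ₁ a₀ a₁ ∘ UGen.be .neg) = conv (shift κ₁ (shift (qu R 2)
        fun k => a₀ (.be .neg k))) (shift (qu R 2) fun k => a₁ (.be .neg k)) := by
      refine (shift_conv _ p₀.symm.cur p₁.symm.cur (Or.inr p₀.symm.bd)).trans ?_
      rw [shift_shift, shift_shift, mul_comm]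
    have hk : lof R (ucop κ₀ κ₁ a₀ a₁) (.L .neg 1 1 k) = _ := congrFun key k
    rw [hk]
    refine (hasSum_conv_left q₀.cur q₁.cur (Or.inr q₀.bd) k).congr_fun fun n => ?_
    change (_ • 0) * _ + _ = _
    rw [smul_zero, zero_mul, zero_add]
    rfl

end CopGenerators

section Pairs

variable {T T' : Theory} {m m' n : ℕ}

lemma emb_commute {e : Fin m ↪ Fin n} {e' : Fin m' ↪ Fin n} (h : ∀ i j, e i ≠ e' j)
    (η : Completed T m) (θ : Completed T m') : Commute (emb T e η) (emb T e' θ) :=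
  commute_hom_of_gens (continuous_emb e') (fun i x => (commute_hom_of_gens (continuous_emb e)
    (fun j y => (gen_commute (h j i).symm x y)) η).symm) θ

/-- The tensor product of two homomorphisms. -/
def ActData.pair (D : ActData T 1 T' m) (D' : ActData T 1 T' m') (e : Fin m ↪ Fin n)
    (e' : Fin m' ↪ Fin n) (h : ∀ i j, e i ≠ e' j) : ActData T 2 T' n where
  act i x := match i with
    | 0 => emb T' e (D.act 0 x)
    | 1 => emb T' e' (D'.act 0 x)
  mem i x := match i with
    | 0 => emb_mem e (D.mem 0 x)
    | 1 => emb_mem e' (D'.mem 0 x)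
  rel V i := match i with
    | 0 => D.rel (V.restrict e) 0
    | 1 => D'.rel (V.restrict e') 0
  comm i j hij _ _ := match i, j with
    | 0, 0 => absurd rfl hij
    | 0, 1 => emb_commute h _ _
    | 1, 0 => (emb_commute h _ _).symm
    | 1, 1 => absurd rfl hij
  sgn := D.sgn

lemma ActData.pair_leg_zero (D : ActData T 1 T' m) (D' : ActData T 1 T' m') (e : Fin m ↪ Fin n)
    (e' : Fin m' ↪ Fin n) (h : ∀ i j, e i ≠ e' j) (η : Completed T 1) :
    (D.pair D' e e' h).hom (leg T 0 η) = emb T' e (D.hom η) := by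
  have : (D.pair D' e e' h).hom.comp (leg T 0) = (emb T' e).comp D.hom := by
    refine completed_algHom_ext ((D.pair D' e e' h).continuous_hom.comp (continuous_leg 0))
      ((continuous_emb e).comp D.continuous_hom) fun j x => ?_
    obtain rfl : j = 0 := Subsingleton.elim _ _
    rfl
  exact DFunLike.congr_fun this η

lemma ActData.pair_leg_one (D : ActData T 1 T' m) (D' : ActData T 1 T' m') (e : Fin m ↪ Fin n)
    (e' : Fin m' ↪ Fin n) (h : ∀ i j, e i ≠ e' j) (η : Completed T 1) :
    (D.pair D' e e' h).hom (leg T 1 η) = emb T' e' (D'.hom η) := by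
  have : (D.pair D' e e' h).hom.comp (leg T 1) = (emb T' e').comp D'.hom := by
    refine completed_algHom_ext ((D.pair D' e e' h).continuous_hom.comp (continuous_leg 1))
      ((continuous_emb e').comp D'.continuous_hom) fun j x => ?_
    obtain rfl : j = 0 := Subsingleton.elim _ _
    rfl
  exact DFunLike.congr_fun this η

variable (T) in
/-- The identity. -/
def ActData.refl : ActData T 1 T 1 where
  act i x := gen T i x
  mem i x := act_mem_piece i x
  rel V i := V.rel i
  comm _ _ h x y := gen_commute h x y
  sgn := rfl

lemma mapsSums_emb [Fact (T.sgn = 1)] (e : Fin m ↪ Fin n) : MapsSums (Cent T m) (emb T e) :=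
  mapsSums_of_continuous (F := emb T e) (continuous_emb e)

end Pairs

section Coproduct

variable (ζ : Bool)

lemma ug_commute {n : ℕ} {i j : Fin n} (h : i ≠ j) (x y : UGen) :
    Commute (ug ζ .high i x) (ug ζ .high j y) :=
  gen_commute (T := UTh ζ .high) h x y

/-- The coproducts of the generators. -/
def ucopGen {n : ℕ} (i j : Fin n) : UGen → Completed (UTh ζ .high) n :=
  ucop (ukap ζ .high i) (ukap ζ .high j) (ug ζ .high i) (ug ζ .high j)

lemma ugraded_ucopGen {n : ℕ} {i j : Fin n} (h : i ≠ j) :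
    UGraded (ukap ζ .high i * ukap ζ .high j) (ucopGen ζ i j) :=
  ugraded_ucop (ucore_high ζ i) (ucore_high ζ j) (ug_commute ζ h) (ugraded_high ζ i) (ugraded_high ζ j)

lemma ucore_ucopGen {n : ℕ} {i j : Fin n} (h : i ≠ j) :
    UCore (ukap ζ .high i * ukap ζ .high j) (ucopGen ζ i j) :=
  ucore_ucop (ucore_high ζ i) (ucore_high ζ j) (ug_commute ζ h)

lemma urel_ucopGen {n : ℕ} {i j : Fin n} (h : i ≠ j) : URel ζ (ucopGen ζ i j) :=
  (ugraded_ucopGen ζ h).urel_of_core (ucore_ucopGen ζ h)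
    (zeroModes_ucop (ucore_high ζ i) (ucore_high ζ j) (ug_commute ζ h) (zeroModes_high ζ i)
      (zeroModes_high ζ j))

lemma zero_ne_one_fin : (0 : Fin 2) ≠ 1 := by decide

lemma urel_copData (V : Rep (UTh ζ .high) 2) : URel ζ fun x => (ucopGen ζ (0 : Fin 2) 1 x).1 V :=
  (urel_ucopGen ζ zero_ne_one_fin).eval V

/-- The coproduct on generators. -/
def copData : ActData (UTh ζ .high) 1 (UTh ζ .high) 2 where
  act _ := ucopGen ζ 0 1
  mem _ := (ugraded_ucopGen ζ zero_ne_one_fin).mem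
  rel V _ := urel_copData ζ V
  comm i j h := absurd (Subsingleton.elim i j) h
  sgn := rfl

/-- The coproduct in the first factor. -/
def copLeft : ActData (UTh ζ .high) 2 (UTh ζ .high) 3 :=
  (copData ζ).pair (ActData.refl _) Fin.castSuccEmb
    ⟨fun _ => (2 : Fin 3), fun _ _ _ => Subsingleton.elim _ _⟩ (by decide)

/-- The coproduct in the second factor. -/
def copRight : ActData (UTh ζ .high) 2 (UTh ζ .high) 3 :=
  (ActData.refl _).pair (copData ζ) ⟨fun _ => (0 : Fin 3), fun _ _ _ => Subsingleton.elim _ _⟩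
    (Fin.succEmb 2) (by decide)

lemma emb_ucopGen {m n : ℕ} (e : Fin m ↪ Fin n) (i j : Fin m) (x : UGen) :
    emb (UTh ζ .high) e (ucopGen ζ i j x) = ucopGen ζ (e i) (e j) x := by
  have hF : MapsSums (Cent (UTh ζ .high) m) (emb (UTh ζ .high) e) := mapsSums_emb e
  exact hF.map_ucop (R' := Cent (UTh ζ .high) n) (κ₀' := ukap ζ .high (e i)) (κ₁' := ukap ζ .high (e j))
    (ucore_high ζ i) (ucore_high ζ j) rfl rfl x

lemma copLeft_copGen (x : UGen) : (copLeft ζ).hom (ucopGen ζ 0 1 x) =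
    ucop (ukap ζ .high (0 : Fin 3) * ukap ζ .high 1) (ukap ζ .high 2) (ucopGen ζ 0 1) (ug ζ .high 2) x := by
  have hF : MapsSums (Cent (UTh ζ .high) 2) (copLeft ζ).hom := mapsSums_high (copLeft ζ)
  have h0 : (fun x => (copLeft ζ).hom (ug ζ .high 0 x)) = ucopGen ζ (0 : Fin 3) 1 :=
    funext fun x => emb_ucopGen ζ Fin.castSuccEmb 0 1 x
  have := hF.map_ucop (R' := Cent (UTh ζ .high) 3) (κ₀' := ukap ζ .high (0 : Fin 3) * ukap ζ .high 1)
    (κ₁' := ukap ζ .high (2 : Fin 3)) (ucore_high ζ 0) (ucore_high ζ 1) rfl rfl x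
  rw [h0] at this
  exact this

lemma copRight_copGen (x : UGen) : (copRight ζ).hom (ucopGen ζ 0 1 x) =
    ucop (ukap ζ .high (0 : Fin 3)) (ukap ζ .high 1 * ukap ζ .high 2) (ug ζ .high 0) (ucopGen ζ 1 2) x := by
  have hF : MapsSums (Cent (UTh ζ .high) 2) (copRight ζ).hom := mapsSums_high (copRight ζ)
  have h0 : (fun x => (copRight ζ).hom (ug ζ .high 1 x)) = ucopGen ζ (1 : Fin 3) 2 :=
    funext fun x => emb_ucopGen ζ (Fin.succEmb 2) 0 1 x
  have := hF.map_ucop (R' := Cent (UTh ζ .high) 3) (κ₀' := ukap ζ .high (0 : Fin 3))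
    (κ₁' := ukap ζ .high (1 : Fin 3) * ukap ζ .high 2) (ucore_high ζ 0) (ucore_high ζ 1) rfl rfl x
  rw [h0] at this
  exact this

lemma copLeft_cop (η : Completed (UTh ζ .high) 1) :
    (copLeft ζ).hom ((copData ζ).hom η) = (copRight ζ).hom ((copData ζ).hom η) := by
  have : (copLeft ζ).hom.comp (copData ζ).hom = (copRight ζ).hom.comp (copData ζ).hom := by
    refine completed_algHom_ext ((copLeft ζ).continuous_hom.comp (copData ζ).continuous_hom)
      ((copRight ζ).continuous_hom.comp (copData ζ).continuous_hom) fun i x => ?_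
    exact (copLeft_copGen ζ x).trans ((ucop_ucop (ucore_high ζ 0) (ucore_high ζ 1) (ucore_high ζ 2)
      (ug_commute ζ (by decide)) (ug_commute ζ (by decide)) x).trans (copRight_copGen ζ x).symm)
  exact DFunLike.congr_fun this η

/-! ### The counit -/

lemma triv_eq_zero {x : UGen} (h : x.deg ≠ 0) : triv x = 0 := by
  cases x with
  | xi s k => rfl
  | al s k => exact if_neg h
  | be s k => exact if_neg h
  | qc => exact absurd rfl h
  | qc' => exact absurd rfl h

lemma urel_algebraMap_triv (A : Type*) [Ring A] [Algebra B A] :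
    URel ζ fun x => algebraMap B A (triv x) := (urel_triv ζ).map (Algebra.ofId B A)

lemma triv_mem {T : Theory} {n : ℕ} (x : UGen) :
    (algebraMap B (Completed T n) (triv x)).1 ∈ piece T n x.deg := by
  by_cases h : x.deg = 0
  · rw [h, Algebra.algebraMap_eq_smul_one]
    exact (pieceSub T n 0).smul_mem _ one_mem_piece
  · rw [triv_eq_zero h, map_zero]
    exact (pieceSub T n _).zero_mem

/-- The counit on generators. -/
def trivData (n : ℕ) : ActData (UTh ζ .high) 1 (UTh ζ .high) n where
  act _ x := algebraMap B _ (triv x)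
  mem _ := triv_mem
  rel V _ := urel_algebraMap_triv ζ (Module.End B V.carrier)
  comm i j h := absurd (Subsingleton.elim i j) h
  sgn := rfl

/-- The trivial representation. -/
def trivRep : Rep (UTh ζ .high) 0 where
  carrier := B
  act i := i.elim0
  rel i := i.elim0
  bounded i := i.elim0
  comm i := i.elim0

/-- The counit. -/
def counit : Completed (UTh ζ .high) 1 →ₐ[B] B where
  toFun η := ((trivData ζ 0).hom η).1 (trivRep ζ) (1 : B)
  map_one' := rfl
  map_mul' η θ := by
    have h : ∀ (f : Module.End B B) (x : B), f x = f 1 * x := fun f x => by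
      rw [mul_comm, ← smul_eq_mul, ← map_smul, smul_eq_mul, mul_one]
    rw [map_mul]
    exact h (((trivData ζ 0).hom η).1 (trivRep ζ)) _
  map_zero' := rfl
  map_add' _ _ := rfl
  commutes' b := mul_one b

lemma counit_gen (x : UGen) : counit ζ (ug ζ .high 0 x) = triv x := mul_one (triv x)

lemma isLocallyConstant_counit : IsLocallyConstant (counit ζ) :=
  (IsLocallyConstant.iff_eventually_eq _).2 fun η =>
    eventually_eval η ((trivData ζ 0).pull (trivRep ζ)) (1 : B)

lemma trivData_hom {n : ℕ} (η : Completed (UTh ζ .high) 1) :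
    (trivData ζ n).hom η = algebraMap B _ (counit ζ η) := by
  have : (trivData ζ n).hom = (Algebra.ofId B _).comp (counit ζ) := by
    refine completed_algHom_ext (trivData ζ n).continuous_hom
      ((isLocallyConstant_counit ζ).comp (algebraMap B (Completed (UTh ζ .high) n))).continuous
      fun i x => ?_
    obtain rfl : i = 0 := Subsingleton.elim _ _
    exact congrArg (algebraMap B _) (counit_gen ζ x).symm
  exact DFunLike.congr_fun this η

/-- The counit in the first factor. -/
def counitLeft : ActData (UTh ζ .high) 2 (UTh ζ .high) 1 :=
  (trivData ζ 0).pair (ActData.refl _) (⟨Fin.elim0, fun i => i.elim0⟩ : Fin 0 ↪ Fin 1)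
    ⟨fun _ => 0, fun _ _ _ => Subsingleton.elim _ _⟩ fun i => i.elim0

/-- The counit in the second factor. -/
def counitRight : ActData (UTh ζ .high) 2 (UTh ζ .high) 1 :=
  (ActData.refl _).pair (trivData ζ 0) ⟨fun _ => 0, fun _ _ _ => Subsingleton.elim _ _⟩
    (⟨Fin.elim0, fun i => i.elim0⟩ : Fin 0 ↪ Fin 1) fun _ i => i.elim0

lemma emb_one : emb (UTh ζ .high) (⟨Fin.elim0, fun i => i.elim0⟩ : Fin 0 ↪ Fin 1) (algebraMap B _ 1) =
    algebraMap (Cent (UTh ζ .high) 1) _ ((1 : (Cent (UTh ζ .high) 1)ˣ) : Cent (UTh ζ .high) 1) := by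
  rw [Units.val_one, map_one, map_one, map_one]

lemma counitLeft_cop (η : Completed (UTh ζ .high) 1) :
    (counitLeft ζ).hom ((copData ζ).hom η) = η := by
  have : (counitLeft ζ).hom.comp (copData ζ).hom = AlgHom.id B _ := by
    refine completed_algHom_ext ((counitLeft ζ).continuous_hom.comp (copData ζ).continuous_hom)
      continuous_id fun i x => ?_
    obtain rfl : i = 0 := Subsingleton.elim _ _
    have hF : MapsSums (Cent (UTh ζ .high) 2) (counitLeft ζ).hom := mapsSums_high (counitLeft ζ)
    refine (hF.map_ucop (R' := Cent (UTh ζ .high) 1) (κ₀' := 1) (κ₁' := ukap ζ .high (0 : Fin 1))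
      (ucore_high ζ 0) (ucore_high ζ 1) (by exact emb_one ζ) rfl x).trans ?_
    exact congrFun (ucop_triv_left (a₁ := ug ζ .high 0)) x
  exact DFunLike.congr_fun this η

lemma counitRight_cop (η : Completed (UTh ζ .high) 1) :
    (counitRight ζ).hom ((copData ζ).hom η) = η := by
  have : (counitRight ζ).hom.comp (copData ζ).hom = AlgHom.id B _ := by
    refine completed_algHom_ext ((counitRight ζ).continuous_hom.comp (copData ζ).continuous_hom)
      continuous_id fun i x => ?_
    obtain rfl : i = 0 := Subsingleton.elim _ _
    have hF : MapsSums (Cent (UTh ζ .high) 2) (counitRight ζ).hom := mapsSums_high (counitRight ζ)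
    refine (hF.map_ucop (R' := Cent (UTh ζ .high) 1) (κ₀' := ukap ζ .high (0 : Fin 1)) (κ₁' := 1)
      (ucore_high ζ 0) (ucore_high ζ 1) rfl (by exact emb_one ζ) x).trans ?_
    exact congrFun (ucop_triv_right (a₀ := ug ζ .high 0)) x
  exact DFunLike.congr_fun this η

end Coproduct

section

/-! ### Antihomomorphisms from highest to lowest weight theories -/

section Loop

variable {M : Type} [AddCommGroup M] [Module B M]

/-- The operator `g` on Laurent polynomials with coefficients in `M`, shifted by `k`. -/
def loopEnd (k : ℤ) (g : Module.End B M) : Module.End B (ℤ →₀ M) :=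
  Finsupp.lsum B fun i => Finsupp.lsingle (i + k) ∘ₗ g

lemma loopEnd_single (k i : ℤ) (g : Module.End B M) (v : M) :
    loopEnd k g (Finsupp.single i v) = Finsupp.single (i + k) (g v) := by
  simp [loopEnd]

lemma loopEnd_prod {G : Type} (deg : G → ℤ) (a : G → Module.End B M) (w : List G) (i : ℤ) (v : M) :
    (w.map fun x => loopEnd (deg x) (a x)).prod (Finsupp.single i v) =
      Finsupp.single (i + (w.map deg).sum) ((w.map a).prod v) := by
  induction w with
  | nil => simp
  | cons x w ih =>
    simp only [List.map_cons, List.prod_cons, List.sum_cons, Module.End.mul_apply, ih, loopEnd_single]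
    congr 1; ring

end Loop

/-- Generators of the opposite of the algebra of a lowest weight theory that satisfy the relations
of a highest weight theory. -/
structure AntiData (T T' : Theory) where
  act : T.Gen → (Completed T' 1)ᵐᵒᵖ
  mem : ∀ x, (act x).unop.1 ∈ piece T' 1 (T.deg x)
  rel : ∀ (M : Type) [AddCommGroup M] [Module B M] (φ : (Completed T' 1)ᵐᵒᵖ →ₐ[B] Module.End B M),
    T.Rel M fun x => φ (act x)
  loop : ∀ V : Rep T' 1, T'.Rel (ℤ →₀ V.carrier) fun x => loopEnd (T'.deg x) (V.act 0 x)
  sgn : T.sgn = 1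
  sgn' : T'.sgn = -1

namespace AntiData

variable {T T' : Theory} (D : AntiData T T')

/-- The Laurent polynomials with coefficients in a representation, graded by the exponent. -/
def lrep (V : Rep T' 1) : Rep T' 1 where
  carrier := ℤ →₀ V.carrier
  act _ x := loopEnd (T'.deg x) (V.act 0 x)
  rel _ := D.loop V
  bounded _ f := by
    induction f using Finsupp.induction_linear with
    | zero => exact ⟨0, fun _ _ => map_zero _⟩
    | add f g hf hg =>
      obtain ⟨N, hN⟩ := hf
      obtain ⟨N', hN'⟩ := hg
      exact ⟨max N N', fun w hw => by
        rw [map_add, hN w ((le_max_left _ _).trans hw), hN' w ((le_max_right _ _).trans hw), add_zero]⟩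
    | single i v =>
      obtain ⟨N, hN⟩ := V.bounded 0 v
      exact ⟨N, fun w hw => by rw [loopEnd_prod, hN w hw, Finsupp.single_zero]⟩
  comm i j h := absurd (Subsingleton.elim i j) h

/-- The monomial with coefficient `v`. -/
def mon (V : Rep T' 1) (i : ℤ) : V.carrier →ₗ[B] (D.lrep V).carrier :=
  (Finsupp.lsingle i : V.carrier →ₗ[B] (ℤ →₀ V.carrier))

/-- The coefficients of Laurent polynomials. -/
def lcoeff (V : Rep T' 1) (k : ℤ) : (D.lrep V).carrier →ₗ[B] V.carrier :=
  (Finsupp.lapply k : (ℤ →₀ V.carrier) →ₗ[B] V.carrier)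

lemma lcoeff_mon (V : Rep T' 1) (i k : ℤ) (v : V.carrier) :
    D.lcoeff V k (D.mon V i v) = if i = k then v else 0 := Finsupp.single_apply

lemma lrep_mon {V : Rep T' 1} {j : ℤ} {η : (V : Rep T' 1) → Module.End B V.carrier}
    (h : η ∈ piece T' 1 j) (i : ℤ) (v : V.carrier) :
    η (D.lrep V) (D.mon V i v) = D.mon V (i + j) (η V v) := by
  classical
  obtain ⟨x, hx, h⟩ := h {⟨D.lrep V, D.mon V i v⟩, ⟨V, v⟩}
  have h1 := h ⟨V, v⟩ (by simp)
  have h2 := h ⟨D.lrep V, D.mon V i v⟩ (by simp)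
  dsimp only at h1 h2
  rw [h1, h2]
  clear h h1 h2
  refine Submodule.span_induction (p := fun x _ => (D.lrep V).eval x (D.mon V i v) =
    D.mon V (i + j) (V.eval x v)) ?_ ?_ ?_ ?_ hx
  · rintro _ ⟨w, rfl, rfl⟩
    rw [Rep.eval_prod, Rep.eval_prod]
    have h0 : ∀ p : Fin 1 × T'.Gen, V.act p.1 p.2 = V.act 0 p.2 := fun p => by
      rw [Subsingleton.elim p.1 0]
    simp only [h0]
    exact loopEnd_prod (fun p : Fin 1 × T'.Gen => T'.deg p.2) (fun p => V.act 0 p.2) w i v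
  · rw [map_zero, map_zero, LinearMap.zero_apply, LinearMap.zero_apply, map_zero]
  · intro x y _ _ hx hy
    rw [map_add, map_add, LinearMap.add_apply, LinearMap.add_apply, hx, hy, map_add]
  · intro b x _ hx
    rw [map_smul, map_smul, LinearMap.smul_apply, LinearMap.smul_apply, hx, map_smul]

/-- The antihomomorphism on noncommutative polynomials. -/
def pol : FreeAlgebra B (Fin 1 × T.Gen) →ₐ[B] (Completed T' 1)ᵐᵒᵖ := FreeAlgebra.lift B fun p => D.act p.2

lemma prod_mem (w : List T.Gen) : (w.map D.act).prod.unop.1 ∈ piece T' 1 (w.map T.deg).sum := by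
  induction w with
  | nil => exact one_mem_piece
  | cons x w ih =>
    rw [List.map_cons, List.map_cons, List.prod_cons, List.sum_cons, add_comm]
    exact piece_mul ih (D.mem x)

lemma pol_mem {k : ℤ} {x : FreeAlgebra B (Fin 1 × T.Gen)} (hx : x ∈ homog T 1 k) :
    (D.pol x).unop.1 ∈ piece T' 1 k := by
  have : homog T 1 k ≤ ((pieceSub T' 1 k).comap (completed T' 1).val.toLinearMap).comap
      ((opLinearEquiv B).symm.toLinearMap ∘ₗ D.pol.toLinearMap) := by
    refine Submodule.span_le.2 ?_
    rintro _ ⟨w, rfl, rfl⟩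
    have h := D.prod_mem (w.map Prod.snd)
    rw [List.map_map, List.map_map] at h
    have h2 : D.pol (w.map (FreeAlgebra.ι B)).prod = (w.map (D.act ∘ Prod.snd)).prod := by
      rw [map_list_prod, List.map_map]
      exact congrArg _ (List.map_congr_left fun p _ => FreeAlgebra.lift_ι_apply _ p)
    rw [← h2] at h
    exact h
  exact this hx

section Module

variable (V : Rep T' 1) (v : V.carrier) (k : ℤ)

/-- The operators on Laurent polynomials, in the opposite order. -/
abbrev Ops : Type := (evalAt (D.lrep V)).rangeᵐᵒᵖ

/-- The representation on Laurent polynomials. -/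
def ops : (Completed T' 1)ᵐᵒᵖ →ₐ[B] D.Ops V := AlgHom.op (evalAt (D.lrep V)).rangeRestrict

lemma ops_surjective : Function.Surjective (D.ops V) := fun a => by
  obtain ⟨η, h⟩ := (evalAt (D.lrep V)).rangeRestrict_surjective a.unop
  exact ⟨op η, congrArg op h⟩

/-- The coefficient of degree `k` of the image of `v`. -/
def coefAux : D.Ops V →ₗ[B] V.carrier :=
  D.lcoeff V k ∘ₗ LinearMap.applyₗ (D.mon V 0 v) ∘ₗ
    (evalAt (D.lrep V)).range.val.toLinearMap ∘ₗ (opLinearEquiv B).symm.toLinearMap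

/-- The largest left ideal in the kernel of the coefficient map. -/
def radical : Submodule (D.Ops V) (D.Ops V) where
  carrier := {p | ∀ q, D.coefAux V v k (q * p) = 0}
  zero_mem' q := by rw [mul_zero, map_zero]
  add_mem' {a b} ha hb q := by rw [mul_add, map_add, ha, hb, add_zero]
  smul_mem' a p hp q := by rw [smul_eq_mul, ← mul_assoc]; exact hp _

lemma exists_bound_ops (η : Completed T' 1) : ∃ N : ℤ, ∀ j, N ≤ j → ∀ ω : Completed T' 1,
    ω.1 ∈ piece T' 1 j → ∀ θ, D.coefAux V v k (D.ops V (op θ) * (D.ops V (op ω) * D.ops V (op η))) = 0 := by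
  obtain ⟨N, hN⟩ := exists_bound_piece V v
  simp only [← map_mul, ← op_mul]
  induction η using completed_induction with
  | h i η hη =>
    refine ⟨N - i + k, fun j hj ω hω θ => ?_⟩
    induction θ using completed_induction with
    | h m θ hθ =>
      change D.lcoeff V k (η.1 (D.lrep V) (ω.1 (D.lrep V) (θ.1 (D.lrep V) (D.mon V 0 v)))) = 0
      rw [D.lrep_mon hθ, D.lrep_mon hω, D.lrep_mon hη, lcoeff_mon]
      split_ifs with h
      · rw [hN m (by rw [D.sgn']; omega) _ hθ, map_zero, map_zero]
      · rfl
    | h0 => rw [mul_zero, op_zero, map_zero, map_zero]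
    | hadd a b ha hb => rw [mul_add, op_add, map_add, map_add, ha, hb, add_zero]
  | h0 => exact ⟨0, fun _ _ _ _ _ => by rw [zero_mul, zero_mul, op_zero, map_zero, map_zero]⟩
  | hadd a b ha hb =>
    obtain ⟨N, hN⟩ := ha
    obtain ⟨N', hN'⟩ := hb
    exact ⟨max N N', fun j hj ω hω θ => by
      rw [add_mul, add_mul, op_add, map_add, map_add, hN j ((le_max_left _ _).trans hj) ω hω,
        hN' j ((le_max_right _ _).trans hj) ω hω, add_zero]⟩

/-- The action on the cyclic module. -/
def cycHom : (Completed T' 1)ᵐᵒᵖ →ₐ[B] Module.End B (D.Ops V ⧸ D.radical V v k) :=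
  (Algebra.lsmul B B _).comp (D.ops V)

/-- The cyclic highest weight representation whose matrix coefficient is the coefficient of degree
`k` of the image of `v`. -/
def cyc : Rep T 1 where
  carrier := D.Ops V ⧸ D.radical V v k
  act _ x := D.cycHom V v k (D.act x)
  rel _ := D.rel _ _
  bounded _ p := by
    obtain ⟨p, rfl⟩ := Submodule.Quotient.mk_surjective _ p
    obtain ⟨p, rfl⟩ := D.ops_surjective V p
    obtain ⟨N, hN⟩ := D.exists_bound_ops V v k p.unop
    refine ⟨N, fun w hw => ?_⟩
    rw [D.sgn, one_mul] at hw
    have h : (w.map fun x => D.cycHom V v k (D.act x)).prod = D.cycHom V v k (w.map D.act).prod := by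
      rw [map_list_prod, List.map_map]; rfl
    rw [h]
    refine (Submodule.Quotient.mk_eq_zero _).2 fun q => ?_
    obtain ⟨q, rfl⟩ := D.ops_surjective V q
    exact hN _ hw _ (D.prod_mem w) q.unop
  comm i j h := absurd (Subsingleton.elim i j) h

/-- The coefficient map on the cyclic module. -/
def cycCoef : (D.Ops V ⧸ D.radical V v k) →ₗ[B] V.carrier :=
  ((D.radical V v k).restrictScalars B).liftQ (D.coefAux V v k)
    (fun p hp => by simpa using hp 1) ∘ₗ
    (Submodule.Quotient.restrictScalarsEquiv B (D.radical V v k)).symm.toLinearMap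

/-- The generator of the cyclic module. -/
def cycVec : (D.cyc V v k).carrier := Submodule.Quotient.mk (p := D.radical V v k) 1

/-- The component of degree `k` of the antihomomorphism, at the vector `v`. -/
def coef : Completed T 1 →ₗ[B] V.carrier :=
  D.cycCoef V v k ∘ₗ LinearMap.applyₗ (D.cycVec V v k) ∘ₗ (evalAt (D.cyc V v k)).toLinearMap

variable {V v k}

lemma coef_congr {η θ : Completed T 1} (h : η.1 (D.cyc V v k) (D.cycVec V v k) = θ.1 _ (D.cycVec V v k)) :
    D.coef V v k η = D.coef V v k θ := congrArg (D.cycCoef V v k) h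

lemma coef_eq {j : ℤ} {x : FreeAlgebra B (Fin 1 × T.Gen)} (hx : x ∈ homog T 1 j) {η : Completed T 1}
    (h : η.1 (D.cyc V v k) (D.cycVec V v k) = (D.cyc V v k).eval x (D.cycVec V v k)) :
    D.coef V v k η = if j = k then (D.pol x).unop.1 V v else 0 := by
  have he : (D.cyc V v k).eval = (D.cycHom V v k).comp D.pol := by
    refine FreeAlgebra.hom_ext (funext fun p => ?_)
    exact (FreeAlgebra.lift_ι_apply _ p).trans (congrArg (D.cycHom V v k)
      (FreeAlgebra.lift_ι_apply (fun p : Fin 1 × T.Gen => D.act p.2) p).symm)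
  refine (congrArg (D.cycCoef V v k) h).trans ?_
  rw [he]
  change D.coefAux V v k (D.ops V (D.pol x) * 1) = _
  rw [mul_one]
  change D.lcoeff V k ((D.pol x).unop.1 (D.lrep V) (D.mon V 0 v)) = _
  rw [D.lrep_mon (D.pol_mem hx), lcoeff_mon, zero_add]

end Module

lemma exists_piece {j : ℤ} {η : Completed T 1} (h : η.1 ∈ piece T 1 j) :
    ∃ θ : Completed T' 1, θ.1 ∈ piece T' 1 j ∧ ∀ V v k, D.coef V v k η = if j = k then θ.1 V v else 0 := by
  classical
  have key : ∀ S : Finset (Pt T' 1), ∃ x ∈ homog T 1 j, ∀ p ∈ S,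
      D.coef p.1 p.2 j η = (D.pol x).unop.1 p.1 p.2 := fun S => by
    obtain ⟨x, hx, h⟩ := h (S.image fun p : Pt T' 1 => (⟨D.cyc p.1 p.2 j, D.cycVec p.1 p.2 j⟩ : Pt T 1))
    refine ⟨x, hx, fun p hp => ?_⟩
    rw [D.coef_eq hx (h ⟨D.cyc p.1 p.2 j, D.cycVec p.1 p.2 j⟩ (Finset.mem_image_of_mem _ hp)), if_pos rfl]
  let θ : (V : Rep T' 1) → Module.End B V.carrier := fun V =>
    { toFun := fun v => D.coef V v j η
      map_add' := fun v w => by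
        obtain ⟨x, -, hx⟩ := key {⟨V, v⟩, ⟨V, w⟩, ⟨V, v + w⟩}
        rw [hx ⟨V, v⟩ (by simp), hx ⟨V, w⟩ (by simp), hx ⟨V, v + w⟩ (by simp), map_add]
      map_smul' := fun b v => by
        obtain ⟨x, -, hx⟩ := key {⟨V, v⟩, ⟨V, b • v⟩}
        rw [hx ⟨V, v⟩ (by simp), hx ⟨V, b • v⟩ (by simp), map_smul]; rfl }
  have hθ : θ ∈ piece T' 1 j := piece_of_forall fun S => by
    obtain ⟨x, hx, h⟩ := key S
    exact ⟨_, D.pol_mem hx, h⟩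
  refine ⟨⟨θ, piece_subset_completed hθ⟩, hθ, fun V v k => ?_⟩
  split_ifs with hk
  · subst hk; rfl
  · obtain ⟨x, hx, h⟩ := h {⟨D.cyc V v k, D.cycVec V v k⟩}
    rw [D.coef_eq hx (h ⟨D.cyc V v k, D.cycVec V v k⟩ (by simp)), if_neg hk]

lemma exists_map (η : Completed T 1) : ∃ θ : Completed T' 1, ∀ V v,
    (Function.support fun k => D.coef V v k η).Finite ∧ θ.1 V v = ∑ᶠ k, D.coef V v k η := by
  induction η using completed_induction with
  | h j η h =>
    obtain ⟨θ, -, h⟩ := D.exists_piece h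
    refine ⟨θ, fun V v => ⟨(Set.finite_singleton j).subset fun k hk => ?_, ?_⟩⟩
    · by_contra hj
      exact hk (by simp only [h]; exact if_neg fun h => hj h.symm)
    · rw [finsum_eq_single _ j fun k hk => by rw [h, if_neg hk.symm], h, if_pos rfl]
  | h0 => exact ⟨0, fun V v => by simp [map_zero, Function.support]⟩
  | hadd a b ha hb =>
    obtain ⟨α, hα⟩ := ha
    obtain ⟨β, hβ⟩ := hb
    refine ⟨α + β, fun V v => ?_⟩
    simp only [map_add]
    refine ⟨((hα V v).1.union (hβ V v).1).subset (Function.support_add _ _), ?_⟩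
    rw [finsum_add_distrib (hα V v).1 (hβ V v).1, ← (hα V v).2, ← (hβ V v).2]
    rfl

/-- The antihomomorphism as a map. -/
def fn (η : Completed T 1) : Completed T' 1 := (D.exists_map η).choose

lemma fn_apply (η : Completed T 1) (V : Rep T' 1) (v : V.carrier) :
    (D.fn η).1 V v = ∑ᶠ k, D.coef V v k η := ((D.exists_map η).choose_spec V v).2

lemma fn_piece {j : ℤ} {η : Completed T 1} (h : η.1 ∈ piece T 1 j) :
    (D.fn η).1 ∈ piece T' 1 j ∧ ∀ V v, (D.fn η).1 V v = D.coef V v j η := by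
  obtain ⟨θ, h1, h2⟩ := D.exists_piece h
  have h3 : ∀ V v, (D.fn η).1 V v = D.coef V v j η := fun V v => by
    rw [fn_apply, finsum_eq_single _ j fun k hk => by rw [h2, if_neg hk.symm]]
  have h4 : D.fn η = θ := completed_ext fun V v => by rw [h3, h2, if_pos rfl]
  exact ⟨h4 ▸ h1, h3⟩

lemma fn_add (η θ : Completed T 1) : D.fn (η + θ) = D.fn η + D.fn θ := completed_ext fun V v => by
  rw [fn_apply]
  simp only [map_add]
  rw [finsum_add_distrib ((D.exists_map η).choose_spec V v).1 ((D.exists_map θ).choose_spec V v).1,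
    ← fn_apply, ← fn_apply]
  rfl

lemma fn_zero : D.fn 0 = 0 := by simpa using D.fn_add 0 0

lemma fn_smul (b : B) (η : Completed T 1) : D.fn (b • η) = b • D.fn η := completed_ext fun V v => by
  rw [fn_apply]
  simp only [map_smul]
  rw [← smul_finsum' b ((D.exists_map η).choose_spec V v).1, ← fn_apply]
  rfl

lemma fn_eval {x : FreeAlgebra B (Fin 1 × T.Gen)} {j : ℤ} (hx : x ∈ homog T 1 j) {η : Completed T 1}
    (h : ∀ V, η.1 V = V.eval x) : D.fn η = (D.pol x).unop := completed_ext fun V v => by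
  have hη : η.1 ∈ piece T 1 j := fun S => ⟨x, hx, fun p _ => by rw [h]⟩
  rw [(D.fn_piece hη).2, D.coef_eq hx (by rw [h]), if_pos rfl]

lemma fn_mul (η θ : Completed T 1) : D.fn (η * θ) = D.fn θ * D.fn η := by
  classical
  induction η using completed_induction with
  | h j η hη =>
    induction θ using completed_induction with
    | h k θ hθ =>
      refine completed_ext fun V v => ?_
      have hm : ∀ (α β : Completed T' 1) w, (α * β).1 V w = α.1 V (β.1 V w) := fun _ _ _ => rfl
      rw [(D.fn_piece (η := η * θ) (piece_mul hη hθ)).2, hm, (D.fn_piece hη).2, (D.fn_piece hθ).2]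
      obtain ⟨y, hy, h1⟩ := hθ {⟨D.cyc V (D.coef V v j η) k, D.cycVec V (D.coef V v j η) k⟩,
        ⟨D.cyc V v (j + k), D.cycVec V v (j + k)⟩}
      obtain ⟨x, hx, h2⟩ := hη {⟨D.cyc V v j, D.cycVec V v j⟩,
        ⟨D.cyc V v (j + k), (D.cyc V v (j + k)).eval y (D.cycVec V v (j + k))⟩}
      rw [D.coef_eq (homog_mul hx hy), if_pos rfl, D.coef_eq hy (h1 ⟨_, _⟩ (Finset.mem_insert_self _ _)), if_pos rfl,
        D.coef_eq hx (h2 ⟨_, _⟩ (Finset.mem_insert_self _ _)), if_pos rfl, map_mul]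
      · rfl
      · have h3 := h1 ⟨D.cyc V v (j + k), D.cycVec V v (j + k)⟩ (by simp)
        have h4 := h2 ⟨D.cyc V v (j + k), (D.cyc V v (j + k)).eval y (D.cycVec V v (j + k))⟩ (by simp)
        rw [map_mul, Module.End.mul_apply, ← h4, ← h3]
        rfl
    | h0 => rw [mul_zero, fn_zero, zero_mul]
    | hadd a b ha hb => rw [mul_add, fn_add, fn_add, add_mul, ha, hb]
  | h0 => rw [zero_mul, fn_zero, mul_zero]
  | hadd a b ha hb => rw [add_mul, fn_add, fn_add, mul_add, ha, hb]

/-- The antihomomorphism with the given values on the generators. -/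
def hom : Completed T 1 →ₐ[B] (Completed T' 1)ᵐᵒᵖ :=
  AlgHom.ofLinearMap
    { toFun := fun η => op (D.fn η)
      map_add' := fun η θ => congrArg op (D.fn_add η θ)
      map_smul' := fun b η => congrArg op (D.fn_smul b η) }
    (congrArg op ((D.fn_eval one_mem_homog fun V => (map_one V.eval).symm).trans
      (congrArg unop (map_one D.pol))))
    fun η θ => congrArg op (D.fn_mul η θ)

lemma hom_gen (x : T.Gen) : D.hom (gen T 0 x) = D.act x :=
  congrArg op ((D.fn_eval (x := FreeAlgebra.ι B (0, x)) (j := T.deg x)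
    (Submodule.subset_span ⟨[(0, x)], by simp, by simp⟩)
    fun V => (FreeAlgebra.lift_ι_apply (R := B) (fun p : Fin 1 × T.Gen => V.act p.1 p.2) (0, x)).symm).trans
      (congrArg unop (FreeAlgebra.lift_ι_apply _ _)))

lemma continuousOn_hom (k : ℤ) : ContinuousOn D.hom {η | η.1 ∈ piece T 1 k} := fun η hη => by
  refine (continuous_op.tendsto _).comp (tendsto_completed_iff.2 fun V v => ?_)
  filter_upwards [self_mem_nhdsWithin, mem_nhdsWithin_of_mem_nhds
    (eventually_eval η (D.cyc V v k) (D.cycVec V v k))] with θ hθ h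
  rw [(D.fn_piece hθ).2, (D.fn_piece hη).2, D.coef_congr h]

lemma mapsSums [Fact (T.sgn = 1)] [Fact (T'.sgn = -1)] : MapsSums (Cent T 1) D.hom := fun {f a k} hf h => by
  have hm : ∀ s : Finset ℤ, ∑ i ∈ s, f i ∈ {η : Completed T 1 | η.1 ∈ piece T 1 k} :=
    fun s => Submodule.sum_mem (pc (Cent T 1) k) fun i _ => hf i
  have ha := (isClosed_piece k).mem_of_tendsto h (Eventually.of_forall hm)
  have := (D.continuousOn_hom k a ha).tendsto.comp (tendsto_nhdsWithin_iff.2 ⟨h, Eventually.of_forall hm⟩)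
  simpa only [HasSum, Function.comp_def, map_sum] using this

end AntiData

end

section Shifted

variable [Algebra B R] [Algebra B E] [IsScalarTower B R E] {κ : Rˣ} {a : UGen → E}

/-- The generators with the spectral parameter multiplied by `c`. -/
def ush (c : Rˣ) (a : UGen → E) (x : UGen) : E := (↑(c ^ x.deg) : R) • a x

lemma URel.ush {ζ : Bool} (c : Rˣ) (h : URel ζ a) : URel ζ (ush c a) := by
  have := h.rescl (c := Units.map (algebraMap R E : R →* E) c) fun x => Algebra.commutes (c : R) (a x)
  simp only [← map_zpow, Units.coe_map, MonoidHom.coe_coe, ← Algebra.smul_def] at this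
  exact this

lemma lof_ush (c : Rˣ) (h : UCore κ a) (s : Sgn) (i j : Fin 2) (k : ℤ) :
    lof R (ush c a) (.L s i j k) = (↑(c ^ k) : R) • lof R a (.L s i j k) := by
  have hp := h.pair
  match s, i, j with
  | .pos, 0, 0 => rfl
  | .pos, 0, 1 => exact (smul_zero _).symm
  | .pos, 1, 0 => exact (congrFun (shift_conv c (h.cur .pos) (hp .pos).cur (Or.inl (hp .pos).bd)) k).symm
  | .pos, 1, 1 => exact smul_comm _ _ _
  | .neg, 0, 0 => rfl
  | .neg, 0, 1 => exact (congrArg Neg.neg (congrFun (shift_conv c (hp .neg).cur (h.cur .neg)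
      (Or.inr (hp .neg).bd)) k).symm).trans (smul_neg _ _).symm
  | .neg, 1, 0 => exact (smul_zero _).symm
  | .neg, 1, 1 => exact smul_comm _ _ _

lemma hasSum_shift_conv (c : Rˣ) {X Y : ℤ → E} (hX : IsCurrent R X) (hY : IsCurrent R Y)
    (h : Plus Y ∨ Minus X) (k : ℤ) :
    HasSum (fun n => (↑(c ^ k) : R) • -(X (k - n) * Y n)) ((↑(c ^ k) : R) • -conv X Y k) := by
  have h1 := summable_conv (isCurrent_shift c hX) (isCurrent_shift c hY)
    (h.imp (fun h => h.shift c) fun h => h.shift c) k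
  have h2 := h1.hasSum.neg
  rw [show ∑' n, shift c X (k - n) * shift c Y n = _ from
    (congrFun (shift_conv c hX hY h) k).symm, shift, ← smul_neg] at h2
  refine h2.congr_fun fun n => ?_
  rw [shift, shift, smul_mul_smul_comm, ← Units.val_mul, ← zpow_add, sub_add_cancel, smul_neg]

end Shifted

lemma loopEnd_mul {M : Type} [AddCommGroup M] [Module B M] (j k : ℤ) (g g' : Module.End B M) :
    loopEnd j g * loopEnd k g' = loopEnd (j + k) (g * g') :=
  Finsupp.lhom_ext fun i v => by
    rw [Module.End.mul_apply, loopEnd_single, loopEnd_single, loopEnd_single, add_assoc, add_comm k]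
    rfl

lemma loopEnd_one {M : Type} [AddCommGroup M] [Module B M] : loopEnd 0 (1 : Module.End B M) = 1 :=
  Finsupp.lhom_ext fun i v => by rw [loopEnd_single, add_zero]; rfl

lemma URel.loop {ζ : Bool} {M : Type} [AddCommGroup M] [Module B M] {a : UGen → Module.End B M}
    (h : URel ζ a) : URel ζ fun x => loopEnd x.deg (a x) := by
  let φ : Module.End B M →ₐ[B] Module.End B (ℤ →₀ M) := AlgHom.ofLinearMap
    { toFun := loopEnd 0
      map_add' := fun f g => Finsupp.lhom_ext fun i v => by
        simp only [LinearMap.add_apply, loopEnd_single, Finsupp.single_add]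
      map_smul' := fun b f => Finsupp.lhom_ext fun i v => by
        simp only [LinearMap.smul_apply, loopEnd_single, RingHom.id_apply, Finsupp.smul_single] }
    loopEnd_one fun f g => (loopEnd_mul 0 0 f g).symm
  let t : Multiplicative ℤ →* Module.End B (ℤ →₀ M) :=
    { toFun := fun n => loopEnd n.toAdd 1
      map_one' := loopEnd_one
      map_mul' := fun m n => by rw [loopEnd_mul, mul_one]; rfl }
  have h0 : ∀ f : Module.End B M, φ f = loopEnd 0 f := fun _ => rfl
  have := (h.map φ).rescl (c := t.toHomUnits (Multiplicative.ofAdd 1)) fun x => by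
    change loopEnd 1 1 * loopEnd 0 (a x) = loopEnd 0 (a x) * loopEnd 1 1
    rw [loopEnd_mul, loopEnd_mul, one_mul, mul_one, add_comm]
  simp only [← map_zpow, ← ofAdd_zsmul, MonoidHom.coe_toHomUnits, smul_eq_mul, mul_one] at this
  have h1 : ∀ x : UGen, t (Multiplicative.ofAdd x.deg) * φ (a x) = loopEnd x.deg (a x) := fun x =>
    (loopEnd_mul _ _ _ _).trans (by rw [add_zero, one_mul, toAdd_ofAdd])
  simpa only [h1] using this

lemma unop_smul_cent {T : Theory} {n : ℕ} (κ : (Cent T n)ˣ) (k : ℤ) (z : (Completed T n)ᵐᵒᵖ) :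
    (((κ⁻¹ ^ k : (Cent T n)ˣ) : Cent T n) • z).unop =
      kpow (κ : Cent T n).1 ((κ⁻¹ : (Cent T n)ˣ) : Cent T n).1 (-k) * z.unop := by
  rw [inv_zpow', unop_smul, Algebra.smul_def]
  exact congrArg (· * z.unop) (kpow_units (E := Completed T n) κ (-k)).symm

lemma leg_self {T : Theory} (η : Completed T 1) : leg T (0 : Fin 1) η = η :=
  DFunLike.congr_fun (completed_algHom_ext (f := leg T (0 : Fin 1)) (g := AlgHom.id B _) (continuous_leg 0)
    continuous_id fun i x => by rw [Subsingleton.elim i 0]; try rfl) η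

section Antipode

variable (ζ : Bool)

/-- The antipodes of the generators. -/
def usg : UGen → (Completed (UTh ζ .low) 1)ᵐᵒᵖ :=
  ush (R := Cent (UTh ζ .low) 1) (ukap ζ .low 0)⁻¹ (uga ζ 0)

lemma usg_mem (x : UGen) : (usg ζ x).unop.1 ∈ piece (UTh ζ .low) 1 x.deg :=
  (pc (E := (Completed (UTh ζ .low) 1)ᵐᵒᵖ) (Cent (UTh ζ .low) 1) x.deg).smul_mem _
    ((ugraded_uga (n := 1) ζ 0).mem x)

lemma urel_usg : URel ζ (usg ζ) := (urel_uga (n := 1) ζ 0).ush _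

lemma urel_loop (V : Rep (UTh ζ .low) 1) : URel ζ fun x => loopEnd (UGen.deg x) (V.act 0 x) :=
  URel.loop (V.rel 0)

/-- The antipode on generators. -/
def antiData : AntiData (UTh ζ .high) (UTh ζ .low) where
  act := usg ζ
  mem := usg_mem ζ
  rel _ _ _ φ := (urel_usg ζ).map φ
  loop V := urel_loop ζ V
  sgn := rfl
  sgn' := rfl

lemma phiInv_low (s : Sgn) (k : ℤ) : phiInv (ug ζ .low (n := 1) 0) s k =
    (dblc (Cent (UTh ζ .low) 1) (fun k => ugo (n := 1) ζ 0 (.al s k)) k).unop := by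
  have hp := pair_low (n := 1) ζ 0 s
  apply op_injective
  rw [op_unop, ← dbl_eq_dblc (Cent (UTh ζ .low) 1) hp.bd, phiInv, dbl, dbl, op_finsum]
  refine finsum_congr fun i => ?_
  rw [op_smul, op_mul]
  exact congrArg _ (hp.comm (k - i) i).eq

lemma unop_smul_low (k : ℤ) (z : (Completed (UTh ζ .low) 1)ᵐᵒᵖ) :
    ((((ukap ζ .low 0)⁻¹ ^ k : (Cent (UTh ζ .low) 1)ˣ) : Cent (UTh ζ .low) 1) • z).unop =
      kpow (ug ζ .low (n := 1) 0 .qc) (ug ζ .low 0 .qc') (-k) * z.unop :=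
  unop_smul_cent (ukap ζ .low (0 : Fin 1)) k z

lemma hasSum_unop_shift_conv {X Y : ℤ → (Completed (UTh ζ .low) 1)ᵐᵒᵖ}
    (hX : IsCurrent (Cent (UTh ζ .low) 1) X) (hY : IsCurrent (Cent (UTh ζ .low) 1) Y)
    (h : Plus Y ∨ Minus X) (k : ℤ) :
    HasSum (fun n => -(kpow (ug ζ .low (n := 1) 0 .qc) (ug ζ .low 0 .qc') (-k) * (Y n).unop * (X (k - n)).unop))
      ((((ukap ζ .low 0)⁻¹ ^ k : (Cent (UTh ζ .low) 1)ˣ) : Cent (UTh ζ .low) 1) • -conv X Y k).unop := by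
  refine ((hasSum_shift_conv (ukap ζ .low 0)⁻¹ hX hY h k).map
    (opAddEquiv (α := Completed (UTh ζ .low) 1)).symm.toAddMonoidHom continuous_unop).congr_fun fun n => ?_
  rw [mul_assoc]
  exact (neg_mul_eq_mul_neg _ _).trans (unop_smul_low ζ k _).symm

lemma hasSum_usg_pos (k : ℤ) : HasSum (fun n : ℤ => -(kpow (ug ζ .low 0 .qc) (ug ζ .low 0 .qc') (-k) *
      phiInv (ug ζ .low (n := 1) 0) .pos n * ug ζ .low 0 (.xi .pos (k - n))))
    (usg ζ (.xi .pos k)).unop := by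
  have hp := (pair_low (n := 1) ζ 0 .pos).dblc
  simp only [phiInv_low]
  exact hasSum_unop_shift_conv ζ ((ugraded_low (n := 1) ζ 0).cur_xi .pos) hp.cur (Or.inl hp.bd) k

lemma hasSum_usg_neg (k : ℤ) : HasSum (fun n : ℤ => -(kpow (ug ζ .low 0 .qc) (ug ζ .low 0 .qc') (-k) *
      ug ζ .low (n := 1) 0 (.xi .neg n) * phiInv (ug ζ .low 0) .neg (k - n)))
    (usg ζ (.xi .neg k)).unop := by
  have hp := (pair_low (n := 1) ζ 0 .neg).dblc
  simp only [phiInv_low]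
  exact hasSum_unop_shift_conv ζ hp.cur ((ugraded_low (n := 1) ζ 0).cur_xi .neg) (Or.inr hp.bd) k

/-- The Hopf structure of the extended Drinfeld algebra. -/
def uHopf : HopfData (UTh ζ .high) (UTh ζ .low) where
  Δ := (copData ζ).hom
  ε := counit ζ
  S := (antiData ζ).hom
  continuous_Δ := (copData ζ).continuous_hom
  continuous_ε := isLocallyConstant_counit ζ
  continuous_S := (antiData ζ).continuousOn_hom
  coassoc := ⟨(copLeft ζ).hom, (copRight ζ).hom, (copLeft ζ).continuous_hom, (copRight ζ).continuous_hom,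
    ActData.pair_leg_zero _ _ _ _ _, fun x => ActData.pair_leg_one _ _ _ _ _ x,
    fun x => ActData.pair_leg_zero _ _ _ _ _ x, ActData.pair_leg_one _ _ _ _ _, copLeft_cop ζ⟩
  counit := ⟨(counitLeft ζ).hom, (counitRight ζ).hom, (counitLeft ζ).continuous_hom,
    (counitRight ζ).continuous_hom,
    fun x => (ActData.pair_leg_zero _ _ _ _ _ x).trans ((congrArg _ (trivData_hom ζ x)).trans
      (AlgHom.commutes _ _)),
    fun x => (ActData.pair_leg_one (trivData ζ 0) (ActData.refl _) _ _ _ x).trans (leg_self x),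
    fun x => (ActData.pair_leg_zero (ActData.refl _) (trivData ζ 0) _ _ _ x).trans (leg_self x),
    fun x => (ActData.pair_leg_one _ _ _ _ _ x).trans ((congrArg _ (trivData_hom ζ x)).trans
      (AlgHom.commutes _ _)), fun x => ⟨counitLeft_cop ζ x, counitRight_cop ζ x⟩⟩

lemma S_ug (x : UGen) : (uHopf ζ).S (ug ζ .high 0 x) = usg ζ x := (antiData ζ).hom_gen x

lemma isDrinfeldHopf : IsDrinfeldHopf ζ (uHopf ζ) where
  Δ_qc := rfl
  Δ_xi_pos := hasSum_ucop_xi_pos (ugraded_high ζ 0) (ucore_high ζ 0) (ucore_high ζ 1) (ug_commute ζ zero_ne_one_fin)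
  Δ_xi_neg := hasSum_ucop_xi_neg (ugraded_high ζ 1) (ucore_high ζ 0) (ucore_high ζ 1) (ug_commute ζ zero_ne_one_fin)
  Δ_al_pos := hasSum_ucop_al_pos (ugraded_high ζ 0) (ucore_high ζ 0) (ucore_high ζ 1) (ug_commute ζ zero_ne_one_fin)
  Δ_al_neg := hasSum_ucop_al_neg (ugraded_high ζ 1) (ucore_high ζ 0) (ucore_high ζ 1) (ug_commute ζ zero_ne_one_fin)
  ε_qc := counit_gen ζ .qc
  ε_xi s k := counit_gen ζ (.xi s k)
  ε_al s k := counit_gen ζ (.al s k)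
  S_qc := (S_ug ζ .qc).trans (by
    rw [usg, ush, show UGen.deg .qc = 0 from rfl, zpow_zero, Units.val_one, one_smul]; rfl)
  S_al s k := (S_ug ζ (.al s k)).trans (unop_injective (unop_smul_low ζ k _))
  S_xi_pos k := (congrArg unop (S_ug ζ (.xi .pos k))).symm ▸ hasSum_usg_pos ζ k
  S_xi_neg k := (congrArg unop (S_ug ζ (.xi .neg k))).symm ▸ hasSum_usg_neg ζ k

end Antipode

section

/-- The transport of Hopf structure maps along isomorphisms. -/
def HopfData.transport {T T' S S' : Theory} (H : HopfData T T') (D : ActData S 1 T 1)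
    (D' : ActData T 1 S 1) (h : ∀ x, D'.hom (D.act 0 x) = gen S 0 x)
    (h' : ∀ x, D.hom (D'.act 0 x) = gen T 0 x) (L : ActData T' 1 S' 1) : HopfData S S' where
  Δ := (D'.pow 2).hom.comp (H.Δ.comp D.hom)
  ε := H.ε.comp D.hom
  S := (AlgHom.op L.hom).comp (H.S.comp D.hom)
  continuous_Δ := (D'.pow 2).continuous_hom.comp (H.continuous_Δ.comp D.continuous_hom)
  continuous_ε := H.continuous_ε.comp_continuous D.continuous_hom
  continuous_S k := (continuous_op.comp (L.continuous_hom.comp continuous_unop)).comp_continuousOn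
    ((H.continuous_S k).comp D.continuous_hom.continuousOn fun _ hx => D.hom_mem hx)
  coassoc := by
    obtain ⟨D₁, D₂, c1, c2, h1, h2, h3, h4, h5⟩ := H.coassoc
    refine ⟨(D'.pow 3).hom.comp (D₁.comp (D.pow 2).hom), (D'.pow 3).hom.comp (D₂.comp (D.pow 2).hom),
      (D'.pow 3).continuous_hom.comp (c1.comp (D.pow 2).continuous_hom),
      (D'.pow 3).continuous_hom.comp (c2.comp (D.pow 2).continuous_hom), fun x => ?_, fun x => ?_,
      fun x => ?_, fun x => ?_, fun x => ?_⟩ <;>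
    simp only [AlgHom.comp_apply, ActData.pow_leg, ActData.pow_hom_pow_hom D' D h', h1, h2, h3, h4, h5,
      ActData.pow_emb, ActData.hom_hom D D' h]
  counit := by
    obtain ⟨E₁, E₂, c1, c2, h1, h2, h3, h4, h5⟩ := H.counit
    refine ⟨D'.hom.comp (E₁.comp (D.pow 2).hom), D'.hom.comp (E₂.comp (D.pow 2).hom),
      D'.continuous_hom.comp (c1.comp (D.pow 2).continuous_hom),
      D'.continuous_hom.comp (c2.comp (D.pow 2).continuous_hom), fun x => ?_, fun x => ?_,
      fun x => ?_, fun x => ?_, fun x => ⟨?_, ?_⟩⟩ <;>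
    simp only [AlgHom.comp_apply, ActData.pow_leg, ActData.pow_hom_pow_hom D' D h', h1, h2, h3, h4,
      (h5 _).1, (h5 _).2, AlgHom.commutes, ActData.hom_hom D D' h]

section

variable [Algebra B R] [Algebra B E] [IsScalarTower B R E]

lemma lof_triv (s : Sgn) (i j : Fin 2) (k : ℤ) :
    lof R (fun x => algebraMap B E (triv x)) (.L s i j k) = algebraMap B E (if i = j ∧ k = 0 then 1 else 0) := by
  have e1 : (fun k : ℤ => algebraMap B E (if k = 0 then 1 else 0)) = oneCurrent E := funext fun k => by
    rw [oneCurrent, apply_ite (algebraMap B E), map_one, map_zero]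
  have e0 : (fun _ : ℤ => (0 : E)) = 0 := rfl
  have e2 := congrFun ((congrArg (shift (qu R 2)) e1).trans ((shift_oneCurrent _).trans e1.symm)) k
  match s, i, j with
  | .pos, 0, 0 => simp [lof, lpos, triv]
  | .pos, 0, 1 => simp [lof, lpos]
  | .pos, 1, 0 => simpa [lof, lpos, triv, e0] using congrFun (conv_zero_left' _) k
  | .pos, 1, 1 => simpa [lof, lpos, triv] using e2
  | .neg, 0, 0 => simp [lof, lneg, triv]
  | .neg, 0, 1 => simpa [lof, lneg, triv, e0] using congrFun (conv_zero_right' _) k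
  | .neg, 1, 0 => simp [lof, lneg]
  | .neg, 1, 1 => simpa [lof, lneg, triv] using e2

lemma neg_conv_dblc_conv {X A A' : ℤ → E} (hX : IsCurrent R X) (h : InvPair R .pos A A') :
    conv (fun k => -conv X (dblc R A) k) A' = fun k => -conv X (shift (qu R 2) A) k := by
  rw [neg_conv', conv_assoc hX h.dblc.cur h.cur' (Or.inl ⟨h.dblc.bd, h.bd'⟩), dblc_conv_inv h.symm]

lemma neg_conv_neg_conv_dblc {X A A' : ℤ → E} (hX : IsCurrent R X) (h : InvPair R .neg A A') :
    (fun k => -conv A' (fun k => -conv (dblc R A) X k) k) = conv (shift (qu R 2) A) X := by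
  rw [conv_neg', ← conv_assoc h.cur' h.dblc.cur hX (Or.inr (Or.inl ⟨h.bd', h.dblc.bd⟩)),
    conv_dblc_inv h.symm]
  simp only [neg_neg]

end

lemma hasSum_unop_conv {T : Theory} {n : ℕ} [Fact (T.sgn = -1)] {X Y : ℤ → (Completed T n)ᵐᵒᵖ}
    (hX : IsCurrent (Cent T n) X) (hY : IsCurrent (Cent T n) Y) (h : Plus Y ∨ Minus X) (k : ℤ) :
    HasSum (fun i => (Y i).unop * (X (k - i)).unop) (conv X Y k).unop :=
  (summable_conv hX hY h k).hasSum.map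
    (opAddEquiv (α := Completed T n)).symm.toAddMonoidHom continuous_unop

variable (ζ : Bool)

/-- The Hopf structure of the `L`-matrix algebra. -/
def aHopf : HopfData (ATh ζ .high) (ATh ζ .low) :=
  (uHopf ζ).transport (muData ζ) (muInvData ζ) (muInv_mu ζ) (mu_muInv ζ) (muLowInvData ζ)

lemma muInv_pow_lof {n : ℕ} (i : Fin n) (x : AGen) :
    ((muInvData ζ).pow n).hom (lof (Cent (UTh ζ .high) n) (ug ζ .high i) x) = ag ζ .high i x := by
  have hF : MapsSums (Cent (UTh ζ .high) 1) (leg (UTh ζ .high) i) := mapsSums_emb _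
  have h : leg (UTh ζ .high) i _ = _ :=
    congrFun (hF.map_lof (R' := Cent (UTh ζ .high) n) (ucore_high (n := 1) ζ 0)) x
  refine (congrArg ((muInvData ζ).pow n).hom h).symm.trans ?_
  exact ((muInvData ζ).pow_leg i _).trans (congrArg (leg (ATh ζ .high) i) (muInv_mu ζ x))

lemma aHopf_Δ (x : AGen) : (aHopf ζ).Δ (ag ζ .high 0 x) =
    ((muInvData ζ).pow 2).hom (lof (Cent (UTh ζ .high) 2) (ucopGen ζ (0 : Fin 2) 1) x) := by
  have hF : MapsSums (Cent (UTh ζ .high) 1) (copData ζ).hom := mapsSums_high (copData ζ)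
  exact congrArg ((muInvData ζ).pow 2).hom
    (congrFun (hF.map_lof (R' := Cent (UTh ζ .high) 2) (ucore_high (n := 1) ζ 0)) x)

lemma hasSum_aHopf_Δ (x : AGen) {F : ℤ → Completed (UTh ζ .high) 2}
    (h : HasSum F (lof (Cent (UTh ζ .high) 2) (ucopGen ζ (0 : Fin 2) 1) x)) :
    HasSum (fun n => ((muInvData ζ).pow 2).hom (F n)) ((aHopf ζ).Δ (ag ζ .high 0 x)) := by
  rw [aHopf_Δ]
  exact h.map _ ((muInvData ζ).pow 2).continuous_hom

lemma hasSum_Δ_L_pos (i j : Fin 2) (k : ℤ) :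
    HasSum (fun n : ℤ => ∑ p : Fin 2, ag ζ .high (n := 2) 0 (.L .pos i p n) *
      kpow (ag ζ .high 0 .qc) (ag ζ .high 0 .qc') (k - n) * ag ζ .high 1 (.L .pos p j (k - n)))
    ((aHopf ζ).Δ (ag ζ .high 0 (.L .pos i j k))) := by
  simpa only [map_sum, map_mul, map_kpow, muInv_pow_lof] using hasSum_aHopf_Δ ζ _ (hasSum_lof_ucop_pos
    (ugraded_high ζ 0) (ucore_high ζ 0) (ucore_high ζ 1) (ug_commute ζ zero_ne_one_fin) i j k)

lemma hasSum_Δ_L_neg (i j : Fin 2) (k : ℤ) :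
    HasSum (fun n : ℤ => ∑ p : Fin 2, ag ζ .high (n := 2) 0 (.L .neg i p n) *
      kpow (ag ζ .high 1 .qc) (ag ζ .high 1 .qc') n * ag ζ .high 1 (.L .neg p j (k - n)))
    ((aHopf ζ).Δ (ag ζ .high 0 (.L .neg i j k))) := by
  simpa only [map_sum, map_mul, map_kpow, muInv_pow_lof] using hasSum_aHopf_Δ ζ _ (hasSum_lof_ucop_neg
    (ugraded_high ζ 1) (ucore_high ζ 0) (ucore_high ζ 1) (ug_commute ζ zero_ne_one_fin) i j k)

lemma aHopf_ε_L (s : Sgn) (i j : Fin 2) (k : ℤ) :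
    (aHopf ζ).ε (ag ζ .high 0 (.L s i j k)) = if i = j ∧ k = 0 then 1 else 0 := by
  have hF : MapsSums (Cent (UTh ζ .high) 1) (trivData ζ 0).hom := mapsSums_high (trivData ζ 0)
  have h := (congrFun (hF.map_lof (R' := Cent (UTh ζ .high) 0) (ucore_high (n := 1) ζ 0)) (.L s i j k)).trans
    (lof_triv s i j k)
  exact (congrArg (fun η : Completed (UTh ζ .high) 0 => η.1 (trivRep ζ) (1 : B)) h).trans
    (mul_one (if i = j ∧ k = 0 then (1 : B) else 0))

lemma aHopf_S_L (s : Sgn) (i j : Fin 2) (k : ℤ) : (aHopf ζ).S (ag ζ .high 0 (.L s i j k)) =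
    op (kpow (ag ζ .low 0 .qc) (ag ζ .low 0 .qc') (-k) * ag ζ .low 0 (.L s i j k)) := by
  have hF : MapsSums (Cent (UTh ζ .high) 1) (antiData ζ).hom := (antiData ζ).mapsSums
  have h1 := congrFun (hF.map_lof (R' := Cent (UTh ζ .low) 1) (ucore_high (n := 1) ζ 0)) (.L s i j k)
  have h2 : (fun x => (antiData ζ).hom (ug ζ .high 0 x)) = usg ζ := funext fun x => S_ug ζ x
  rw [h2] at h1
  have h3 := (congrArg unop (h1.trans (lof_ush (ukap ζ .low 0)⁻¹ (ucore_uga (n := 1) ζ 0) s i j k))).trans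
    (unop_smul_low ζ k _)
  refine unop_injective ((congrArg (muLowInvData ζ).hom h3).trans ?_)
  rw [map_mul, map_kpow]
  exact congrArg₂ (· * ·) rfl (muLowInv_muLow ζ (.L s i j k))

lemma isLHopf : IsLHopf ζ (aHopf ζ) where
  Δ_qc := (aHopf_Δ ζ .qc).trans ((map_mul ((muInvData ζ).pow 2).hom _ _).trans
    (congrArg₂ (· * ·) (muInv_pow_lof ζ (0 : Fin 2) .qc) (muInv_pow_lof ζ (1 : Fin 2) .qc)))
  Δ_L_pos := hasSum_Δ_L_pos ζ
  Δ_L_neg := hasSum_Δ_L_neg ζ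
  ε_qc := counit_gen ζ .qc
  ε_L := aHopf_ε_L ζ
  S_qc := congrArg (fun z => op ((muLowInvData ζ).hom (unop z))) (isDrinfeldHopf ζ).S_qc
  S_L := aHopf_S_L ζ

/-- The isomorphism `μ`. -/
def mu : Completed (ATh ζ .high) 1 ≃ₐ[B] Completed (UTh ζ .high) 1 :=
  ActData.equiv (muData ζ) (muInvData ζ) (muInv_mu ζ) (mu_muInv ζ)

/-- The isomorphism `μ` on lowest weight representations. -/
def muLow : Completed (ATh ζ .low) 1 ≃ₐ[B] Completed (UTh ζ .low) 1 :=
  ActData.equiv (muLowData ζ) (muLowInvData ζ) (muLowInv_muLow ζ) (muLow_muLowInv ζ)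

lemma mu_pos_21 (k : ℤ) : HasSum
    (fun n : ℤ => ug ζ .high 0 (.xi .pos n) * ug ζ .high 0 (.al .pos (k - n)))
    (mu ζ (ag ζ .high 0 (.L .pos 1 0 k))) := by
  have h := ucore_high (n := 1) ζ 0
  exact hasSum_conv_left (h.cur .pos) (h.pair .pos).cur (Or.inl (h.pair .pos).bd) k

lemma mu_neg_12 (k : ℤ) : HasSum
    (fun n : ℤ => -(ug ζ .high 0 (.al .neg n) * ug ζ .high 0 (.xi .neg (k - n))))
    (mu ζ (ag ζ .high 0 (.L .neg 0 1 k))) := by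
  have h := ucore_high (n := 1) ζ 0
  exact (hasSum_conv_left (h.pair .neg).cur (h.cur .neg) (Or.inr (h.pair .neg).bd) k).neg

lemma shift_high (s : Sgn) (k : ℤ) :
    shift (qu (Cent (UTh ζ .high) 1) 2) (fun k => ug ζ .high (n := 1) 0 (.be s k)) k =
      qp (2 * (k : ℂ)) • ug ζ .high 0 (.be s k) :=
  (qp_smul (R := Cent (UTh ζ .high) 1) k (ug ζ .high (n := 1) 0 (.be s k))).symm

lemma isMu : IsMu ζ (mu ζ) where
  qc := rfl
  pos_11 _ := rfl
  pos_12 _ := rfl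
  pos_21 := mu_pos_21 ζ
  pos_22 := shift_high ζ .pos
  neg_11 _ := rfl
  neg_12 := mu_neg_12 ζ
  neg_21 _ := rfl
  neg_22 := shift_high ζ .neg

lemma shift_low (s : Sgn) (k : ℤ) :
    (shift (qu (Cent (UTh ζ .low) 1) 2) (fun k => ugo (n := 1) ζ 0 (.al s k)) k).unop =
      qp (2 * (k : ℂ)) • ug ζ .low 0 (.al s k) :=
  congrArg unop (qp_smul (R := Cent (UTh ζ .low) 1) k (ugo (n := 1) ζ 0 (.al s k))).symm

lemma muLow_pos_21 (k : ℤ) : HasSum (fun n : ℤ => -(qp (2 * (n : ℂ)) •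
      (ug ζ .low 0 (.al .pos n) * ug ζ .low 0 (.xi .pos (k - n)))))
    (muLow ζ (ag ζ .low 0 (.L .pos 1 0 k))) := by
  have hp := pair_low (n := 1) ζ 0 .pos
  have hx := (ugraded_low (n := 1) ζ 0).cur_xi .pos
  have h := (hasSum_unop_conv hx (isCurrent_shift (qu (Cent (UTh ζ .low) 1) 2) hp.cur)
    (Or.inl (hp.bd.shift _)) k).neg
  have e : muLow ζ (ag ζ .low 0 (.L .pos 1 0 k)) = _ := congrArg unop (congrFun (neg_conv_dblc_conv hx hp) k)
  rw [e]
  refine h.congr_fun fun n => congrArg Neg.neg ?_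
  rw [shift_low]
  exact (smul_mul_assoc _ _ _).symm

lemma muLow_neg_12 (k : ℤ) : HasSum (fun n : ℤ => qp (2 * ((k - n : ℤ) : ℂ)) •
      (ug ζ .low 0 (.xi .neg n) * ug ζ .low 0 (.al .neg (k - n))))
    (muLow ζ (ag ζ .low 0 (.L .neg 0 1 k))) := by
  have hp := pair_low (n := 1) ζ 0 .neg
  have hx := (ugraded_low (n := 1) ζ 0).cur_xi .neg
  have h := hasSum_unop_conv (isCurrent_shift (qu (Cent (UTh ζ .low) 1) 2) hp.cur) hx
    (Or.inr (hp.bd.shift _)) k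
  have e : muLow ζ (ag ζ .low 0 (.L .neg 0 1 k)) = _ :=
    congrArg unop (congrFun (neg_conv_neg_conv_dblc hx hp) k)
  rw [e]
  refine h.congr_fun fun n => ?_
  rw [shift_low]
  exact (mul_smul_comm _ _ _).symm

lemma isMuLow : IsMuLow ζ (muLow ζ) where
  qc := rfl
  pos_11 _ := rfl
  pos_12 _ := rfl
  pos_21 := muLow_pos_21 ζ
  pos_22 := shift_low ζ .pos
  neg_11 _ := rfl
  neg_12 := muLow_neg_12 ζ
  neg_21 _ := rfl
  neg_22 := shift_low ζ .neg

end

end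

end QCurrent

theorem proposition3p1 (ζ : Bool) :
    ∃ (HA : HopfData (ATh ζ .high) (ATh ζ .low)) (HU : HopfData (UTh ζ .high) (UTh ζ .low)),
      IsLHopf ζ HA ∧ IsDrinfeldHopf ζ HU ∧
      ∃ (μ : Completed (ATh ζ .high) 1 ≃ₐ[B] Completed (UTh ζ .high) 1)
        (μ₂ : Completed (ATh ζ .high) 2 ≃ₐ[B] Completed (UTh ζ .high) 2)
        (μlow : Completed (ATh ζ .low) 1 ≃ₐ[B] Completed (UTh ζ .low) 1),
        IsHomeomorph μ ∧ IsHomeomorph μ₂ ∧ IsHomeomorph μlow ∧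
        IsMu ζ μ ∧ IsMuLow ζ μlow ∧
        (∀ (i : Fin 2) x, μ₂ (leg (ATh ζ .high) i x) = leg (UTh ζ .high) i (μ x)) ∧
        (∀ x, μ₂ (HA.Δ x) = HU.Δ (μ x)) ∧
        (∀ x, HA.ε x = HU.ε (μ x)) ∧
        (∀ x, μlow (HA.S x).unop = (HU.S (μ x)).unop) :=
  ⟨aHopf ζ, uHopf ζ, isLHopf ζ, isDrinfeldHopf ζ, mu ζ,
    ActData.powEquiv (muData ζ) (muInvData ζ) (muInv_mu ζ) (mu_muInv ζ) 2, muLow ζ,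
    ActData.isHomeomorph_equiv _ _ _ _, ActData.isHomeomorph_powEquiv _ _ _ _ 2,
    ActData.isHomeomorph_equiv _ _ _ _, isMu ζ, isMuLow ζ, (muData ζ).pow_leg,
    fun _ => ActData.pow_hom_pow_hom (muInvData ζ) (muData ζ) (mu_muInv ζ) _, fun _ => rfl,
    fun _ => ActData.hom_hom (muLowInvData ζ) (muLowData ζ) (muLow_muLowInv ζ) _⟩
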